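/- Let $L(s,\chi)$ be the (analytically continued) Dirichlet $L$-function of a Dirichlet character $\chi$, let $L^{(k)}$ be its $k$-th derivative in $s$, and let $\mathscr C_q^+$ be the set of even ($\chi(-1)=1$) primitive Dirichlet characters $\chi$ modulo $q$. For an integer $k\ge 1$ put $$P_k^*=\left(\frac12+\frac{k\coth\Lambda_k}{\sqrt{4k^2-1}}\right)^{-1},\qquad \Lambda_k=\frac k2\sqrt{\frac{2k+1}{2k-1}} .$$ **Theorem.** Let $k\ge1$ be an integer. For every $\varepsilon>0$ there is $q_0=q_0(k,\varepsilon)$ such that for all integers $q\ge q_0$ $$\#\{\chi\in\mathscr C_q^+ : L^{(k)}(\tfrac12,\chi)\ne0\}\ \ge\ (P_k^*-\varepsilon)\,\#\mathscr C_q^+ .$$ Moreover, there is an absolute constant $c>0$ such that for every $k\ge1$ $$P_k^*=1-\frac1{16k^2}-\frac{c_k}{k^4}\qquad\text{with some } 0<c_k\le c ;$$ in particular $P_k^*\to1$ as $k\to\infty$. Finally, $P_1^*\ge .7544$, $P_2^*\ge .9083$, $P_3^*\ge .9642$, $P_4^*\ge .9853$, $P_5^*\ge .9935$ and $P_{25}^*\ge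 .99989$. -/

import Mathlib

noncomputable section

/-- The set of even primitive Dirichlet characters modulo `q`. -/
def evenPrimitive (q : ℕ) : Set (DirichletCharacter ℂ q) :=
  {χ | χ.IsPrimitive ∧ χ.Even}

/-- The even primitive Dirichlet characters `χ` modulo `q` with `L^{(k)}(1/2, χ) ≠ 0`, where
`L(s, χ)` is the analytically continued Dirichlet `L`-function. -/
def nonvanishing (k q : ℕ) [NeZero q] : Set (DirichletCharacter ℂ q) :=
  {χ ∈ evenPrimitive q | iteratedDeriv k (DirichletCharacter.LFunction χ) (1 / 2) ≠ 0}

/-- The parameter `Λ_k = (k / 2) √((2k + 1) / (2k - 1))`, for `k ≥ 1`. -/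
def mollifierParam (k : ℕ) : ℝ :=
  (k : ℝ) / 2 * Real.sqrt ((2 * (k : ℝ) + 1) / (2 * (k : ℝ) - 1))

/-- The proportion `P_k^* = (1 / 2 + k coth Λ_k / √(4k² - 1))⁻¹`, for `k ≥ 1`. -/
def Pstar (k : ℕ) : ℝ :=
  (1 / 2 + (k : ℝ) / Real.sqrt (4 * (k : ℝ) ^ 2 - 1) *
    (Real.cosh (mollifierParam k) / Real.sinh (mollifierParam k)))⁻¹

/-- There are finitely many characters, so the cardinality `Set.ncard` of a set of them is the
actual number of elements. -/
theorem finite_evenPrimitive (q : ℕ) [NeZero q] : (evenPrimitive q).Finite :=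
  Set.toFinite _

end

/-! Nonvanishing is detected by Cauchy–Schwarz with a mollifier. Let `M(χ) = ∑ μ(a) h(log a / log q)
a^{-1/2} χ(a)`, where `h` is smooth, `h 0 = 1` and `h r = 0` for `r ≥ θ`, with a fixed `θ < 1/2`.
Let `ε_χ` (`thetaSign`) be the unimodular sign of the functional equation. The proportion of `χ`
with `L^{(k)}(1/2, χ) ≠ 0` is at least `|m₁|² / m₂`, where `m₁` is the mean of `conj(ε_χ) M(conj χ)
L^{(k)}(1/2, χ) / (log q)^k` over the even primitive characters, and `m₂` is the mean of its squared
modulus, in which `ε_χ` disappears.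

The sign in `m₁` is what makes `k ≥ 1` work. The mean of `M(χ) L(1/2 + α/log q, χ)` tends to the
constant `h 0`, whose derivatives in `α` vanish. By the functional equation, multiplication by
`conj(ε_χ)` brings in a factor tending to `e^{-α}`, so that `m₁ → (-1)^k h 0`
(`tendsto_firstMoment`).

For `m₂`, the product `L(1/2 + α/log q, χ) L(1/2 + β/log q, conj χ)` is a double integral of theta
series in logarithmic variables `x, y`. Inserting a smooth partition of unity in `x + y` and
reflecting one half by the theta functional equation gives an approximate functional equation
(`LFunction_mul_eq_thetaForm`) in which effectively `m n ≤ q^{1+δ}`. Orthogonality leaves the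
diagonal `a m = b n` and terms with `a m ≡ ± b n` modulo a divisor of `q`. The latter save a power
of `q` by absolute bounds, since `θ < 1/2`, while there are at least `q^{1-o(1)}` characters as soon
as there is one (`exists_le_card_evenPrim`).

On the diagonal, `W` and `h` are written as superpositions of exponentials `e^{-sx}` on the line `Re
s = 1`, and the sum becomes an Euler product, a quotient of zeta values near `1` times a harmless
factor. Dominated convergence replaces `ζ(1 + X/log q)` by `log q / X`; no contour is moved. The
limiting integrals are evaluated by Laplace transforms and the mean tends to `(A + Bαβ) ∫₀¹
e^{-(α+β)r} dr + (h 0)²/2 · (1 + e^{-(α+β)})`, with `A = ∫ h'²` and `B = ∫ h²` over `r > 0`. Taking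
`k` derivatives in each of `α` and `β` by Cauchy's formula on fixed circles gives `m₂ → A/(2k+1) + B
k²/(2k-1) + 1/2` (`tendsto_secondMoment`).

Minimizing `A + κ² B`, `κ² = k²(2k+1)/(2k-1)`, subject to `h 0 = 1` and `h θ = 0`, leads to `h r =
sinh(κ(θ - r)) / sinh(κθ)`, of energy `κ coth(κθ)`. As `θ → 1/2` one has `κθ → Λ_k`, and the limit
of `m₂` approaches `1/P_k^*`. The expansion and the numerical values are elementary inequalities for
`coth` and the square root. -/

noncomputable section

/-! ### Divisor bound, and the count of primitive characters. -/

open Finset DirichletCharacter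

/-- Divisor bound. -/
theorem exists_card_divisors_le_rpow {e : ℝ} (he : 0 < e) :
    ∃ C : ℝ, 1 ≤ C ∧ ∀ n : ℕ, n ≠ 0 → (#n.divisors : ℝ) ≤ C * (n : ℝ) ^ e := by
  have hl2 : 0 < Real.log 2 := Real.log_pos one_lt_two
  set C₀ : ℝ := 1 + 1 / (e * Real.log 2) with hC₀
  have hC₀1 : 1 ≤ C₀ := by rw [hC₀]; have : 0 < 1 / (e * Real.log 2) := by positivity
                           linarith
  obtain ⟨P, hP⟩ := exists_nat_gt ((2 : ℝ) ^ (1 / e))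
  refine ⟨C₀ ^ P, one_le_pow₀ hC₀1, fun n hn ↦ ?_⟩
  -- Once `p ^ e ≥ 2`, that is for `p ≥ P`, the inequality `k + 1 ≤ 2 ^ k` needs no constant. Each
  -- smaller prime costs one factor `C₀`, chosen so that `C₀ (1 + k e log 2) ≥ k + 1`; there are at
  -- most `P` of them.
  have key : ∀ p ∈ n.primeFactors, ((n.factorization p + 1 : ℕ) : ℝ) ≤
      (if p < P then C₀ else 1) * ((p : ℝ) ^ n.factorization p) ^ e := by
    intro p hp
    have hp2 : (2 : ℝ) ≤ p := by exact_mod_cast (Nat.prime_of_mem_primeFactors hp).two_le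
    set k := n.factorization p
    have h1 : ((p : ℝ) ^ k) ^ e = ((p : ℝ) ^ e) ^ k := by
      rw [← Real.rpow_natCast, ← Real.rpow_natCast, ← Real.rpow_mul (by positivity),
        ← Real.rpow_mul (by positivity), mul_comm]
    rw [h1]
    split_ifs with h
    · have h2 : 1 + k * (e * Real.log 2) ≤ ((p : ℝ) ^ e) ^ k := by
        calc 1 + k * (e * Real.log 2) ≤ Real.exp (k * (e * Real.log 2)) := by
              rw [add_comm]; exact Real.add_one_le_exp _
          _ = ((2 : ℝ) ^ e) ^ k := by
              rw [Real.rpow_def_of_pos two_pos, ← Real.exp_nat_mul]; ring_nf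
          _ ≤ _ := by gcongr
      have h3 : C₀ * (1 + k * (e * Real.log 2)) ≥ k + 1 := by
        rw [hC₀]
        have : (1 + 1 / (e * Real.log 2)) * (1 + k * (e * Real.log 2)) =
            1 + k + k * (e * Real.log 2) + 1 / (e * Real.log 2) := by field_simp; ring
        rw [this]
        have : 0 ≤ k * (e * Real.log 2) := by positivity
        have : 0 ≤ 1 / (e * Real.log 2) := by positivity
        linarith
      push_cast
      nlinarith
    · rw [one_mul]
      have h2 : (2 : ℝ) ≤ (p : ℝ) ^ e := by
        have : (2 : ℝ) ^ (1 / e) ≤ p := hP.le.trans (by exact_mod_cast not_lt.mp h)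
        calc (2 : ℝ) = ((2 : ℝ) ^ (1 / e)) ^ e := by
              rw [← Real.rpow_mul (by norm_num), one_div_mul_cancel he.ne', Real.rpow_one]
          _ ≤ _ := by gcongr
      calc ((k + 1 : ℕ) : ℝ) ≤ (2 : ℝ) ^ k := by exact_mod_cast Nat.lt_two_pow_self
        _ ≤ _ := by gcongr
  rw [Nat.card_divisors hn, Nat.cast_prod]
  refine (Finset.prod_le_prod (fun _ _ ↦ by positivity) key).trans ?_
  rw [Finset.prod_mul_distrib]
  have h2 : ∏ p ∈ n.primeFactors, ((p : ℝ) ^ n.factorization p) ^ e = (n : ℝ) ^ e := by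
    rw [Real.finsetProd_rpow _ _ (fun _ _ ↦ by positivity)]
    congr 1
    conv_rhs => rw [← Nat.prod_factorization_pow_eq_self hn]
    simp [Finsupp.prod]
  rw [h2]
  gcongr
  rw [Finset.prod_ite, prod_const, prod_const, one_pow, mul_one]
  refine pow_le_pow_right₀ hC₀1 ?_
  calc _ ≤ #(Finset.range P) := card_le_card (fun x hx ↦ by simpa using (mem_filter.mp hx).2)
    _ = P := card_range P

/-- The convolution `μ * φ`, which counts primitive characters. -/
def primTotient (q : ℕ) : ℤ := ∑ x ∈ q.divisorsAntidiagonal, ArithmeticFunction.moebius x.1 * (x.2.totient : ℤ)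

theorem primTotient_mul {m n : ℕ} (h : m.Coprime n) :
    primTotient (m * n) = primTotient m * primTotient n := by
  let f : ArithmeticFunction ℤ := ⟨fun n ↦ (n.totient : ℤ), by simp⟩
  have hf : f.IsMultiplicative := by
    refine ArithmeticFunction.IsMultiplicative.iff_ne_zero.mpr ⟨by simp [f], fun {m n} _ _ h ↦ ?_⟩
    simp [f, Nat.totient_mul h]
  have := (ArithmeticFunction.isMultiplicative_moebius.mul hf).map_mul_of_coprime h
  exact this

theorem primTotient_prime {p : ℕ} (hp : p.Prime) : primTotient p = p - 2 := by
  rw [primTotient, Nat.sum_divisorsAntidiagonal (fun a b ↦ ArithmeticFunction.moebius a * (b.totient : ℤ)),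
    Nat.Prime.sum_divisors hp]
  simp [Nat.div_self hp.pos, Nat.totient_prime hp, ArithmeticFunction.moebius_apply_prime hp, Nat.cast_sub hp.one_lt.le]
  ring

theorem primTotient_prime_pow {p k : ℕ} (hp : p.Prime) :
    primTotient (p ^ (k + 2)) = p ^ k * (p - 1) ^ 2 := by
  rw [primTotient, Nat.sum_divisorsAntidiagonal (fun a b ↦ ArithmeticFunction.moebius a * (b.totient : ℤ)),
    Nat.sum_divisors_prime_pow hp, sum_range_succ', sum_range_succ']
  have : ∀ i ∈ range (k + 1), ArithmeticFunction.moebius (p ^ (i + 1 + 1)) * ((p ^ (k + 2) / p ^ (i + 1 + 1)).totient : ℤ) = 0 := by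
    intro i _
    rw [ArithmeticFunction.moebius_apply_prime_pow hp (by omega)]
    simp
  rw [sum_eq_zero this]
  simp only [zero_add, pow_one, pow_zero, Nat.div_one]
  rw [ArithmeticFunction.moebius_apply_prime hp, show p ^ (k + 2) / p = p ^ (k + 1) by
    rw [pow_succ]; exact Nat.mul_div_cancel _ hp.pos, Nat.totient_prime_pow_succ hp,
    Nat.totient_prime_pow_succ hp]
  simp [Nat.cast_sub hp.one_lt.le]
  ring

/-- By multiplicativity it suffices to treat prime powers, where the square of the number of
divisors is at least `4` and `4 (p - 2) ≥ p` for `p ≥ 3`, `2 (p - 1) ≥ p`. The excluded residue is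
the case of an exact factor `2`, whose local factor `p - 2` vanishes. -/
theorem primTotient_lower {q : ℕ} (hq : q ≠ 0) (h4 : q % 4 ≠ 2) :
    (q : ℤ) ≤ primTotient q * (#q.divisors : ℤ) ^ 2 := by
  induction q using Nat.recOnPosPrimePosCoprime with
  | zero => simp at hq
  | one => simp [primTotient]
  | prime_pow p n hp hn =>
    rw [Nat.divisors_prime_pow hp, card_map, card_range]
    obtain _ | _ | n := n
    · omega
    · simp only [zero_add, pow_one] at h4 ⊢
      rw [primTotient_prime hp]
      have : p ≠ 2 := by rintro rfl; simp at h4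
      have := hp.two_le
      push_cast; zify at *; omega
    · rw [primTotient_prime_pow hp]
      have h2 : (2 : ℤ) ≤ p := by exact_mod_cast hp.two_le
      push_cast
      have h3 : (p : ℤ) ^ 2 ≤ (p - 1) ^ 2 * (n + 1 + 1 + 1) ^ 2 := by
        rw [← mul_pow]
        gcongr
        nlinarith
      calc (p : ℤ) ^ (n + 1 + 1) = p ^ n * p ^ 2 := by ring
        _ ≤ p ^ n * ((p - 1) ^ 2 * (n + 1 + 1 + 1) ^ 2) := by gcongr
        _ = _ := by ring
  | coprime a b ha hb hab iha ihb =>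
    rw [primTotient_mul hab, hab.card_divisors_mul]
    have ha4 : a % 4 ≠ 2 := by
      intro h
      have hb2 : b % 2 = 1 := by
        by_contra hc
        have h1 : 2 ∣ a := by omega
        have h2 : 2 ∣ b := by omega
        have := Nat.dvd_gcd h1 h2
        rw [hab] at this; omega
      apply h4
      have : b % 4 = 1 ∨ b % 4 = 3 := by omega
      rw [Nat.mul_mod, h]; rcases this with h | h <;> rw [h]
    have hb4 : b % 4 ≠ 2 := by
      intro h
      have hb2 : a % 2 = 1 := by
        by_contra hc
        have h1 : 2 ∣ a := by omega
        have h2 : 2 ∣ b := by omega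
        have := Nat.dvd_gcd h1 h2
        rw [hab] at this; omega
      apply h4
      have : a % 4 = 1 ∨ a % 4 = 3 := by omega
      rw [Nat.mul_mod, h]; rcases this with h | h <;> rw [h]
    have h1 := iha (by omega) ha4
    have h2 := ihb (by omega) hb4
    push_cast
    calc (a : ℤ) * b ≤ (primTotient a * (#a.divisors : ℤ) ^ 2) * (primTotient b * (#b.divisors : ℤ) ^ 2) := by
          apply mul_le_mul h1 h2 (by positivity)
          exact le_trans (by positivity) h1
      _ = _ := by ring

/-- The sum of `χ u` over the primitive Dirichlet characters modulo `q`. -/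
def primSum (q : ℕ) [NeZero q] (u : (ZMod q)ˣ) : ℂ :=
  open Classical in ∑ χ : DirichletCharacter ℂ q with χ.IsPrimitive, χ u

/-- The characters of conductor dividing `w` are exactly the lifts of the characters modulo `w`, so
this is orthogonality modulo `w`. -/
theorem sum_factorsThrough (q w : ℕ) [NeZero q] (hw : w ∣ q) (u : (ZMod q)ˣ) :
    (open Classical in ∑ χ : DirichletCharacter ℂ q with χ.conductor ∣ w, χ (u : ZMod q)) =
      if ZMod.unitsMap hw u = 1 then (w.totient : ℂ) else 0 := by
  classical
  have hw0 : NeZero w := ⟨fun h ↦ NeZero.ne q (by simpa [h] using hw)⟩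
  have h1 := DirichletCharacter.sum_characters_eq (R := ℂ) (n := w) ((ZMod.unitsMap hw u : (ZMod w)ˣ) : ZMod w)
  simp only [Units.val_eq_one] at h1
  rw [← h1]
  symm
  refine Finset.sum_bij (fun χ _ ↦ changeLevel hw χ) ?_ ?_ ?_ ?_
  · intro χ _
    simp only [mem_filter, mem_univ, true_and]
    rw [conductor_changeLevel]
    exact conductor_dvd_level χ
  · intro a _ b _ h
    exact changeLevel_injective hw h
  · intro χ hχ
    simp only [mem_filter, mem_univ, true_and] at hχ
    have := (DirichletCharacter.mem_conductorSet_iff_conductor_dvd χ hw).mpr hχ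
    obtain ⟨h, ψ, hψ⟩ := this
    exact ⟨ψ, mem_univ _, hψ.symm⟩
  · intro χ _
    rw [changeLevel_eq_cast_of_dvd]
    simp [ZMod.unitsMap]

/-- Möbius inversion over the divisors of `q`: sorting the characters in `sum_factorsThrough` by
their exact conductor `d ∣ w` gives the summatory relation, and the characters of conductor `q` are
the primitive ones. -/
theorem primSum_eq (q : ℕ) [NeZero q] (u : (ZMod q)ˣ) :
    primSum q u = ∑ x ∈ q.divisorsAntidiagonal, (ArithmeticFunction.moebius x.1 : ℂ) *
      (if (u : ZMod q).cast = (1 : ZMod x.2) then (x.2.totient : ℂ) else 0) := by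
  classical
  have key := (ArithmeticFunction.sum_eq_iff_sum_mul_moebius_eq_on (R := ℂ)
    (f := fun d ↦ ∑ χ : DirichletCharacter ℂ q with χ.conductor = d, χ (u : ZMod q))
    (g := fun w ↦ if (u : ZMod q).cast = (1 : ZMod w) then (w.totient : ℂ) else 0)
    {d | d ∣ q} (fun m n hm hn ↦ hm.trans hn)).mp ?_ q (NeZero.pos q) (dvd_refl q)
  · rw [key, primSum]
    refine Finset.sum_congr ?_ fun _ _ ↦ rfl
    ext χ
    simp [DirichletCharacter.isPrimitive_def]
  · intro w hw0 hw
    have hw' : w ∣ q := hw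
    have h := sum_factorsThrough q w hw' u
    have h2 : (ZMod.unitsMap hw' u = 1) ↔ ((u : ZMod q).cast = (1 : ZMod w)) := by
      rw [← Units.val_eq_one]; simp [ZMod.unitsMap]
    simp only [h2] at h
    rw [← h, ← Finset.sum_fiberwise_of_maps_to (t := w.divisors) (g := fun χ : DirichletCharacter ℂ q ↦ χ.conductor)
      (fun χ hχ ↦ ?_)]
    · refine Finset.sum_congr rfl fun d hd ↦ ?_
      refine Finset.sum_congr ?_ fun _ _ ↦ rfl
      ext χ
      simp only [mem_filter, mem_univ, true_and, iff_and_self]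
      rintro rfl
      exact Nat.dvd_of_mem_divisors hd
    · simp only [mem_filter, mem_univ, true_and] at hχ
      exact Nat.mem_divisors.mpr ⟨hχ, hw0.ne'⟩

/-- The finset of even primitive characters modulo `q`. -/
def evenPrim (q : ℕ) [NeZero q] : Finset (DirichletCharacter ℂ q) := (finite_evenPrimitive q).toFinset

theorem mem_evenPrim {q : ℕ} [NeZero q] {χ : DirichletCharacter ℂ q} :
    χ ∈ evenPrim q ↔ χ.IsPrimitive ∧ χ.Even := by simp [evenPrim, evenPrimitive]

theorem sum_evenPrim_eq (q : ℕ) [NeZero q] (u : (ZMod q)ˣ) :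
    ∑ χ ∈ evenPrim q, χ (u : ZMod q) = (primSum q u + primSum q (-u)) / 2 := by
  classical
  rw [primSum, primSum, ← sum_add_distrib, sum_div]
  have : evenPrim q = (univ.filter fun χ : DirichletCharacter ℂ q ↦ χ.IsPrimitive).filter
      (fun χ ↦ χ.Even) := by ext; simp [mem_evenPrim]
  rw [this, Finset.sum_filter]
  refine Finset.sum_congr rfl fun χ _ ↦ ?_
  rcases χ.even_or_odd with h | h
  · rw [if_pos h, Units.val_neg, h.eval_neg]; ring
  · rw [if_neg h.not_even, Units.val_neg, h.eval_neg]; ring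
end


/-! ### Orthogonality for even primitive characters, and a lower bound for their number. -/

noncomputable section

open Finset DirichletCharacter

/-- The sum of `χ x * conj (χ y)` over the even primitive characters modulo `q`. -/
def charSum (q : ℕ) [NeZero q] (x y : ℕ) : ℂ := ∑ χ ∈ evenPrim q, χ (x : ZMod q) * χ⁻¹ (y : ZMod q)

theorem charSum_self {q : ℕ} [NeZero q] {x : ℕ} (h : x.Coprime q) :
    charSum q x x = #(evenPrim q) := by
  rw [charSum, card_eq_sum_ones, Nat.cast_sum]
  refine sum_congr rfl fun χ _ ↦ ?_
  rw [← MulChar.mul_apply, mul_inv_cancel, MulChar.one_apply ((ZMod.isUnit_iff_coprime x q).mpr h)]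
  simp

theorem charSum_eq_zero {q : ℕ} [NeZero q] {x y : ℕ} (h : ¬ (x * y).Coprime q) :
    charSum q x y = 0 := by
  refine sum_eq_zero fun χ _ ↦ ?_
  rw [Nat.coprime_mul_iff_left, not_and_or] at h
  rcases h with h | h
  · rw [MulChar.map_nonunit χ (mt (ZMod.isUnit_iff_coprime x q).mp h), zero_mul]
  · rw [MulChar.map_nonunit χ⁻¹ (mt (ZMod.isUnit_iff_coprime y q).mp h), mul_zero]

theorem norm_primSum_le {q : ℕ} [NeZero q] (u : (ZMod q)ˣ) :
    ‖primSum q u‖ ≤ ∑ w ∈ q.divisors,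
      (if (u : ZMod q).cast = (1 : ZMod w) then (w.totient : ℝ) else 0) := by
  rw [primSum_eq, ← Nat.map_div_left_divisors, Finset.sum_map]
  refine (norm_sum_le _ _).trans (Finset.sum_le_sum fun w _ ↦ ?_)
  rw [norm_mul]
  have h1 : ‖(ArithmeticFunction.moebius (q / w) : ℂ)‖ ≤ 1 := by
    rw [Complex.norm_intCast]
    exact_mod_cast ArithmeticFunction.abs_moebius_le_one
  calc _ ≤ 1 * ‖(if (u : ZMod q).cast = (1 : ZMod w) then (w.totient : ℂ) else 0)‖ := by
        exact mul_le_mul h1 le_rfl (norm_nonneg _) zero_le_one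
    _ = _ := by split_ifs <;> simp

/-- For `x, y` prime to `q` the sum is half of `primSum` at `x/y` plus half of `primSum` at `-x/y`,
and these only see the divisors `w` with `x ≡ y`, respectively `x ≡ -y`. The factor one half pays
for the `w` where both congruences hold. -/
theorem norm_charSum_le {q : ℕ} [NeZero q] (x y : ℕ) :
    ‖charSum q x y‖ ≤ ∑ w ∈ q.divisors,
      (if (w : ℤ) ∣ x - y ∨ (w : ℤ) ∣ x + y then (w : ℝ) else 0) := by
  by_cases h : (x * y).Coprime q
  swap
  · rw [charSum_eq_zero h, norm_zero]
    exact sum_nonneg fun w _ ↦ by split_ifs <;> positivity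
  rw [Nat.coprime_mul_iff_left] at h
  obtain ⟨hx, hy⟩ := h
  set ux := ZMod.unitOfCoprime x hx
  set uy := ZMod.unitOfCoprime y hy
  have h1 : charSum q x y = ∑ χ ∈ evenPrim q, χ ((ux * uy⁻¹ : (ZMod q)ˣ) : ZMod q) := by
    refine sum_congr rfl fun χ _ ↦ ?_
    rw [Units.val_mul, map_mul, MulChar.inv_apply, ← ZMod.coe_unitOfCoprime x hx,
      ← ZMod.coe_unitOfCoprime y hy, Ring.inverse_unit]
  rw [h1, sum_evenPrim_eq, norm_div, Complex.norm_two, div_le_iff₀ two_pos]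
  refine (norm_add_le _ _).trans ((add_le_add (norm_primSum_le _) (norm_primSum_le _)).trans ?_)
  rw [← sum_add_distrib, sum_mul]
  refine sum_le_sum fun w hw ↦ ?_
  have hw' := Nat.dvd_of_mem_divisors hw
  have ht : (w.totient : ℝ) ≤ w := by exact_mod_cast Nat.totient_le w
  have e1 : ∀ u v : (ZMod q)ˣ, ((u * v⁻¹ : (ZMod q)ˣ) : ZMod q).cast = (1 : ZMod w) →
      ((u : ZMod q).cast : ZMod w) = ((v : ZMod q).cast : ZMod w) := by
    intro u v huv
    have : (u : ZMod q) = ((u * v⁻¹ : (ZMod q)ˣ) : ZMod q) * v := by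
      rw [← Units.val_mul]; simp
    rw [this, ZMod.cast_mul hw', huv, one_mul]
  have hxw : ((ux : ZMod q).cast : ZMod w) = (x : ZMod w) := by
    simp [ux, ZMod.coe_unitOfCoprime, ZMod.cast_natCast hw']
  have hyw : ((uy : ZMod q).cast : ZMod w) = (y : ZMod w) := by
    simp [uy, ZMod.coe_unitOfCoprime, ZMod.cast_natCast hw']
  have c1 : ((ux * uy⁻¹ : (ZMod q)ˣ) : ZMod q).cast = (1 : ZMod w) → (w : ℤ) ∣ x - y := by
    intro hh
    have := e1 _ _ hh
    rw [hxw, hyw] at this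
    rw [← ZMod.intCast_zmod_eq_zero_iff_dvd]
    simp [this]
  have c2 : ((-(ux * uy⁻¹) : (ZMod q)ˣ) : ZMod q).cast = (1 : ZMod w) → (w : ℤ) ∣ x + y := by
    intro hh
    rw [← neg_mul] at hh
    have := e1 _ _ hh
    rw [Units.val_neg, ZMod.cast_neg hw', hxw, hyw] at this
    rw [← ZMod.intCast_zmod_eq_zero_iff_dvd]
    simp [← this]
  by_cases d1 : ((ux * uy⁻¹ : (ZMod q)ˣ) : ZMod q).cast = (1 : ZMod w) <;>
  by_cases d2 : ((-(ux * uy⁻¹) : (ZMod q)ˣ) : ZMod q).cast = (1 : ZMod w)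
  · rw [if_pos d1, if_pos d2, if_pos (Or.inl (c1 d1))]; linarith
  · rw [if_pos d1, if_neg d2, if_pos (Or.inl (c1 d1))]; linarith [(w.cast_nonneg : (0:ℝ) ≤ w)]
  · rw [if_neg d1, if_pos d2, if_pos (Or.inr (c2 d2))]; linarith [(w.cast_nonneg : (0:ℝ) ≤ w)]
  · rw [if_neg d1, if_neg d2]; split_ifs <;> simp

/-- If `q = 2 r` with `r` odd, reduction identifies the units modulo `q` with those modulo `r`, so
every character modulo `q` is induced from `r`. -/
theorem evenPrim_eq_empty {q : ℕ} [NeZero q] (h : q % 4 = 2) : evenPrim q = ∅ := by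
  refine eq_empty_of_forall_notMem fun χ hχ ↦ ?_
  have hprim := (mem_evenPrim.mp hχ).1
  obtain ⟨r, hr⟩ : 2 ∣ q := by omega
  have hr2 : r % 2 = 1 := by omega
  have hrq : r ∣ q := ⟨2, by omega⟩
  have hr0 : NeZero r := ⟨by omega⟩
  have hcop : Nat.Coprime 2 r := (Nat.coprime_two_left).mpr (Nat.odd_iff.mpr hr2)
  have hinj : Function.Injective (ZMod.unitsMap hrq) := by
    refine ((Fintype.bijective_iff_surjective_and_card _).mpr ⟨ZMod.unitsMap_surjective hrq, ?_⟩).1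
    rw [ZMod.card_units_eq_totient, ZMod.card_units_eq_totient, hr, Nat.totient_mul hcop]
    simp
  have : χ.FactorsThrough r := by
    rw [factorsThrough_iff_ker_unitsMap hrq, (MonoidHom.ker_eq_bot_iff _).mpr hinj]
    exact bot_le
  have h1 := conductor_le_conductor_mem_conductorSet (χ := χ) this
  have h2 := conductor_dvd_of_mem_conductorSet χ this
  have h3 := Nat.le_of_dvd (by omega) h2
  rw [(isPrimitive_def χ).mp hprim] at h3
  omega

theorem primSum_one (q : ℕ) [NeZero q] : primSum q 1 = primTotient q := by
  rw [primSum_eq, primTotient]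
  push_cast
  refine sum_congr rfl fun x hx ↦ ?_
  have : x.2 ∣ q := ⟨x.1, by rw [mul_comm]; exact (Nat.mem_divisorsAntidiagonal.mp hx).1.symm⟩
  rw [if_pos (ZMod.cast_one this)]

/-- Only the moduli `w ∈ {1, 2}` satisfy `-1 ≡ 1`, and each of them has totient `1`. -/
theorem norm_primSum_neg_one_le (q : ℕ) [NeZero q] : ‖primSum q (-1)‖ ≤ 2 := by
  refine (norm_primSum_le _).trans ?_
  calc _ ≤ ∑ w ∈ q.divisors, (if w ∈ ({1, 2} : Finset ℕ) then (w.totient : ℝ) else 0) := by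
        refine sum_le_sum fun w hw ↦ ?_
        have hwq := Nat.dvd_of_mem_divisors hw
        split_ifs with h1 h2 h2
        · rfl
        · exfalso
          rw [Units.val_neg, Units.val_one, ZMod.cast_neg hwq, ZMod.cast_one hwq] at h1
          have : ((2 : ℕ) : ZMod w) = 0 := by
            push_cast
            have h3 : (1 : ZMod w) + 1 = 0 := by nth_rewrite 1 [← h1]; simp
            rw [← one_add_one_eq_two, h3]
          rw [ZMod.natCast_eq_zero_iff] at this
          have := (Nat.dvd_prime Nat.prime_two).mp this
          simp at h2; omega
        · positivity
        · rfl
    _ = ∑ w ∈ q.divisors ∩ {1, 2}, (w.totient : ℝ) := by rw [← sum_filter, filter_mem_eq_inter]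
    _ ≤ ∑ w ∈ ({1, 2} : Finset ℕ), (w.totient : ℝ) :=
        sum_le_sum_of_subset_of_nonneg inter_subset_right (fun _ _ _ ↦ by positivity)
    _ ≤ 2 := by rw [sum_pair (by norm_num)]; simp; norm_num

/-- Up to a bounded error, half of the primitive characters are even. Having at least one such
character both excludes `q ≡ 2 mod 4` and absorbs the bounded error into the factor `4`. -/
theorem card_evenPrim_lower {q : ℕ} [NeZero q] (h : (evenPrim q).Nonempty) :
    (q : ℝ) ≤ 4 * #(evenPrim q) * (#q.divisors : ℝ) ^ 2 := by
  have h4 : q % 4 ≠ 2 := fun h4 ↦ by simp [evenPrim_eq_empty h4] at h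
  have h1 : (q : ℝ) ≤ primTotient q * (#q.divisors : ℝ) ^ 2 := by
    exact_mod_cast primTotient_lower (NeZero.ne q) h4
  have h2 : (#(evenPrim q) : ℂ) = (primTotient q + primSum q (-1)) / 2 := by
    have := sum_evenPrim_eq q 1
    rw [primSum_one] at this
    rw [← this, card_eq_sum_ones]
    simp
  have h3 : (primTotient q : ℝ) - 2 ≤ 2 * #(evenPrim q) := by
    have h5 : (primTotient q : ℂ) - 2 * #(evenPrim q) = - primSum q (-1) := by rw [h2]; ring
    have h6 : ‖(primTotient q : ℂ) - 2 * #(evenPrim q)‖ ≤ 2 := by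
      rw [h5, norm_neg]; exact norm_primSum_neg_one_le q
    have h7 : ((primTotient q : ℝ) - 2 * #(evenPrim q)) ≤ ‖(primTotient q : ℂ) - 2 * #(evenPrim q)‖ := by
      have := Complex.re_le_norm ((primTotient q : ℂ) - 2 * #(evenPrim q))
      simpa using this
    linarith
  have h8 : (1 : ℝ) ≤ #(evenPrim q) := by exact_mod_cast h.card_pos
  refine h1.trans ?_
  gcongr
  linarith

/-- This is what makes any power saving in a moment computation sufficient, for arbitrary composite
`q`. -/
theorem exists_le_card_evenPrim {e : ℝ} (he : 0 < e) :
    ∃ C : ℝ, 0 < C ∧ ∀ (q : ℕ) [NeZero q], (evenPrim q).Nonempty →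
      (q : ℝ) ^ (1 - e) ≤ C * #(evenPrim q) := by
  obtain ⟨C, hC, h⟩ := exists_card_divisors_le_rpow (half_pos he)
  refine ⟨4 * C ^ 2, by positivity, fun q _ hq ↦ ?_⟩
  have hq0 : (0 : ℝ) < q := by exact_mod_cast NeZero.pos q
  have h1 := card_evenPrim_lower hq
  have h2 : (#q.divisors : ℝ) ^ 2 ≤ C ^ 2 * (q : ℝ) ^ e := by
    calc (#q.divisors : ℝ) ^ 2 ≤ (C * (q : ℝ) ^ (e / 2)) ^ 2 := by gcongr; exact h q (NeZero.ne q)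
      _ = _ := by rw [mul_pow, ← Real.rpow_natCast ((q : ℝ) ^ (e / 2)), ← Real.rpow_mul hq0.le]; norm_num
  rw [Real.rpow_sub hq0, Real.rpow_one, div_le_iff₀ (by positivity)]
  calc (q : ℝ) ≤ _ := h1
    _ ≤ 4 * #(evenPrim q) * (C ^ 2 * (q : ℝ) ^ e) := by gcongr
    _ = _ := by ring
end


/-! ### Theta series of even characters and their functional equation. -/

noncomputable section

open Finset DirichletCharacter Real

set_option linter.unusedSectionVars false

variable {q : ℕ} [NeZero q]

/-- The theta series `∑ χ(n) exp(-π n² t)` of a Dirichlet character. -/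
def thetaSeries (χ : DirichletCharacter ℂ q) (t : ℝ) : ℂ :=
  ∑' n : ℕ, χ (n : ZMod q) * (exp (-π * n ^ 2 * t) : ℝ)

theorem summable_exp_neg_sq {t : ℝ} (ht : 0 < t) : Summable fun n : ℕ ↦ exp (-π * n ^ 2 * t) := by
  refine Summable.of_nonneg_of_le (fun n ↦ (exp_pos _).le) (fun n ↦ ?_)
    (summable_geometric_of_lt_one (exp_pos (-π * t)).le ((exp_lt_exp.mpr (by nlinarith [pi_pos] : -π * t < 0)).trans_eq exp_zero))
  rw [← exp_nat_mul]
  apply exp_le_exp.mpr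
  have : (n : ℝ) ≤ n ^ 2 := by exact_mod_cast Nat.le_self_pow two_ne_zero n
  nlinarith [mul_pos pi_pos ht]

theorem norm_char_mul_exp_le (χ : DirichletCharacter ℂ q) (n : ℕ) (r : ℝ) :
    ‖χ (n : ZMod q) * (exp r : ℝ)‖ ≤ exp r := by
  rw [norm_mul, Complex.norm_real, norm_of_nonneg (exp_pos _).le]
  exact mul_le_of_le_one_left (exp_pos _).le (DirichletCharacter.norm_le_one χ _)

theorem hasSum_thetaSeries (χ : DirichletCharacter ℂ q) {t : ℝ} (ht : 0 < t) :
    HasSum (fun n : ℕ ↦ χ (n : ZMod q) * (exp (-π * n ^ 2 * t) : ℝ)) (thetaSeries χ t) :=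
  (Summable.of_norm_bounded (summable_exp_neg_sq ht)
    (fun n ↦ norm_char_mul_exp_le χ n _)).hasSum

/-- The term `n = 0` vanishes because `q > 1`; for the others `n² ≥ n` gives a geometric series, and
`(1 - e^{-πt})⁻¹ ≤ 1 + 1/(πt)`. -/
theorem norm_thetaSeries_le (hq : 1 < q) (χ : DirichletCharacter ℂ q) {t : ℝ} (ht : 0 < t) :
    ‖thetaSeries χ t‖ ≤ (1 + 1 / t) * exp (-π * t) := by
  have hlt : exp (-π * t) < 1 := (exp_lt_exp.mpr (by nlinarith [pi_pos] : -π * t < 0)).trans_eq exp_zero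
  have hg := (hasSum_geometric_of_lt_one (exp_pos (-π * t)).le hlt).mul_left (exp (-π * t))
  have h0 : thetaSeries χ t = ∑' n : ℕ, χ ((n + 1 : ℕ) : ZMod q) * (exp (-π * (n + 1 : ℕ) ^ 2 * t) : ℝ) := by
    have := (hasSum_nat_add_iff' (f := fun n : ℕ ↦ χ (n : ZMod q) * (exp (-π * n ^ 2 * t) : ℝ)) 1).mpr
      (hasSum_thetaSeries χ ht)
    rw [this.tsum_eq]
    simp [DirichletCharacter.map_zero' χ hq.ne']
  rw [h0]
  refine (tsum_of_norm_bounded hg fun n ↦ (norm_char_mul_exp_le χ _ _).trans ?_).trans ?_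
  · rw [← exp_nat_mul, ← exp_add]
    apply exp_le_exp.mpr
    have : ((n : ℝ) + 1) ≤ (n + 1) ^ 2 := by nlinarith [(n.cast_nonneg : (0:ℝ) ≤ n)]
    push_cast
    nlinarith [mul_pos pi_pos ht]
  · rw [mul_comm]
    gcongr
    have h1 : π * t + 1 ≤ exp (π * t) := add_one_le_exp _
    have h2 : exp (-π * t) = (exp (π * t))⁻¹ := by rw [← exp_neg]; ring_nf
    have h3 : 0 < π * t := mul_pos pi_pos ht
    have h4 : (exp (π * t))⁻¹ ≤ (π * t + 1)⁻¹ := by gcongr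
    have h5 : π * t / (π * t + 1) ≤ 1 - exp (-π * t) := by
      rw [h2]
      have : π * t / (π * t + 1) = 1 - (π * t + 1)⁻¹ := by field_simp; ring
      linarith
    calc (1 - exp (-π * t))⁻¹ ≤ (π * t / (π * t + 1))⁻¹ := by gcongr
      _ = 1 + 1 / (π * t) := by field_simp
      _ ≤ 1 + 1 / t := by
        gcongr
        nlinarith [pi_gt_three]

theorem hasSum_int_thetaSeries (hq : 1 < q) {χ : DirichletCharacter ℂ q} (hχ : χ.Even) {t : ℝ} (ht : 0 < t) :
    HasSum (fun n : ℤ ↦ χ (n : ZMod q) * (exp (-π * n ^ 2 * t) : ℝ)) (2 * thetaSeries χ t) := by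
  have h1 := hasSum_thetaSeries χ ht
  have h2 := (hasSum_nat_add_iff' (f := fun n : ℕ ↦ χ (n : ZMod q) * (exp (-π * n ^ 2 * t) : ℝ)) 1).mpr h1
  have := HasSum.of_nat_of_neg_add_one (f := fun n : ℤ ↦ χ (n : ZMod q) * (exp (-π * n ^ 2 * t) : ℝ))
    (m := thetaSeries χ t) (m' := thetaSeries χ t) (by simpa using h1) ?_
  · rwa [← two_mul] at this
  · convert! h2 using 1
    · ext n
      have h3 : ((-((n : ℤ) + 1) : ℤ) : ZMod q) = -((n + 1 : ℕ) : ZMod q) := by push_cast; rfl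
      have h4 : ((-((n : ℤ) + 1) : ℤ) : ℝ) ^ 2 = ((n + 1 : ℕ) : ℝ) ^ 2 := by push_cast; ring
      rw [h3, hχ.eval_neg, h4]
    · simp [DirichletCharacter.map_zero' χ hq.ne']

/-- Splitting the integers by residue modulo `q` expresses the theta series by finitely many Hurwitz
kernels, whose continuity and transformation law are known. -/
theorem hasSum_int_residues (χ : DirichletCharacter ℂ q) {t : ℝ} (ht : 0 < t) {S : ℂ}
    (hS : HasSum (fun n : ℤ ↦ χ (n : ZMod q) * (exp (-π * n ^ 2 * t) : ℝ)) S) :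
    S = ∑ a : Fin q, χ ((a : ℕ) : ZMod q) *
      (HurwitzZeta.evenKernel ((((a : ℕ) : ℝ) / q : ℝ) : UnitAddCircle) (q ^ 2 * t) : ℝ) := by
  have hq0 : (q : ℝ) ≠ 0 := by exact_mod_cast NeZero.ne q
  have h1 := (Int.divModEquiv q).symm.hasSum_iff.mpr hS
  have h2 := (Equiv.prodComm (Fin q) ℤ).hasSum_iff.mpr h1
  have h3 := HasSum.prod_fiberwise h2 (g := fun a : Fin q ↦ χ ((a : ℕ) : ZMod q) *
      (HurwitzZeta.evenKernel ((((a : ℕ) : ℝ) / q : ℝ) : UnitAddCircle) (q ^ 2 * t) : ℝ)) ?_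
  · exact h3.unique (hasSum_fintype _)
  · intro a
    have := (HurwitzZeta.hasSum_int_evenKernel ((a : ℕ) / q) (t := q ^ 2 * t) (by positivity))
    convert! (Complex.hasSum_ofReal.mpr this).mul_left (χ ((a : ℕ) : ZMod q)) using 1
    ext n
    simp only [Function.comp_apply, Equiv.prodComm_apply, Prod.swap_prod_mk, Int.divModEquiv_symm_apply]
    push_cast
    simp only [CharP.cast_eq_zero, mul_zero, zero_add]
    congr 2
    have : (q : ℂ) ≠ 0 := by exact_mod_cast NeZero.ne q
    field_simp

theorem thetaSeries_eq_sum (hq : 1 < q) {χ : DirichletCharacter ℂ q} (hχ : χ.Even) {t : ℝ} (ht : 0 < t) :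
    2 * thetaSeries χ t = ∑ a : Fin q, χ ((a : ℕ) : ZMod q) *
      (HurwitzZeta.evenKernel ((((a : ℕ) : ℝ) / q : ℝ) : UnitAddCircle) (q ^ 2 * t) : ℝ) :=
  hasSum_int_residues χ ht (hasSum_int_thetaSeries hq hχ ht)

theorem continuousOn_thetaSeries (hq : 1 < q) {χ : DirichletCharacter ℂ q} (hχ : χ.Even) :
    ContinuousOn (thetaSeries χ) (Set.Ioi 0) := by
  have hq0 : (0 : ℝ) < q := by exact_mod_cast NeZero.pos q
  have : Set.EqOn (thetaSeries χ) (fun t ↦ (∑ a : Fin q, χ ((a : ℕ) : ZMod q) *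
      (HurwitzZeta.evenKernel ((((a : ℕ) : ℝ) / q : ℝ) : UnitAddCircle) (q ^ 2 * t) : ℝ)) / 2) (Set.Ioi 0) := by
    intro t ht
    have := thetaSeries_eq_sum hq hχ ht
    simp only
    rw [← this]; ring
  refine ContinuousOn.congr ?_ this
  refine ContinuousOn.div_const (continuousOn_finsetSum _ fun a _ ↦ continuousOn_const.mul ?_) _
  refine Complex.continuous_ofReal.comp_continuousOn ?_
  refine (HurwitzZeta.continuousOn_evenKernel _).comp (by fun_prop) ?_
  intro t ht
  exact mul_pos (pow_pos hq0 2) ht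

theorem inv_even {χ : DirichletCharacter ℂ q} (hχ : χ.Even) : (χ⁻¹).Even := by
  have : χ (-1) = 1 := hχ
  rw [DirichletCharacter.Even, MulChar.inv_apply_eq_inv, this, Ring.inverse_one]

/-- The law `t ↦ 1/t` for Hurwitz kernels (Poisson summation) turns residues into additive
characters. Summing these against a primitive `χ` produces the Gauss sum times `χ⁻¹`, also at
integers not prime to `q`. -/
theorem thetaSeries_functional_equation (hq : 1 < q) {χ : DirichletCharacter ℂ q} (hχ : χ.Even)
    (hp : χ.IsPrimitive) {t : ℝ} (ht : 0 < t) :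
    thetaSeries χ t = gaussSum χ ZMod.stdAddChar / (q * sqrt t : ℝ) *
      thetaSeries χ⁻¹ (1 / (q ^ 2 * t)) := by
  have hq0 : (0 : ℝ) < q := by exact_mod_cast NeZero.pos q
  have hqc : (q : ℂ) ≠ 0 := by exact_mod_cast NeZero.ne q
  have h1 := thetaSeries_eq_sum hq hχ ht
  set T : ℝ := 1 / (q ^ 2 * t) with hT
  have hT0 : 0 < T := by positivity
  have h2 : HasSum (fun n : ℤ ↦ ∑ a : Fin q, χ ((a : ℕ) : ZMod q) *
      (Complex.exp (2 * π * Complex.I * ((((a : ℕ) : ℝ) / q : ℝ) : ℂ) * n) * rexp (-π * n ^ 2 * T)))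
      (∑ a : Fin q, χ ((a : ℕ) : ZMod q) *
        (HurwitzZeta.cosKernel ((((a : ℕ) : ℝ) / q : ℝ) : UnitAddCircle) T : ℝ)) :=
    hasSum_sum fun a _ ↦ (HurwitzZeta.hasSum_int_cosKernel _ hT0).mul_left _
  have h3 : ∀ n : ℤ, ∑ a : Fin q, χ ((a : ℕ) : ZMod q) *
      (Complex.exp (2 * π * Complex.I * ((((a : ℕ) : ℝ) / q : ℝ) : ℂ) * n) * rexp (-π * n ^ 2 * T)) =
      gaussSum χ ZMod.stdAddChar * (χ⁻¹ (n : ZMod q) * (rexp (-π * n ^ 2 * T) : ℝ)) := by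
    intro n
    rw [← mul_assoc, mul_comm (gaussSum _ _), ← gaussSum_mulShift_of_isPrimitive _ hp, gaussSum,
      Finset.sum_mul]
    refine Fintype.sum_equiv (ZMod.finEquiv q).toEquiv _ _ fun a ↦ ?_
    have ha : (ZMod.finEquiv q).toEquiv a = ((a : ℕ) : ZMod q) := by
      obtain _ | m := q
      · exact absurd rfl (NeZero.ne 0)
      · exact (Fin.cast_val_eq_self a).symm
    rw [ha, AddChar.mulShift_apply, ← mul_assoc]
    congr 2
    have : ((n : ZMod q) * ((a : ℕ) : ZMod q)) = ((n * (a : ℕ) : ℤ) : ZMod q) := by push_cast; rfl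
    rw [this, ZMod.stdAddChar_coe]
    congr 1
    push_cast
    ring
  simp_rw [h3] at h2
  have h4 := h2.unique ((hasSum_int_thetaSeries hq (inv_even hχ) hT0).mul_left _)
  have h5 : 2 * thetaSeries χ t = (1 / (q * sqrt t : ℝ) : ℂ) * (∑ a : Fin q, χ ((a : ℕ) : ZMod q) *
        (HurwitzZeta.cosKernel ((((a : ℕ) : ℝ) / q : ℝ) : UnitAddCircle) T : ℝ)) := by
    rw [h1, Finset.mul_sum]
    refine Finset.sum_congr rfl fun a _ ↦ ?_
    rw [HurwitzZeta.evenKernel_functional_equation, ← hT]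
    have : (q ^ 2 * t : ℝ) ^ (1 / 2 : ℝ) = q * sqrt t := by
      rw [← sqrt_eq_rpow, sqrt_mul (by positivity), sqrt_sq hq0.le]
    rw [this]
    push_cast
    ring
  rw [h4] at h5
  have h6 : thetaSeries χ t = (2 * thetaSeries χ t) / 2 := by ring
  rw [h6, h5]
  push_cast
  ring
end


/-! ### The L-function as a two-sided Laplace transform of the theta series. -/

noncomputable section

open Finset DirichletCharacter Real Filter Topology MeasureTheory

set_option linter.unusedSectionVars false

variable {q : ℕ} [NeZero q]

/-- The theta series in a logarithmic variable, normalized to have the functional equation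
`Θ_χ(-x) = ε_χ Θ_{χ⁻¹}(x)`. -/
def logTheta (χ : DirichletCharacter ℂ q) (x : ℝ) : ℂ :=
  (exp (x / 4) : ℝ) * thetaSeries χ (exp (x - log q))

/-- The sign of the functional equation of an even primitive character. -/
def thetaSign (χ : DirichletCharacter ℂ q) : ℂ := gaussSum χ ZMod.stdAddChar / (sqrt q : ℝ)

/-- The point `t = 1/q` fixed by `t ↦ 1/(q² t)` corresponds to `x = 0`, and the factor `e^{x/4}`
balances the square root `√t` of the functional equation. -/
theorem logTheta_neg (hq : 1 < q) {χ : DirichletCharacter ℂ q} (hχ : χ.Even)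
    (hp : χ.IsPrimitive) (x : ℝ) : logTheta χ (-x) = thetaSign χ * logTheta χ⁻¹ x := by
  have hq0 : (0 : ℝ) < q := by exact_mod_cast NeZero.pos q
  rw [logTheta, thetaSeries_functional_equation hq hχ hp (exp_pos _), logTheta, thetaSign]
  have h1 : 1 / ((q : ℝ) ^ 2 * exp (-x - log q)) = exp (x - log q) := by
    rw [sub_eq_add_neg, sub_eq_add_neg, exp_add, exp_add, exp_neg, exp_neg, exp_log hq0]
    field_simp
  rw [h1]
  have h2 : (exp (-x / 4)) / (q * sqrt (exp (-x - log q))) = exp (x / 4) / sqrt q := by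
    have : sqrt (exp (-x - log q)) = exp (-x / 2) / sqrt q := by
      rw [exp_sub, exp_log hq0, sqrt_div (exp_pos _).le, ← exp_half]
    rw [this, div_eq_div_iff (by positivity) (by positivity)]
    have h3 : exp (x / 4) * exp (-x / 2) = exp (-x / 4) := by rw [← exp_add]; ring_nf
    rw [← h3]
    nth_rewrite 2 [← mul_self_sqrt hq0.le]
    field_simp
  have h2' := congrArg (fun r : ℝ ↦ (r : ℂ)) h2
  push_cast at h2' ⊢
  calc _ = (Complex.exp (-x / 4) / (q * (sqrt (exp (-x - log q)) : ℝ))) * gaussSum χ ZMod.stdAddChar *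
        thetaSeries χ⁻¹ (exp (x - log q)) := by ring
    _ = _ := by rw [h2']; ring

theorem conj_char (χ : DirichletCharacter ℂ q) (a : ZMod q) : star (χ a) = χ⁻¹ a := by
  rw [← MulChar.star_apply, MulChar.star_eq_inv]

theorem conj_thetaSeries (χ : DirichletCharacter ℂ q) (t : ℝ) :
    star (thetaSeries χ t) = thetaSeries χ⁻¹ t := by
  rw [thetaSeries, thetaSeries, tsum_star]
  refine tsum_congr fun n ↦ ?_
  rw [star_mul', conj_char]
  congr 1
  exact Complex.conj_ofReal _

theorem conj_logTheta (χ : DirichletCharacter ℂ q) (x : ℝ) :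
    star (logTheta χ x) = logTheta χ⁻¹ x := by
  rw [logTheta, star_mul', conj_thetaSeries, logTheta]
  congr 1
  exact Complex.conj_ofReal _

theorem norm_logTheta_le (hq : 1 < q) (χ : DirichletCharacter ℂ q) (x : ℝ) :
    ‖logTheta χ x‖ ≤ exp (x / 4) * ((1 + exp (log q - x)) * exp (-π * exp (x - log q))) := by
  rw [logTheta, norm_mul, Complex.norm_real, norm_of_nonneg (exp_pos _).le]
  gcongr
  refine (norm_thetaSeries_le hq χ (exp_pos _)).trans_eq ?_
  rw [one_div, ← exp_neg, neg_sub]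

theorem continuous_logTheta (hq : 1 < q) {χ : DirichletCharacter ℂ q} (hχ : χ.Even) :
    Continuous (logTheta χ) := by
  refine Continuous.mul (by fun_prop) ?_
  exact (continuousOn_thetaSeries hq hχ).comp_continuous (by fun_prop) (fun x ↦ exp_pos _)

/-- For `x ≥ 0` the doubly exponential decay in `x` beats every exponential. The constant does not
depend on `χ`, so the bound can be used for `χ⁻¹` as well, and reflection then gives two-sided
decay. -/
theorem exists_norm_logTheta_le_of_nonneg (q : ℕ) [NeZero q] (hq : 1 < q) (A : ℝ) :
    ∃ C : ℝ, 0 < C ∧ ∀ (χ : DirichletCharacter ℂ q) (x : ℝ), 0 ≤ x → ‖logTheta χ x‖ ≤ C * exp (-A * x) := by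
  have hq0 : (0 : ℝ) < q := by exact_mod_cast NeZero.pos q
  have h1 : Tendsto (fun y : ℝ ↦ y ^ (A + 1 / 4) * exp (-(π / q) * y)) atTop (𝓝 0) :=
    tendsto_rpow_mul_exp_neg_mul_atTop_nhds_zero _ _ (by positivity)
  have h2 : ContinuousOn (fun y : ℝ ↦ y ^ (A + 1 / 4) * exp (-(π / q) * y)) (Set.Ici 1) := by
    refine ContinuousOn.mul (fun y hy ↦ ?_) (by fun_prop)
    have : y ≠ 0 := (lt_of_lt_of_le zero_lt_one hy).ne'
    exact (Real.continuousAt_rpow_const _ _ (Or.inl this)).continuousWithinAt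
  obtain ⟨C, hC⟩ : ∃ C, ∀ y ∈ Set.Ici (1 : ℝ), y ^ (A + 1 / 4) * exp (-(π / q) * y) ≤ C := by
    have h3 : ∀ᶠ y in atTop, y ^ (A + 1 / 4) * exp (-(π / q) * y) < 1 := h1.eventually_lt_const zero_lt_one
    obtain ⟨Y, hY⟩ := eventually_atTop.mp h3
    obtain ⟨C, hC⟩ := (isCompact_Icc (a := (1 : ℝ)) (b := Y)).bddAbove_image (h2.mono Set.Icc_subset_Ici_self)
    refine ⟨max C 1, fun y hy ↦ ?_⟩
    rcases le_total y Y with h | h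
    · exact le_max_of_le_left (hC ⟨y, ⟨hy, h⟩, rfl⟩)
    · exact le_max_of_le_right (hY y h).le
  refine ⟨(1 + q) * max C 1, by positivity, fun χ x hx ↦ (norm_logTheta_le hq χ x).trans ?_⟩
  have h4 := hC (exp x) (by simpa using one_le_exp hx)
  have h5 : exp (x / 4) * exp (-π * exp (x - log q)) ≤ max C 1 * exp (-A * x) := by
    have e1 : exp x ^ (A + 1 / 4) = exp (A * x) * exp (x / 4) := by
      rw [← exp_mul, ← exp_add]; ring_nf
    have e2 : exp (-(π / q) * exp x) = exp (-π * exp (x - log q)) := by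
      rw [exp_sub, exp_log hq0]; ring_nf
    rw [e1, e2] at h4
    have h6 : exp (A * x) * (exp (x / 4) * exp (-π * exp (x - log q))) ≤ max C 1 :=
      le_trans (by rw [← mul_assoc]; exact h4) (le_max_left _ _)
    have e3 : exp (-A * x) = (exp (A * x))⁻¹ := by rw [← exp_neg]; ring_nf
    rw [e3, ← div_eq_mul_inv, le_div_iff₀ (exp_pos _)]
    linarith
  have h6 : 1 + exp (log q - x) ≤ 1 + q := by
    gcongr
    calc exp (log q - x) ≤ exp (log q) := exp_le_exp.mpr (by linarith)
      _ = q := exp_log hq0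
  calc _ = (1 + exp (log q - x)) * (exp (x / 4) * exp (-π * exp (x - log q))) := by ring
    _ ≤ (1 + q) * (max C 1 * exp (-A * x)) := by gcongr
    _ = _ := by ring

theorem exists_norm_logTheta_le (hq : 1 < q) {χ : DirichletCharacter ℂ q} (hχ : χ.Even)
    (hp : χ.IsPrimitive) (A : ℝ) :
    ∃ C : ℝ, 0 < C ∧ ∀ x : ℝ, ‖logTheta χ x‖ ≤ C * exp (-A * |x|) := by
  obtain ⟨C, hC, h⟩ := exists_norm_logTheta_le_of_nonneg q hq A
  refine ⟨C * (1 + ‖thetaSign χ‖), by positivity, fun x ↦ ?_⟩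
  rcases le_total 0 x with hx | hx
  · rw [abs_of_nonneg hx]
    refine (h χ x hx).trans ?_
    gcongr
    exact le_mul_of_one_le_right hC.le (by linarith [norm_nonneg (thetaSign χ)])
  · rw [abs_of_nonpos hx]
    have : logTheta χ x = thetaSign χ * logTheta χ⁻¹ (-x) := by rw [← logTheta_neg hq hχ hp, neg_neg]
    rw [this, norm_mul]
    calc _ ≤ (1 + ‖thetaSign χ‖) * (C * exp (-A * -x)) := by
          gcongr
          · linarith
          · exact h _ _ (by linarith)
      _ = _ := by ring

theorem integrable_exp_neg_mul_abs {A : ℝ} (hA : 0 < A) : Integrable fun x : ℝ ↦ exp (-A * |x|) := by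
  rw [← integrableOn_univ, ← Set.Iic_union_Ioi (a := (0 : ℝ))]
  refine IntegrableOn.union ?_ ?_
  · refine (integrableOn_exp_mul_Iic hA 0).congr_fun (fun x hx ↦ ?_) measurableSet_Iic
    simp only [abs_of_nonpos (Set.mem_Iic.mp hx)]
    ring_nf
  · refine (integrableOn_exp_mul_Ioi (neg_neg_of_pos hA) 0).congr_fun (fun x hx ↦ ?_) measurableSet_Ioi
    simp only [abs_of_pos (Set.mem_Ioi.mp hx)]

theorem mellin_eq_integral_exp (f : ℝ → ℂ) (s : ℂ) :
    mellin f s = ∫ x : ℝ, Complex.exp (s * x) * f (exp x) := by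
  have h : Set.Ioi (0 : ℝ) = exp '' Set.univ := by rw [Set.image_univ, Real.range_exp]
  rw [mellin, h, integral_image_eq_integral_abs_deriv_smul MeasurableSet.univ
    (fun x _ ↦ (hasDerivAt_exp x).hasDerivWithinAt) exp_injective.injOn]
  rw [Measure.restrict_univ]
  refine integral_congr_ae (Eventually.of_forall fun x ↦ ?_)
  simp only [abs_of_pos (exp_pos x), Complex.real_smul, smul_eq_mul]
  rw [← mul_assoc]
  congr 1
  have : ((exp x : ℝ) : ℂ) ≠ 0 := by exact_mod_cast (exp_pos x).ne'
  rw [Complex.cpow_def_of_ne_zero this, ← Complex.ofReal_log (exp_pos x).le, log_exp, Complex.ofReal_exp,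
    ← Complex.exp_add]
  ring_nf

theorem thetaSeries_eq_logTheta (χ : DirichletCharacter ℂ q) (x : ℝ) :
    thetaSeries χ (exp x) = (exp (-(x + log q) / 4) : ℝ) * logTheta χ (x + log q) := by
  rw [logTheta, ← mul_assoc, ← Complex.ofReal_mul, ← exp_add,
    show -(x + log q) / 4 + (x + log q) / 4 = 0 by ring]
  simp

theorem differentiable_mellin_thetaSeries (hq : 1 < q) {χ : DirichletCharacter ℂ q} (hχ : χ.Even)
    (hp : χ.IsPrimitive) : Differentiable ℂ (mellin (thetaSeries χ)) := by
  intro s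
  -- This rate is what yields `thetaSeries χ t = O(t ^ {-(Re s - 1)})` at `0` after the factor
  -- `e^{-x/4}` is restored, so the Mellin integral converges at `s` with room to spare.
  obtain ⟨C, hC, h⟩ := exists_norm_logTheta_le hq hχ hp (1 / 4 - (s.re - 1))
  have hq0 : (0 : ℝ) < q := by exact_mod_cast NeZero.pos q
  refine mellin_differentiableAt_of_isBigO_rpow_exp pi_pos
    ((continuousOn_thetaSeries hq hχ).locallyIntegrableOn measurableSet_Ioi) ?_
    (b := s.re - 1) ?_ (by linarith)
  · refine Asymptotics.IsBigO.of_bound 2 ?_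
    filter_upwards [eventually_ge_atTop 1] with t ht
    refine (norm_thetaSeries_le hq χ (by linarith)).trans ?_
    rw [norm_of_nonneg (exp_pos _).le]
    gcongr
    have : 1 / t ≤ 1 := by rw [div_le_one (by linarith)]; exact ht
    linarith
  · refine Asymptotics.IsBigO.of_bound (C * exp ((1 / 4 - (s.re - 1)) * log q - log q / 4)) ?_
    have h1 : ∀ᶠ t : ℝ in 𝓝[>] 0, t < 1 / q :=
      (eventually_lt_nhds (by positivity : (0 : ℝ) < 1 / q)).filter_mono nhdsWithin_le_nhds
    filter_upwards [self_mem_nhdsWithin, h1] with t ht ht2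
    have ht0 : 0 < t := ht
    have h2 : log t + log q ≤ 0 := by
      rw [← log_mul ht0.ne' hq0.ne']
      refine log_nonpos (by positivity) ?_
      rw [lt_div_iff₀ hq0] at ht2
      exact ht2.le
    have h3 := thetaSeries_eq_logTheta χ (log t)
    rw [exp_log ht0] at h3
    rw [h3, norm_mul, Complex.norm_real, norm_of_nonneg (exp_pos _).le,
      norm_of_nonneg (rpow_nonneg ht0.le _), rpow_def_of_pos ht0]
    calc _ ≤ exp (-(log t + log q) / 4) * (C * exp (-(1 / 4 - (s.re - 1)) * |log t + log q|)) := by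
          gcongr
          exact h _
      _ = _ := by
          rw [abs_of_nonpos h2, mul_assoc, mul_left_comm, ← exp_add, ← exp_add]
          ring_nf

theorem ne_one_of_isPrimitive (hq : 1 < q) {χ : DirichletCharacter ℂ q} (hp : χ.IsPrimitive) : χ ≠ 1 := by
  rintro rfl
  rw [isPrimitive_def, conductor_one] at hp
  omega

/-- For `Re s > 1` this is termwise integration of the theta series. Both sides are entire, the
right side because `1/Γℝ` is entire and the theta series decays rapidly at both ends, so the
identity theorem applies. -/
theorem LFunction_eq_mellin (hq : 1 < q) {χ : DirichletCharacter ℂ q} (hχ : χ.Even)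
    (hp : χ.IsPrimitive) (s : ℂ) :
    LFunction χ s = (Complex.Gammaℝ s)⁻¹ * mellin (thetaSeries χ) (s / 2) := by
  have hd1 : Differentiable ℂ (LFunction χ) := differentiable_LFunction (ne_one_of_isPrimitive hq hp)
  have hd2 : Differentiable ℂ (fun s ↦ (Complex.Gammaℝ s)⁻¹ * mellin (thetaSeries χ) (s / 2)) :=
    Complex.differentiable_Gammaℝ_inv.mul
      ((differentiable_mellin_thetaSeries hq hχ hp).comp (differentiable_id.div_const 2))
  refine congrFun (AnalyticOnNhd.eq_of_eventuallyEq (z₀ := 2)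
    (hd1.differentiableOn.analyticOnNhd isOpen_univ)
    (hd2.differentiableOn.analyticOnNhd isOpen_univ) ?_) s
  have : ∀ᶠ s : ℂ in 𝓝 2, 1 < s.re := Complex.continuous_re.continuousAt.eventually_const_lt (by norm_num)
  filter_upwards [this] with s hs
  have h0 : s ≠ 0 := by rintro rfl; simp at hs; linarith
  have h1 := hasSum_mellin_pi_mul_sq (a := fun n : ℕ ↦ χ (n : ZMod q)) (r := fun n : ℕ ↦ (n : ℝ))
    (F := thetaSeries χ) (s := s) (by linarith) ?_ ?_
  · rw [← h1.tsum_eq, LFunction_eq_LSeries χ hs, LSeries, ← tsum_mul_left]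
    refine tsum_congr fun n ↦ ?_
    rcases eq_or_ne n 0 with rfl | hn
    · simp [h0]
    · rw [LSeries.term_of_ne_zero hn]
      have : Complex.Gammaℝ s ≠ 0 := Complex.Gammaℝ_ne_zero_of_re_pos (by linarith)
      field_simp
      simp
  · intro t ht
    convert hasSum_thetaSeries χ ht using 2 with n
    rcases eq_or_ne n 0 with rfl | hn
    · simp [DirichletCharacter.map_zero' χ hq.ne']
    · rw [if_neg (by exact_mod_cast hn)]
  · refine Summable.of_nonneg_of_le (fun n ↦ by positivity) (fun n ↦ ?_)
      (Real.summable_one_div_nat_rpow.mpr hs)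
    rw [Nat.abs_cast]
    gcongr
    exact DirichletCharacter.norm_le_one χ _

theorem LFunction_eq_integral (hq : 1 < q) {χ : DirichletCharacter ℂ q} (hχ : χ.Even)
    (hp : χ.IsPrimitive) (a : ℂ) :
    LFunction χ (1 / 2 + a) = (Complex.Gammaℝ (1 / 2 + a))⁻¹ *
      (Complex.exp (-(1 / 4 + a / 2) * log q) * ∫ x : ℝ, logTheta χ x * Complex.exp (a * x / 2)) := by
  rw [LFunction_eq_mellin hq hχ hp, mellin_eq_integral_exp]
  congr 1
  rw [← integral_sub_right_eq_self (fun x : ℝ ↦ Complex.exp ((1 / 2 + a) / 2 * x) * thetaSeries χ (exp x)) (log q),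
    ← integral_const_mul]
  refine integral_congr_ae (Eventually.of_forall fun x ↦ ?_)
  simp only
  rw [logTheta]
  have : Complex.exp ((1 / 2 + a) / 2 * (x - log q : ℝ)) = Complex.exp (-(1 / 4 + a / 2) * log q) *
      ((exp (x / 4) : ℝ) * Complex.exp (a * x / 2)) := by
    rw [Complex.ofReal_exp, ← Complex.exp_add, ← Complex.exp_add]
    push_cast
    ring_nf
  rw [this]
  ring
end


/-! ### Sign of the functional equation, and a smoothed product formula. -/

noncomputable section

open Finset DirichletCharacter Real Filter Topology MeasureTheory

set_option linter.unusedSectionVars false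

variable {q : ℕ} [NeZero q]

theorem inv_isPrimitive {χ : DirichletCharacter ℂ q} (hp : χ.IsPrimitive) : (χ⁻¹).IsPrimitive := by
  rw [isPrimitive_def] at hp ⊢
  rw [conductor_inv, hp]

/-- Otherwise the integral representation would force `L(2, χ) = 0`. A point of nonvanishing allows
identities between signs to be read off from `logTheta_neg`, with no evaluation of the Gauss sum. -/
theorem exists_logTheta_ne_zero (hq : 1 < q) {χ : DirichletCharacter ℂ q} (hχ : χ.Even)
    (hp : χ.IsPrimitive) : ∃ x, logTheta χ x ≠ 0 := by
  by_contra! h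
  have h1 := LFunction_eq_integral hq hχ hp (3 / 2)
  simp only [h, zero_mul, integral_zero, mul_zero] at h1
  exact LFunction_ne_zero_of_one_le_re χ (Or.inl (ne_one_of_isPrimitive hq hp)) (by norm_num) h1

theorem thetaSign_mul_inv (hq : 1 < q) {χ : DirichletCharacter ℂ q} (hχ : χ.Even)
    (hp : χ.IsPrimitive) : thetaSign χ * thetaSign χ⁻¹ = 1 := by
  obtain ⟨x, hx⟩ := exists_logTheta_ne_zero hq hχ hp
  have h1 := logTheta_neg hq hχ hp (-x)
  rw [neg_neg, logTheta_neg hq (inv_even hχ) (inv_isPrimitive hp), inv_inv, ← mul_assoc] at h1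
  exact (mul_right_cancel₀ hx (by rw [one_mul]; exact h1)).symm

theorem conj_thetaSign (hq : 1 < q) {χ : DirichletCharacter ℂ q} (hχ : χ.Even)
    (hp : χ.IsPrimitive) : star (thetaSign χ) = thetaSign χ⁻¹ := by
  obtain ⟨x, hx⟩ := exists_logTheta_ne_zero hq hχ hp
  have h1 := congrArg star (logTheta_neg hq hχ hp x)
  rw [conj_logTheta, star_mul', conj_logTheta, inv_inv,
    logTheta_neg hq (inv_even hχ) (inv_isPrimitive hp), inv_inv] at h1
  exact (mul_right_cancel₀ hx h1).symm

/-- Unimodularity is what allows the first moment to be twisted by the sign without changing the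
second moment. -/
theorem norm_thetaSign (hq : 1 < q) {χ : DirichletCharacter ℂ q} (hχ : χ.Even)
    (hp : χ.IsPrimitive) : ‖thetaSign χ‖ = 1 := by
  have h1 := thetaSign_mul_inv hq hχ hp
  rw [← conj_thetaSign hq hχ hp] at h1
  have h2 := congrArg norm h1
  rw [norm_mul, norm_star, norm_one] at h2
  nlinarith [norm_nonneg (thetaSign χ)]

/-- Multiplicative cutoff functions at `1`, in logarithmic variable, with `W v + W (2 - v) = 1`. -/
structure IsCutoff (W : ℝ → ℝ) (δ : ℝ) : Prop where
  meas : Measurable W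
  nonneg : ∀ v, 0 ≤ W v
  le_one : ∀ v, W v ≤ 1
  symm : ∀ v, W v + W (2 - v) = 1
  supp : ∀ v, 1 + δ ≤ v → W v = 0

theorem integral_cexp_mul_exp_neg_exp {σ : ℂ} {r : ℝ} (hσ : 0 < σ.re) (hr : 0 < r) :
    ∫ x : ℝ, Complex.exp (σ * x) * (exp (-(r * exp x)) : ℝ) = (1 / r : ℂ) ^ σ * Complex.Gamma σ := by
  rw [← Complex.integral_cpow_mul_exp_neg_mul_Ioi hσ hr]
  have := mellin_eq_integral_exp (fun t ↦ ((exp (-(r * t)) : ℝ) : ℂ)) σ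
  rw [← this, mellin]
  simp

theorem integral_exp_mul_exp_neg_exp {σ r : ℝ} (hσ : 0 < σ) (hr : 0 < r) :
    ∫ x : ℝ, exp (σ * x) * exp (-(r * exp x)) = (1 / r) ^ σ * Real.Gamma σ := by
  have := integral_cexp_mul_exp_neg_exp (σ := σ) (by simpa using hσ) hr
  have h2 : ∀ x : ℝ, Complex.exp ((σ : ℂ) * x) * (exp (-(r * exp x)) : ℝ) =
    ((exp (σ * x) * exp (-(r * exp x)) : ℝ) : ℂ) := fun x ↦ by push_cast; rfl
  simp_rw [h2] at this
  rw [integral_complex_ofReal] at this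
  apply Complex.ofReal_injective
  rw [this, Complex.Gamma_ofReal, Complex.ofReal_mul, Complex.ofReal_cpow (by positivity)]
  simp

/-- The integral of a non-integrable function is `0` by convention, whereas this one has been
computed to be positive. -/
theorem integrable_exp_mul_exp_neg_exp {σ r : ℝ} (hσ : 0 < σ) (hr : 0 < r) :
    Integrable fun x : ℝ ↦ exp (σ * x) * exp (-(r * exp x)) := by
  by_contra h
  have h1 := integral_exp_mul_exp_neg_exp hσ hr
  rw [integral_undef h] at h1
  have := mul_pos (rpow_pos_of_pos (one_div_pos.mpr hr) σ) (Real.Gamma_pos_of_pos hσ)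
  linarith

theorem integrable_logTheta_mul (hq : 1 < q) {χ : DirichletCharacter ℂ q} (hχ : χ.Even)
    (hp : χ.IsPrimitive) (a : ℂ) : Integrable fun x : ℝ ↦ logTheta χ x * Complex.exp (a * x / 2) := by
  obtain ⟨C, hC, h⟩ := exists_norm_logTheta_le hq hχ hp (|a.re| + 1)
  refine Integrable.mono' ((integrable_exp_neg_mul_abs one_pos).const_mul C)
    (((continuous_logTheta hq hχ).mul (by fun_prop)).aestronglyMeasurable)
    (Eventually.of_forall fun x ↦ ?_)
  rw [norm_mul, Complex.norm_exp]
  have h1 : (a * x / 2).re ≤ |a.re| * |x| := by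
    have : (a * x / 2).re = a.re * x / 2 := by simp
    rw [this, ← abs_mul]
    have := le_abs_self (a.re * x)
    have := abs_nonneg (a.re * x)
    linarith
  calc _ ≤ C * exp (-(|a.re| + 1) * |x|) * exp (|a.re| * |x|) := by
        gcongr; exact h x
    _ = _ := by rw [mul_assoc, ← exp_add]; ring_nf

/-- The bilinear form in the approximate functional equation. -/
def thetaForm (W : ℝ → ℝ) (χ : DirichletCharacter ℂ q) (a b : ℂ) : ℂ :=
  ∫ p : ℝ × ℝ, (logTheta χ p.1 * Complex.exp (a * p.1 / 2)) *
    (logTheta χ⁻¹ p.2 * Complex.exp (b * p.2 / 2)) * (W (1 - (p.1 + p.2) / (2 * log q)) : ℝ)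

/-- In the double integral one inserts `1 = W(1 - u) + W(1 + u)` with `u = (x + y)/(2 log q)`. The
substitution `(x, y) ↦ (-y, -x)` carries the second half to the first with shifts `(-b, -a)`; the
signs of `χ` and `χ⁻¹` multiply to `1`. -/
theorem LFunction_mul_eq_thetaForm (hq : 1 < q) {χ : DirichletCharacter ℂ q} (hχ : χ.Even)
    (hp : χ.IsPrimitive) {W : ℝ → ℝ} {δ : ℝ} (hW : IsCutoff W δ) (a b : ℂ) :
    LFunction χ (1 / 2 + a) * LFunction χ⁻¹ (1 / 2 + b) =
      (Complex.Gammaℝ (1 / 2 + a))⁻¹ * (Complex.Gammaℝ (1 / 2 + b))⁻¹ *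
      (Complex.exp (-(1 / 2 + (a + b) / 2) * log q) *
        (thetaForm W χ a b + thetaForm W χ (-b) (-a))) := by
  have hf := integrable_logTheta_mul hq hχ hp a
  have hg := integrable_logTheta_mul hq (inv_even hχ) (inv_isPrimitive hp) b
  have hfg := hf.mul_prod hg
  have hbd : ∀ c : ℝ, Integrable (fun p : ℝ × ℝ ↦ (logTheta χ p.1 * Complex.exp (a * p.1 / 2)) *
      (logTheta χ⁻¹ p.2 * Complex.exp (b * p.2 / 2)) * (W (1 - c * ((p.1 + p.2) / (2 * log q))) : ℝ)) := by
    intro c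
    have hm := hW.meas
    refine hfg.mul_bdd (c := 1) ?_ (Eventually.of_forall fun p ↦ ?_)
    · exact (Complex.measurable_ofReal.comp (hm.comp (by fun_prop))).aestronglyMeasurable
    · rw [Complex.norm_real, norm_of_nonneg (hW.nonneg _)]
      exact hW.le_one _
  have h1 : (∫ x : ℝ, logTheta χ x * Complex.exp (a * x / 2)) *
      (∫ x : ℝ, logTheta χ⁻¹ x * Complex.exp (b * x / 2)) =
      thetaForm W χ a b + thetaForm W χ (-b) (-a) := by
    have h2 : thetaForm W χ (-b) (-a) = ∫ p : ℝ × ℝ, (logTheta χ p.1 * Complex.exp (a * p.1 / 2)) *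
      (logTheta χ⁻¹ p.2 * Complex.exp (b * p.2 / 2)) * (W (1 + (p.1 + p.2) / (2 * log q)) : ℝ) := by
      have h3 := integral_neg_eq_self (fun p : ℝ × ℝ ↦ (logTheta χ p.1 * Complex.exp (a * p.1 / 2)) *
        (logTheta χ⁻¹ p.2 * Complex.exp (b * p.2 / 2)) * (W (1 + (p.1 + p.2) / (2 * log q)) : ℝ)) volume
      rw [← h3, thetaForm]
      have h4 := integral_prod_swap (μ := (volume : Measure ℝ)) (ν := (volume : Measure ℝ)) (fun p : ℝ × ℝ ↦ (logTheta χ p.1 * Complex.exp (-b * p.1 / 2)) *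
        (logTheta χ⁻¹ p.2 * Complex.exp (-a * p.2 / 2)) * (W (1 - (p.1 + p.2) / (2 * log q)) : ℝ))
      rw [Measure.volume_eq_prod, ← h4]
      refine integral_congr_ae (Eventually.of_forall fun p ↦ ?_)
      simp only [Prod.fst_neg, Prod.snd_neg, Prod.fst_swap, Prod.snd_swap]
      rw [logTheta_neg hq hχ hp, logTheta_neg hq (inv_even hχ) (inv_isPrimitive hp), inv_inv]
      have h5 := thetaSign_mul_inv hq hχ hp
      have h6 : 1 - (p.2 + p.1) / (2 * log q) = 1 + (-p.1 + -p.2) / (2 * log q) := by ring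
      rw [h6]
      push_cast
      have h7 : Complex.exp (a * -↑p.1 / 2) = Complex.exp (-a * ↑p.1 / 2) := by ring_nf
      have h8 : Complex.exp (b * -↑p.2 / 2) = Complex.exp (-b * ↑p.2 / 2) := by ring_nf
      rw [h7, h8]
      linear_combination (-(logTheta χ⁻¹ p.1 * logTheta χ p.2 * Complex.exp (-a * ↑p.1 / 2) *
        Complex.exp (-b * ↑p.2 / 2) * (W (1 + (-p.1 + -p.2) / (2 * log q)) : ℝ))) * h5
    rw [h2, thetaForm, ← integral_add (by simpa using hbd 1) (by simpa using hbd (-1)),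
      ← integral_prod_mul, ← Measure.volume_eq_prod]
    refine integral_congr_ae (Eventually.of_forall fun p ↦ ?_)
    simp only
    have := hW.symm (1 - (p.1 + p.2) / (2 * log q))
    rw [show 2 - (1 - (p.1 + p.2) / (2 * log q)) = 1 + (p.1 + p.2) / (2 * log q) by ring] at this
    rw [← mul_add, ← Complex.ofReal_add, this]
    simp
  rw [LFunction_eq_integral hq hχ hp, LFunction_eq_integral hq (inv_even hχ) (inv_isPrimitive hp), ← h1]
  have h9 : Complex.exp (-(1 / 2 + (a + b) / 2) * log q) = Complex.exp (-(1 / 4 + a / 2) * log q) *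
    Complex.exp (-(1 / 4 + b / 2) * log q) := by rw [← Complex.exp_add]; ring_nf
  rw [h9]
  ring
end


/-! ### The weight of the approximate functional equation and its decay. -/

noncomputable section

open Finset DirichletCharacter Real Filter Topology MeasureTheory

set_option linter.unusedSectionVars false

variable {q : ℕ} [NeZero q]

/-- The exponential factor of the `n`-th term of the theta series. -/
def thetaTerm (ℓ : ℝ) (a : ℂ) (n : ℕ) (x : ℝ) : ℂ :=
  Complex.exp ((1 / 4 + a / 2) * x) * (exp (-(π * n ^ 2 * exp (-ℓ) * exp x)) : ℝ)

/-- Integrand for `afeKernel`. -/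
def afeIntegrand (W : ℝ → ℝ) (ℓ : ℝ) (a b : ℂ) (m n : ℕ) (p : ℝ × ℝ) : ℂ :=
  thetaTerm ℓ a m p.1 * thetaTerm ℓ b n p.2 * (W (1 - (p.1 + p.2) / (2 * ℓ)) : ℝ)

/-- The weight function of the approximate functional equation. -/
def afeKernel (W : ℝ → ℝ) (ℓ : ℝ) (a b : ℂ) (m n : ℕ) : ℂ :=
  Complex.exp (-(1 / 2 + (a + b) / 2) * ℓ) * ∫ p, afeIntegrand W ℓ a b m n p

/-- Real majorant of `thetaTerm`. -/
def thetaBound (ℓ σ : ℝ) (n : ℕ) (x : ℝ) : ℝ :=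
  exp (σ * x) * exp (-(π * n ^ 2 * exp (-ℓ) / 2 * exp x))

theorem integral_thetaBound {ℓ σ : ℝ} {n : ℕ} (hn : n ≠ 0) (hσ : 0 < σ) :
    ∫ x, thetaBound ℓ σ n x = (2 / π) ^ σ * Real.Gamma σ * (n : ℝ) ^ (-2 * σ) * exp (σ * ℓ) := by
  have hn0 : (0 : ℝ) < n := by positivity
  unfold thetaBound
  rw [integral_exp_mul_exp_neg_exp hσ (by positivity)]
  have : 1 / (π * n ^ 2 * exp (-ℓ) / 2) = (2 / π) * ((n : ℝ) ^ (-2 : ℝ) * exp ℓ) := by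
    rw [exp_neg, rpow_neg hn0.le, rpow_two]
    field_simp
  rw [this, mul_rpow (by positivity) (by positivity), mul_rpow (by positivity) (by positivity),
    ← rpow_mul hn0.le, ← exp_mul]
  ring_nf

theorem integrable_thetaBound {ℓ σ : ℝ} {n : ℕ} (hn : n ≠ 0) (hσ : 0 < σ) :
    Integrable (thetaBound ℓ σ n) := by
  have hn0 : (0 : ℝ) < n := by positivity
  exact integrable_exp_mul_exp_neg_exp hσ (by positivity)

/-- On the support of the cutoff `x + y > -2δℓ`, so the inequality of means bounds the sum of the
two theta exponents below by `2π m n e^{-(1+δ)ℓ}`. Half of the exponents is spent on this factor;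
the other half stays in `thetaBound` for convergence. With `ℓ = log q` this confines `m n`
essentially to `q^{1+δ}`. -/
theorem norm_afeIntegrand_le {W : ℝ → ℝ} {δ ℓ : ℝ} (hW : IsCutoff W δ) (hℓ : 0 < ℓ) (a b : ℂ) (m n : ℕ)
    (p : ℝ × ℝ) : ‖afeIntegrand W ℓ a b m n p‖ ≤ exp (-(π * (m * n) * exp (-(1 + δ) * ℓ))) *
      (thetaBound ℓ (1 / 4 + a.re / 2) m p.1 * thetaBound ℓ (1 / 4 + b.re / 2) n p.2) := by
  have hnn : 0 ≤ exp (-(π * (m * n) * exp (-(1 + δ) * ℓ))) *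
      (thetaBound ℓ (1 / 4 + a.re / 2) m p.1 * thetaBound ℓ (1 / 4 + b.re / 2) n p.2) := by
    unfold thetaBound; positivity
  by_cases h : 1 + δ ≤ 1 - (p.1 + p.2) / (2 * ℓ)
  · simp only [afeIntegrand, hW.supp _ h, Complex.ofReal_zero, mul_zero, norm_zero]
    exact hnn
  have hxy : -(2 * δ * ℓ) < p.1 + p.2 := by
    have h1 : (p.1 + p.2) / (2 * ℓ) > -δ := by linarith
    rw [gt_iff_lt, lt_div_iff₀ (by positivity)] at h1
    linarith
  have hre : ∀ (c : ℂ) (x : ℝ), ((1 / 4 + c / 2) * x).re = (1 / 4 + c.re / 2) * x := by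
    intro c x; simp
  have hAB : 2 * (m * n * exp (-(1 + δ) * ℓ)) ≤ m ^ 2 * exp (-ℓ) * exp p.1 + n ^ 2 * exp (-ℓ) * exp p.2 := by
    have h1 : exp (-(1 + δ) * ℓ) ≤ exp (-ℓ) * (exp (p.1 / 2) * exp (p.2 / 2)) := by
      rw [← exp_add, ← exp_add]
      apply exp_le_exp.mpr
      linarith
    have h2 : exp p.1 = exp (p.1 / 2) ^ 2 := by rw [← exp_nat_mul]; push_cast; ring_nf
    have h3 : exp p.2 = exp (p.2 / 2) ^ 2 := by rw [← exp_nat_mul]; push_cast; ring_nf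
    calc _ ≤ 2 * (m * n * (exp (-ℓ) * (exp (p.1 / 2) * exp (p.2 / 2)))) := by gcongr
      _ ≤ _ := by
        rw [h2, h3]
        nlinarith [mul_nonneg (exp_pos (-ℓ)).le (sq_nonneg (m * exp (p.1 / 2) - n * exp (p.2 / 2)))]
  rw [afeIntegrand, thetaTerm, thetaTerm, norm_mul, norm_mul, norm_mul, norm_mul, Complex.norm_real,
    Complex.norm_real, Complex.norm_real, Complex.norm_exp, Complex.norm_exp, hre, hre,
    norm_of_nonneg (exp_pos _).le, norm_of_nonneg (exp_pos _).le, norm_of_nonneg (hW.nonneg _)]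
  refine (mul_le_of_le_one_right (by positivity) (hW.le_one _)).trans ?_
  unfold thetaBound
  have key : exp (-(π * m ^ 2 * exp (-ℓ) * exp p.1)) * exp (-(π * n ^ 2 * exp (-ℓ) * exp p.2)) ≤
      exp (-(π * (m * n) * exp (-(1 + δ) * ℓ))) * (exp (-(π * m ^ 2 * exp (-ℓ) / 2 * exp p.1)) *
        exp (-(π * n ^ 2 * exp (-ℓ) / 2 * exp p.2))) := by
    rw [← exp_add, ← exp_add, ← exp_add]
    apply exp_le_exp.mpr
    nlinarith [mul_le_mul_of_nonneg_left hAB pi_pos.le]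
  calc _ = exp ((1 / 4 + a.re / 2) * p.1) * exp ((1 / 4 + b.re / 2) * p.2) *
        (exp (-(π * m ^ 2 * exp (-ℓ) * exp p.1)) * exp (-(π * n ^ 2 * exp (-ℓ) * exp p.2))) := by ring
    _ ≤ _ := mul_le_mul_of_nonneg_left key (by positivity)
    _ = _ := by ring

theorem measurable_afeIntegrand {W : ℝ → ℝ} {δ : ℝ} (hW : IsCutoff W δ) (ℓ : ℝ) (a b : ℂ) (m n : ℕ) :
    Measurable (afeIntegrand W ℓ a b m n) := by
  have hm := hW.meas
  unfold afeIntegrand thetaTerm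
  refine Measurable.mul (by fun_prop) (Complex.measurable_ofReal.comp (hm.comp (by fun_prop)))

theorem integrable_afeIntegrand {W : ℝ → ℝ} {δ ℓ : ℝ} (hW : IsCutoff W δ) (hℓ : 0 < ℓ) {a b : ℂ}
    (ha : 0 < 1 / 4 + a.re / 2) (hb : 0 < 1 / 4 + b.re / 2) {m n : ℕ} (hm : m ≠ 0) (hn : n ≠ 0) :
    Integrable (afeIntegrand W ℓ a b m n) :=
  Integrable.mono' (((integrable_thetaBound hm ha).mul_prod (integrable_thetaBound hn hb)).const_mul _)
    (measurable_afeIntegrand hW ℓ a b m n).aestronglyMeasurable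
    (Eventually.of_forall fun p ↦ norm_afeIntegrand_le hW hℓ a b m n p)

theorem integral_norm_afeIntegrand_le {W : ℝ → ℝ} {δ ℓ : ℝ} (hW : IsCutoff W δ) (hℓ : 0 < ℓ) {a b : ℂ}
    (ha : 0 < 1 / 4 + a.re / 2) (hb : 0 < 1 / 4 + b.re / 2) {m n : ℕ} (hm : m ≠ 0) (hn : n ≠ 0) :
    ∫ p, ‖afeIntegrand W ℓ a b m n p‖ ≤ exp (-(π * (m * n) * exp (-(1 + δ) * ℓ))) *
      (Real.Gamma (1 / 4 + a.re / 2) * (m : ℝ) ^ (-1 / 2 - a.re) * exp ((1 / 4 + a.re / 2) * ℓ) *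
      (Real.Gamma (1 / 4 + b.re / 2) * (n : ℝ) ^ (-1 / 2 - b.re) * exp ((1 / 4 + b.re / 2) * ℓ))) := by
  have h1 := integral_mono (integrable_afeIntegrand hW hℓ ha hb hm hn).norm
    (((integrable_thetaBound hm ha).mul_prod (integrable_thetaBound hn hb)).const_mul _)
    (fun p ↦ norm_afeIntegrand_le hW hℓ a b m n p)
  refine h1.trans ?_
  rw [integral_const_mul, Measure.volume_eq_prod, integral_prod_mul, integral_thetaBound hm ha,
    integral_thetaBound hn hb]
  have h2 : ∀ σ : ℝ, 0 < σ → (2 / π) ^ σ ≤ 1 := fun σ hσ ↦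
    rpow_le_one (by positivity) (by rw [div_le_one pi_pos]; linarith [pi_gt_three]) hσ.le
  have h3 : ∀ (c : ℂ) (k : ℕ), 0 < 1 / 4 + c.re / 2 → (2 / π) ^ (1 / 4 + c.re / 2) * Real.Gamma (1 / 4 + c.re / 2) *
      (k : ℝ) ^ (-2 * (1 / 4 + c.re / 2)) * exp ((1 / 4 + c.re / 2) * ℓ) ≤
      Real.Gamma (1 / 4 + c.re / 2) * (k : ℝ) ^ (-1 / 2 - c.re) * exp ((1 / 4 + c.re / 2) * ℓ) := by
    intro c k hc
    have := (Real.Gamma_pos_of_pos hc).le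
    rw [show -2 * (1 / 4 + c.re / 2) = -1 / 2 - c.re by ring]
    gcongr
    exact mul_le_of_le_one_left this (h2 _ hc)
  have := (Real.Gamma_pos_of_pos ha).le
  have := (Real.Gamma_pos_of_pos hb).le
  exact mul_le_mul_of_nonneg_left (mul_le_mul (h3 a m ha) (h3 b n hb) (by positivity) (by positivity)) (exp_pos _).le

theorem norm_afeKernel_le_Gamma {W : ℝ → ℝ} {δ ℓ : ℝ} (hW : IsCutoff W δ) (hℓ : 0 < ℓ) {a b : ℂ}
    (ha : 0 < 1 / 4 + a.re / 2) (hb : 0 < 1 / 4 + b.re / 2) {m n : ℕ} (hm : m ≠ 0) (hn : n ≠ 0) :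
    ‖afeKernel W ℓ a b m n‖ ≤ Real.Gamma (1 / 4 + a.re / 2) * Real.Gamma (1 / 4 + b.re / 2) *
      ((m : ℝ) ^ (-1 / 2 - a.re) * (n : ℝ) ^ (-1 / 2 - b.re)) *
      exp (-(π * (m * n) * exp (-(1 + δ) * ℓ))) := by
  rw [afeKernel, norm_mul, Complex.norm_exp]
  have h1 := (norm_integral_le_integral_norm _).trans (integral_norm_afeIntegrand_le hW hℓ ha hb hm hn)
  refine (mul_le_mul_of_nonneg_left h1 (exp_pos _).le).trans_eq ?_
  have h2 : (-(1 / 2 + (a + b) / 2) * (ℓ : ℂ)).re = -((1 / 4 + a.re / 2) * ℓ) + -((1 / 4 + b.re / 2) * ℓ) := by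
    simp; ring
  rw [h2, exp_add, exp_neg, exp_neg]
  field_simp

/-- The condition on the real parts is that of shifts `α/ℓ` with `|α| ≤ 1/2`; it keeps the arguments
of the gamma functions in a fixed compact interval, so the constant is absolute. -/
theorem exists_norm_afeKernel_le : ∃ C : ℝ, 0 < C ∧ ∀ {W : ℝ → ℝ} {δ ℓ : ℝ}, IsCutoff W δ → 2 ≤ ℓ →
    ∀ {a b : ℂ}, |a.re| ≤ 1 / (2 * ℓ) → |b.re| ≤ 1 / (2 * ℓ) → ∀ {m n : ℕ}, m ≠ 0 → n ≠ 0 →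
    ‖afeKernel W ℓ a b m n‖ ≤ C * ((m * n : ℕ) : ℝ) ^ (-1 / 2 + 1 / (2 * ℓ)) *
      exp (-(π * (m * n : ℕ) * exp (-(1 + δ) * ℓ))) := by
  have hc : ContinuousOn Real.Gamma (Set.Icc (1 / 8) 1) := fun x hx ↦
    (Real.differentiableAt_Gamma fun m h ↦ by
      have := hx.1; rw [h] at this; linarith [(m.cast_nonneg : (0 : ℝ) ≤ m)]).continuousAt.continuousWithinAt
  obtain ⟨C, hC⟩ := (isCompact_Icc (a := (1 / 8 : ℝ)) (b := 1)).bddAbove_image hc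
  have hC' : ∀ x ∈ Set.Icc (1 / 8 : ℝ) 1, Real.Gamma x ≤ C := fun x hx ↦ hC ⟨x, hx, rfl⟩
  have hC0 : 0 < C := lt_of_lt_of_le (Real.Gamma_pos_of_pos one_pos) (hC' 1 ⟨by norm_num, le_rfl⟩)
  refine ⟨C ^ 2, by positivity, fun {W δ ℓ} hW hℓ {a b} ha hb {m n} hm hn ↦ ?_⟩
  have h4 : 1 / (2 * ℓ) ≤ 1 / 4 := by
    apply one_div_le_one_div_of_le <;> linarith
  have ha' := abs_le.mp ha
  have hb' := abs_le.mp hb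
  have hm1 : (1 : ℝ) ≤ m := by exact_mod_cast Nat.one_le_iff_ne_zero.mpr hm
  have hn1 : (1 : ℝ) ≤ n := by exact_mod_cast Nat.one_le_iff_ne_zero.mpr hn
  refine (norm_afeKernel_le_Gamma hW (by linarith) (by linarith) (by linarith) hm hn).trans ?_
  push_cast
  have e1 : (m : ℝ) ^ (-1 / 2 - a.re) ≤ (m : ℝ) ^ (-1 / 2 + 1 / (2 * ℓ)) :=
    rpow_le_rpow_of_exponent_le hm1 (by linarith)
  have e2 : (n : ℝ) ^ (-1 / 2 - b.re) ≤ (n : ℝ) ^ (-1 / 2 + 1 / (2 * ℓ)) :=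
    rpow_le_rpow_of_exponent_le hn1 (by linarith)
  rw [mul_rpow (by linarith) (by linarith), pow_two]
  have g1 := hC' (1 / 4 + a.re / 2) ⟨by linarith, by linarith⟩
  have g2 := hC' (1 / 4 + b.re / 2) ⟨by linarith, by linarith⟩
  have := (Real.Gamma_pos_of_pos (show 0 < 1 / 4 + b.re / 2 by linarith)).le
  gcongr

theorem hasSum_logTheta_mul (χ : DirichletCharacter ℂ q) (a : ℂ) (x : ℝ) :
    HasSum (fun n : ℕ ↦ χ (n : ZMod q) * thetaTerm (log q) a n x) (logTheta χ x * Complex.exp (a * x / 2)) ∧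
    Summable fun n : ℕ ↦ ‖χ (n : ZMod q) * thetaTerm (log q) a n x‖ := by
  have h0 : ∀ n : ℕ, χ (n : ZMod q) * thetaTerm (log q) a n x =
      Complex.exp ((1 / 4 + a / 2) * x) * (χ (n : ZMod q) * (exp (-π * n ^ 2 * exp (x - log q)) : ℝ)) := by
    intro n
    rw [thetaTerm]
    have : -(π * n ^ 2 * exp (-log q) * exp x) = -π * n ^ 2 * exp (x - log q) := by
      rw [sub_eq_add_neg, exp_add]; ring
    rw [this]
    ring
  constructor
  · have h1 := (hasSum_thetaSeries χ (exp_pos (x - log q))).mul_left (Complex.exp ((1 / 4 + a / 2) * x))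
    convert! h1 using 1
    · exact funext h0
    · rw [logTheta]
      have : Complex.exp ((1 / 4 + a / 2) * x) = (exp (x / 4) : ℝ) * Complex.exp (a * x / 2) := by
        rw [Complex.ofReal_exp, ← Complex.exp_add]; push_cast; ring_nf
      rw [this]; ring
  · simp_rw [h0, norm_mul (Complex.exp _)]
    refine Summable.mul_left _ ?_
    exact Summable.of_nonneg_of_le (fun _ ↦ norm_nonneg _) (fun n ↦ norm_char_mul_exp_le χ n _)
      (summable_exp_neg_sq (exp_pos _))

theorem summable_exp_neg_mul_prod {c : ℝ} (hc : 0 < c) :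
    Summable fun p : ℕ × ℕ ↦ if p.1 = 0 ∨ p.2 = 0 then 0 else exp (-(c * (p.1 * p.2))) := by
  have h1 : Summable fun n : ℕ ↦ exp (-(c / 2)) ^ n :=
    summable_geometric_of_lt_one (exp_pos _).le ((exp_lt_exp.mpr (by linarith : -(c / 2) < 0)).trans_eq exp_zero)
  have h2 := h1.mul_of_nonneg h1 (fun n ↦ by positivity) (fun n ↦ by positivity)
  refine Summable.of_nonneg_of_le (fun p ↦ by split_ifs <;> positivity) (fun p ↦ ?_) h2
  split_ifs with h
  · positivity
  · rw [← exp_nat_mul, ← exp_nat_mul, ← exp_add]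
    apply exp_le_exp.mpr
    push Not at h
    have h3 : (1 : ℝ) ≤ p.1 := by exact_mod_cast Nat.one_le_iff_ne_zero.mpr h.1
    have h4 : (1 : ℝ) ≤ p.2 := by exact_mod_cast Nat.one_le_iff_ne_zero.mpr h.2
    have h5 : ((p.1 : ℝ) + p.2) / 2 ≤ p.1 * p.2 := by nlinarith
    nlinarith

/-- Expanding both theta series and integrating termwise is legitimate because the bound for the
integrand decays exponentially in `m n`. Terms with `m = 0` or `n = 0` vanish since `χ 0 = 0`. -/
theorem hasSum_thetaForm (hq : 1 < q) (χ : DirichletCharacter ℂ q) {W : ℝ → ℝ} {δ : ℝ}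
    (hW : IsCutoff W δ) {a b : ℂ} (ha : |a.re| ≤ 1 / 4) (hb : |b.re| ≤ 1 / 4) :
    HasSum (fun p : ℕ × ℕ ↦ χ (p.1 : ZMod q) * χ⁻¹ (p.2 : ZMod q) * afeKernel W (log q) a b p.1 p.2)
      (Complex.exp (-(1 / 2 + (a + b) / 2) * log q) * thetaForm W χ a b) := by
  have hℓ : 0 < log q := log_pos (by exact_mod_cast hq)
  have hχ0 : χ (0 : ZMod q) = 0 := DirichletCharacter.map_zero' χ hq.ne'
  have hχ0' : χ⁻¹ (0 : ZMod q) = 0 := DirichletCharacter.map_zero' χ⁻¹ hq.ne'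
  have ha' : 0 < 1 / 4 + a.re / 2 := by linarith [(abs_le.mp ha).1]
  have hb' : 0 < 1 / 4 + b.re / 2 := by linarith [(abs_le.mp hb).1]
  set F : ℕ × ℕ → ℝ × ℝ → ℂ := fun i p ↦
    χ (i.1 : ZMod q) * χ⁻¹ (i.2 : ZMod q) * afeIntegrand W (log q) a b i.1 i.2 p with hF
  have hsum : ∀ p : ℝ × ℝ, HasSum (fun i ↦ F i p) ((logTheta χ p.1 * Complex.exp (a * p.1 / 2)) *
    (logTheta χ⁻¹ p.2 * Complex.exp (b * p.2 / 2)) * (W (1 - (p.1 + p.2) / (2 * log q)) : ℝ)) := by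
    intro p
    obtain ⟨h1, h2⟩ := hasSum_logTheta_mul χ a p.1
    obtain ⟨h3, h4⟩ := hasSum_logTheta_mul χ⁻¹ b p.2
    have h5 := summable_mul_of_summable_norm (f := fun n : ℕ ↦ χ (n : ZMod q) * thetaTerm (log q) a n p.1)
      (g := fun n : ℕ ↦ χ⁻¹ (n : ZMod q) * thetaTerm (log q) b n p.2) h2 h4
    have h6 := HasSum.mul h1 h3 h5
    have := h6.mul_right ((W (1 - (p.1 + p.2) / (2 * log q)) : ℝ) : ℂ)
    convert! this using 1
    ext i
    simp only [hF, afeIntegrand]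
    ring
  have hF0 : ∀ i : ℕ × ℕ, i.1 = 0 ∨ i.2 = 0 → F i = fun _ ↦ 0 := by
    rintro i (h | h)
    · funext p
      simp only [hF, h, Nat.cast_zero, hχ0, zero_mul]
    · funext p
      simp only [hF, h, Nat.cast_zero, hχ0', zero_mul, mul_zero]
  have hint : ∀ i, Integrable (F i) := by
    intro i
    by_cases h0 : i.1 = 0 ∨ i.2 = 0
    · rw [hF0 i h0]; exact integrable_zero _ _ _
    obtain ⟨h1, h2⟩ := not_or.mp h0
    exact (integrable_afeIntegrand hW hℓ ha' hb' h1 h2).const_mul _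
  set c := π * exp (-(1 + δ) * log q)
  have hsm : Summable fun i ↦ ∫ p, ‖F i p‖ := by
    refine Summable.of_nonneg_of_le (fun i ↦ integral_nonneg fun _ ↦ norm_nonneg _) (fun i ↦ ?_)
      ((summable_exp_neg_mul_prod (c := c) (by positivity)).mul_right
      (Real.Gamma (1 / 4 + a.re / 2) * exp ((1 / 4 + a.re / 2) * log q) *
      (Real.Gamma (1 / 4 + b.re / 2) * exp ((1 / 4 + b.re / 2) * log q))))
    by_cases h0 : i.1 = 0 ∨ i.2 = 0
    · rw [hF0 i h0, if_pos h0]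
      simp only [norm_zero, integral_zero, zero_mul, le_refl]
    obtain ⟨h1, h2⟩ := not_or.mp h0
    rw [if_neg h0]
    simp only [hF, norm_mul]
    rw [integral_const_mul]
    have h3 : ‖χ (i.1 : ZMod q)‖ * ‖χ⁻¹ (i.2 : ZMod q)‖ ≤ 1 :=
      mul_le_one₀ (DirichletCharacter.norm_le_one χ _) (norm_nonneg _) (DirichletCharacter.norm_le_one χ⁻¹ _)
    refine (mul_le_of_le_one_left (integral_nonneg fun _ ↦ norm_nonneg _) h3).trans
      ((integral_norm_afeIntegrand_le hW hℓ ha' hb' h1 h2).trans ?_)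
    rw [show π * ((i.1 : ℝ) * i.2) * exp (-(1 + δ) * log q) = c * (i.1 * i.2) by ring]
    have h4 : ∀ (k : ℕ) (r : ℝ), k ≠ 0 → r ≤ 0 → (k : ℝ) ^ r ≤ 1 := fun k r hk hr ↦
      rpow_le_one_of_one_le_of_nonpos (by exact_mod_cast Nat.one_le_iff_ne_zero.mpr hk) hr
    have g1 := (Real.Gamma_pos_of_pos ha').le
    have g2 := (Real.Gamma_pos_of_pos hb').le
    gcongr
    · exact mul_le_of_le_one_right g1 (h4 _ _ h1 (by linarith [(abs_le.mp ha).1]))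
    · exact mul_le_of_le_one_right g2 (h4 _ _ h2 (by linarith [(abs_le.mp hb).1]))
  have := hasSum_integral_of_summable_integral_norm hint hsm
  have h5 : ∫ p, ∑' i, F i p = thetaForm W χ a b :=
    integral_congr_ae (Eventually.of_forall fun p ↦ (hsum p).tsum_eq)
  rw [h5] at this
  convert! this.mul_left (Complex.exp (-(1 / 2 + (a + b) / 2) * log q)) using 1
  ext i
  simp only [hF]
  rw [integral_const_mul, afeKernel]
  ring
end


/-! ### Smooth functions as superpositions of exponentials on the line of real part one. -/

noncomputable section

open Real Filter Topology MeasureTheory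

open scoped FourierTransform SchwartzMap ContDiff

/-- Parametrization of the vertical line of real part one. -/
def lineC (t : ℝ) : ℂ := 1 - 2 * π * t * Complex.I

theorem lineC_re (t : ℝ) : (lineC t).re = 1 := by simp [lineC]

theorem continuous_lineC : Continuous lineC := by unfold lineC; fun_prop

theorem lineC_ne_zero (t : ℝ) : lineC t ≠ 0 := by
  intro h
  have := lineC_re t
  rw [h] at this
  simp at this

theorem one_le_norm_lineC (t : ℝ) : 1 ≤ ‖lineC t‖ := by
  have := Complex.re_le_norm (lineC t)
  rwa [lineC_re] at this

theorem norm_lineC_le (t : ℝ) : ‖lineC t‖ ≤ 7 * (1 + |t|) := by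
  calc ‖lineC t‖ ≤ ‖(1 : ℂ)‖ + ‖(2 * π * t * Complex.I : ℂ)‖ := norm_sub_le _ _
    _ = 1 + 2 * π * |t| := by simp [abs_of_pos pi_pos]
    _ ≤ 7 * (1 + |t|) := by nlinarith [pi_lt_d2, abs_nonneg t]

/-- `f` is the superposition, with rapidly decaying density `ρ`, of the exponentials
`x ↦ exp (-s x)` with `Re s = 1`. -/
structure IsLineDensity (f : ℝ → ℝ) (ρ : ℝ → ℂ) : Prop where
  cont : Continuous ρ
  decay : ∀ n : ℕ, Integrable fun t ↦ (1 + |t|) ^ n * ‖ρ t‖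
  rep : ∀ x : ℝ, (f x : ℂ) = ∫ t, ρ t * Complex.exp (-(lineC t * x))

theorem IsLineDensity.integrable {f : ℝ → ℝ} {ρ : ℝ → ℂ} (h : IsLineDensity f ρ) : Integrable ρ := by
  have := h.decay 0
  simp only [pow_zero, one_mul] at this
  exact (integrable_norm_iff h.cont.aestronglyMeasurable).mp this

theorem norm_exp_neg_lineC_mul (t x : ℝ) : ‖Complex.exp (-(lineC t * x))‖ = exp (-x) := by
  rw [Complex.norm_exp]; simp [lineC_re]

theorem IsLineDensity.integrable_mul_exp {f : ℝ → ℝ} {ρ : ℝ → ℂ} (h : IsLineDensity f ρ) (x : ℝ) :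
    Integrable fun t ↦ ρ t * Complex.exp (-(lineC t * x)) := by
  refine h.integrable.mul_bdd (c := exp (-x)) ?_ (Eventually.of_forall fun t ↦ ?_)
  · have := continuous_lineC
    exact Continuous.aestronglyMeasurable (by fun_prop)
  · rw [norm_exp_neg_lineC_mul]

/-- The density is the Fourier transform of `f(x) e^x`, a Schwartz function, and the representation
is Fourier inversion. Differentiation multiplies the density by `-s`. -/
theorem exists_lineDensity {f : ℝ → ℝ} (hf : ContDiff ℝ ∞ f) (hc : HasCompactSupport f) :
    ∃ ρ, IsLineDensity f ρ ∧ IsLineDensity (deriv f) (fun t ↦ -(lineC t * ρ t)) := by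
  let mk : (ℝ → ℝ) → ℝ → ℂ := fun f x ↦ ((f x * exp x : ℝ) : ℂ)
  have key : ∀ f : ℝ → ℝ, ContDiff ℝ ∞ f → HasCompactSupport f → IsLineDensity f (𝓕 (mk f)) := by
    intro f hf hc
    have hg1 : HasCompactSupport (mk f) := by
      have h1 : HasCompactSupport (fun x ↦ f x * exp x) := hc.mul_right
      exact h1.comp_left (g := fun r : ℝ ↦ (r : ℂ)) (by simp)
    have hg2 : ContDiff ℝ ∞ (mk f) := Complex.ofRealCLM.contDiff.comp (hf.mul contDiff_exp)
    set g : 𝓢(ℝ, ℂ) := hg1.toSchwartzMap hg2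
    have hgc : (g : ℝ → ℂ) = mk f := by ext x; rfl
    have hFc : ((𝓕 g : 𝓢(ℝ, ℂ)) : ℝ → ℂ) = 𝓕 (mk f) := by rw [SchwartzMap.fourier_coe, hgc]
    refine ⟨?_, fun n ↦ ?_, fun x ↦ ?_⟩
    · rw [← hFc]; exact (𝓕 g).continuous
    · rw [← hFc]
      have h1 : ∀ k, Integrable (fun t : ℝ ↦ |t| ^ k * ‖(𝓕 g) t‖) := fun k ↦ by
        simpa using (𝓕 g).integrable_pow_mul volume k
      have h2 : ∀ t : ℝ, (1 + |t|) ^ n * ‖(𝓕 g) t‖ =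
          ∑ k ∈ Finset.range (n + 1), (n.choose k : ℝ) * (|t| ^ k * ‖(𝓕 g) t‖) := by
        intro t
        rw [add_comm, add_pow, Finset.sum_mul]
        refine Finset.sum_congr rfl fun k _ ↦ by simp; ring
      simp_rw [h2]
      exact integrable_finsetSum _ fun k _ ↦ (h1 k).const_mul _
    · have h1 : Integrable (mk f) := by rw [← hgc]; exact g.integrable
      have h2 : Integrable (𝓕 (mk f)) := by rw [← hFc]; exact (𝓕 g).integrable
      have h3 := congrFun (Continuous.fourierInv_fourier_eq hg2.continuous h1 h2) x
      rw [Real.fourierInv_eq'] at h3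
      have h4 : (f x : ℂ) = Complex.exp (-x) * mk f x := by
        simp only [mk]
        push_cast
        rw [mul_left_comm, ← Complex.exp_add, neg_add_cancel, Complex.exp_zero, mul_one]
      rw [h4, ← h3, ← integral_const_mul]
      refine integral_congr_ae (Eventually.of_forall fun t ↦ ?_)
      simp only [smul_eq_mul]
      rw [← mul_assoc, ← Complex.exp_add, mul_comm]
      congr 2
      rw [lineC]
      simp
      ring
  refine ⟨𝓕 (mk f), key f hf hc, ?_⟩
  have hd : ContDiff ℝ ∞ (deriv f) := (contDiff_infty_iff_deriv.mp hf).2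
  have h1 := key _ hd hc.deriv
  convert! h1 using 1
  have hgd : ∀ x, HasDerivAt (mk f) (mk (deriv f) x + mk f x) x := by
    intro x
    have h2 := ((hf.differentiable (by simp)).differentiableAt (x := x)).hasDerivAt.mul (Real.hasDerivAt_exp x)
    have h3 := h2.ofReal_comp
    convert! h3 using 1
    simp [mk]
  have hint : ∀ f : ℝ → ℝ, ContDiff ℝ ∞ f → HasCompactSupport f → Integrable (mk f) := by
    intro f hf hc
    refine Continuous.integrable_of_hasCompactSupport ?_ ?_
    · exact Complex.continuous_ofReal.comp (hf.continuous.mul continuous_exp)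
    · have h1 : HasCompactSupport (fun x ↦ f x * exp x) := hc.mul_right
      exact h1.comp_left (g := fun r : ℝ ↦ (r : ℂ)) (by simp)
  have hde : deriv (mk f) = fun x ↦ mk (deriv f) x + mk f x := funext fun x ↦ (hgd x).deriv
  have hi := hint f hf hc
  have hi' := hint _ hd hc.deriv
  have h2 := Real.fourier_deriv hi (fun x ↦ (hgd x).differentiableAt) (by rw [hde]; exact hi'.add hi)
  rw [hde] at h2
  have h4 : 𝓕 (fun x ↦ mk (deriv f) x + mk f x) = 𝓕 (mk (deriv f)) + 𝓕 (mk f) :=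
    (VectorFourier.fourierIntegral_add (L := innerₗ ℝ) Real.continuous_fourierChar continuous_inner hi' hi)
  rw [h4] at h2
  ext t
  have h3 := congrFun h2 t
  simp only [Pi.add_apply, smul_eq_mul] at h3
  rw [lineC]
  linear_combination (-1 : ℂ) * h3

/-- Fubini, together with `∫₀^∞ e^{-cr} dr = 1/c`. It recognizes the rational functions in the
limiting diagonal as Laplace transforms. -/
theorem integral_Ioi_integral_mul_exp {X : Type*} [MeasurableSpace X] {μ : Measure X} [SFinite μ]
    {ρ : X → ℂ} (hρ : Integrable ρ μ) {c : X → ℂ} (hc : Measurable c) {η : ℝ} (hη : 0 < η)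
    (hcη : ∀ x, η ≤ (c x).re) :
    ∫ r in Set.Ioi (0 : ℝ), ∫ x, ρ x * Complex.exp (-(c x * r)) ∂μ = ∫ x, ρ x / c x ∂μ := by
  rw [integral_integral_swap]
  · refine integral_congr_ae (Eventually.of_forall fun x ↦ ?_)
    simp only
    rw [integral_const_mul, div_eq_mul_inv]
    congr 1
    have hre : (-(c x)).re < 0 := by
      rw [Complex.neg_re]; linarith [hcη x]
    have := integral_exp_mul_complex_Ioi hre 0
    simp only [neg_mul] at this
    rw [this]
    simp [neg_div_neg_eq]
  · have h2 : Integrable (fun r : ℝ ↦ exp (-η * r)) (volume.restrict (Set.Ioi 0)) :=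
      exp_neg_integrableOn_Ioi 0 hη
    have h3 := h2.mul_prod hρ.norm
    refine Integrable.mono' h3 ?_ ?_
    · refine AEStronglyMeasurable.mul hρ.aestronglyMeasurable.comp_snd ?_
      exact Measurable.aestronglyMeasurable (by fun_prop)
    · have : ∀ᵐ r : ℝ ∂(volume.restrict (Set.Ioi 0)), r ∈ Set.Ioi (0 : ℝ) :=
        ae_restrict_mem measurableSet_Ioi
      have h4 := Measure.quasiMeasurePreserving_fst.ae (μb := volume.restrict (Set.Ioi (0 : ℝ)))
        (μa := (volume.restrict (Set.Ioi (0 : ℝ))).prod μ) this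
      filter_upwards [h4] with z hz
      simp only [Function.uncurry]
      rw [norm_mul, mul_comm, Complex.norm_exp]
      gcongr
      simp only [Complex.neg_re, Complex.re_mul_ofReal]
      have hz' : 0 < z.1 := hz
      nlinarith [hcη z.2]

theorem IsLineDensity.integral_mul {f g : ℝ → ℝ} {ρ σ : ℝ → ℂ} (hf : IsLineDensity f ρ)
    (hg : IsLineDensity g σ) :
    ((∫ r in Set.Ioi 0, f r * g r : ℝ) : ℂ) = ∫ p : ℝ × ℝ, ρ p.1 * σ p.2 / (lineC p.1 + lineC p.2) := by
  have hcl := continuous_lineC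
  have h1 : ∀ r : ℝ, ((f r * g r : ℝ) : ℂ) = ∫ p : ℝ × ℝ, (ρ p.1 * σ p.2) *
      Complex.exp (-((lineC p.1 + lineC p.2) * r)) := by
    intro r
    push_cast
    rw [hf.rep, hg.rep, ← integral_prod_mul, ← Measure.volume_eq_prod]
    refine integral_congr_ae (Eventually.of_forall fun p ↦ ?_)
    simp only
    rw [show -((lineC p.1 + lineC p.2) * (r : ℂ)) = -(lineC p.1 * r) + -(lineC p.2 * r) by ring,
      Complex.exp_add]
    ring
  rw [← integral_complex_ofReal]
  simp_rw [h1]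
  refine integral_Ioi_integral_mul_exp (hf.integrable.mul_prod hg.integrable) (by fun_prop) two_pos fun p ↦ ?_
  rw [Complex.add_re, lineC_re, lineC_re]; norm_num

theorem IsLineDensity.integral_laplace {f : ℝ → ℝ} {ρ : ℝ → ℂ} (hf : IsLineDensity f ρ) {γ : ℂ}
    (hγ : -2 < γ.re) :
    ∫ r in Set.Ioi (0 : ℝ), (f (2 * r) : ℂ) * Complex.exp (-(γ * r)) = ∫ t, ρ t / (2 * lineC t + γ) := by
  have hcl := continuous_lineC
  have h1 : ∀ r : ℝ, (f (2 * r) : ℂ) * Complex.exp (-(γ * r)) =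
      ∫ t, ρ t * Complex.exp (-((2 * lineC t + γ) * r)) := by
    intro r
    rw [hf.rep, ← integral_mul_const]
    refine integral_congr_ae (Eventually.of_forall fun p ↦ ?_)
    simp only
    rw [mul_assoc, ← Complex.exp_add]
    push_cast
    ring_nf
  simp_rw [h1]
  refine integral_Ioi_integral_mul_exp hf.integrable (by fun_prop) (η := 2 + γ.re) (by linarith) fun t ↦ ?_
  simp [lineC_re]

/-- `W` is the tail integral of a symmetric bump of mass one around `1`, which gives the reflection
identity, and its density is that of the bump divided by `s`. The vanishing moment expresses `W'(0)
= 0`; both it and `W 0 = 1` hold because the bump is supported away from `0`. -/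
theorem exists_cutoff {δ : ℝ} (hδ : 0 < δ) (hδ1 : δ < 1) : ∃ (W : ℝ → ℝ) (ρ : ℝ → ℂ), IsCutoff W δ ∧
    IsLineDensity W ρ ∧ ∫ t, ρ t * lineC t = 0 ∧ W 0 = 1 := by
  let B : ContDiffBump (1 : ℝ) := ⟨δ / 2, δ, by positivity, by linarith⟩
  set φ := B.normed volume with hφ
  have hφ0 : ∀ x, 0 ≤ φ x := B.nonneg_normed
  have hφi : Integrable φ := B.integrable_normed
  have hφ1 : ∫ x, φ x = 1 := B.integral_normed
  have hφs : ∀ x, δ ≤ |x - 1| → φ x = 0 := by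
    intro x hx
    have : x ∉ Function.support φ := by
      rw [hφ, B.support_normed_eq, Metric.mem_ball, Real.dist_eq]
      exact not_lt.mpr hx
    simpa using this
  obtain ⟨ρ, hρ, -⟩ := exists_lineDensity (f := φ) B.contDiff_normed B.hasCompactSupport_normed
  set W : ℝ → ℝ := fun v ↦ ∫ u in Set.Ioi v, φ u with hW
  have hsym : ∀ v, W v + W (2 - v) = 1 := by
    intro v
    have h1 : W (2 - v) = ∫ u in Set.Iic v, φ u := by
      have h2 := integral_comp_neg_Iic v (fun u ↦ φ (2 + u))
      have h3 : ∀ u, φ (2 + -u) = φ u := by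
        intro u
        have := B.normed_sub (μ := (volume : Measure ℝ)) (1 - u)
        rw [show 1 - (1 - u) = u by ring] at this
        rw [hφ, this]; ring_nf
      simp_rw [h3] at h2
      rw [h2]
      have h4 := (measurePreserving_add_left (volume : Measure ℝ) 2).setIntegral_preimage_emb
        (measurableEmbedding_addLeft 2) φ (Set.Ioi (2 - v))
      rw [hW]
      simp only
      rw [← h4]
      congr 2
      ext x
      simp only [Set.mem_preimage, Set.mem_Ioi]
      constructor <;> intro h <;> linarith
    rw [h1, add_comm, hW, ← hφ1]
    exact intervalIntegral.integral_Iic_add_Ioi hφi.integrableOn hφi.integrableOn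
  have hnn : ∀ v, 0 ≤ W v := fun v ↦ integral_nonneg hφ0
  have hsupp : ∀ v, 1 + δ ≤ v → W v = 0 := by
    intro v hv
    refine setIntegral_eq_zero_of_forall_eq_zero fun u hu ↦ hφs u ?_
    have : v < u := hu
    rw [abs_of_nonneg (by linarith)]
    linarith
  have hmono : Antitone W := by
    intro v w hvw
    exact setIntegral_mono_set hφi.integrableOn (ae_of_all _ hφ0) (Set.Ioi_subset_Ioi hvw).eventuallyLE
  have hcl := continuous_lineC
  refine ⟨W, fun t ↦ ρ t / lineC t, ⟨hmono.measurable, hnn, fun v ↦ ?_, hsym, hsupp⟩,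
    ⟨?_, fun n ↦ ?_, fun v ↦ ?_⟩, ?_, ?_⟩
  · linarith [hsym v, hnn (2 - v)]
  · exact hρ.cont.div hcl lineC_ne_zero
  · refine (hρ.decay n).mono' ?_ (Eventually.of_forall fun t ↦ ?_)
    · refine Continuous.aestronglyMeasurable ?_
      have := hρ.cont.div hcl lineC_ne_zero
      exact (by fun_prop : Continuous fun t : ℝ ↦ (1 + |t|) ^ n).mul this.norm
    · rw [norm_mul, norm_norm, norm_div, norm_of_nonneg (by positivity)]
      gcongr
      exact div_le_self (norm_nonneg _) (one_le_norm_lineC t)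
  · have h4 := (measurePreserving_add_left (volume : Measure ℝ) v).setIntegral_preimage_emb
        (measurableEmbedding_addLeft v) φ (Set.Ioi v)
    have h5 : (fun x ↦ v + x) ⁻¹' Set.Ioi v = Set.Ioi 0 := by
      ext x; simp
    have h6 := integral_Ioi_integral_mul_exp (hρ.integrable_mul_exp v) hcl.measurable one_pos
      (fun t ↦ (lineC_re t).ge)
    rw [hW]
    simp only
    rw [← h4, h5, ← integral_complex_ofReal]
    have h7 : ∀ r : ℝ, ((φ (v + r) : ℝ) : ℂ) = ∫ t, ρ t * Complex.exp (-(lineC t * v)) *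
        Complex.exp (-(lineC t * r)) := by
      intro r
      rw [hρ.rep]
      refine integral_congr_ae (Eventually.of_forall fun t ↦ ?_)
      simp only
      rw [mul_assoc, ← Complex.exp_add]
      push_cast
      ring_nf
    simp_rw [h7]
    rw [h6]
    refine integral_congr_ae (Eventually.of_forall fun t ↦ ?_)
    simp only
    ring
  · have h1 := hρ.rep 0
    -- The density of `W` times `s` is the density of the bump, so its integral is the value of the
    -- bump at `0`.
    rw [hφs 0 (by simpa using hδ1.le)] at h1
    simp only [Complex.ofReal_zero, mul_zero, neg_zero, Complex.exp_zero, mul_one] at h1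
    rw [h1]
    refine integral_congr_ae (Eventually.of_forall fun t ↦ ?_)
    exact div_mul_cancel₀ _ (lineC_ne_zero t)
  · have h1 := hsym 0
    rw [hsupp (2 - 0) (by linarith)] at h1
    linarith
end


/-! ### The zeta function near `1`, and sums over the primes dividing `q`. -/

noncomputable section

open Real Filter Topology Finset

/-- The function `s ζ(1 + s)`, extended continuously to `s = 0`. -/
def zetaReg : ℂ → ℂ := Function.update (fun s ↦ s * riemannZeta (1 + s)) 0 1

theorem zetaReg_of_ne_zero {s : ℂ} (hs : s ≠ 0) : zetaReg s = s * riemannZeta (1 + s) := by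
  simp [zetaReg, hs]

theorem zetaReg_zero : zetaReg 0 = 1 := by simp [zetaReg]

theorem continuous_zetaReg : Continuous zetaReg := by
  rw [continuous_iff_continuousAt]
  intro s
  rcases eq_or_ne s 0 with rfl | hs
  · rw [zetaReg, continuousAt_update_same]
    have h1 : Tendsto (fun s : ℂ ↦ 1 + s) (𝓝[≠] 0) (𝓝[≠] 1) := by
      refine tendsto_nhdsWithin_iff.mpr ⟨?_, ?_⟩
      · have : Tendsto (fun s : ℂ ↦ 1 + s) (𝓝 0) (𝓝 (1 + 0)) := (continuous_const.add continuous_id).tendsto 0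
        rw [add_zero] at this
        exact this.mono_left nhdsWithin_le_nhds
      · filter_upwards [self_mem_nhdsWithin] with s hs
        simpa using hs
    have h2 := riemannZeta_residue_one.comp h1
    refine h2.congr fun s ↦ ?_
    simp
  · rw [zetaReg, continuousAt_update_of_ne hs]
    refine continuousAt_id.mul ?_
    have h1 : (1 + s) ≠ 1 := by simpa using hs
    exact ContinuousAt.comp (g := riemannZeta) (differentiableAt_riemannZeta h1).continuousAt
      (continuousAt_const.add continuousAt_id)

theorem zetaReg_ne_zero {s : ℂ} (hs : 0 ≤ s.re) : zetaReg s ≠ 0 := by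
  rcases eq_or_ne s 0 with rfl | h
  · simp [zetaReg_zero]
  · rw [zetaReg_of_ne_zero h]
    exact mul_ne_zero h (riemannZeta_ne_zero_of_one_le_re (by simpa using hs))

/-- Both `ζ` and `1/ζ` have Dirichlet coefficients bounded by `1`, so each is dominated termwise by
`ζ(1 + σ)`. -/
theorem norm_zeta_bounds {σ : ℝ} (hσ : 0 < σ) {x : ℂ} (hx : σ ≤ x.re) :
    ‖riemannZeta (1 + x)‖ ≤ ‖riemannZeta (1 + σ)‖ ∧ ‖(riemannZeta (1 + x))⁻¹‖ ≤ ‖riemannZeta (1 + σ)‖ := by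
  have hS : Summable fun n : ℕ ↦ 1 / ((n + 1 : ℕ) : ℝ) ^ (1 + σ) :=
    (summable_nat_add_iff (f := fun n : ℕ ↦ 1 / (n : ℝ) ^ (1 + σ)) 1).mpr
      (Real.summable_one_div_nat_rpow.mpr (by linarith))
  have h1 : ‖riemannZeta (1 + σ)‖ = ∑' n : ℕ, 1 / ((n + 1 : ℕ) : ℝ) ^ (1 + σ) := by
    rw [zeta_eq_tsum_one_div_nat_add_one_cpow (by simpa using hσ)]
    have : ∀ n : ℕ, (1 : ℂ) / ((n : ℂ) + 1) ^ (1 + (σ : ℂ)) = ((1 / ((n + 1 : ℕ) : ℝ) ^ (1 + σ) : ℝ) : ℂ) := by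
      intro n
      rw [Complex.ofReal_div, Complex.ofReal_cpow (by positivity)]
      push_cast
      rfl
    simp_rw [this]
    rw [← Complex.ofReal_tsum, Complex.norm_real, norm_of_nonneg (tsum_nonneg fun n ↦ by positivity)]
  have hle : ∀ n : ℕ, ((n + 1 : ℕ) : ℝ) ^ (1 + σ) ≤ ((n + 1 : ℕ) : ℝ) ^ (1 + x.re) := fun n ↦
    rpow_le_rpow_of_exponent_le (by exact_mod_cast Nat.le_add_left 1 n) (by linarith)
  have hre : 1 < (1 + x).re := by simp; linarith
  constructor
  · rw [h1, zeta_eq_tsum_one_div_nat_add_one_cpow hre]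
    refine tsum_of_norm_bounded hS.hasSum fun n ↦ ?_
    rw [norm_div, norm_one, show (n : ℂ) + 1 = ((n + 1 : ℕ) : ℂ) by push_cast; rfl,
      Complex.norm_natCast_cpow_of_pos (Nat.succ_pos n)]
    simp only [Complex.add_re, Complex.one_re]
    exact one_div_le_one_div_of_le (by positivity) (hle n)
  · have h2 := ArithmeticFunction.LSeries_zeta_mul_Lseries_moebius hre
    rw [ArithmeticFunction.LSeries_zeta_eq_riemannZeta hre] at h2
    rw [inv_eq_of_mul_eq_one_right h2, h1, LSeries]
    have hs0 : Summable fun n : ℕ ↦ if n = 0 then 0 else 1 / (n : ℝ) ^ (1 + σ) := by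
      refine Summable.of_nonneg_of_le (fun n ↦ by split_ifs <;> positivity) (fun n ↦ ?_)
        (Real.summable_one_div_nat_rpow.mpr (by linarith : 1 < 1 + σ))
      split_ifs
      · positivity
      · rfl
    have h3 : ∑' n : ℕ, 1 / ((n + 1 : ℕ) : ℝ) ^ (1 + σ) = ∑' n : ℕ, if n = 0 then 0 else 1 / (n : ℝ) ^ (1 + σ) := by
      rw [hs0.tsum_eq_zero_add]
      simp
    rw [h3]
    refine tsum_of_norm_bounded hs0.hasSum fun n ↦ ?_
    rcases eq_or_ne n 0 with rfl | hn
    · simp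
    · rw [LSeries.term_of_ne_zero hn, if_neg hn, norm_div,
        Complex.norm_natCast_cpow_of_pos (Nat.pos_of_ne_zero hn)]
      have hm : ‖((ArithmeticFunction.moebius n : ℤ) : ℂ)‖ ≤ 1 := by
        rw [Complex.norm_intCast]
        exact_mod_cast ArithmeticFunction.abs_moebius_le_one
      simp only [Complex.add_re, Complex.one_re]
      have hn1 : (1 : ℝ) ≤ n := by exact_mod_cast Nat.one_le_iff_ne_zero.mpr hn
      gcongr

/-- The function `s ζ(1 + s)` is continuous and has no zero on the compact half disc `|s| ≤ 1`, `Re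
s ≥ 0`; this uses nonvanishing of `ζ` on the line of real part one. Hence `ζ(1 + σ) ≪ 1/σ`, and
`1/ζ(1 + x) ≪ |x|` near the pole. -/
theorem exists_zeta_bounds : ∃ C : ℝ, 1 ≤ C ∧ ∀ σ : ℝ, 0 < σ → σ ≤ 1 → ∀ x : ℂ, σ ≤ x.re →
    ‖riemannZeta (1 + x)‖ ≤ C / σ ∧ ‖(riemannZeta (1 + x))⁻¹‖ ≤ C / σ ∧
    (‖x‖ ≤ 1 → ‖(riemannZeta (1 + x))⁻¹‖ ≤ C * ‖x‖) := by
  have hK : IsCompact (Metric.closedBall (0 : ℂ) 1 ∩ {s | 0 ≤ s.re}) :=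
    (isCompact_closedBall _ _).inter_right (isClosed_le continuous_const Complex.continuous_re)
  obtain ⟨C1, hC1⟩ := hK.exists_bound_of_continuousOn continuous_zetaReg.continuousOn
  obtain ⟨C2, hC2⟩ := hK.exists_bound_of_continuousOn (f := fun s ↦ (zetaReg s)⁻¹)
    (continuous_zetaReg.continuousOn.inv₀ fun s hs ↦ zetaReg_ne_zero hs.2)
  refine ⟨max 1 (max C1 C2), le_max_left _ _, fun σ hσ hσ1 x hx ↦ ?_⟩
  have h1 : ‖riemannZeta (1 + σ)‖ ≤ max 1 (max C1 C2) / σ := by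
    rw [le_div_iff₀ hσ]
    have h2 := hC1 σ ⟨by simp [abs_of_pos hσ, hσ1], by simp [hσ.le]⟩
    rw [zetaReg_of_ne_zero (by exact_mod_cast hσ.ne'), norm_mul, Complex.norm_real,
      norm_of_nonneg hσ.le, mul_comm] at h2
    exact h2.trans (le_max_of_le_right (le_max_left _ _))
  obtain ⟨h2, h3⟩ := norm_zeta_bounds hσ hx
  refine ⟨h2.trans h1, h3.trans h1, fun hx1 ↦ ?_⟩
  have hx0 : x ≠ 0 := by rintro rfl; simp at hx; linarith
  have h4 := hC2 x ⟨by simpa using hx1, by simp; linarith⟩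
  rw [zetaReg_of_ne_zero hx0] at h4
  have h5 : (riemannZeta (1 + x))⁻¹ = x * (x * riemannZeta (1 + x))⁻¹ := by
    rw [mul_inv, ← mul_assoc, mul_inv_cancel₀ hx0, one_mul]
  rw [h5, norm_mul, mul_comm]
  gcongr
  exact h4.trans (le_max_of_le_right (le_max_right _ _))

/-- Crude bound for `∑_{p ∣ q} log p / p`. -/
theorem sum_log_div_primeFactors_le {q : ℕ} (hq : 1 < q) :
    ∑ p ∈ q.primeFactors, log p / p ≤ 2 * sqrt (log q) := by
  have hL : 0 < log q := log_pos (by exact_mod_cast hq)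
  set T := sqrt (log q) with hT
  have hT0 : 0 < T := sqrt_pos.mpr hL
  have hTT : T * T = log q := mul_self_sqrt hL.le
  -- There are at most `T` primes up to `T`, each contributing at most `1`. Beyond `T` the sum is at
  -- most `(∑ log p) / T ≤ log q / T`; the choice `T = √(log q)` balances the two.
  have h1 : ∀ p ∈ q.primeFactors, log p / p ≤ (if p ∈ Finset.Icc 1 ⌊T⌋₊ then 1 else 0) + log p / T := by
    intro p hp
    have hp1 : (1 : ℝ) ≤ p := by exact_mod_cast (Nat.prime_of_mem_primeFactors hp).one_lt.le
    have hlp : 0 ≤ log p := log_nonneg hp1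
    split_ifs with h
    · have : log p / p ≤ 1 := by
        rw [div_le_one (by linarith)]
        exact (log_le_sub_one_of_pos (by linarith)).trans (by linarith)
      have : 0 ≤ log p / T := by positivity
      linarith
    · rw [Finset.mem_Icc, not_and, not_le] at h
      have h2 := h (by exact_mod_cast hp1)
      have h3 : T < p := (Nat.floor_lt hT0.le).mp h2
      rw [zero_add]
      gcongr
  refine (Finset.sum_le_sum h1).trans ?_
  rw [Finset.sum_add_distrib, ← Finset.sum_div]
  have h2 : ∑ p ∈ q.primeFactors, (if p ∈ Finset.Icc 1 ⌊T⌋₊ then (1 : ℝ) else 0) ≤ T := by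
    rw [← Finset.sum_filter, Finset.filter_mem_eq_inter, Finset.sum_const, nsmul_eq_mul, mul_one]
    calc ((#(q.primeFactors ∩ Finset.Icc 1 ⌊T⌋₊) : ℕ) : ℝ) ≤ #(Finset.Icc 1 ⌊T⌋₊) := by
          exact_mod_cast Finset.card_le_card Finset.inter_subset_right
      _ = ⌊T⌋₊ := by simp
      _ ≤ T := Nat.floor_le hT0.le
  have h3 : ∑ p ∈ q.primeFactors, log p ≤ log q := by
    rw [← log_prod (fun p hp ↦ by exact_mod_cast (Nat.prime_of_mem_primeFactors hp).ne_zero)]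
    refine log_le_log (Finset.prod_pos fun p hp ↦ by exact_mod_cast (Nat.prime_of_mem_primeFactors hp).pos) ?_
    rw [← Nat.cast_prod]
    exact_mod_cast Nat.le_of_dvd (by omega) (Nat.prod_primeFactors_dvd q)
  have h4 : (∑ p ∈ q.primeFactors, log p) / T ≤ T := by
    rw [div_le_iff₀ hT0, hTT]; exact h3
  linarith

/-- Crude bound for `∑_{p ∣ q} 1 / p`. -/
theorem sum_inv_primeFactors_le {q : ℕ} (hq : 1 ≤ log q) :
    ∑ p ∈ q.primeFactors, (1 : ℝ) / p ≤ 3 + log (log q) := by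
  have hq0 : q ≠ 0 := by rintro rfl; simp at hq; linarith
  set T := log q with hT
  have hT0 : 0 < T := by linarith
  -- With `T = log q`, primes up to `T` are covered by a harmonic sum, and beyond `T` one has `1/p ≤
  -- 1/T ≤ 2 log p / T` because `log p ≥ 1/2`.
  have h1 : ∀ p ∈ q.primeFactors, (1 : ℝ) / p ≤ (if p ∈ Finset.Icc 1 ⌊T⌋₊ then (p : ℝ)⁻¹ else 0) +
      2 * log p / T := by
    intro p hp
    have hp2 : (2 : ℝ) ≤ p := by exact_mod_cast (Nat.prime_of_mem_primeFactors hp).two_le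
    have hlp : 1 / 2 ≤ log p := by
      have := log_le_log two_pos hp2
      linarith [log_two_gt_d9]
    split_ifs with h
    · have : 0 ≤ 2 * log p / T := by positivity
      rw [one_div]; linarith
    · rw [Finset.mem_Icc, not_and, not_le] at h
      have h2 := h (by exact_mod_cast (by linarith : (1 : ℝ) ≤ p))
      have h3 : T < p := (Nat.floor_lt hT0.le).mp h2
      rw [zero_add]
      gcongr
      linarith
  refine (Finset.sum_le_sum h1).trans ?_
  rw [Finset.sum_add_distrib, ← Finset.sum_div, ← Finset.mul_sum]
  have h2 : ∑ p ∈ q.primeFactors, (if p ∈ Finset.Icc 1 ⌊T⌋₊ then (p : ℝ)⁻¹ else 0) ≤ 1 + log T := by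
    rw [← Finset.sum_filter, Finset.filter_mem_eq_inter]
    calc _ ≤ ∑ p ∈ Finset.Icc 1 ⌊T⌋₊, (p : ℝ)⁻¹ :=
          Finset.sum_le_sum_of_subset_of_nonneg Finset.inter_subset_right (fun _ _ _ ↦ by positivity)
      _ = (harmonic ⌊T⌋₊ : ℝ) := by rw [harmonic_eq_sum_Icc]; push_cast; rfl
      _ ≤ 1 + log ⌊T⌋₊ := harmonic_le_one_add_log _
      _ ≤ 1 + log T := by
        have h5 : (0 : ℝ) < ⌊T⌋₊ := by exact_mod_cast Nat.floor_pos.mpr hq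
        have := log_le_log h5 (Nat.floor_le hT0.le)
        linarith
  have h3 : ∑ p ∈ q.primeFactors, log p ≤ T := by
    rw [← log_prod (fun p hp ↦ by exact_mod_cast (Nat.prime_of_mem_primeFactors hp).ne_zero)]
    refine log_le_log (Finset.prod_pos fun p hp ↦ by exact_mod_cast (Nat.prime_of_mem_primeFactors hp).pos) ?_
    rw [← Nat.cast_prod]
    exact_mod_cast Nat.le_of_dvd (by omega) (Nat.prod_primeFactors_dvd q)
  have h4 : (2 * ∑ p ∈ q.primeFactors, log p) / T ≤ 2 := by
    rw [div_le_iff₀ hT0]; linarith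
  linarith
end


/-! ### Uniformity in `q` of the Euler factors at primes dividing `q`. -/

noncomputable section

open Real Filter Topology Finset

/-- The finite Euler product `∏_{p ∣ q} (1 - p^{-1-x})`. -/
def eulerDefect (q : ℕ) (x : ℂ) : ℂ := ∏ p ∈ q.primeFactors, (1 - (p : ℂ) ^ (-(1 + x)))

/-- A bound for the logarithm of the variation of `eulerDefect` near `0`. -/
def defectBound (q : ℕ) (r : ℝ) : ℝ := ∑ p ∈ q.primeFactors, 4 / (p : ℝ) * min 1 (r * log p)

theorem norm_one_sub_natCast_cpow_le {p : ℕ} (hp : 1 ≤ p) {x : ℂ} (hx : 0 ≤ x.re) :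
    ‖1 - (p : ℂ) ^ (-x)‖ ≤ 2 * min 1 (‖x‖ * log p) := by
  have hp0 : (p : ℂ) ≠ 0 := by exact_mod_cast (by omega : p ≠ 0)
  have hlp : 0 ≤ log p := log_nonneg (by exact_mod_cast hp)
  have h1 : ‖(p : ℂ) ^ (-x)‖ ≤ 1 := by
    rw [Complex.norm_natCast_cpow_of_pos (by omega)]
    exact rpow_le_one_of_one_le_of_nonpos (by exact_mod_cast hp) (by simpa using hx)
  rcases le_total 1 (‖x‖ * log p) with h | h
  · rw [min_eq_left h]
    calc _ ≤ ‖(1 : ℂ)‖ + ‖(p : ℂ) ^ (-x)‖ := norm_sub_le _ _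
      _ ≤ _ := by rw [norm_one]; linarith
  · rw [min_eq_right h, norm_sub_rev, Complex.cpow_def_of_ne_zero hp0]
    have h2 : ‖Complex.log p * -x‖ = ‖x‖ * log p := by
      rw [norm_mul, norm_neg, ← Complex.ofReal_natCast, ← Complex.ofReal_log (by positivity),
        Complex.norm_real, norm_of_nonneg hlp, mul_comm]
    rw [← h2]
    exact Complex.norm_exp_sub_one_le (by rw [h2]; exact h)

theorem natCast_cpow_neg_one_add {p : ℕ} (hp : p ≠ 0) (x : ℂ) :
    (p : ℂ) ^ (-(1 + x)) = (p : ℂ)⁻¹ * (p : ℂ) ^ (-x) := by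
  have hp0 : (p : ℂ) ≠ 0 := by exact_mod_cast hp
  rw [neg_add, Complex.cpow_add _ _ hp0, Complex.cpow_neg_one]

theorem half_le_norm_one_sub {p : ℕ} (hp : 2 ≤ p) {x : ℂ} (hx : 0 ≤ x.re) :
    1 / 2 ≤ ‖1 - (p : ℂ) ^ (-(1 + x))‖ := by
  have hp2 : (2 : ℝ) ≤ p := by exact_mod_cast hp
  have h1 : ‖(p : ℂ) ^ (-(1 + x))‖ ≤ 1 / 2 := by
    rw [Complex.norm_natCast_cpow_of_pos (by omega)]
    calc (p : ℝ) ^ (-(1 + x)).re ≤ (p : ℝ) ^ (-1 : ℝ) :=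
          rpow_le_rpow_of_exponent_le (by linarith) (by simp; linarith)
      _ = (p : ℝ)⁻¹ := rpow_neg_one _
      _ ≤ 1 / 2 := by rw [one_div]; gcongr
  have h2 := norm_sub_norm_le (1 : ℂ) ((p : ℂ) ^ (-(1 + x)))
  rw [norm_one] at h2
  linarith

/-- The ratio is a product of factors `1 + u_p`, with `|u_p| ≤ (4/p) min(1, r log p)` since the
denominators are at least `1/2`. The two alternatives in `hr` cover the ratio and its inverse. -/
theorem eulerDefect_ratio_bounds (q : ℕ) {x y : ℂ} (hx : 0 ≤ x.re) (hy : 0 ≤ y.re) {r : ℝ}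
    (hr : x = 0 ∧ ‖y‖ ≤ r ∨ y = 0 ∧ ‖x‖ ≤ r) :
    ‖eulerDefect q x / eulerDefect q y - 1‖ ≤ exp (defectBound q r) - 1 := by
  have h0 : ∀ p ∈ q.primeFactors, (1 - (p : ℂ) ^ (-(1 + y))) ≠ 0 := by
    intro p hp
    have := half_le_norm_one_sub (Nat.prime_of_mem_primeFactors hp).two_le hy
    intro h
    rw [h, norm_zero] at this
    linarith
  have h1 : eulerDefect q x / eulerDefect q y = ∏ p ∈ q.primeFactors,
      (1 + ((p : ℂ) ^ (-(1 + y)) - (p : ℂ) ^ (-(1 + x))) / (1 - (p : ℂ) ^ (-(1 + y)))) := by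
    rw [eulerDefect, eulerDefect, ← Finset.prod_div_distrib]
    refine Finset.prod_congr rfl fun p hp ↦ ?_
    have := h0 p hp
    field_simp
    ring
  rw [h1]
  refine (Finset.norm_prod_one_add_sub_one_le _ _).trans ?_
  gcongr
  refine Finset.sum_le_sum fun p hp ↦ ?_
  have hpp := Nat.prime_of_mem_primeFactors hp
  have hp0 : (0 : ℝ) < p := by exact_mod_cast hpp.pos
  have hlp : 0 ≤ log p := log_nonneg (by exact_mod_cast hpp.one_lt.le)
  have h2 := half_le_norm_one_sub hpp.two_le hy
  rw [norm_div, div_le_iff₀ (by linarith), natCast_cpow_neg_one_add hpp.ne_zero,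
    natCast_cpow_neg_one_add hpp.ne_zero, ← mul_sub, norm_mul, norm_inv, Complex.norm_natCast]
  have h3 : ‖(p : ℂ) ^ (-y) - (p : ℂ) ^ (-x)‖ ≤ 2 * min 1 (r * log p) := by
    rcases hr with ⟨rfl, hr⟩ | ⟨rfl, hr⟩
    · rw [neg_zero, Complex.cpow_zero, norm_sub_rev]
      refine (norm_one_sub_natCast_cpow_le hpp.one_lt.le hy).trans ?_
      gcongr
    · rw [neg_zero, Complex.cpow_zero]
      refine (norm_one_sub_natCast_cpow_le hpp.one_lt.le hx).trans ?_
      gcongr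
  have hr0 : 0 ≤ r := by rcases hr with h | h <;> exact (norm_nonneg _).trans h.2
  have hm : 0 ≤ min 1 (r * log p) := le_min zero_le_one (by positivity)
  rw [natCast_cpow_neg_one_add hpp.ne_zero] at h2
  calc (p : ℝ)⁻¹ * ‖(p : ℂ) ^ (-y) - (p : ℂ) ^ (-x)‖ ≤ (p : ℝ)⁻¹ * (2 * min 1 (r * log p)) := by gcongr
    _ = 4 / p * min 1 (r * log p) * (1 / 2) := by ring
    _ ≤ _ := by gcongr

theorem defectBound_le {q : ℕ} (hq : 1 ≤ log q) {r : ℝ} (hr : 0 ≤ r) :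
    defectBound q (r / log q) ≤ 8 * r / sqrt (log q) ∧ defectBound q (r / log q) ≤ 4 * (3 + log (log q)) := by
  have hq1 : 1 < q := by
    by_contra h
    have : log q ≤ 0 := log_nonpos (by positivity) (by exact_mod_cast not_lt.mp h)
    linarith
  have hL : 0 < log q := by linarith
  constructor
  · calc defectBound q (r / log q) ≤ ∑ p ∈ q.primeFactors, (4 * r / log q) * (log p / p) := by
          refine Finset.sum_le_sum fun p hp ↦ ?_
          calc 4 / (p : ℝ) * min 1 (r / log q * log p) ≤ 4 / (p : ℝ) * (r / log q * log p) := by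
                gcongr; exact min_le_right _ _
            _ = _ := by ring
      _ = (4 * r / log q) * ∑ p ∈ q.primeFactors, log p / p := by rw [Finset.mul_sum]
      _ ≤ (4 * r / log q) * (2 * sqrt (log q)) := by gcongr; exact sum_log_div_primeFactors_le hq1
      _ = _ := by
          have h1 := sqrt_pos.mpr hL
          nth_rewrite 1 [← mul_self_sqrt hL.le]
          field_simp
          ring
  · calc defectBound q (r / log q) ≤ ∑ p ∈ q.primeFactors, 4 * (1 / (p : ℝ)) := by
          refine Finset.sum_le_sum fun p hp ↦ ?_
          calc 4 / (p : ℝ) * min 1 (r / log q * log p) ≤ 4 / (p : ℝ) * 1 := by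
                gcongr; exact min_le_left _ _
            _ = _ := by ring
      _ = 4 * ∑ p ∈ q.primeFactors, 1 / (p : ℝ) := by rw [Finset.mul_sum]
      _ ≤ _ := by gcongr; exact sum_inv_primeFactors_le hq

/-- The exponential is at most a constant for `r ≤ √(log q)`. For larger `r` the second bound of
`defectBound_le` gives a constant times `(log q)^4`, which is at most the same constant times `r^8`.
The outcome is polynomial in `r` uniformly in `q`, as dominated convergence requires. -/
theorem exp_defectBound_le {q : ℕ} (hq : 1 ≤ log q) {r : ℝ} (hr : 0 ≤ r) :
    exp (defectBound q (r / log q)) ≤ exp 12 * (1 + r) ^ 8 := by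
  have hL : 0 < log q := by linarith
  obtain ⟨h1, h2⟩ := defectBound_le hq hr
  have hs := sqrt_pos.mpr hL
  rcases le_total r (sqrt (log q)) with h | h
  · have h3 : 8 * r / sqrt (log q) ≤ 8 := by rw [div_le_iff₀ hs]; linarith
    calc exp (defectBound q (r / log q)) ≤ exp 12 := exp_le_exp.mpr (by linarith)
      _ ≤ _ := le_mul_of_one_le_right (exp_pos _).le (one_le_pow₀ (by linarith))
  · calc exp (defectBound q (r / log q)) ≤ exp (4 * (3 + log (log q))) := exp_le_exp.mpr h2
      _ = exp 12 * (log q) ^ 4 := by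
          rw [show 4 * (3 + log (log q)) = 12 + (4 : ℕ) * log (log q) by push_cast; ring, exp_add, exp_nat_mul,
            exp_log hL]
      _ = exp 12 * (sqrt (log q)) ^ 8 := by
          nth_rewrite 1 [← sq_sqrt hL.le]; ring
      _ ≤ _ := by gcongr; linarith

theorem tendsto_log_natCast : Tendsto (fun q : ℕ ↦ log q) atTop atTop :=
  tendsto_log_atTop.comp tendsto_natCast_atTop_atTop

theorem tendsto_exp_defectBound {r : ℝ} (hr : 0 ≤ r) :
    Tendsto (fun q : ℕ ↦ exp (defectBound q (r / log q)) - 1) atTop (𝓝 0) := by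
  have h1 : Tendsto (fun q : ℕ ↦ 8 * r / sqrt (log q)) atTop (𝓝 0) :=
    tendsto_const_nhds.div_atTop (tendsto_sqrt_atTop.comp tendsto_log_natCast)
  have h2 : Tendsto (fun q : ℕ ↦ defectBound q (r / log q)) atTop (𝓝 0) := by
    refine tendsto_of_tendsto_of_tendsto_of_le_of_le' tendsto_const_nhds h1 ?_ ?_
    · filter_upwards [tendsto_log_natCast.eventually_ge_atTop 1] with q hq
      refine Finset.sum_nonneg fun p hp ↦ ?_
      have hlp : 0 ≤ log p := log_nonneg (by exact_mod_cast (Nat.prime_of_mem_primeFactors hp).one_lt.le)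
      have : 0 ≤ min 1 (r / log q * log p) := le_min zero_le_one (by positivity)
      positivity
    · filter_upwards [tendsto_log_natCast.eventually_ge_atTop 1] with q hq
      exact (defectBound_le hq hr).1
  have h3 := (continuous_exp.tendsto 0).comp h2
  rw [exp_zero] at h3
  simpa using h3.sub_const 1

/-- `ℓ ζ_q(1 + X / ℓ)^{-1}`-type factors: `ζ(1+x) R_q(x) / R_q(0)`. -/
def zetaQ (q : ℕ) (x : ℂ) : ℂ := riemannZeta (1 + x) * (eulerDefect q x / eulerDefect q 0)

theorem eulerDefect_ne_zero (q : ℕ) {x : ℂ} (hx : 0 ≤ x.re) : eulerDefect q x ≠ 0 := by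
  refine Finset.prod_ne_zero_iff.mpr fun p hp h ↦ ?_
  have := half_le_norm_one_sub (Nat.prime_of_mem_primeFactors hp).two_le hx
  rw [h, norm_zero] at this
  linarith

theorem norm_eulerDefect_ratio_le {q : ℕ} (hq : 1 ≤ log q) {X : ℂ} (hX : 0 ≤ X.re) :
    ‖eulerDefect q (X / log q) / eulerDefect q 0‖ ≤ exp 12 * (1 + ‖X‖) ^ 8 ∧
    ‖eulerDefect q 0 / eulerDefect q (X / log q)‖ ≤ exp 12 * (1 + ‖X‖) ^ 8 := by
  have hL : 0 < log q := by linarith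
  have hn : ‖X / (log q : ℂ)‖ ≤ ‖X‖ / log q := by
    rw [norm_div, Complex.norm_real, norm_of_nonneg hL.le]
  have hre : 0 ≤ (X / (log q : ℂ)).re := by rw [Complex.div_ofReal_re]; positivity
  have h0 := exp_defectBound_le hq (norm_nonneg X)
  have h3 : ∀ z : ℂ, ‖z - 1‖ ≤ exp (defectBound q (‖X‖ / log q)) - 1 → ‖z‖ ≤ exp 12 * (1 + ‖X‖) ^ 8 := by
    intro z hz
    have : ‖z‖ ≤ ‖z - 1‖ + ‖(1 : ℂ)‖ := by simpa using norm_add_le (z - 1) 1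
    rw [norm_one] at this
    linarith
  exact ⟨h3 _ (eulerDefect_ratio_bounds q hre (by simp) (Or.inr ⟨rfl, hn⟩)),
    h3 _ (eulerDefect_ratio_bounds q (by simp) hre (Or.inl ⟨rfl, hn⟩))⟩

theorem tendsto_eulerDefect_ratio {X : ℂ} (hX : 0 ≤ X.re) :
    Tendsto (fun q : ℕ ↦ eulerDefect q (X / log q) / eulerDefect q 0) atTop (𝓝 1) := by
  rw [tendsto_iff_norm_sub_tendsto_zero]
  refine squeeze_zero' (Eventually.of_forall fun _ ↦ norm_nonneg _) ?_ (tendsto_exp_defectBound (norm_nonneg X))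
  filter_upwards [tendsto_log_natCast.eventually_ge_atTop 1] with q hq
  have hL : 0 < log q := by linarith
  have hn : ‖X / (log q : ℂ)‖ ≤ ‖X‖ / log q := by
    rw [norm_div, Complex.norm_real, norm_of_nonneg hL.le]
  have hre : 0 ≤ (X / (log q : ℂ)).re := by rw [Complex.div_ofReal_re]; positivity
  exact eulerDefect_ratio_bounds q hre (by simp) (Or.inr ⟨rfl, hn⟩)

theorem tendsto_zetaQ {X : ℂ} (hX : 0 < X.re) :
    Tendsto (fun q : ℕ ↦ zetaQ q (X / log q) / log q) atTop (𝓝 X⁻¹) := by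
  have hX0 : X ≠ 0 := by rintro rfl; simp at hX
  have h1 : Tendsto (fun q : ℕ ↦ X / (log q : ℂ)) atTop (𝓝 0) := by
    have : Tendsto (fun q : ℕ ↦ ((log q : ℝ) : ℂ)) atTop (Bornology.cobounded ℂ) :=
      (RCLike.tendsto_ofReal_atTop_cobounded ℂ).comp tendsto_log_natCast
    have h2 := (tendsto_inv₀_cobounded (α := ℂ)).comp this
    simpa [div_eq_mul_inv] using h2.const_mul X
  have h2 := (continuous_zetaReg.tendsto 0).comp h1
  rw [zetaReg_zero] at h2
  have h3 := (h2.mul (tendsto_eulerDefect_ratio hX.le)).mul_const X⁻¹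
  rw [one_mul, one_mul] at h3
  refine h3.congr' ?_
  filter_upwards [tendsto_log_natCast.eventually_ge_atTop 1] with q hq
  have hL : (log q : ℂ) ≠ 0 := by exact_mod_cast (by linarith : log q ≠ 0)
  simp only [Function.comp_apply]
  rw [zetaReg_of_ne_zero (div_ne_zero hX0 hL), zetaQ]
  field_simp

/-- For the inverse two ranges are needed. If `|X| ≤ log q`, then `1/ζ(1 + x) ≪ |x|` gains the
factor `1/log q`. If `|X| > log q`, the crude bound `log q` is at most `|X|²/log q`; this accounts
for the two extra powers. -/
theorem exists_zetaQ_bounds : ∃ C : ℝ, 1 ≤ C ∧ ∀ (q : ℕ) (X : ℂ), 1 ≤ log q → 1 / 2 ≤ X.re →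
    ‖zetaQ q (X / log q)‖ ≤ C * (1 + ‖X‖) ^ 8 * log q ∧
    ‖(zetaQ q (X / log q))⁻¹‖ ≤ C * (1 + ‖X‖) ^ 10 / log q := by
  obtain ⟨C, hC, h⟩ := exists_zeta_bounds
  refine ⟨2 * C * exp 12, ?_, fun q X hq hX ↦ ?_⟩
  · have : (1 : ℝ) ≤ exp 12 := one_le_exp (by norm_num)
    nlinarith
  have hL : 0 < log q := by linarith
  have hre : (1 / 2) / log q ≤ (X / (log q : ℂ)).re := by rw [Complex.div_ofReal_re]; gcongr
  have hσ1 : (1 / 2) / log q ≤ 1 := by rw [div_le_one hL]; linarith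
  obtain ⟨h1, h2, h3⟩ := h ((1 / 2) / log q) (by positivity) hσ1 _ hre
  obtain ⟨h4, h5⟩ := norm_eulerDefect_ratio_le hq (by linarith : 0 ≤ X.re)
  have hCL : C / (1 / 2 / log q) = 2 * C * log q := by field_simp
  rw [hCL] at h1 h2
  constructor
  · rw [zetaQ, norm_mul]
    calc _ ≤ (2 * C * log q) * (exp 12 * (1 + ‖X‖) ^ 8) := by gcongr
      _ = _ := by ring
  · rw [zetaQ, mul_inv, inv_div, norm_mul]
    have h6 : ‖(riemannZeta (1 + X / (log q : ℂ)))⁻¹‖ ≤ 2 * C * (1 + ‖X‖) ^ 2 / log q := by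
      have hn : ‖X / (log q : ℂ)‖ = ‖X‖ / log q := by
        rw [norm_div, Complex.norm_real, norm_of_nonneg hL.le]
      have hX0 := norm_nonneg X
      rcases le_total ‖X‖ (log q) with h7 | h7
      · have h8 := h3 (by rw [hn, div_le_one hL]; exact h7)
        rw [hn] at h8
        calc _ ≤ C * (‖X‖ / log q) := h8
          _ = C * ‖X‖ / log q := by ring
          _ ≤ _ := by
            gcongr
            · linarith
            · nlinarith
      · refine h2.trans ?_
        rw [le_div_iff₀ hL]
        calc 2 * C * log q * log q ≤ 2 * C * ‖X‖ * ‖X‖ := by gcongr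
          _ ≤ _ := by
            rw [mul_assoc]
            gcongr
            nlinarith
    calc _ ≤ (2 * C * (1 + ‖X‖) ^ 2 / log q) * (exp 12 * (1 + ‖X‖) ^ 8) := by gcongr
      _ = _ := by ring
end


/-! ### Euler product of the mollified diagonal. -/

noncomputable section

open Real Filter Topology Finset

/-- The quadruples are sorted by the common value `N` of the two products. The hypothesis on `g₁`
disposes of `N = 0`, whose set of factorizations is empty by convention. -/
theorem hasSum_of_mul_eq_mul {g₁ g₂ : ℕ × ℕ → ℂ} {c : ℕ → ℂ} (hg₁ : ∀ p, p.1 * p.2 = 0 → g₁ p = 0)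
    (hs : Summable fun N : ℕ ↦ ‖c N‖ * ((∑ x ∈ N.divisorsAntidiagonal, ‖g₁ x‖) *
      ∑ x ∈ N.divisorsAntidiagonal, ‖g₂ x‖)) :
    HasSum (fun p : (ℕ × ℕ) × (ℕ × ℕ) ↦ if p.1.1 * p.1.2 = p.2.1 * p.2.2 then
        c (p.1.1 * p.1.2) * (g₁ p.1 * g₂ p.2) else 0)
      (∑' N : ℕ, c N * ((∑ x ∈ N.divisorsAntidiagonal, g₁ x) *
        ∑ x ∈ N.divisorsAntidiagonal, g₂ x)) := by
  classical
  let G : ℕ × ((ℕ × ℕ) × (ℕ × ℕ)) → ℂ := fun r ↦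
    if r.2 ∈ r.1.divisorsAntidiagonal ×ˢ r.1.divisorsAntidiagonal then
      c r.1 * (g₁ r.2.1 * g₂ r.2.2) else 0
  have hGn (N : ℕ) : HasSum (fun p ↦ ‖G (N, p)‖) (‖c N‖ *
      ((∑ x ∈ N.divisorsAntidiagonal, ‖g₁ x‖) * ∑ x ∈ N.divisorsAntidiagonal, ‖g₂ x‖)) := by
    rw [Finset.sum_mul_sum, ← Finset.sum_product', Finset.mul_sum]
    convert! hasSum_sum_of_ne_finset_zero (f := fun p ↦ ‖G (N, p)‖)
      (s := N.divisorsAntidiagonal ×ˢ N.divisorsAntidiagonal) ?_ using 1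
    · refine Finset.sum_congr rfl fun p hp ↦ ?_
      simp only [G]
      rw [if_pos hp, norm_mul, norm_mul]
    · intro p hp
      simp only [G]
      rw [if_neg hp, norm_zero]
    · infer_instance
  have hGs (N : ℕ) : HasSum (fun p ↦ G (N, p)) (c N *
      ((∑ x ∈ N.divisorsAntidiagonal, g₁ x) * ∑ x ∈ N.divisorsAntidiagonal, g₂ x)) := by
    rw [Finset.sum_mul_sum, ← Finset.sum_product', Finset.mul_sum]
    convert! hasSum_sum_of_ne_finset_zero (f := fun p ↦ G (N, p))
      (s := N.divisorsAntidiagonal ×ˢ N.divisorsAntidiagonal) ?_ using 1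
    · refine Finset.sum_congr rfl fun p hp ↦ ?_
      simp only [G]
      rw [if_pos hp]
    · intro p hp
      simp only [G]
      rw [if_neg hp]
    · infer_instance
  have hG : Summable G := by
    refine Summable.of_norm ((summable_prod_of_nonneg fun _ ↦ norm_nonneg _).mpr
      ⟨fun N ↦ (hGn N).summable, ?_⟩)
    simpa only [(hGn _).tsum_eq] using hs
  have h1 := hG.hasSum.prod_fiberwise hGs
  rw [h1.tsum_eq]
  have h2 := ((Equiv.prodComm _ _).hasSum_iff (f := G)).mpr hG.hasSum
  refine h2.prod_fiberwise fun p ↦ ?_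
  simp only [Function.comp_def, Equiv.prodComm_apply, Prod.swap_prod_mk]
  convert! hasSum_ite_eq (p.1.1 * p.1.2) (if p.1.1 * p.1.2 = p.2.1 * p.2.2 then
        c (p.1.1 * p.1.2) * (g₁ p.1 * g₂ p.2) else 0) using 1
  ext N
  simp only [G, Finset.mem_product, Nat.mem_divisorsAntidiagonal]
  by_cases h : N = p.1.1 * p.1.2
  · subst h
    by_cases h0 : p.1.1 * p.1.2 = 0
    · simp [h0, hg₁ _ h0]
    · simp only [true_and, h0, ne_eq, not_false_eq_true, and_true, if_true, eq_comm]
  · rw [if_neg h, if_neg]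
    rintro ⟨⟨h', -⟩, -⟩
    exact h h'.symm

/-- The arithmetic function `n ↦ n^{-κ}`. -/
def powArith (κ : ℂ) : ArithmeticFunction ℂ := ⟨fun n ↦ if n = 0 then 0 else (n : ℂ) ^ (-κ), by simp⟩

/-- The arithmetic function `n ↦ μ(n) n^{-ζ}`. -/
def moebiusPow (ζ : ℂ) : ArithmeticFunction ℂ :=
  ArithmeticFunction.pmul (ArithmeticFunction.moebius : ArithmeticFunction ℂ) (powArith ζ)

/-- The Dirichlet convolution of `μ(n) n^{-ζ}` and `n^{-κ}`. -/
def moebiusConv (ζ κ : ℂ) : ArithmeticFunction ℂ := moebiusPow ζ * powArith κ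

theorem powArith_apply (κ : ℂ) {n : ℕ} (hn : n ≠ 0) : powArith κ n = (n : ℂ) ^ (-κ) := if_neg hn

theorem isMultiplicative_powArith (κ : ℂ) : (powArith κ).IsMultiplicative := by
  rw [ArithmeticFunction.IsMultiplicative.iff_ne_zero]
  refine ⟨by simp [powArith], fun {m n} hm hn _ ↦ ?_⟩
  rw [powArith_apply _ (mul_ne_zero hm hn), powArith_apply _ hm, powArith_apply _ hn]
  push_cast
  exact Complex.natCast_mul_natCast_cpow m n (-κ)

theorem moebiusPow_apply (ζ : ℂ) {n : ℕ} (hn : n ≠ 0) :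
    moebiusPow ζ n = (ArithmeticFunction.moebius n : ℂ) * (n : ℂ) ^ (-ζ) := by
  simp [moebiusPow, powArith_apply _ hn]

theorem isMultiplicative_moebiusPow (ζ : ℂ) : (moebiusPow ζ).IsMultiplicative :=
  ArithmeticFunction.isMultiplicative_moebius.intCast.pmul (isMultiplicative_powArith ζ)

theorem isMultiplicative_moebiusConv (ζ κ : ℂ) : (moebiusConv ζ κ).IsMultiplicative :=
  (isMultiplicative_moebiusPow ζ).mul (isMultiplicative_powArith κ)

theorem natCast_pow_cpow (p e : ℕ) (s : ℂ) : ((p ^ e : ℕ) : ℂ) ^ s = ((p : ℂ) ^ s) ^ e := by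
  induction e with
  | zero => simp
  | succ e ih =>
    rw [pow_succ, pow_succ, ← ih]
    push_cast
    exact_mod_cast Complex.natCast_mul_natCast_cpow (p ^ e) p s

/-- Only the squarefree divisors `1` and `p` contribute, so the values form a geometric progression
from `e = 0` on, and the local series can be summed. -/
theorem moebiusConv_prime_pow (ζ κ : ℂ) {p : ℕ} (hp : p.Prime) (e : ℕ) :
    moebiusConv ζ κ (p ^ (e + 1)) =
      ((p : ℂ) ^ (-κ)) ^ e * ((p : ℂ) ^ (-κ) - (p : ℂ) ^ (-ζ)) := by
  rw [moebiusConv, ArithmeticFunction.mul_apply,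
    Nat.sum_divisorsAntidiagonal (f := fun a b ↦ moebiusPow ζ a * powArith κ b),
    Nat.sum_divisors_prime_pow hp, Finset.sum_range_succ', Finset.sum_range_succ']
  have h0 (n : ℕ) : p ^ n ≠ 0 := pow_ne_zero _ hp.ne_zero
  rw [Finset.sum_eq_zero, zero_add]
  · have h1 : p ^ (e + 1) / p ^ (0 + 1) = p ^ e := by
      rw [Nat.pow_div (by omega) hp.pos]; simp
    rw [h1, pow_zero, Nat.div_one, moebiusPow_apply _ (h0 _), moebiusPow_apply _ one_ne_zero,
      powArith_apply _ (h0 _), powArith_apply _ (h0 _), natCast_pow_cpow, natCast_pow_cpow,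
      natCast_pow_cpow, zero_add, pow_one, ArithmeticFunction.moebius_apply_prime hp]
    simp only [Int.reduceNeg, Int.cast_neg, Int.cast_one, ArithmeticFunction.moebius_apply_one,
      Nat.cast_one, Complex.one_cpow, pow_one]
    ring
  · intro i _
    rw [moebiusPow_apply _ (h0 _), ArithmeticFunction.moebius_apply_prime_pow hp (by omega),
      if_neg (by omega)]
    simp

theorem sum_norm_moebiusPow_mul_powArith_le {η : ℝ} {ζ κ : ℂ} (hζ : η ≤ ζ.re) (hκ : η ≤ κ.re) (N : ℕ) :
    ∑ x ∈ N.divisorsAntidiagonal, ‖moebiusPow ζ x.1 * powArith κ x.2‖ ≤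
      #N.divisors * (N : ℝ) ^ (-η) := by
  have hle (n : ℕ) (hn : n ≠ 0) (s : ℂ) (hs : η ≤ s.re) : ‖(n : ℂ) ^ (-s)‖ ≤ (n : ℝ) ^ (-η) := by
    rw [Complex.norm_natCast_cpow_of_pos (Nat.pos_of_ne_zero hn)]
    refine rpow_le_rpow_of_exponent_le (by exact_mod_cast Nat.one_le_iff_ne_zero.mpr hn) ?_
    simpa using hs
  calc _ ≤ ∑ x ∈ N.divisorsAntidiagonal, (N : ℝ) ^ (-η) := by
        refine Finset.sum_le_sum fun x hx ↦ ?_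
        rw [Nat.mem_divisorsAntidiagonal] at hx
        have hx1 : x.1 ≠ 0 := fun h ↦ hx.2 (by rw [← hx.1, h, zero_mul])
        have hx2 : x.2 ≠ 0 := fun h ↦ hx.2 (by rw [← hx.1, h, mul_zero])
        rw [← hx.1, norm_mul, moebiusPow_apply _ hx1, powArith_apply _ hx2, norm_mul, Nat.cast_mul,
          mul_rpow (by positivity) (by positivity)]
        have hμ : ‖(ArithmeticFunction.moebius x.1 : ℂ)‖ ≤ 1 := by
          rw [Complex.norm_intCast]
          exact_mod_cast ArithmeticFunction.abs_moebius_le_one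
        have h1 := hle x.1 hx1 ζ hζ
        have h2 := hle x.2 hx2 κ hκ
        gcongr
        calc _ ≤ 1 * ‖(x.1 : ℂ) ^ (-ζ)‖ := by gcongr
          _ ≤ _ := by rwa [one_mul]
    _ = _ := by
        rw [Finset.sum_const, ← Nat.map_div_right_divisors, Finset.card_map, nsmul_eq_mul]

theorem summable_card_divisors_sq {η : ℝ} (hη : 0 < η) :
    Summable fun N : ℕ ↦ (N : ℝ)⁻¹ * ((#N.divisors * (N : ℝ) ^ (-η)) * (#N.divisors * (N : ℝ) ^ (-η))) := by
  obtain ⟨C, hC, h⟩ := exists_card_divisors_le_rpow (e := η / 2) (by positivity)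
  refine Summable.of_nonneg_of_le (fun N ↦ by positivity) (fun N ↦ ?_)
    ((Real.summable_nat_rpow_inv (p := 1 + η).mpr (by linarith)).mul_left (C ^ 2))
  rcases eq_or_ne N 0 with rfl | hN
  · simp; positivity
  have hN0 : (0 : ℝ) < N := by positivity
  calc _ ≤ (N : ℝ)⁻¹ * (((C * (N : ℝ) ^ (η / 2)) * (N : ℝ) ^ (-η)) * ((C * (N : ℝ) ^ (η / 2)) * (N : ℝ) ^ (-η))) := by
        have := h N hN
        gcongr
    _ = _ := by
        rw [← rpow_neg hN0.le]
        have : (N : ℝ) ^ (-(1 + η)) = (N : ℝ)⁻¹ * ((N : ℝ) ^ (η / 2) * (N : ℝ) ^ (-η) * ((N : ℝ) ^ (η / 2) * (N : ℝ) ^ (-η))) := by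
          rw [← rpow_neg_one (N : ℝ), ← rpow_add hN0, ← rpow_add hN0, ← rpow_add hN0]
          ring_nf
        rw [this]; ring

/-- The coefficient at `N` of the Dirichlet series of the mollified diagonal. -/
def diagCoeff (q : ℕ) (ζ₁ κ₁ ζ₂ κ₂ : ℂ) (N : ℕ) : ℂ :=
  (if N.Coprime q then (N : ℂ)⁻¹ else 0) * (moebiusConv ζ₁ κ₁ N * moebiusConv ζ₂ κ₂ N)

/-- The Dirichlet series of the mollified diagonal. -/
def diagSeries (q : ℕ) (ζ₁ κ₁ ζ₂ κ₂ : ℂ) : ℂ := ∑' N, diagCoeff q ζ₁ κ₁ ζ₂ κ₂ N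

/-- The terms of the mollified diagonal: `((a, m), (b, n))` with `a m = b n`. -/
def diagTerm (q : ℕ) (ζ₁ κ₁ ζ₂ κ₂ : ℂ) (p : (ℕ × ℕ) × (ℕ × ℕ)) : ℂ :=
  if p.1.1 * p.1.2 = p.2.1 * p.2.2 then
    (if (p.1.1 * p.1.2).Coprime q then ((p.1.1 * p.1.2 : ℕ) : ℂ)⁻¹ else 0) *
      ((moebiusPow ζ₁ p.1.1 * powArith κ₁ p.1.2) * (moebiusPow ζ₂ p.2.1 * powArith κ₂ p.2.2)) else 0

section
variable {ζ₁ κ₁ ζ₂ κ₂ : ℂ} {η : ℝ} (q : ℕ)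

theorem hasSum_diagTerm (hη : 0 < η) (hζ₁ : η ≤ ζ₁.re) (hκ₁ : η ≤ κ₁.re) (hζ₂ : η ≤ ζ₂.re) (hκ₂ : η ≤ κ₂.re) :
    HasSum (diagTerm q ζ₁ κ₁ ζ₂ κ₂) (diagSeries q ζ₁ κ₁ ζ₂ κ₂) := by
  refine hasSum_of_mul_eq_mul (g₁ := fun p ↦ moebiusPow ζ₁ p.1 * powArith κ₁ p.2)
    (g₂ := fun p ↦ moebiusPow ζ₂ p.1 * powArith κ₂ p.2)
    (c := fun N ↦ if N.Coprime q then (N : ℂ)⁻¹ else 0) ?_ ?_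
  · rintro ⟨a, b⟩ h
    rcases mul_eq_zero.mp h with h | h <;> (simp only at h; simp [h])
  · refine Summable.of_nonneg_of_le (fun N ↦ by positivity) (fun N ↦ ?_) (summable_card_divisors_sq hη)
    gcongr
    · split_ifs
      · simp
      · simp
    · exact sum_norm_moebiusPow_mul_powArith_le hζ₁ hκ₁ N
    · exact sum_norm_moebiusPow_mul_powArith_le hζ₂ hκ₂ N

theorem summable_norm_diagCoeff (hη : 0 < η) (hζ₁ : η ≤ ζ₁.re) (hκ₁ : η ≤ κ₁.re) (hζ₂ : η ≤ ζ₂.re)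
    (hκ₂ : η ≤ κ₂.re) : Summable fun N ↦ ‖diagCoeff q ζ₁ κ₁ ζ₂ κ₂ N‖ := by
  refine Summable.of_nonneg_of_le (fun N ↦ by positivity) (fun N ↦ ?_) (summable_card_divisors_sq hη)
  rw [diagCoeff, norm_mul, norm_mul]
  gcongr
  · split_ifs
    · simp
    · simp
  · exact (norm_sum_le _ _).trans (sum_norm_moebiusPow_mul_powArith_le hζ₁ hκ₁ N)
  · exact (norm_sum_le _ _).trans (sum_norm_moebiusPow_mul_powArith_le hζ₂ hκ₂ N)

theorem norm_prime_cpow_lt_one {p : ℕ} (hp : 2 ≤ p) {s : ℂ} (hs : 0 < s.re) :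
    ‖(p : ℂ) ^ (-(1 + s))‖ < 1 / p := by
  rw [Complex.norm_natCast_cpow_of_pos (by omega), one_div, ← rpow_neg_one]
  refine rpow_lt_rpow_of_exponent_lt (by exact_mod_cast hp) ?_
  simp; linarith

/-- The local factor at `p ∤ q` of the convergent part of `diagSeries`. -/
def diagLocal (ζ₁ κ₁ ζ₂ κ₂ : ℂ) (p : ℕ) : ℂ :=
  (p : ℂ) ^ (-(1 + (ζ₁ + ζ₂))) * ((p : ℂ) ^ (-(1 + (ζ₁ + κ₂))) + (p : ℂ) ^ (-(1 + (κ₁ + ζ₂)))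
    - (p : ℂ) ^ (-(1 + (ζ₁ + ζ₂))) - (p : ℂ) ^ (-(1 + (κ₁ + κ₂)))) /
    ((1 - (p : ℂ) ^ (-(1 + (ζ₁ + κ₂)))) * (1 - (p : ℂ) ^ (-(1 + (κ₁ + ζ₂)))))

/-- To first order in `1/p` the local series agrees with that of `ζ(1+κ₁+κ₂) ζ(1+ζ₁+ζ₂) /
(ζ(1+ζ₁+κ₂) ζ(1+κ₁+ζ₂))`, and `diagLocal` is the exact correction. The denominators are moved across
so that every factor belongs to a convergent Euler product. -/
theorem tsum_diagCoeff_prime_pow (hη : 0 < η) (hζ₁ : η ≤ ζ₁.re) (hκ₁ : η ≤ κ₁.re) (hζ₂ : η ≤ ζ₂.re)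
    (hκ₂ : η ≤ κ₂.re) {p : ℕ} (hp : p.Prime) :
    (∑' e, diagCoeff q ζ₁ κ₁ ζ₂ κ₂ (p ^ e)) *
      ((1 - (1 : DirichletCharacter ℂ q) p * (p : ℂ) ^ (-(1 + (ζ₁ + κ₂))))⁻¹ *
      (1 - (1 : DirichletCharacter ℂ q) p * (p : ℂ) ^ (-(1 + (κ₁ + ζ₂))))⁻¹) =
    (1 + if p ∣ q then 0 else diagLocal ζ₁ κ₁ ζ₂ κ₂ p) *
      ((1 - (1 : DirichletCharacter ℂ q) p * (p : ℂ) ^ (-(1 + (κ₁ + κ₂))))⁻¹ *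
      (1 - (1 : DirichletCharacter ℂ q) p * (p : ℂ) ^ (-(1 + (ζ₁ + ζ₂))))⁻¹) := by
  by_cases hpq : p ∣ q
  · have hn : ¬ p.Coprime q := by rwa [hp.coprime_iff_not_dvd, not_not]
    have h1 : (1 : DirichletCharacter ℂ q) p = 0 :=
      MulChar.map_nonunit _ (by rwa [ZMod.isUnit_iff_coprime])
    have h2 : ∑' e, diagCoeff q ζ₁ κ₁ ζ₂ κ₂ (p ^ e) = 1 := by
      rw [tsum_eq_single 0]
      · simp [diagCoeff, (isMultiplicative_moebiusConv _ _).map_one]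
      · intro e he
        rw [diagCoeff, if_neg, zero_mul]
        rwa [Nat.coprime_pow_left_iff (Nat.pos_of_ne_zero he)]
    rw [h1, h2, if_pos hpq]
    simp
  · have hc : p.Coprime q := hp.coprime_iff_not_dvd.mpr hpq
    have h1 : (1 : DirichletCharacter ℂ q) p = 1 :=
      MulChar.one_apply (by rwa [ZMod.isUnit_iff_coprime])
    have hp0 : (p : ℂ) ≠ 0 := Nat.cast_ne_zero.mpr hp.ne_zero
    have hlt (s : ℂ) (hs : 0 < s.re) : ‖(p : ℂ) ^ (-(1 + s))‖ < 1 :=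
      (norm_prime_cpow_lt_one hp.two_le hs).trans_le (by
        rw [div_le_one (by exact_mod_cast hp.pos)]; exact_mod_cast hp.one_le)
    have hne (s : ℂ) (hs : 0 < s.re) : 1 - (p : ℂ) ^ (-(1 + s)) ≠ 0 := fun h ↦ by
      have := hlt s hs
      rw [← sub_eq_zero.mp h] at this
      simp at this
    have hX := hlt (κ₁ + κ₂) (by simp; linarith)
    have hX' := hne (κ₁ + κ₂) (by simp; linarith)
    have hV' := hne (ζ₁ + ζ₂) (by simp; linarith)
    have hY1' := hne (ζ₁ + κ₂) (by simp; linarith)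
    have hY2' := hne (κ₁ + ζ₂) (by simp; linarith)
    have hsplit (s t : ℂ) : (p : ℂ) ^ (-(1 + (s + t))) = (p : ℂ)⁻¹ * ((p : ℂ) ^ (-s) * (p : ℂ) ^ (-t)) := by
      rw [← Complex.cpow_add _ _ hp0, ← Complex.cpow_neg_one, ← Complex.cpow_add _ _ hp0]
      ring_nf
    have hsum : ∑' e, diagCoeff q ζ₁ κ₁ ζ₂ κ₂ (p ^ e) = 1 + (p : ℂ)⁻¹ *
        (((p : ℂ) ^ (-κ₁) - (p : ℂ) ^ (-ζ₁)) * ((p : ℂ) ^ (-κ₂) - (p : ℂ) ^ (-ζ₂))) *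
        (1 - (p : ℂ) ^ (-(1 + (κ₁ + κ₂))))⁻¹ := by
      have hgs := (hasSum_geometric_of_norm_lt_one hX).mul_left ((p : ℂ)⁻¹ *
        (((p : ℂ) ^ (-κ₁) - (p : ℂ) ^ (-ζ₁)) * ((p : ℂ) ^ (-κ₂) - (p : ℂ) ^ (-ζ₂))))
      have hterm (e : ℕ) : diagCoeff q ζ₁ κ₁ ζ₂ κ₂ (p ^ (e + 1)) = (p : ℂ)⁻¹ *
          (((p : ℂ) ^ (-κ₁) - (p : ℂ) ^ (-ζ₁)) * ((p : ℂ) ^ (-κ₂) - (p : ℂ) ^ (-ζ₂))) *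
          ((p : ℂ) ^ (-(1 + (κ₁ + κ₂)))) ^ e := by
        rw [diagCoeff, if_pos (hc.pow_left _), moebiusConv_prime_pow _ _ hp,
          moebiusConv_prime_pow _ _ hp, hsplit]
        push_cast
        rw [mul_pow, mul_pow, pow_succ, mul_inv, ← inv_pow]
        ring
      have h0 : diagCoeff q ζ₁ κ₁ ζ₂ κ₂ (p ^ 0) = 1 := by
        simp [diagCoeff, (isMultiplicative_moebiusConv _ _).map_one]
      have := (hasSum_nat_add_iff' (f := fun e ↦ diagCoeff q ζ₁ κ₁ ζ₂ κ₂ (p ^ e)) (g := 1 + (p : ℂ)⁻¹ *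
        (((p : ℂ) ^ (-κ₁) - (p : ℂ) ^ (-ζ₁)) * ((p : ℂ) ^ (-κ₂) - (p : ℂ) ^ (-ζ₂))) *
        (1 - (p : ℂ) ^ (-(1 + (κ₁ + κ₂))))⁻¹) 1).mp (by
          simp only [hterm, Finset.sum_range_one, h0]
          convert! hgs using 1
          ring)
      exact this.tsum_eq
    rw [hsum, h1, if_neg hpq, diagLocal]
    simp only [one_mul]
    rw [hsplit] at hX' hV' hY1' hY2'
    simp only [hsplit] at *
    generalize (p : ℂ) ^ (-κ₁) = k1 at *
    generalize (p : ℂ) ^ (-κ₂) = k2 at *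
    generalize (p : ℂ) ^ (-ζ₁) = z1 at *
    generalize (p : ℂ) ^ (-ζ₂) = z2 at *
    generalize (p : ℂ)⁻¹ = P at *
    simp only [← mul_assoc] at hX' hV' hY1' hY2' ⊢
    field_simp
    ring

theorem norm_diagLocal_le (hη : 0 < η) (hζ₁ : η ≤ ζ₁.re) (hκ₁ : η ≤ κ₁.re) (hζ₂ : η ≤ ζ₂.re)
    (hκ₂ : η ≤ κ₂.re) {p : ℕ} (hp : p.Prime) : ‖diagLocal ζ₁ κ₁ ζ₂ κ₂ p‖ ≤ 16 * ((p : ℝ) ^ 2)⁻¹ := by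
  have h2 : (2 : ℝ) ≤ p := by exact_mod_cast hp.two_le
  have hX := (norm_prime_cpow_lt_one hp.two_le (s := κ₁ + κ₂) (by simp; linarith)).le
  have hV := (norm_prime_cpow_lt_one hp.two_le (s := ζ₁ + ζ₂) (by simp; linarith)).le
  have hY1 := (norm_prime_cpow_lt_one hp.two_le (s := ζ₁ + κ₂) (by simp; linarith)).le
  have hY2 := (norm_prime_cpow_lt_one hp.two_le (s := κ₁ + ζ₂) (by simp; linarith)).le
  have hD1 := half_le_norm_one_sub hp.two_le (x := ζ₁ + κ₂) (by simp; linarith)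
  have hD2 := half_le_norm_one_sub hp.two_le (x := κ₁ + ζ₂) (by simp; linarith)
  rw [diagLocal, norm_div, norm_mul, norm_mul]
  calc _ ≤ (1 / p * (1 / p + 1 / p + 1 / p + 1 / p)) / (1 / 2 * (1 / 2) : ℝ) := by
        gcongr
        refine (norm_sub_le _ _).trans (add_le_add ((norm_sub_le _ _).trans (add_le_add
          ((norm_add_le _ _).trans (add_le_add hY1 hY2)) hV)) hX)
    _ = _ := by field_simp; norm_num

theorem summable_primes_inv_sq : Summable fun p : Nat.Primes ↦ 16 * (((p : ℕ) : ℝ) ^ 2)⁻¹ :=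
  ((Real.summable_nat_pow_inv.mpr one_lt_two).subtype {p | p.Prime}).mul_left 16

theorem norm_ite_diagLocal_le (hη : 0 < η) (hζ₁ : η ≤ ζ₁.re) (hκ₁ : η ≤ κ₁.re) (hζ₂ : η ≤ ζ₂.re)
    (hκ₂ : η ≤ κ₂.re) (p : Nat.Primes) :
    ‖if (p : ℕ) ∣ q then 0 else diagLocal ζ₁ κ₁ ζ₂ κ₂ p‖ ≤ 16 * (((p : ℕ) : ℝ) ^ 2)⁻¹ := by
  split_ifs
  · rw [norm_zero]; positivity
  · exact norm_diagLocal_le hη hζ₁ hκ₁ hζ₂ hκ₂ p.2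

/-- The convergent part of `diagSeries`. -/
def diagRegular (ζ₁ κ₁ ζ₂ κ₂ : ℂ) : ℂ :=
  ∏' p : Nat.Primes, (1 + if (p : ℕ) ∣ q then 0 else diagLocal ζ₁ κ₁ ζ₂ κ₂ p)

/-- The bound runs over all primes, hence depends on `q` only through the four exponents. -/
theorem norm_diagRegular_sub_one_le (hη : 0 < η) (hζ₁ : η ≤ ζ₁.re) (hκ₁ : η ≤ κ₁.re) (hζ₂ : η ≤ ζ₂.re)
    (hκ₂ : η ≤ κ₂.re) : ‖diagRegular q ζ₁ κ₁ ζ₂ κ₂ - 1‖ ≤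
      exp (∑' p : Nat.Primes, ‖diagLocal ζ₁ κ₁ ζ₂ κ₂ p‖) - 1 := by
  have hs := summable_primes_inv_sq.of_nonneg_of_le (fun _ ↦ norm_nonneg _)
    (norm_ite_diagLocal_le q hη hζ₁ hκ₁ hζ₂ hκ₂)
  have hs' : Summable fun p : Nat.Primes ↦ ‖diagLocal ζ₁ κ₁ ζ₂ κ₂ p‖ :=
    summable_primes_inv_sq.of_nonneg_of_le (fun _ ↦ norm_nonneg _)
    (fun p ↦ norm_diagLocal_le hη hζ₁ hκ₁ hζ₂ hκ₂ p.2)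
  refine le_of_tendsto ((multipliable_one_add_of_summable hs).hasProd.sub_const 1).norm
    (Eventually.of_forall fun t ↦ (Finset.norm_prod_one_add_sub_one_le t _).trans ?_)
  gcongr
  refine le_trans ?_ (hs'.sum_le_tsum t fun _ _ ↦ norm_nonneg _)
  refine Finset.sum_le_sum fun p _ ↦ ?_
  split_ifs <;> simp

theorem norm_diagRegular_le (hη : 0 < η) (hζ₁ : η ≤ ζ₁.re) (hκ₁ : η ≤ κ₁.re) (hζ₂ : η ≤ ζ₂.re)
    (hκ₂ : η ≤ κ₂.re) : ‖diagRegular q ζ₁ κ₁ ζ₂ κ₂‖ ≤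
      exp (∑' p : Nat.Primes, 16 * (((p : ℕ) : ℝ) ^ 2)⁻¹) := by
  have h := norm_diagRegular_sub_one_le q hη hζ₁ hκ₁ hζ₂ hκ₂
  have hle : ∑' p : Nat.Primes, ‖diagLocal ζ₁ κ₁ ζ₂ κ₂ p‖ ≤ ∑' p : Nat.Primes, 16 * (((p : ℕ) : ℝ) ^ 2)⁻¹ :=
    Summable.tsum_le_tsum (fun p ↦ norm_diagLocal_le hη hζ₁ hκ₁ hζ₂ hκ₂ p.2)
      (summable_primes_inv_sq.of_nonneg_of_le (fun _ ↦ norm_nonneg _)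
        (fun p ↦ norm_diagLocal_le hη hζ₁ hκ₁ hζ₂ hκ₂ p.2)) summable_primes_inv_sq
  have h2 := norm_add_le (diagRegular q ζ₁ κ₁ ζ₂ κ₂ - 1) 1
  rw [sub_add_cancel, norm_one] at h2
  have := exp_le_exp.mpr hle
  linarith

/-- The local identities are multiplied over all primes. Two L-functions of the trivial character
stand on each side, so the normalizing factors `eulerDefect q 0` cancel. -/
theorem diagSeries_mul_eq [NeZero q] (hη : 0 < η) (hζ₁ : η ≤ ζ₁.re) (hκ₁ : η ≤ κ₁.re) (hζ₂ : η ≤ ζ₂.re)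
    (hκ₂ : η ≤ κ₂.re) : diagSeries q ζ₁ κ₁ ζ₂ κ₂ = diagRegular q ζ₁ κ₁ ζ₂ κ₂ *
      (zetaQ q (κ₁ + κ₂) * zetaQ q (ζ₁ + ζ₂) * ((zetaQ q (ζ₁ + κ₂))⁻¹ * (zetaQ q (κ₁ + ζ₂))⁻¹)) := by
  have hL (s : ℂ) (hs : 0 < s.re) : LSeries (fun n ↦ (1 : DirichletCharacter ℂ q) n) (1 + s) =
      eulerDefect q 0 * zetaQ q s ∧ LSeries (fun n ↦ (1 : DirichletCharacter ℂ q) n) (1 + s) ≠ 0 := by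
    have h1 : 1 < (1 + s).re := by simp; linarith
    have hs0 : 1 + s ≠ 1 := fun h ↦ by rw [h] at h1; simp at h1
    refine ⟨?_, DirichletCharacter.LSeries_ne_zero_of_one_lt_re _ h1⟩
    rw [← DirichletCharacter.LFunction_eq_LSeries _ h1]
    refine (DirichletCharacter.LFunctionTrivChar_eq_mul_riemannZeta hs0).trans ?_
    rw [zetaQ, mul_comm]
    have : eulerDefect q 0 ≠ 0 := eulerDefect_ne_zero q le_rfl
    field_simp
    rfl
  have hP (s : ℂ) (hs : 0 < s.re) := DirichletCharacter.LSeries_eulerProduct_hasProd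
    (1 : DirichletCharacter ℂ q) (s := 1 + s) (by simp; linarith)
  have hre1 : 0 < (κ₁ + κ₂).re := by simp; linarith
  have hre2 : 0 < (ζ₁ + ζ₂).re := by simp; linarith
  have hre3 : 0 < (ζ₁ + κ₂).re := by simp; linarith
  have hre4 : 0 < (κ₁ + ζ₂).re := by simp; linarith
  have hZ : HasProd (fun p : Nat.Primes ↦ ∑' e, diagCoeff q ζ₁ κ₁ ζ₂ κ₂ (p ^ e))
      (diagSeries q ζ₁ κ₁ ζ₂ κ₂) := by
    refine EulerProduct.eulerProduct_hasProd ?_ ?_ (summable_norm_diagCoeff q hη hζ₁ hκ₁ hζ₂ hκ₂) ?_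
    · simp [diagCoeff, (isMultiplicative_moebiusConv _ _).map_one]
    · intro m n hmn
      rw [diagCoeff, diagCoeff, diagCoeff, (isMultiplicative_moebiusConv _ _).map_mul_of_coprime hmn,
        (isMultiplicative_moebiusConv _ _).map_mul_of_coprime hmn]
      by_cases h1 : m.Coprime q
      · by_cases h2 : n.Coprime q
        · rw [if_pos h1, if_pos h2, if_pos (Nat.coprime_mul_iff_left.mpr ⟨h1, h2⟩)]
          push_cast
          rw [mul_inv]
          ring
        · rw [if_neg h2, if_neg fun h ↦ h2 (Nat.coprime_mul_iff_left.mp h).2]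
          ring
      · rw [if_neg h1, if_neg fun h ↦ h1 (Nat.coprime_mul_iff_left.mp h).1]
        ring
    · simp [diagCoeff]
  have hE : HasProd (fun p : Nat.Primes ↦ (1 + if (p : ℕ) ∣ q then 0 else diagLocal ζ₁ κ₁ ζ₂ κ₂ p))
      (diagRegular q ζ₁ κ₁ ζ₂ κ₂) :=
    (multipliable_one_add_of_summable (summable_primes_inv_sq.of_nonneg_of_le (fun _ ↦ norm_nonneg _)
      (norm_ite_diagLocal_le q hη hζ₁ hκ₁ hζ₂ hκ₂))).hasProd
  have h1 := hZ.mul ((hP _ hre3).mul (hP _ hre4))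
  have h2 := hE.mul ((hP _ hre1).mul (hP _ hre2))
  have h3 := h1.unique (by
    convert! h2 using 2 with p
    exact tsum_diagCoeff_prime_pow q hη hζ₁ hκ₁ hζ₂ hκ₂ p.2)
  have h0 : eulerDefect q 0 ≠ 0 := eulerDefect_ne_zero q le_rfl
  have hn3 := (hL _ hre3).2
  have hn4 := (hL _ hre4).2
  rw [(hL _ hre3).1] at hn3 h3
  rw [(hL _ hre4).1] at hn4 h3
  rw [(hL _ hre1).1, (hL _ hre2).1] at h3
  have hn3' := right_ne_zero_of_mul hn3
  have hn4' := right_ne_zero_of_mul hn4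
  field_simp at h3 ⊢
  linear_combination h3
end

/-- The scaled diagonal series. -/
def scaledDiag (q : ℕ) (α β s z w : ℂ) : ℂ :=
  diagSeries q (z / log q) ((α + s) / log q) (w / log q) ((β + s) / log q)

/-- Two zeta factors contribute `log q` each and two inverse ones `1/log q` each, so what remains is
polynomial in the variables and free of `q`. -/
theorem exists_norm_scaledDiag_le : ∃ C : ℝ, 0 < C ∧ ∀ (q : ℕ) [NeZero q] (α β s z w : ℂ), 1 ≤ log q →
    -1 / 2 ≤ α.re → -1 / 2 ≤ β.re → s.re = 1 → z.re = 1 → w.re = 1 →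
    ‖scaledDiag q α β s z w‖ ≤ C * ((1 + ‖α + s + (β + s)‖) ^ 8 * (1 + ‖z + w‖) ^ 8 *
      ((1 + ‖z + (β + s)‖) ^ 10 * (1 + ‖α + s + w‖) ^ 10)) := by
  obtain ⟨C, hC, h⟩ := exists_zetaQ_bounds
  refine ⟨exp (∑' p : Nat.Primes, 16 * (((p : ℕ) : ℝ) ^ 2)⁻¹) * C ^ 4, by positivity,
    fun q _ α β s z w hq hα hβ hs hz hw ↦ ?_⟩
  have hL : 0 < log q := by linarith
  have hη : 0 < 1 / 2 / log q := by positivity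
  have hre (x : ℂ) (hx : 1 / 2 ≤ x.re) : 1 / 2 / log q ≤ (x / (log q : ℂ)).re := by
    rw [Complex.div_ofReal_re]; gcongr
  have h1 := hre z (by rw [hz]; norm_num)
  have h2 := hre (α + s) (by simp; linarith)
  have h3 := hre w (by rw [hw]; norm_num)
  have h4 := hre (β + s) (by simp; linarith)
  rw [scaledDiag, diagSeries_mul_eq q hη h1 h2 h3 h4]
  have hE := norm_diagRegular_le q hη h1 h2 h3 h4
  simp only [← add_div]
  rw [norm_mul, norm_mul, norm_mul, norm_mul]
  have b1 := (h q (α + s + (β + s)) hq (by simp; linarith)).1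
  have b2 := (h q (z + w) hq (by simp; linarith)).1
  have b3 := (h q (z + (β + s)) hq (by simp; linarith)).2
  have b4 := (h q (α + s + w) hq (by simp; linarith)).2
  calc _ ≤ exp (∑' p : Nat.Primes, 16 * (((p : ℕ) : ℝ) ^ 2)⁻¹) *
      ((C * (1 + ‖α + s + (β + s)‖) ^ 8 * log q) * (C * (1 + ‖z + w‖) ^ 8 * log q) *
      ((C * (1 + ‖z + (β + s)‖) ^ 10 / log q) * (C * (1 + ‖α + s + w‖) ^ 10 / log q))) := by gcongr
    _ = _ := by field_simp

theorem tendsto_scaledDiag {α β s z w : ℂ} (hα : -1 / 2 ≤ α.re) (hβ : -1 / 2 ≤ β.re) (hs : s.re = 1)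
    (hz : z.re = 1) (hw : w.re = 1) :
    Tendsto (fun q : ℕ ↦ scaledDiag q α β s z w) atTop
      (𝓝 ((z + (β + s)) * (α + s + w) / ((α + s + (β + s)) * (z + w)))) := by
  have hX1 : 0 < (α + s + (β + s)).re := by simp; linarith
  have hX2 : 0 < (z + w).re := by simp; linarith
  have hX3 : 0 < (z + (β + s)).re := by simp; linarith
  have hX4 : 0 < (α + s + w).re := by simp; linarith
  have hn {x : ℂ} (hx : 0 < x.re) : x ≠ 0 := by rintro rfl; simp at hx
  have t1 := tendsto_zetaQ hX1
  have t2 := tendsto_zetaQ hX2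
  have t3 := (tendsto_zetaQ hX3).inv₀ (inv_ne_zero (hn hX3))
  have t4 := (tendsto_zetaQ hX4).inv₀ (inv_ne_zero (hn hX4))
  have hdiv (x : ℂ) : Tendsto (fun q : ℕ ↦ x / (log q : ℂ)) atTop (𝓝 0) := by
    have : Tendsto (fun q : ℕ ↦ ((log q : ℝ) : ℂ)) atTop (Bornology.cobounded ℂ) :=
      (RCLike.tendsto_ofReal_atTop_cobounded ℂ).comp tendsto_log_natCast
    simpa [div_eq_mul_inv] using ((tendsto_inv₀_cobounded (α := ℂ)).comp this).const_mul x
  have hev : ∀ᶠ q : ℕ in atTop, 1 ≤ log q := tendsto_log_natCast.eventually_ge_atTop 1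
  have hfacts (q : ℕ) (hq : 1 ≤ log q) : 0 < 1 / 2 / log q ∧ 1 / 2 / log q ≤ (z / (log q : ℂ)).re ∧
      1 / 2 / log q ≤ ((α + s) / (log q : ℂ)).re ∧ 1 / 2 / log q ≤ (w / (log q : ℂ)).re ∧
      1 / 2 / log q ≤ ((β + s) / (log q : ℂ)).re := by
    have hL : 0 < log q := by linarith
    have hre (x : ℂ) (hx : 1 / 2 ≤ x.re) : 1 / 2 / log q ≤ (x / (log q : ℂ)).re := by
      rw [Complex.div_ofReal_re]; gcongr
    exact ⟨by positivity, hre z (by rw [hz]; norm_num), hre (α + s) (by simp; linarith),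
      hre w (by rw [hw]; norm_num), hre (β + s) (by simp; linarith)⟩
  have hE : Tendsto (fun q : ℕ ↦ diagRegular q (z / log q) ((α + s) / log q) (w / log q) ((β + s) / log q))
      atTop (𝓝 1) := by
    rw [tendsto_iff_norm_sub_tendsto_zero]
    have hlim : Tendsto (fun q : ℕ ↦ exp (∑' p : Nat.Primes,
        ‖diagLocal (z / log q) ((α + s) / log q) (w / log q) ((β + s) / log q) p‖) - 1) atTop (𝓝 0) := by
      have : Tendsto (fun q : ℕ ↦ ∑' p : Nat.Primes,
          ‖diagLocal (z / log q) ((α + s) / log q) (w / log q) ((β + s) / log q) p‖) atTop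
          (𝓝 (∑' p : Nat.Primes, (0 : ℝ))) := by
        -- As the exponents tend to `0`, the bracket in `diagLocal` tends to `1/p + 1/p - 1/p - 1/p
        -- = 0`, so each local correction disappears; `16/p²` is the majorant.
        refine tendsto_tsum_of_dominated_convergence summable_primes_inv_sq (fun p ↦ ?_) ?_
        · have hp0 : ((p : ℕ) : ℂ) ≠ 0 := Nat.cast_ne_zero.mpr p.2.ne_zero
          have hc (x y : ℂ) : Tendsto (fun q : ℕ ↦ ((p : ℕ) : ℂ) ^ (-(1 + (x / (log q : ℂ) + y / (log q : ℂ)))))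
              atTop (𝓝 (((p : ℕ) : ℂ)⁻¹)) := by
            have h1 : Tendsto (fun q : ℕ ↦ -(1 + (x / (log q : ℂ) + y / (log q : ℂ)))) atTop (𝓝 (-1)) := by
              simpa using (((hdiv x).add (hdiv y)).const_add 1).neg
            have := (tendsto_const_nhds (x := ((p : ℕ) : ℂ))).cpow h1 (Or.inl (by simpa using p.2.pos))
            rwa [Complex.cpow_neg_one] at this
          have hne : (1 : ℂ) - ((p : ℕ) : ℂ)⁻¹ ≠ 0 := by
            rw [sub_ne_zero, ne_comm, ne_eq, inv_eq_one]
            exact_mod_cast p.2.ne_one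
          have := (((hc z w).mul ((((hc z (β + s)).add (hc (α + s) w)).sub (hc z w)).sub
            (hc (α + s) (β + s)))).div (((hc z (β + s)).const_sub 1).mul ((hc (α + s) w).const_sub 1))
            (mul_ne_zero hne hne)).norm
          simpa [diagLocal] using this
        · filter_upwards [hev] with q hq p
          obtain ⟨h0, h1, h2, h3, h4⟩ := hfacts q hq
          rw [norm_norm]
          exact norm_diagLocal_le h0 h1 h2 h3 h4 p.2
      rw [tsum_zero] at this
      simpa using ((continuous_exp.tendsto 0).comp this).sub_const 1
    refine squeeze_zero' (Eventually.of_forall fun _ ↦ norm_nonneg _) ?_ hlim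
    filter_upwards [hev] with q hq
    obtain ⟨h0, h1, h2, h3, h4⟩ := hfacts q hq
    exact norm_diagRegular_sub_one_le q h0 h1 h2 h3 h4
  have := hE.mul ((t1.mul t2).mul (t3.mul t4))
  rw [inv_inv, inv_inv] at this
  have heq : (1 : ℂ) * ((α + s + (β + s))⁻¹ * (z + w)⁻¹ * ((z + (β + s)) * (α + s + w))) =
      (z + (β + s)) * (α + s + w) / ((α + s + (β + s)) * (z + w)) := by
    rw [div_eq_mul_inv, mul_inv]; ring
  rw [heq] at this
  refine this.congr' ?_
  filter_upwards [hev] with q hq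
  obtain ⟨h0, h1, h2, h3, h4⟩ := hfacts q hq
  have hL : (log q : ℂ) ≠ 0 := by
    rw [ne_eq, Complex.ofReal_eq_zero]; linarith
  have : NeZero q := ⟨by rintro rfl; simp at hq; linarith⟩
  rw [scaledDiag, diagSeries_mul_eq q h0 h1 h2 h3 h4]
  simp only [← add_div, inv_div]
  field_simp
end


/-! ### Separation of variables: the diagonal as a triple integral. -/

noncomputable section

open Real Filter Topology MeasureTheory

theorem norm_Gamma_le {s : ℂ} (hs : 0 < s.re) : ‖Complex.Gamma s‖ ≤ Real.Gamma s.re := by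
  rw [Complex.Gamma_eq_integral hs, Real.Gamma_eq_integral hs, Complex.GammaIntegral]
  refine (norm_integral_le_integral_norm _).trans_eq (setIntegral_congr_fun measurableSet_Ioi fun x hx ↦ ?_)
  rw [norm_mul, Complex.norm_cpow_eq_rpow_re_of_pos hx, Complex.norm_of_nonneg (exp_pos _).le]
  simp

theorem exists_norm_Gammaℝ_le : ∃ C : ℝ, 0 < C ∧ ∀ s : ℂ, 1 / 2 ≤ s.re → s.re ≤ 3 / 2 →
    ‖Complex.Gammaℝ s‖ ≤ C := by
  have hc : ContinuousOn Real.Gamma (Set.Icc (1 / 4) 1) := fun x hx ↦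
    (Real.differentiableAt_Gamma fun m h ↦ by
      have := hx.1; rw [h] at this; linarith [(m.cast_nonneg : (0 : ℝ) ≤ m)]).continuousAt.continuousWithinAt
  obtain ⟨C, hC⟩ := (isCompact_Icc (a := (1 / 4 : ℝ)) (b := 1)).bddAbove_image hc
  have hC' : ∀ x ∈ Set.Icc (1 / 4 : ℝ) 1, Real.Gamma x ≤ C := fun x hx ↦ hC ⟨x, hx, rfl⟩
  refine ⟨C, lt_of_lt_of_le (Real.Gamma_pos_of_pos one_pos) (hC' 1 ⟨by norm_num, le_rfl⟩),
    fun s h1 h2 ↦ ?_⟩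
  have hre : (s / 2).re = s.re / 2 := by simp
  rw [Complex.Gammaℝ_def, norm_mul, Complex.norm_cpow_eq_rpow_re_of_pos pi_pos]
  have h3 := norm_Gamma_le (s := s / 2) (by rw [hre]; linarith)
  have h4 := hC' (s / 2).re (by rw [hre]; constructor <;> linarith)
  calc _ ≤ 1 * C := by
        gcongr
        · exact rpow_le_one_of_one_le_of_nonpos (by linarith [pi_gt_three])
            (by rw [neg_div, Complex.neg_re, hre]; linarith)
        · exact h3.trans h4
    _ = C := one_mul C

theorem continuousAt_Gammaℝ {s : ℂ} (hs : 0 < s.re) : ContinuousAt Complex.Gammaℝ s := by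
  have h : ContinuousAt (fun s ↦ ((Complex.Gammaℝ s)⁻¹)⁻¹) s :=
    (Complex.differentiable_Gammaℝ_inv.continuous.continuousAt (x := s)).inv₀
      (inv_ne_zero (Complex.Gammaℝ_ne_zero_of_re_pos hs))
  simpa only [inv_inv] using h

theorem continuous_Gammaℝ_comp {X : Type*} [TopologicalSpace X] {f : X → ℂ} (hf : Continuous f)
    (hre : ∀ x, 0 < (f x).re) : Continuous fun x ↦ Complex.Gammaℝ (f x) :=
  continuous_iff_continuousAt.mpr fun x ↦
    ContinuousAt.comp (g := Complex.Gammaℝ) (continuousAt_Gammaℝ (hre x)) hf.continuousAt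

theorem integral_thetaTerm {ℓ : ℝ} {a : ℂ} {n : ℕ} (hn : n ≠ 0) (ha : -1 / 2 < a.re) :
    ∫ x, thetaTerm ℓ a n x =
      Complex.Gammaℝ (1 / 2 + a) * (n : ℂ) ^ (-(1 / 2 + a)) * Complex.exp ((1 / 4 + a / 2) * ℓ) := by
  have hn0 : (0 : ℝ) < n := by positivity
  unfold thetaTerm
  have hr : 0 < π * n ^ 2 * exp (-ℓ) := by positivity
  rw [integral_cexp_mul_exp_neg_exp (by simp; linarith) hr, Complex.Gammaℝ_def]
  have h1 : (1 / ((π * n ^ 2 * exp (-ℓ) : ℝ) : ℂ)) = ((1 / (π * n ^ 2 * exp (-ℓ)) : ℝ) : ℂ) := by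
    push_cast; rfl
  have hπ : (π : ℂ) ≠ 0 := by exact_mod_cast pi_ne_zero
  rw [h1, Complex.cpow_def_of_ne_zero (by exact_mod_cast (one_div_pos.mpr hr).ne'),
    Complex.cpow_def_of_ne_zero hπ, Complex.cpow_def_of_ne_zero (Nat.cast_ne_zero.mpr hn),
    ← Complex.ofReal_log (one_div_pos.mpr hr).le, ← Complex.ofReal_log pi_pos.le, ← Complex.natCast_log,
    one_div, log_inv, log_mul (by positivity) (by positivity), log_mul (by positivity) (by positivity),
    log_pow, log_exp]
  have h2 : (1 / 2 + a) / 2 = 1 / 4 + a / 2 := by ring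
  have h3 : Complex.exp (((-(log π + (2 : ℕ) * log n + -ℓ) : ℝ) : ℂ) * (1 / 4 + a / 2)) =
      Complex.exp ((log π : ℂ) * (-(1 / 2 + a) / 2)) * (Complex.exp ((log n : ℂ) * -(1 / 2 + a)) *
        Complex.exp ((1 / 4 + a / 2) * ℓ)) := by
    rw [← Complex.exp_add, ← Complex.exp_add]
    congr 1
    push_cast
    ring
  rw [h2, h3]
  ring

theorem integrable_thetaTerm {ℓ : ℝ} {a : ℂ} {n : ℕ} (hn : n ≠ 0) (ha : -1 / 2 < a.re) :
    Integrable (thetaTerm ℓ a n) := by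
  have hn0 : (0 : ℝ) < n := by positivity
  have h := integrable_exp_mul_exp_neg_exp (σ := 1 / 4 + a.re / 2) (r := π * n ^ 2 * exp (-ℓ))
    (by linarith) (by positivity)
  refine h.mono' (Continuous.aestronglyMeasurable (by unfold thetaTerm; fun_prop))
    (Eventually.of_forall fun x ↦ ?_)
  rw [thetaTerm, norm_mul, Complex.norm_exp, Complex.norm_of_nonneg (exp_pos _).le]
  simp

theorem thetaTerm_add (ℓ : ℝ) (a c : ℂ) (n : ℕ) (x : ℝ) :
    thetaTerm ℓ (a + c) n x = thetaTerm ℓ a n x * Complex.exp (c * x / 2) := by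
  have h : Complex.exp ((1 / 4 + (a + c) / 2) * x) = Complex.exp ((1 / 4 + a / 2) * x) *
      Complex.exp (c * x / 2) := by
    rw [← Complex.exp_add]
    congr 1
    ring
  rw [thetaTerm, thetaTerm, h]
  ring

/-- Replacing `W` by its superposition of exponentials shifts both `a` and `b` by `s/ℓ` and
decouples `x` from `y`; each integral is then a gamma factor times a power of `m` or `n`. -/
theorem afeKernel_eq_integral {W : ℝ → ℝ} {ρ : ℝ → ℂ} (hρ : IsLineDensity W ρ) {ℓ : ℝ} (hℓ : 0 < ℓ)
    {a b : ℂ} (ha : -1 / 2 < a.re) (hb : -1 / 2 < b.re) {m n : ℕ} (hm : m ≠ 0) (hn : n ≠ 0) :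
    afeKernel W ℓ a b m n = ∫ t, ρ t *
      ((Complex.Gammaℝ (1 / 2 + (a + lineC t / ℓ)) * (m : ℂ) ^ (-(1 / 2 + (a + lineC t / ℓ)))) *
      (Complex.Gammaℝ (1 / 2 + (b + lineC t / ℓ)) * (n : ℂ) ^ (-(1 / 2 + (b + lineC t / ℓ))))) := by
  have hℓ0 : (ℓ : ℂ) ≠ 0 := by exact_mod_cast hℓ.ne'
  have hcl := continuous_lineC
  have hρc := hρ.cont
  have hre (c : ℂ) (hc : -1 / 2 < c.re) (t : ℝ) : -1 / 2 < (c + lineC t / (ℓ : ℂ)).re := by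
    rw [Complex.add_re, Complex.div_ofReal_re, lineC_re]
    have : 0 < 1 / ℓ := by positivity
    linarith
  have h1 (p : ℝ × ℝ) : afeIntegrand W ℓ a b m n p = ∫ t, ρ t * Complex.exp (-lineC t) *
      (thetaTerm ℓ (a + lineC t / ℓ) m p.1 * thetaTerm ℓ (b + lineC t / ℓ) n p.2) := by
    rw [afeIntegrand, hρ.rep, ← integral_const_mul]
    refine integral_congr_ae (Eventually.of_forall fun t ↦ ?_)
    simp only
    rw [thetaTerm_add, thetaTerm_add]
    have : Complex.exp (-(lineC t * ((1 - (p.1 + p.2) / (2 * ℓ) : ℝ) : ℂ))) =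
        Complex.exp (-lineC t) * (Complex.exp (lineC t / ℓ * p.1 / 2) * Complex.exp (lineC t / ℓ * p.2 / 2)) := by
      rw [← Complex.exp_add, ← Complex.exp_add]
      congr 1
      push_cast
      field_simp
      ring
    rw [this]
    ring
  rw [afeKernel]
  simp only [h1]
  rw [integral_integral_swap]
  · rw [← integral_const_mul]
    refine integral_congr_ae (Eventually.of_forall fun t ↦ ?_)
    simp only
    rw [integral_const_mul, Measure.volume_eq_prod, integral_prod_mul (thetaTerm ℓ (a + lineC t / ℓ) m),
      integral_thetaTerm hm (hre a ha t), integral_thetaTerm hn (hre b hb t)]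
    have : Complex.exp (-(1 / 2 + (a + b) / 2) * ℓ) * (Complex.exp (-lineC t) *
        (Complex.exp ((1 / 4 + (a + lineC t / ℓ) / 2) * ℓ) * Complex.exp ((1 / 4 + (b + lineC t / ℓ) / 2) * ℓ))) = 1 := by
      rw [← Complex.exp_add, ← Complex.exp_add, ← Complex.exp_add, Complex.exp_eq_one_iff]
      refine ⟨0, ?_⟩
      field_simp
      ring
    linear_combination (ρ t * (Complex.Gammaℝ (1 / 2 + (a + lineC t / ℓ)) * (m : ℂ) ^ (-(1 / 2 + (a + lineC t / ℓ))) *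
      (Complex.Gammaℝ (1 / 2 + (b + lineC t / ℓ)) * (n : ℂ) ^ (-(1 / 2 + (b + lineC t / ℓ)))))) * this
  · have hi := ((integrable_thetaTerm (ℓ := ℓ) (a := a + (1 / ℓ : ℝ)) hm
      (by have : 0 < 1 / ℓ := by positivity
          rw [Complex.add_re, Complex.ofReal_re]; linarith)).mul_prod
      (integrable_thetaTerm (ℓ := ℓ) (a := b + (1 / ℓ : ℝ)) hn
      (by have : 0 < 1 / ℓ := by positivity
          rw [Complex.add_re, Complex.ofReal_re]; linarith))).mul_prod hρ.integrable
    refine (hi.norm.const_mul (exp (-1))).mono' (Continuous.aestronglyMeasurable ?_)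
      (Eventually.of_forall fun p ↦ ?_)
    · unfold thetaTerm Function.uncurry
      fun_prop
    -- On the line `Re s = 1` the modulus of a shifted theta term does not depend on the height, so
    -- the majorant splits into functions of `x`, `y` and `t`.
    · have hnt (c : ℂ) (k : ℕ) (x t : ℝ) : ‖thetaTerm ℓ (c + lineC t / ℓ) k x‖ = ‖thetaTerm ℓ (c + (1 / ℓ : ℝ)) k x‖ := by
        rw [thetaTerm, thetaTerm, norm_mul, norm_mul, Complex.norm_exp, Complex.norm_exp]
        congr 2
        simp [Complex.div_ofReal_re, lineC_re]
      rw [Function.uncurry, norm_mul, norm_mul, norm_mul, hnt, hnt, norm_mul, norm_mul, Complex.norm_exp,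
        Complex.neg_re, lineC_re]
      refine le_of_eq ?_
      ring

/-- The coefficients of the mollifier. -/
def mollCoeff (h : ℝ → ℝ) (ℓ : ℝ) (a : ℕ) : ℂ :=
  (ArithmeticFunction.moebius a : ℂ) * (h (log a / ℓ) : ℂ) * (a : ℂ) ^ (-(1 / 2) : ℂ)

theorem mollCoeff_eq_integral {h : ℝ → ℝ} {σ : ℝ → ℂ} (hσ : IsLineDensity h σ) (ℓ : ℝ) (a : ℕ) :
    mollCoeff h ℓ a = (a : ℂ) ^ (-(1 / 2) : ℂ) * ∫ u, σ u * moebiusPow (lineC u / ℓ) a := by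
  rcases eq_or_ne a 0 with rfl | ha
  · simp [mollCoeff]
  rw [mollCoeff, hσ.rep, mul_comm, ← integral_const_mul]
  congr 1
  refine integral_congr_ae (Eventually.of_forall fun u ↦ ?_)
  simp only
  rw [moebiusPow_apply _ ha, Complex.cpow_def_of_ne_zero (Nat.cast_ne_zero.mpr ha), ← Complex.natCast_log]
  have : -(lineC u * ((log a / ℓ : ℝ) : ℂ)) = (log a : ℂ) * -(lineC u / ℓ) := by
    push_cast; ring
  rw [this]
  ring

theorem norm_powArith_congr {κ κ' : ℂ} (h : κ.re = κ'.re) (n : ℕ) : ‖powArith κ n‖ = ‖powArith κ' n‖ := by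
  rcases eq_or_ne n 0 with rfl | hn
  · simp
  rw [powArith_apply _ hn, powArith_apply _ hn, Complex.norm_natCast_cpow_of_pos (Nat.pos_of_ne_zero hn),
    Complex.norm_natCast_cpow_of_pos (Nat.pos_of_ne_zero hn)]
  simp [h]

theorem norm_moebiusPow_congr {κ κ' : ℂ} (h : κ.re = κ'.re) (n : ℕ) : ‖moebiusPow κ n‖ = ‖moebiusPow κ' n‖ := by
  simp only [moebiusPow, ArithmeticFunction.pmul_apply, norm_mul, norm_powArith_congr h]

theorem norm_diagTerm_congr (q : ℕ) {ζ₁ κ₁ ζ₂ κ₂ ζ₁' κ₁' ζ₂' κ₂' : ℂ} (h1 : ζ₁.re = ζ₁'.re) (h2 : κ₁.re = κ₁'.re)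
    (h3 : ζ₂.re = ζ₂'.re) (h4 : κ₂.re = κ₂'.re) (p : (ℕ × ℕ) × (ℕ × ℕ)) :
    ‖diagTerm q ζ₁ κ₁ ζ₂ κ₂ p‖ = ‖diagTerm q ζ₁' κ₁' ζ₂' κ₂' p‖ := by
  unfold diagTerm
  split_ifs
  · rw [norm_mul, norm_mul, norm_mul, norm_mul, norm_mul, norm_mul, norm_mul, norm_mul,
      norm_moebiusPow_congr h1, norm_moebiusPow_congr h3, norm_powArith_congr h2, norm_powArith_congr h4]
  · simp
  · simp

theorem continuous_powArith (n : ℕ) : Continuous fun κ ↦ powArith κ n := by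
  rcases eq_or_ne n 0 with rfl | hn
  · simpa using continuous_const
  · have : NeZero (n : ℂ) := ⟨Nat.cast_ne_zero.mpr hn⟩
    simp only [powArith_apply _ hn]
    exact (continuous_const_cpow (n : ℂ)).comp continuous_neg

theorem continuous_moebiusPow (n : ℕ) : Continuous fun κ ↦ moebiusPow κ n := by
  simp only [moebiusPow, ArithmeticFunction.pmul_apply]
  exact continuous_const.mul (continuous_powArith n)

theorem continuous_diagTerm (q : ℕ) (p : (ℕ × ℕ) × (ℕ × ℕ)) {X : Type*} [TopologicalSpace X]
    {f₁ f₂ f₃ f₄ : X → ℂ} (h1 : Continuous f₁) (h2 : Continuous f₂) (h3 : Continuous f₃) (h4 : Continuous f₄) :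
    Continuous fun x ↦ diagTerm q (f₁ x) (f₂ x) (f₃ x) (f₄ x) p := by
  unfold diagTerm
  split_ifs
  · exact continuous_const.mul ((((continuous_moebiusPow _).comp h1).mul ((continuous_powArith _).comp h2)).mul
      (((continuous_moebiusPow _).comp h3).mul ((continuous_powArith _).comp h4)))
  · simpa using continuous_const
  · exact continuous_const

/-- The diagonal terms of the mollified second moment. -/
def diagQuad (W h : ℝ → ℝ) (q : ℕ) (α β : ℂ) (p : (ℕ × ℕ) × (ℕ × ℕ)) : ℂ :=
  if p.1.1 * p.1.2 = p.2.1 * p.2.2 ∧ (p.1.1 * p.1.2).Coprime q then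
    mollCoeff h (log q) p.1.1 * mollCoeff h (log q) p.2.1 *
      afeKernel W (log q) (α / log q) (β / log q) p.1.2 p.2.2 else 0

/-- Density of the integral representation of the diagonal. -/
def diagDensity (ρ σ : ℝ → ℂ) (ℓ : ℝ) (α β : ℂ) (r : ℝ × ℝ × ℝ) : ℂ :=
  ρ r.1 * (Complex.Gammaℝ (1 / 2 + (α + lineC r.1) / ℓ) * Complex.Gammaℝ (1 / 2 + (β + lineC r.1) / ℓ)) *
    (σ r.2.1 * σ r.2.2)

section
variable {W h : ℝ → ℝ} {ρ σ : ℝ → ℂ}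

theorem diagQuad_eq_integral (hρ : IsLineDensity W ρ) (hσ : IsLineDensity h σ) {q : ℕ} (hq : 2 ≤ log q)
    {α β : ℂ} (hα : ‖α‖ ≤ 1 / 2) (hβ : ‖β‖ ≤ 1 / 2) (p : (ℕ × ℕ) × (ℕ × ℕ)) :
    diagQuad W h q α β p = ∫ r : ℝ × ℝ × ℝ, diagDensity ρ σ (log q) α β r *
      diagTerm q (lineC r.2.1 / log q) ((α + lineC r.1) / log q) (lineC r.2.2 / log q)
        ((β + lineC r.1) / log q) p := by
  have hL : 0 < log q := by linarith
  have hL0 : ((log q : ℝ) : ℂ) ≠ 0 := by exact_mod_cast hL.ne'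
  obtain ⟨⟨a, m⟩, b, n⟩ := p
  by_cases hc : a * m = b * n ∧ (a * m).Coprime q
  swap
  · rw [diagQuad, if_neg hc, eq_comm]
    refine integral_eq_zero_of_ae (Eventually.of_forall fun r ↦ ?_)
    simp only [diagTerm, Pi.zero_apply]
    split_ifs with h1 h2
    · exact absurd ⟨h1, h2⟩ hc
    · simp
    · simp
  rw [diagQuad, if_pos hc]
  -- Coprimality of `a m` to `q` excludes zero indices: `0` is coprime only to `1`, and `log q > 0`.
  have hN : a * m ≠ 0 := by
    intro h0
    have := hc.2
    rw [h0, Nat.coprime_zero_left] at this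
    rw [this] at hL
    simp at hL
  have ha := left_ne_zero_of_mul hN
  have hm := right_ne_zero_of_mul hN
  have hN' := hN
  rw [hc.1] at hN'
  have hb := left_ne_zero_of_mul hN'
  have hn := right_ne_zero_of_mul hN'
  have hre (c : ℂ) (hc : ‖c‖ ≤ 1 / 2) : -1 / 2 < (c / ((log q : ℝ) : ℂ)).re := by
    rw [Complex.div_ofReal_re, div_lt_div_iff₀ two_pos hL]
    have := (abs_le.mp ((Complex.abs_re_le_norm c).trans hc)).1
    linarith
  simp only
  rw [afeKernel_eq_integral hρ hL (hre α hα) (hre β hβ) hm hn, mollCoeff_eq_integral hσ (log q),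
    mollCoeff_eq_integral hσ (log q)]
  have e1 : ∀ (x y X : ℂ), x * (∫ u, σ u * moebiusPow (lineC u / (log q : ℝ)) a) *
      (y * ∫ u, σ u * moebiusPow (lineC u / (log q : ℝ)) b) * X = X * ((x * y) *
      ∫ r : ℝ × ℝ, (σ r.1 * moebiusPow (lineC r.1 / (log q : ℝ)) a) * (σ r.2 * moebiusPow (lineC r.2 / (log q : ℝ)) b)) := by
    intro x y X
    rw [Measure.volume_eq_prod, integral_prod_mul (fun u ↦ σ u * moebiusPow (lineC u / (log q : ℝ)) a)
      (fun u ↦ σ u * moebiusPow (lineC u / (log q : ℝ)) b)]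
    ring
  rw [e1, ← integral_const_mul, Measure.volume_eq_prod, ← integral_prod_mul]
  refine integral_congr_ae (Eventually.of_forall fun r ↦ ?_)
  simp only [diagTerm, diagDensity]
  rw [if_pos hc.1, if_pos hc.2, powArith_apply _ hm, powArith_apply _ hn]
  have hsp (k : ℕ) (hk : k ≠ 0) (c s : ℂ) : (k : ℂ) ^ (-(1 / 2 + (c / (log q : ℝ) + s / (log q : ℝ)))) =
      (k : ℂ) ^ (-(1 / 2) : ℂ) * (k : ℂ) ^ (-((c + s) / (log q : ℝ))) := by
    rw [← Complex.cpow_add _ _ (Nat.cast_ne_zero.mpr hk)]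
    congr 1
    ring
  rw [hsp m hm, hsp n hn]
  have hNN : (((a * m : ℕ) : ℂ))⁻¹ = ((a : ℂ) ^ (-(1 / 2) : ℂ) * (m : ℂ) ^ (-(1 / 2) : ℂ)) *
      ((b : ℂ) ^ (-(1 / 2) : ℂ) * (n : ℂ) ^ (-(1 / 2) : ℂ)) := by
    rw [← Complex.natCast_mul_natCast_cpow, ← Complex.natCast_mul_natCast_cpow, ← Nat.cast_mul, ← Nat.cast_mul, ← hc.1,
      ← Complex.cpow_add _ _ (Nat.cast_ne_zero.mpr hN), ← Complex.cpow_neg_one]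
    congr 1
    norm_num
  rw [hNN, add_div, add_div]
  ring

theorem exists_norm_diagDensity_le : ∃ C : ℝ, 0 < C ∧ ∀ (ρ σ : ℝ → ℂ) (ℓ : ℝ) (α β : ℂ) (r : ℝ × ℝ × ℝ),
    2 ≤ ℓ → ‖α‖ ≤ 1 / 2 → ‖β‖ ≤ 1 / 2 →
    ‖diagDensity ρ σ ℓ α β r‖ ≤ C * (‖ρ r.1‖ * (‖σ r.2.1‖ * ‖σ r.2.2‖)) := by
  obtain ⟨C, hC, h⟩ := exists_norm_Gammaℝ_le
  refine ⟨C * C, by positivity, fun ρ σ ℓ α β r hℓ hα hβ ↦ ?_⟩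
  have hℓ0 : 0 < ℓ := by linarith
  have hb (c : ℂ) (hc : ‖c‖ ≤ 1 / 2) : ‖Complex.Gammaℝ (1 / 2 + (c + lineC r.1) / ℓ)‖ ≤ C := by
    have h1 := abs_le.mp ((Complex.abs_re_le_norm c).trans hc)
    have h2 : (1 / 2 + (c + lineC r.1) / (ℓ : ℂ)).re = 1 / 2 + (c.re + 1) / ℓ := by
      rw [Complex.add_re, Complex.div_ofReal_re, Complex.add_re, lineC_re]; norm_num
    have h3 : 0 ≤ (c.re + 1) / ℓ := div_nonneg (by linarith) hℓ0.le
    have h4 : (c.re + 1) / ℓ ≤ 1 := by rw [div_le_one hℓ0]; linarith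
    apply h
    · rw [h2]; linarith
    · rw [h2]; linarith
  rw [diagDensity, norm_mul, norm_mul, norm_mul, norm_mul]
  calc _ ≤ ‖ρ r.1‖ * (C * C) * (‖σ r.2.1‖ * ‖σ r.2.2‖) := by
        gcongr
        · exact hb α hα
        · exact hb β hβ
    _ = _ := by ring

theorem continuous_diagDensity (hρ : IsLineDensity W ρ) (hσ : IsLineDensity h σ) {ℓ : ℝ} (hℓ : 0 < ℓ)
    {α β : ℂ} (hα : ‖α‖ ≤ 1 / 2) (hβ : ‖β‖ ≤ 1 / 2) : Continuous (diagDensity ρ σ ℓ α β) := by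
  have hρc := hρ.cont
  have hσc := hσ.cont
  have hcl := continuous_lineC
  have hℓ0 : (ℓ : ℂ) ≠ 0 := by exact_mod_cast hℓ.ne'
  have hre (c : ℂ) (hc : ‖c‖ ≤ 1 / 2) (t : ℝ) : 0 < (1 / 2 + (c + lineC t) / (ℓ : ℂ)).re := by
    have h1 := abs_le.mp ((Complex.abs_re_le_norm c).trans hc)
    rw [Complex.add_re, Complex.div_ofReal_re, Complex.add_re, lineC_re]
    have h3 : 0 ≤ (c.re + 1) / ℓ := div_nonneg (by linarith) hℓ.le
    norm_num
    linarith
  have h1 := continuous_Gammaℝ_comp (f := fun r : ℝ × ℝ × ℝ ↦ 1 / 2 + (α + lineC r.1) / ℓ) (by fun_prop)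
    (fun r ↦ hre α hα r.1)
  have h2 := continuous_Gammaℝ_comp (f := fun r : ℝ × ℝ × ℝ ↦ 1 / 2 + (β + lineC r.1) / ℓ) (by fun_prop)
    (fun r ↦ hre β hβ r.1)
  unfold diagDensity
  fun_prop

theorem integrable_diagDensity (hρ : IsLineDensity W ρ) (hσ : IsLineDensity h σ) {ℓ : ℝ} (hℓ : 2 ≤ ℓ)
    {α β : ℂ} (hα : ‖α‖ ≤ 1 / 2) (hβ : ‖β‖ ≤ 1 / 2) : Integrable (diagDensity ρ σ ℓ α β) := by
  obtain ⟨C, hC, hb⟩ := exists_norm_diagDensity_le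
  exact ((hρ.integrable.norm.mul_prod (hσ.integrable.norm.mul_prod hσ.integrable.norm)).const_mul C).mono'
    (continuous_diagDensity hρ hσ (by linarith) hα hβ).aestronglyMeasurable
    (Eventually.of_forall fun r ↦ hb ρ σ ℓ α β r hℓ hα hβ)

/-- Sum and integral are exchanged at no cost, because the modulus of each term depends only on the
real parts of the exponents, which are constant along the lines; `D` is that common modulus. -/
theorem hasSum_diagQuad (hρ : IsLineDensity W ρ) (hσ : IsLineDensity h σ) {q : ℕ} (hq : 2 ≤ log q)
    {α β : ℂ} (hα : ‖α‖ ≤ 1 / 2) (hβ : ‖β‖ ≤ 1 / 2) :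
    HasSum (diagQuad W h q α β) (∫ r : ℝ × ℝ × ℝ, diagDensity ρ σ (log q) α β r *
      scaledDiag q α β (lineC r.1) (lineC r.2.1) (lineC r.2.2)) := by
  have hL : 0 < log q := by linarith
  have hcl := continuous_lineC
  have hL0 : ((log q : ℝ) : ℂ) ≠ 0 := by exact_mod_cast hL.ne'
  have hη : 0 < 1 / 2 / log q := by positivity
  have hre (c : ℂ) (hc : ‖c‖ ≤ 1 / 2) (t : ℝ) : 1 / 2 / log q ≤ ((c + lineC t) / ((log q : ℝ) : ℂ)).re := by
    have h1 := abs_le.mp ((Complex.abs_re_le_norm c).trans hc)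
    rw [Complex.div_ofReal_re, Complex.add_re, lineC_re]
    gcongr
    linarith
  have hre' (t : ℝ) : 1 / 2 / log q ≤ (lineC t / ((log q : ℝ) : ℂ)).re := by
    rw [Complex.div_ofReal_re, lineC_re]
    gcongr
    norm_num
  have hs (r : ℝ × ℝ × ℝ) := hasSum_diagTerm q hη (hre' r.2.1) (hre α hα r.1) (hre' r.2.2) (hre β hβ r.1)
  set D : (ℕ × ℕ) × (ℕ × ℕ) → ℝ := fun p ↦ ‖diagTerm q (lineC 0 / (log q : ℝ)) ((α + lineC 0) / (log q : ℝ))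
    (lineC 0 / (log q : ℝ)) ((β + lineC 0) / (log q : ℝ)) p‖ with hD
  have hnorm (r : ℝ × ℝ × ℝ) (p) : ‖diagTerm q (lineC r.2.1 / (log q : ℝ)) ((α + lineC r.1) / (log q : ℝ))
      (lineC r.2.2 / (log q : ℝ)) ((β + lineC r.1) / (log q : ℝ)) p‖ = D p := by
    apply norm_diagTerm_congr <;> simp only [Complex.div_ofReal_re, Complex.add_re, lineC_re]
  have hint := integrable_diagDensity hρ hσ hq hα hβ
  have key := hasSum_integral_of_summable_integral_norm (μ := volume)
    (F := fun p (r : ℝ × ℝ × ℝ) ↦ diagDensity ρ σ (log q) α β r *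
      diagTerm q (lineC r.2.1 / (log q : ℝ)) ((α + lineC r.1) / (log q : ℝ)) (lineC r.2.2 / (log q : ℝ))
        ((β + lineC r.1) / (log q : ℝ)) p) (fun p ↦ ?_) ?_
  · simp only [← diagQuad_eq_integral hρ hσ hq hα hβ] at key
    convert! key using 1
    refine integral_congr_ae (Eventually.of_forall fun r ↦ ?_)
    simp only
    rw [tsum_mul_left, (hs r).tsum_eq]
    rfl
  · refine hint.mul_bdd (c := D p) (Continuous.aestronglyMeasurable (continuous_diagTerm q p ?_ ?_ ?_ ?_))
      (Eventually.of_forall fun r ↦ (hnorm r p).le)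
    all_goals fun_prop
  · simp only [norm_mul, hnorm, integral_mul_const]
    exact ((hs (0, 0, 0)).summable.norm).mul_left _
end
end


/-! ### Limit of the diagonal and its evaluation. -/

noncomputable section

open Real Filter Topology MeasureTheory

section
variable {W h h' : ℝ → ℝ} {ρ σ : ℝ → ℂ}

theorem IsLineDensity.integrable_pow_mul {f : ℝ → ℝ} {ρ : ℝ → ℂ} (hρ : IsLineDensity f ρ) {g : ℝ → ℂ}
    (hg : Continuous g) {n : ℕ} {C : ℝ} (hb : ∀ t, ‖g t‖ ≤ C * (1 + |t|) ^ n) :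
    Integrable fun t ↦ ρ t * g t := by
  have hρc := hρ.cont
  refine ((hρ.decay n).const_mul C).mono' (by fun_prop) (Eventually.of_forall fun t ↦ ?_)
  rw [norm_mul]
  calc _ ≤ ‖ρ t‖ * (C * (1 + |t|) ^ n) := by gcongr; exact hb t
    _ = _ := by ring

theorem IsLineDensity.integral_eq {f : ℝ → ℝ} {ρ : ℝ → ℂ} (hρ : IsLineDensity f ρ) :
    ∫ t, ρ t = f 0 := by
  rw [hρ.rep 0]
  simp

theorem norm_scaledDiag_poly_le {α β : ℂ} (hα : ‖α‖ ≤ 1 / 2) (hβ : ‖β‖ ≤ 1 / 2) (t u v : ℝ) :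
    (1 + ‖α + lineC t + (β + lineC t)‖) ^ 8 * (1 + ‖lineC u + lineC v‖) ^ 8 *
      ((1 + ‖lineC u + (β + lineC t)‖) ^ 10 * (1 + ‖α + lineC t + lineC v‖) ^ 10) ≤
    16 ^ 36 * ((1 + |t|) ^ 28 * ((1 + |u|) ^ 18 * (1 + |v|) ^ 18)) := by
  have ht := norm_lineC_le t
  have hu := norm_lineC_le u
  have hv := norm_lineC_le v
  have hT : 1 ≤ 1 + |t| := by linarith [abs_nonneg t]
  have hU : 1 ≤ 1 + |u| := by linarith [abs_nonneg u]
  have hV : 1 ≤ 1 + |v| := by linarith [abs_nonneg v]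
  generalize 1 + |t| = T at *
  generalize 1 + |u| = U at *
  generalize 1 + |v| = V at *
  have h1 : 1 + ‖α + lineC t + (β + lineC t)‖ ≤ 16 * T := by
    have := norm_add_le (α + lineC t) (β + lineC t)
    have := norm_add_le α (lineC t)
    have := norm_add_le β (lineC t)
    linarith
  have h2 : 1 + ‖lineC u + lineC v‖ ≤ 16 * (U * V) := by
    have := norm_add_le (lineC u) (lineC v)
    nlinarith
  have h3 : 1 + ‖lineC u + (β + lineC t)‖ ≤ 16 * (U * T) := by
    have := norm_add_le (lineC u) (β + lineC t)
    have := norm_add_le β (lineC t)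
    nlinarith
  have h4 : 1 + ‖α + lineC t + lineC v‖ ≤ 16 * (T * V) := by
    have := norm_add_le (α + lineC t) (lineC v)
    have := norm_add_le α (lineC t)
    nlinarith
  calc _ ≤ (16 * T) ^ 8 * (16 * (U * V)) ^ 8 * ((16 * (U * T)) ^ 10 * (16 * (T * V)) ^ 10) := by gcongr
    _ = _ := by ring

/-- Majorant of the integrand representing the diagonal. -/
def diagMajorant (ρ σ : ℝ → ℂ) (r : ℝ × ℝ × ℝ) : ℝ :=
  ((1 + |r.1|) ^ 28 * ‖ρ r.1‖) * (((1 + |r.2.1|) ^ 18 * ‖σ r.2.1‖) * ((1 + |r.2.2|) ^ 18 * ‖σ r.2.2‖))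

theorem integrable_diagMajorant (hρ : IsLineDensity W ρ) (hσ : IsLineDensity h σ) :
    Integrable (diagMajorant ρ σ) :=
  (hρ.decay 28).mul_prod ((hσ.decay 18).mul_prod (hσ.decay 18))

theorem exists_norm_diag_integrand_le : ∃ C : ℝ, 0 < C ∧ ∀ (ρ σ : ℝ → ℂ) (q : ℕ) (α β : ℂ) (r : ℝ × ℝ × ℝ),
    2 ≤ log q → ‖α‖ ≤ 1 / 2 → ‖β‖ ≤ 1 / 2 →
    ‖diagDensity ρ σ (log q) α β r * scaledDiag q α β (lineC r.1) (lineC r.2.1) (lineC r.2.2)‖ ≤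
      C * diagMajorant ρ σ r := by
  obtain ⟨C₁, h1, hb1⟩ := exists_norm_diagDensity_le
  obtain ⟨C₂, h2, hb2⟩ := exists_norm_scaledDiag_le
  refine ⟨C₁ * (C₂ * 16 ^ 36), by positivity, fun ρ σ q α β r hq hα hβ ↦ ?_⟩
  have : NeZero q := ⟨by rintro rfl; simp at hq; linarith⟩
  have e1 := hb1 ρ σ (log q) α β r hq hα hβ
  have e2 := hb2 q α β (lineC r.1) (lineC r.2.1) (lineC r.2.2) (by linarith)
    (by linarith [(abs_le.mp ((Complex.abs_re_le_norm α).trans hα)).1])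
    (by linarith [(abs_le.mp ((Complex.abs_re_le_norm β).trans hβ)).1]) (lineC_re _) (lineC_re _) (lineC_re _)
  have e3 := e2.trans (mul_le_mul_of_nonneg_left (norm_scaledDiag_poly_le hα hβ r.1 r.2.1 r.2.2) h2.le)
  rw [norm_mul]
  calc _ ≤ _ := mul_le_mul e1 e3 (norm_nonneg _) (by positivity)
    _ = _ := by
        rw [diagMajorant]
        generalize (1 + |r.1|) ^ 28 = T
        generalize (1 + |r.2.1|) ^ 18 = U
        generalize (1 + |r.2.2|) ^ 18 = V
        ring

theorem continuous_scaledDiag {q : ℕ} (hq : 2 ≤ log q) {α β : ℂ} (hα : ‖α‖ ≤ 1 / 2) (hβ : ‖β‖ ≤ 1 / 2) :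
    Continuous fun r : ℝ × ℝ × ℝ ↦ scaledDiag q α β (lineC r.1) (lineC r.2.1) (lineC r.2.2) := by
  have hL : 0 < log q := by linarith
  have hcl := continuous_lineC
  have hL0 : ((log q : ℝ) : ℂ) ≠ 0 := by exact_mod_cast hL.ne'
  have hη : 0 < 1 / 2 / log q := by positivity
  have hre (c : ℂ) (hc : ‖c‖ ≤ 1 / 2) (t : ℝ) : 1 / 2 / log q ≤ ((c + lineC t) / ((log q : ℝ) : ℂ)).re := by
    have h1 := abs_le.mp ((Complex.abs_re_le_norm c).trans hc)
    rw [Complex.div_ofReal_re, Complex.add_re, lineC_re]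
    gcongr
    linarith
  have hre' (t : ℝ) : 1 / 2 / log q ≤ (lineC t / ((log q : ℝ) : ℂ)).re := by
    rw [Complex.div_ofReal_re, lineC_re]
    gcongr
    norm_num
  have hs (r : ℝ × ℝ × ℝ) := hasSum_diagTerm q hη (hre' r.2.1) (hre α hα r.1) (hre' r.2.2) (hre β hβ r.1)
  simp only [scaledDiag, ← (hs _).tsum_eq]
  refine continuous_tsum (fun p ↦ continuous_diagTerm q p ?_ ?_ ?_ ?_) (hs (0, 0, 0)).summable.norm
    fun p r ↦ le_of_eq ?_
  · fun_prop
  · fun_prop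
  · fun_prop
  · fun_prop
  · apply norm_diagTerm_congr <;> simp only [Complex.div_ofReal_re, Complex.add_re, lineC_re]

/-- The limit of the diagonal, as an integral. -/
def diagLimit (ρ σ : ℝ → ℂ) (α β : ℂ) : ℂ :=
  ∫ r : ℝ × ℝ × ℝ, ρ r.1 * (σ r.2.1 * σ r.2.2) *
    ((lineC r.2.1 + (β + lineC r.1)) * (α + lineC r.1 + lineC r.2.2) /
      ((α + lineC r.1 + (β + lineC r.1)) * (lineC r.2.1 + lineC r.2.2)))

theorem exists_norm_tsum_diagQuad_le (hρ : IsLineDensity W ρ) (hσ : IsLineDensity h σ) :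
    ∃ C : ℝ, 0 < C ∧ ∀ (q : ℕ) (α β : ℂ), 2 ≤ log q → ‖α‖ ≤ 1 / 2 → ‖β‖ ≤ 1 / 2 →
      ‖∑' p, diagQuad W h q α β p‖ ≤ C := by
  obtain ⟨C, hC, hb⟩ := exists_norm_diag_integrand_le
  refine ⟨C * (∫ r, diagMajorant ρ σ r) + 1, ?_, fun q α β hq hα hβ ↦ ?_⟩
  · have : 0 ≤ ∫ r, diagMajorant ρ σ r := integral_nonneg fun r ↦ by unfold diagMajorant; positivity
    positivity
  · rw [(hasSum_diagQuad hρ hσ hq hα hβ).tsum_eq]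
    have := norm_integral_le_of_norm_le ((integrable_diagMajorant hρ hσ).const_mul C)
      (Eventually.of_forall fun r ↦ hb ρ σ q α β r hq hα hβ)
    rw [integral_const_mul] at this
    linarith

/-- Dominated convergence: the integrand grows polynomially at most, uniformly in `q`, against
rapidly decaying densities. The gamma factor in the limit later cancels the inverse gamma factors of
the product formula. -/
theorem tendsto_tsum_diagQuad (hρ : IsLineDensity W ρ) (hσ : IsLineDensity h σ) {α β : ℂ}
    (hα : ‖α‖ ≤ 1 / 2) (hβ : ‖β‖ ≤ 1 / 2) :
    Tendsto (fun q : ℕ ↦ ∑' p, diagQuad W h q α β p) atTop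
      (𝓝 (Complex.Gammaℝ (1 / 2) ^ 2 * diagLimit ρ σ α β)) := by
  obtain ⟨C, hC, hb⟩ := exists_norm_diag_integrand_le
  have hev : ∀ᶠ q : ℕ in atTop, 2 ≤ log q := tendsto_log_natCast.eventually_ge_atTop 2
  have key : Tendsto (fun q : ℕ ↦ ∫ r : ℝ × ℝ × ℝ, diagDensity ρ σ (log q) α β r *
      scaledDiag q α β (lineC r.1) (lineC r.2.1) (lineC r.2.2)) atTop
      (𝓝 (∫ r : ℝ × ℝ × ℝ, Complex.Gammaℝ (1 / 2) ^ 2 * (ρ r.1 * (σ r.2.1 * σ r.2.2) *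
    ((lineC r.2.1 + (β + lineC r.1)) * (α + lineC r.1 + lineC r.2.2) /
      ((α + lineC r.1 + (β + lineC r.1)) * (lineC r.2.1 + lineC r.2.2)))))) := by
    refine tendsto_integral_filter_of_dominated_convergence (fun r ↦ C * diagMajorant ρ σ r) ?_ ?_
      ((integrable_diagMajorant hρ hσ).const_mul C) (Eventually.of_forall fun r ↦ ?_)
    · filter_upwards [hev] with q hq
      exact ((continuous_diagDensity hρ hσ (by linarith) hα hβ).mul
        (continuous_scaledDiag hq hα hβ)).aestronglyMeasurable
    · filter_upwards [hev] with q hq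
      exact Eventually.of_forall fun r ↦ hb ρ σ q α β r hq hα hβ
    · have hdiv (x : ℂ) : Tendsto (fun q : ℕ ↦ x / (log q : ℂ)) atTop (𝓝 0) := by
        have : Tendsto (fun q : ℕ ↦ ((log q : ℝ) : ℂ)) atTop (Bornology.cobounded ℂ) :=
          (RCLike.tendsto_ofReal_atTop_cobounded ℂ).comp tendsto_log_natCast
        simpa [div_eq_mul_inv] using ((tendsto_inv₀_cobounded (α := ℂ)).comp this).const_mul x
      have hG (x : ℂ) : Tendsto (fun q : ℕ ↦ Complex.Gammaℝ (1 / 2 + x / (log q : ℂ))) atTop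
          (𝓝 (Complex.Gammaℝ (1 / 2))) := by
        have h1 : Tendsto (fun q : ℕ ↦ 1 / 2 + x / (log q : ℂ)) atTop (𝓝 (1 / 2)) := by
          have := (hdiv x).const_add (1 / 2 : ℂ)
          rwa [add_zero] at this
        exact (continuousAt_Gammaℝ (s := 1 / 2) (by norm_num)).tendsto.comp h1
      have hD := tendsto_scaledDiag (α := α) (β := β)
        (by linarith [(abs_le.mp ((Complex.abs_re_le_norm α).trans hα)).1])
        (by linarith [(abs_le.mp ((Complex.abs_re_le_norm β).trans hβ)).1])
        (lineC_re r.1) (lineC_re r.2.1) (lineC_re r.2.2)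
      have := ((((hG (α + lineC r.1)).mul (hG (β + lineC r.1))).const_mul (ρ r.1)).mul_const
        (σ r.2.1 * σ r.2.2)).mul hD
      convert! this using 2
      ring
  rw [integral_const_mul] at key
  refine key.congr' ?_
  filter_upwards [hev] with q hq
  rw [(hasSum_diagQuad hρ hσ hq hα hβ).tsum_eq]

/-- Both integrals equal `-∫ h h'`, so they agree, and their sum is `(∫ σ)² = (h 0)²` because the
denominator cancels. This replaces an integration by parts. -/
theorem integral_mul_div_lineC (hσ : IsLineDensity h σ) (hσ' : IsLineDensity h' fun t ↦ -(lineC t * σ t)) :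
    ∫ p : ℝ × ℝ, σ p.1 * σ p.2 * lineC p.1 / (lineC p.1 + lineC p.2) = (h 0 : ℂ) ^ 2 / 2 ∧
    ∫ p : ℝ × ℝ, σ p.1 * σ p.2 * lineC p.2 / (lineC p.1 + lineC p.2) = (h 0 : ℂ) ^ 2 / 2 := by
  have e1 := hσ'.integral_mul hσ
  have e2 := hσ.integral_mul hσ'
  have hcl := continuous_lineC
  have hσc := hσ.cont
  have hne (p : ℝ × ℝ) : lineC p.1 + lineC p.2 ≠ 0 := fun hh ↦ by
    have := congrArg Complex.re hh
    simp [lineC_re] at this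
  have e12 : ∫ r in Set.Ioi 0, h' r * h r = ∫ r in Set.Ioi 0, h r * h' r := by
    simp only [mul_comm]
  have f1 : ∫ p : ℝ × ℝ, σ p.1 * σ p.2 * lineC p.1 / (lineC p.1 + lineC p.2) =
      -((∫ r in Set.Ioi 0, h r * h' r : ℝ) : ℂ) := by
    rw [← e12, e1, ← integral_neg]
    refine integral_congr_ae (Eventually.of_forall fun p ↦ ?_)
    simp only; ring
  have f2 : ∫ p : ℝ × ℝ, σ p.1 * σ p.2 * lineC p.2 / (lineC p.1 + lineC p.2) =
      -((∫ r in Set.Ioi 0, h r * h' r : ℝ) : ℂ) := by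
    rw [e2, ← integral_neg]
    refine integral_congr_ae (Eventually.of_forall fun p ↦ ?_)
    simp only; ring
  have hinv (p : ℝ × ℝ) : ‖(lineC p.1 + lineC p.2)⁻¹‖ ≤ 1 := by
    rw [norm_inv]
    refine inv_le_one_of_one_le₀ ?_
    have := Complex.re_le_norm (lineC p.1 + lineC p.2)
    rw [Complex.add_re, lineC_re, lineC_re] at this
    linarith
  have hc : Continuous fun p : ℝ × ℝ ↦ (lineC p.1 + lineC p.2)⁻¹ :=
    Continuous.inv₀ (by fun_prop) hne
  have i1 : Integrable fun p : ℝ × ℝ ↦ σ p.1 * σ p.2 * lineC p.1 / (lineC p.1 + lineC p.2) := by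
    have h1 := ((hσ'.integrable.mul_prod hσ.integrable).neg).mul_bdd (c := 1) hc.aestronglyMeasurable
      (Eventually.of_forall hinv)
    refine h1.congr (Eventually.of_forall fun p ↦ ?_)
    simp only [Pi.neg_apply]; ring
  have i2 : Integrable fun p : ℝ × ℝ ↦ σ p.1 * σ p.2 * lineC p.2 / (lineC p.1 + lineC p.2) := by
    have h1 := ((hσ.integrable.mul_prod hσ'.integrable).neg).mul_bdd (c := 1) hc.aestronglyMeasurable
      (Eventually.of_forall hinv)
    refine h1.congr (Eventually.of_forall fun p ↦ ?_)
    simp only [Pi.neg_apply]; ring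
  have hsum : (∫ p : ℝ × ℝ, σ p.1 * σ p.2 * lineC p.1 / (lineC p.1 + lineC p.2)) +
      ∫ p : ℝ × ℝ, σ p.1 * σ p.2 * lineC p.2 / (lineC p.1 + lineC p.2) = (h 0 : ℂ) ^ 2 := by
    rw [← integral_add i1 i2, sq, ← hσ.integral_eq, ← integral_prod_mul, ← Measure.volume_eq_prod]
    refine integral_congr_ae (Eventually.of_forall fun p ↦ ?_)
    have := hne p
    simp only
    field_simp
  have hcmb := f1.trans f2.symm
  constructor
  · linear_combination (1 / 2) * hsum + (1 / 2) * hcmb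
  · linear_combination (1 / 2) * hsum - (1 / 2) * hcmb

/-- Expanding `(z + β + s)(w + α + s) = zw + z(α + s) + w(β + s) + (α + s)(β + s)` gives four terms
in each of which the `s`-integral separates from the `(z, w)`-integral. Those in `z, w` produce `∫
h'²`, twice `(h 0)²/2`, and `∫ h²`. -/
theorem diagLimit_eq (hρ : IsLineDensity W ρ) (hρ0 : ∫ t, ρ t * lineC t = 0) (hW0 : W 0 = 1)
    (hσ : IsLineDensity h σ) (hσ' : IsLineDensity h' fun t ↦ -(lineC t * σ t)) {α β : ℂ}
    (hα : ‖α‖ ≤ 1 / 2) (hβ : ‖β‖ ≤ 1 / 2) :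
    diagLimit ρ σ α β = ((∫ r in Set.Ioi 0, h' r * h' r : ℝ) : ℂ) *
        (∫ r in Set.Ioi (0 : ℝ), (W (2 * r) : ℂ) * Complex.exp (-((α + β) * r))) + (h 0 : ℂ) ^ 2 / 2 +
      ((∫ r in Set.Ioi 0, h r * h r : ℝ) : ℂ) * ((α + β) / 4 - (α - β) ^ 2 / 4 *
        ∫ r in Set.Ioi (0 : ℝ), (W (2 * r) : ℂ) * Complex.exp (-((α + β) * r))) := by
  have hcl := continuous_lineC
  have hσc := hσ.cont
  have hρc := hρ.cont
  have hαr := abs_le.mp ((Complex.abs_re_le_norm α).trans hα)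
  have hβr := abs_le.mp ((Complex.abs_re_le_norm β).trans hβ)
  rw [hρ.integral_laplace (by simp; linarith)]
  set ω := ∫ t, ρ t / (2 * lineC t + (α + β)) with hω
  obtain ⟨eZ, eW⟩ := integral_mul_div_lineC hσ hσ'
  rw [hσ'.integral_mul hσ', hσ.integral_mul hσ]
  have hnt (t : ℝ) : 2 * lineC t + (α + β) ≠ 0 := fun hh ↦ by
    have := congrArg Complex.re hh
    simp [lineC_re] at this
    linarith
  have hnp (p : ℝ × ℝ) : lineC p.1 + lineC p.2 ≠ 0 := fun hh ↦ by
    have := congrArg Complex.re hh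
    simp [lineC_re] at this
  have hit (t : ℝ) : ‖(2 * lineC t + (α + β))⁻¹‖ ≤ 1 := by
    rw [norm_inv]
    refine inv_le_one_of_one_le₀ ?_
    have := Complex.re_le_norm (2 * lineC t + (α + β))
    have h2 : (2 * lineC t + (α + β)).re = 2 + (α.re + β.re) := by simp [lineC_re]
    linarith
  have hip (p : ℝ × ℝ) : ‖(lineC p.1 + lineC p.2)⁻¹‖ ≤ 1 := by
    rw [norm_inv]
    refine inv_le_one_of_one_le₀ ?_
    have := Complex.re_le_norm (lineC p.1 + lineC p.2)
    rw [Complex.add_re, lineC_re, lineC_re] at this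
    linarith
  have hct : Continuous fun t : ℝ ↦ (2 * lineC t + (α + β))⁻¹ := Continuous.inv₀ (by fun_prop) hnt
  have hcp : Continuous fun p : ℝ × ℝ ↦ (lineC p.1 + lineC p.2)⁻¹ := Continuous.inv₀ (by fun_prop) hnp
  have hdiv {f : ℝ → ℂ} (hf : Integrable f) : Integrable fun t ↦ f t / (2 * lineC t + (α + β)) :=
    hf.mul_bdd (c := 1) hct.aestronglyMeasurable (Eventually.of_forall hit)
  have hdivp {f : ℝ × ℝ → ℂ} (hf : Integrable f) : Integrable fun p ↦ f p / (lineC p.1 + lineC p.2) :=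
    hf.mul_bdd (c := 1) hcp.aestronglyMeasurable (Eventually.of_forall hip)
  have hls (t : ℝ) (c : ℂ) (hc : ‖c‖ ≤ 1 / 2) : ‖c + lineC t‖ ≤ 8 * (1 + |t|) := by
    have := norm_add_le c (lineC t)
    have := norm_lineC_le t
    have := abs_nonneg t
    linarith
  have iρ := hρ.integrable
  have iρs : Integrable fun t ↦ ρ t * lineC t := hρ.integrable_pow_mul hcl (n := 1) (C := 7)
    (fun t ↦ by rw [pow_one]; exact norm_lineC_le t)
  have iρ1 (c : ℂ) : Integrable fun t ↦ ρ t * (c + lineC t) := by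
    refine ((iρ.mul_const c).add iρs).congr (Eventually.of_forall fun t ↦ ?_)
    simp only [Pi.add_apply]
    ring
  have iρ2 : Integrable fun t ↦ ρ t * ((α + lineC t) * (β + lineC t)) :=
    hρ.integrable_pow_mul (by fun_prop) (n := 2) (C := 64) fun t ↦ by
      rw [norm_mul]
      calc _ ≤ (8 * (1 + |t|)) * (8 * (1 + |t|)) :=
            mul_le_mul (hls t α hα) (hls t β hβ) (norm_nonneg _) (by positivity)
        _ = _ := by ring
  have iρω := hdiv iρ
  have iσ := hσ.integrable
  have iσ1 : Integrable fun t ↦ σ t * lineC t := hσ.integrable_pow_mul hcl (n := 1) (C := 7)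
    (fun t ↦ by rw [pow_one]; exact norm_lineC_le t)
  have hρ1 : ∫ t, ρ t = 1 := by rw [hρ.integral_eq, hW0, Complex.ofReal_one]
  have E1 : ∫ t, ρ t * (α + lineC t) / (2 * lineC t + (α + β)) = 1 / 2 + (α - β) / 2 * ω := by
    rw [hω, ← integral_const_mul, ← hρ1, ← integral_div, ← integral_add (iρ.div_const 2) (iρω.const_mul _)]
    refine integral_congr_ae (Eventually.of_forall fun t ↦ ?_)
    have hD0 := hnt t
    simp only
    obtain ⟨D, hD⟩ : ∃ D, D = 2 * lineC t + (α + β) := ⟨_, rfl⟩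
    have hs : lineC t = (D - (α + β)) / 2 := by rw [hD]; ring
    rw [← hD] at hD0 ⊢
    rw [hs]
    field_simp
    ring
  have E2 : ∫ t, ρ t * (β + lineC t) / (2 * lineC t + (α + β)) = 1 / 2 - (α - β) / 2 * ω := by
    rw [hω, ← integral_const_mul, ← hρ1, ← integral_div, ← integral_sub (iρ.div_const 2) (iρω.const_mul _)]
    refine integral_congr_ae (Eventually.of_forall fun t ↦ ?_)
    have hD0 := hnt t
    simp only
    obtain ⟨D, hD⟩ : ∃ D, D = 2 * lineC t + (α + β) := ⟨_, rfl⟩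
    have hs : lineC t = (D - (α + β)) / 2 := by rw [hD]; ring
    rw [← hD] at hD0 ⊢
    rw [hs]
    field_simp
    ring
  -- With `D = 2s + α + β` the numerator is `(D² - (α - β)²)/4`. The part `D/4` integrates to `(α +
  -- β)/4` because `∫ ρ = W 0 = 1` and `∫ ρ s = 0`.
  have E3 : ∫ t, ρ t * ((α + lineC t) * (β + lineC t)) / (2 * lineC t + (α + β)) =
      (α + β) / 4 - (α - β) ^ 2 / 4 * ω := by
    have : (α + β) / 4 - (α - β) ^ 2 / 4 * ω = (α + β) / 4 * (∫ t, ρ t) + (1 / 2) * (∫ t, ρ t * lineC t)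
        - (α - β) ^ 2 / 4 * ω := by rw [hρ1, hρ0]; ring
    rw [this, hω, ← integral_const_mul, ← integral_const_mul, ← integral_const_mul,
      ← integral_add' (iρ.const_mul _) (iρs.const_mul _),
      ← integral_sub ((iρ.const_mul _).add (iρs.const_mul _)) (iρω.const_mul _)]
    refine integral_congr_ae (Eventually.of_forall fun t ↦ ?_)
    have hD0 := hnt t
    simp only [Pi.add_apply]
    obtain ⟨D, hD⟩ : ∃ D, D = 2 * lineC t + (α + β) := ⟨_, rfl⟩
    have hs : lineC t = (D - (α + β)) / 2 := by rw [hD]; ring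
    rw [← hD] at hD0 ⊢
    rw [hs]
    field_simp
    ring
  have J0 := (hdiv iρ).mul_prod (hdivp (iσ1.mul_prod iσ1))
  have J1 := (hdiv (iρ1 α)).mul_prod (hdivp (iσ1.mul_prod iσ))
  have J2 := (hdiv (iρ1 β)).mul_prod (hdivp (iσ.mul_prod iσ1))
  have J3 := (hdiv iρ2).mul_prod (hdivp (iσ.mul_prod iσ))
  have hsplit : diagLimit ρ σ α β =
      (∫ t, ρ t / (2 * lineC t + (α + β))) * (∫ p : ℝ × ℝ, (σ p.1 * lineC p.1) * (σ p.2 * lineC p.2) / (lineC p.1 + lineC p.2)) +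
      (∫ t, ρ t * (α + lineC t) / (2 * lineC t + (α + β))) * (∫ p : ℝ × ℝ, (σ p.1 * lineC p.1) * σ p.2 / (lineC p.1 + lineC p.2)) +
      (∫ t, ρ t * (β + lineC t) / (2 * lineC t + (α + β))) * (∫ p : ℝ × ℝ, σ p.1 * (σ p.2 * lineC p.2) / (lineC p.1 + lineC p.2)) +
      (∫ t, ρ t * ((α + lineC t) * (β + lineC t)) / (2 * lineC t + (α + β))) * (∫ p : ℝ × ℝ, σ p.1 * σ p.2 / (lineC p.1 + lineC p.2)) := by
    rw [← integral_prod_mul, ← integral_prod_mul, ← integral_prod_mul, ← integral_prod_mul,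
      ← integral_add' J0 J1, ← integral_add' (J0.add J1) J2, ← integral_add' ((J0.add J1).add J2) J3, diagLimit,
      Measure.volume_eq_prod]
    refine integral_congr_ae (Eventually.of_forall fun r ↦ ?_)
    have h1 := hnt r.1
    have h2 := hnp r.2
    have h3 : α + lineC r.1 + (β + lineC r.1) = 2 * lineC r.1 + (α + β) := by ring
    simp only [h3, Pi.add_apply]
    generalize 2 * lineC r.1 + (α + β) = D at *
    generalize hE : lineC r.2.1 + lineC r.2.2 = E at *
    field_simp
    ring
  have gA : ∫ p : ℝ × ℝ, (σ p.1 * lineC p.1) * (σ p.2 * lineC p.2) / (lineC p.1 + lineC p.2) =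
      ∫ p : ℝ × ℝ, -(lineC p.1 * σ p.1) * -(lineC p.2 * σ p.2) / (lineC p.1 + lineC p.2) :=
    integral_congr_ae (Eventually.of_forall fun p ↦ by simp only; ring)
  have gZ : ∫ p : ℝ × ℝ, (σ p.1 * lineC p.1) * σ p.2 / (lineC p.1 + lineC p.2) = (h 0 : ℂ) ^ 2 / 2 := by
    rw [← eZ]
    exact integral_congr_ae (Eventually.of_forall fun p ↦ by simp only; ring)
  have gW : ∫ p : ℝ × ℝ, σ p.1 * (σ p.2 * lineC p.2) / (lineC p.1 + lineC p.2) = (h 0 : ℂ) ^ 2 / 2 := by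
    rw [← eW]
    exact integral_congr_ae (Eventually.of_forall fun p ↦ by simp only; ring)
  rw [hsplit, gA, gZ, gW, E1, E2, E3]
  ring
end
end


/-! ### Weighted sums over congruent pairs, for the off-diagonal terms. -/

noncomputable section

open Real Filter Topology Finset
open scoped ENNReal

/-- The weight `x^{-1-e}` in `[0, ∞]`. -/
def powWeight (e : ℝ) (x : ℕ) : ℝ≥0∞ := ENNReal.ofReal ((x : ℝ) ^ (-(1 + e)))

/-- Zero to a nonzero real power is zero, so zero indices drop out of all weighted sums. -/
theorem powWeight_zero {e : ℝ} (he : 0 < e) : powWeight e 0 = 0 := by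
  rw [powWeight, Nat.cast_zero, zero_rpow (by linarith), ENNReal.ofReal_zero]

theorem tsum_powWeight_ne_top {e : ℝ} (he : 0 < e) : ∑' x, powWeight e x ≠ ⊤ := by
  have h : Summable fun x : ℕ ↦ (x : ℝ) ^ (-(1 + e)) := Real.summable_nat_rpow.mpr (by linarith)
  exact h.tsum_ofReal_ne_top

theorem tsum_mul_eq_tsum_card_divisors {f : ℕ → ℝ≥0∞} (h0 : f 0 = 0) :
    ∑' p : ℕ × ℕ, f (p.1 * p.2) = ∑' x : ℕ, (#x.divisors : ℝ≥0∞) * f x := by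
  have h1 (p : ℕ × ℕ) : f (p.1 * p.2) = ∑' x, if x = p.1 * p.2 then f x else 0 := by
    rw [tsum_eq_single (p.1 * p.2) fun x hx ↦ if_neg hx, if_pos rfl]
  simp only [h1]
  rw [ENNReal.tsum_comm]
  congr 1
  ext x
  rcases eq_or_ne x 0 with rfl | hx
  · simp [h0]
  rw [tsum_eq_sum (s := x.divisorsAntidiagonal)]
  · rw [← Nat.map_div_right_divisors, Finset.sum_map, Finset.sum_congr rfl (g := fun _ ↦ f x)]
    · rw [Finset.sum_const, nsmul_eq_mul]
    · intro d hd
      rw [if_pos]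
      exact (Nat.mul_div_cancel' (Nat.dvd_of_mem_divisors hd)).symm
  · intro p hp
    rw [Nat.mem_divisorsAntidiagonal] at hp
    exact if_neg fun h ↦ hp ⟨h.symm, hx⟩

/-- If `x ≡ ± v` modulo `w` and `x ≠ v`, then `x - v`, `v - x` or `x + v` is a positive multiple `c`
of `w`. The larger variable is at least `c/2`, which bounds its weight, and it is determined by `c`
and the smaller one. Summing over `c` converges and leaves `w^{-1-e}`. -/
theorem tsum_congruent_powWeight_le {e : ℝ} (he : 0 < e) {w : ℕ} (hw : w ≠ 0) :
    ∑' x : ℕ, ∑' v : ℕ, (if x ≠ v ∧ ((w : ℤ) ∣ x - v ∨ (w : ℤ) ∣ x + v) then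
      powWeight e x * powWeight e v else 0) ≤
    4 * (∑' x, powWeight e x) ^ 2 * ENNReal.ofReal (((w : ℝ) / 2) ^ (-(1 + e))) := by
  set S := ∑' x, powWeight e x with hS
  have hw0 : (0 : ℝ) < w := by positivity
  let c : ℕ → ℕ := fun k ↦ w * (k + 1)
  let G : ℕ → ℝ≥0∞ := fun k ↦ ENNReal.ofReal (((c k : ℝ) / 2) ^ (-(1 + e)))
  have hG : ∑' k, G k ≤ ENNReal.ofReal (((w : ℝ) / 2) ^ (-(1 + e))) * S := by
    have : ∀ k, G k = ENNReal.ofReal (((w : ℝ) / 2) ^ (-(1 + e))) * powWeight e (k + 1) := by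
      intro k
      rw [powWeight, ← ENNReal.ofReal_mul (by positivity), ← mul_rpow (by positivity) (by positivity)]
      simp only [G, c]
      congr 2
      push_cast
      ring
    simp only [this]
    rw [ENNReal.tsum_mul_left]
    gcongr
    exact ENNReal.tsum_comp_le_tsum_of_injective (add_left_injective 1) _
  have hle (k x : ℕ) (h : (c k : ℝ) ≤ 2 * x) : powWeight e x ≤ G k := by
    refine ENNReal.ofReal_le_ofReal (rpow_le_rpow_of_nonpos ?_ (by linarith) (by linarith))
    simp only [c]
    positivity
  -- The four cases are the two signs of the difference, and the sum with either variable the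
  -- larger; they account for the constant `4`. The truncated subtractions may add spurious
  -- nonnegative terms, harmless in an upper bound.
  let D : ℕ → ℕ → ℕ → ℝ≥0∞ := fun k x v ↦ ((if x = v + c k then powWeight e v else 0) +
    (if v = x + c k then powWeight e x else 0) + (if v = c k - x then powWeight e x else 0) +
    (if x = c k - v then powWeight e v else 0)) * G k
  have hpt (x v : ℕ) : (if x ≠ v ∧ ((w : ℤ) ∣ x - v ∨ (w : ℤ) ∣ x + v) then
      powWeight e x * powWeight e v else 0) ≤ ∑' k, D k x v := by
    split_ifs with h
    swap
    · exact zero_le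
    obtain ⟨hxv, hd⟩ := h
    have main : ∃ k, (x = v + c k) ∨ (v = x + c k) ∨ (x + v = c k) := by
      rcases hd with hd | hd
      · obtain ⟨j, hj⟩ := hd
        rcases lt_or_gt_of_ne hxv with hlt | hlt
        · have hj0 : j < 0 := by
            by_contra hcon
            push Not at hcon
            have : (0 : ℤ) ≤ w * j := by positivity
            omega
          obtain ⟨k, hk⟩ := Int.eq_ofNat_of_zero_le (show (0 : ℤ) ≤ -j - 1 by omega)
          refine ⟨k, Or.inr (Or.inl ?_)⟩
          have : j = -((k : ℤ) + 1) := by omega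
          rw [this] at hj
          zify
          simp only [c]
          push_cast
          linarith
        · have hj0 : 0 < j := by
            by_contra hcon
            push Not at hcon
            have : (w : ℤ) * j ≤ 0 := mul_nonpos_of_nonneg_of_nonpos (by positivity) hcon
            omega
          obtain ⟨k, hk⟩ := Int.eq_ofNat_of_zero_le (show (0 : ℤ) ≤ j - 1 by omega)
          refine ⟨k, Or.inl ?_⟩
          have : j = (k : ℤ) + 1 := by omega
          rw [this] at hj
          zify
          simp only [c]
          push_cast
          linarith
      · have hd' : w ∣ x + v := by exact_mod_cast hd
        obtain ⟨j, hj⟩ := hd'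
        obtain ⟨k, rfl⟩ := Nat.exists_eq_succ_of_ne_zero (show j ≠ 0 by rintro rfl; omega)
        exact ⟨k, Or.inr (Or.inr hj)⟩
    obtain ⟨k, hk⟩ := main
    refine le_trans ?_ (ENNReal.le_tsum k)
    simp only [D]
    have hck : (0 : ℝ) < c k := by simp only [c]; positivity
    rcases hk with hk | hk | hk
    · have : powWeight e x ≤ G k := hle k x (by rw [hk]; push_cast; linarith [(v.cast_nonneg : (0 : ℝ) ≤ v)])
      rw [if_pos hk, mul_comm]
      refine mul_le_mul' ?_ this
      rw [add_assoc, add_assoc]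
      exact le_self_add
    · have : powWeight e v ≤ G k := hle k v (by rw [hk]; push_cast; linarith [(x.cast_nonneg : (0 : ℝ) ≤ x)])
      rw [if_pos hk]
      refine mul_le_mul' ?_ this
      rw [add_comm (ite (x = _) _ _), add_assoc, add_assoc]
      exact le_self_add
    · have hk' : (x : ℝ) + v = c k := by exact_mod_cast hk
      rcases le_total x v with hle' | hle'
      · have hle2 : (x : ℝ) ≤ v := by exact_mod_cast hle'
        have : powWeight e v ≤ G k := hle k v (by linarith)
        rw [if_pos (show v = c k - x by omega)]
        refine mul_le_mul' ?_ this
        rw [add_assoc, add_comm]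
        rw [add_assoc]
        exact le_self_add
      · have hle2 : (v : ℝ) ≤ x := by exact_mod_cast hle'
        have : powWeight e x ≤ G k := hle k x (by linarith)
        rw [if_pos (show x = c k - v by omega), mul_comm]
        refine mul_le_mul' ?_ this
        rw [add_comm]
        exact le_self_add
  have hone {f : ℕ → ℝ≥0∞} (a : ℕ → ℕ) : ∑' x, ∑' v, (if v = a x then f x else 0) = ∑' x, f x := by
    congr 1; ext x
    rw [tsum_eq_single (a x) fun v hv ↦ if_neg hv, if_pos rfl]
  have hone' {f : ℕ → ℝ≥0∞} (a : ℕ → ℕ) : ∑' x, ∑' v, (if x = a v then f v else 0) = ∑' x, f x := by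
    rw [ENNReal.tsum_comm]; exact hone a
  have hD (k : ℕ) : ∑' x, ∑' v, D k x v = 4 * S * G k := by
    simp only [D, ENNReal.tsum_mul_right, ENNReal.tsum_add]
    rw [hone' (fun v ↦ v + c k), hone (fun x ↦ x + c k), hone (fun x ↦ c k - x), hone' (fun v ↦ c k - v), ← hS]
    ring
  calc _ ≤ ∑' x, ∑' v, ∑' k, D k x v := ENNReal.tsum_le_tsum fun x ↦ ENNReal.tsum_le_tsum fun v ↦ hpt x v
    _ = ∑' k, ∑' x, ∑' v, D k x v := by
        have : ∀ x, ∑' v, ∑' k, D k x v = ∑' k, ∑' v, D k x v := fun x ↦ ENNReal.tsum_comm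
        simp only [this]
        exact ENNReal.tsum_comm
    _ = 4 * S * ∑' k, G k := by simp only [hD, ENNReal.tsum_mul_left]
    _ ≤ 4 * S * (ENNReal.ofReal (((w : ℝ) / 2) ^ (-(1 + e))) * S) := by gcongr
    _ = _ := by ring

/-- Grouping by the products `x = a m`, `v = b n` costs divisor functions, absorbed by halving `e`.
The factor `w` from `norm_charSum_le` is cancelled by the decay `w^{-1-e/2}` of the congruence sum,
so only the number of divisors of `q` remains. -/
theorem exists_tsum_charSum_le {e : ℝ} (he : 0 < e) : ∃ C : ℝ, 0 < C ∧ ∀ (q : ℕ) [NeZero q],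
    ∑' p : (ℕ × ℕ) × (ℕ × ℕ), powWeight e (p.1.1 * p.1.2) * powWeight e (p.2.1 * p.2.2) *
      (if p.1.1 * p.1.2 = p.2.1 * p.2.2 then 0 else ‖charSum q (p.1.1 * p.1.2) (p.2.1 * p.2.2)‖ₑ) ≤
    ENNReal.ofReal (C * (q : ℝ) ^ e) := by
  obtain ⟨C₀, hC₀, hd⟩ := exists_card_divisors_le_rpow (e := e / 2) (by positivity)
  have hC₀' : 0 < C₀ := by linarith
  have he2 : 0 < e / 2 := by positivity
  set S := ∑' x, powWeight (e / 2) x with hS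
  have hSt : S ≠ ⊤ := tsum_powWeight_ne_top he2
  refine ⟨C₀ ^ 3 * (4 * S.toReal ^ 2 * 2 ^ (1 + e / 2)) + 1, by positivity, fun q _ ↦ ?_⟩
  have hq1 : (1 : ℝ) ≤ q := by exact_mod_cast NeZero.one_le
  have hdw (x : ℕ) : (#x.divisors : ℝ≥0∞) * powWeight e x ≤ ENNReal.ofReal C₀ * powWeight (e / 2) x := by
    rcases eq_or_ne x 0 with rfl | hx
    · simp
    have hx0 : (0 : ℝ) < x := by positivity
    rw [powWeight, powWeight, ← ENNReal.ofReal_natCast, ← ENNReal.ofReal_mul (by positivity),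
      ← ENNReal.ofReal_mul (by positivity)]
    refine ENNReal.ofReal_le_ofReal ?_
    calc _ ≤ C₀ * (x : ℝ) ^ (e / 2) * (x : ℝ) ^ (-(1 + e)) := by
          gcongr; exact hd x hx
      _ = _ := by rw [mul_assoc, ← rpow_add hx0]; ring_nf
  let F : ℕ → ℕ → ℝ≥0∞ := fun x v ↦ if x = v then 0 else ‖charSum q x v‖ₑ
  have hF (x v : ℕ) : F x v ≤ ∑ w ∈ q.divisors,
      if x ≠ v ∧ ((w : ℤ) ∣ x - v ∨ (w : ℤ) ∣ x + v) then (w : ℝ≥0∞) else 0 := by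
    simp only [F]
    split_ifs with h
    · exact zero_le
    · rw [← ofReal_norm]
      refine (ENNReal.ofReal_le_ofReal (norm_charSum_le x v)).trans_eq ?_
      rw [ENNReal.ofReal_sum_of_nonneg fun w _ ↦ by positivity]
      refine Finset.sum_congr rfl fun w _ ↦ ?_
      simp only [ne_eq, h, not_false_eq_true, true_and]
      split_ifs <;> simp
  calc _ = ∑' p : ℕ × ℕ, ∑' r : ℕ × ℕ, powWeight e (p.1 * p.2) * powWeight e (r.1 * r.2) *
        F (p.1 * p.2) (r.1 * r.2) := ENNReal.tsum_prod (f := fun p r : ℕ × ℕ ↦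
          powWeight e (p.1 * p.2) * powWeight e (r.1 * r.2) * F (p.1 * p.2) (r.1 * r.2))
    _ = ∑' p : ℕ × ℕ, ∑' v : ℕ, (#v.divisors : ℝ≥0∞) * (powWeight e (p.1 * p.2) * powWeight e v *
        F (p.1 * p.2) v) := by
        congr 1; ext p
        exact tsum_mul_eq_tsum_card_divisors (f := fun v ↦ powWeight e (p.1 * p.2) * powWeight e v *
          F (p.1 * p.2) v) (by rw [powWeight_zero he]; ring)
    _ = ∑' x : ℕ, (#x.divisors : ℝ≥0∞) * ∑' v : ℕ, (#v.divisors : ℝ≥0∞) * (powWeight e x * powWeight e v *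
        F x v) :=
        tsum_mul_eq_tsum_card_divisors (f := fun x ↦ ∑' v : ℕ, (#v.divisors : ℝ≥0∞) *
          (powWeight e x * powWeight e v * F x v)) (by simp [powWeight_zero he])
    _ ≤ ∑' x : ℕ, ∑' v : ℕ, ∑ w ∈ q.divisors, ENNReal.ofReal C₀ ^ 2 * ((w : ℝ≥0∞) *
        if x ≠ v ∧ ((w : ℤ) ∣ x - v ∨ (w : ℤ) ∣ x + v) then powWeight (e / 2) x * powWeight (e / 2) v else 0) := by
        refine ENNReal.tsum_le_tsum fun x ↦ ?_
        rw [← ENNReal.tsum_mul_left]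
        refine ENNReal.tsum_le_tsum fun v ↦ ?_
        calc _ = ((#x.divisors : ℝ≥0∞) * powWeight e x) * ((#v.divisors : ℝ≥0∞) * powWeight e v) * F x v := by ring
          _ ≤ (ENNReal.ofReal C₀ * powWeight (e / 2) x) * (ENNReal.ofReal C₀ * powWeight (e / 2) v) *
              ∑ w ∈ q.divisors, if x ≠ v ∧ ((w : ℤ) ∣ x - v ∨ (w : ℤ) ∣ x + v) then (w : ℝ≥0∞) else 0 := by
              exact mul_le_mul' (mul_le_mul' (hdw x) (hdw v)) (hF x v)
          _ = _ := by
              rw [Finset.mul_sum]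
              refine Finset.sum_congr rfl fun w _ ↦ ?_
              split_ifs <;> ring
    _ = ENNReal.ofReal C₀ ^ 2 * ∑ w ∈ q.divisors, (w : ℝ≥0∞) * ∑' x : ℕ, ∑' v : ℕ,
        if x ≠ v ∧ ((w : ℤ) ∣ x - v ∨ (w : ℤ) ∣ x + v) then powWeight (e / 2) x * powWeight (e / 2) v else 0 := by
        simp only [Summable.tsum_finsetSum (fun _ _ ↦ ENNReal.summable), ENNReal.tsum_mul_left, Finset.mul_sum]
    _ ≤ ENNReal.ofReal C₀ ^ 2 * ∑ w ∈ q.divisors, (4 * S ^ 2 * ENNReal.ofReal (2 ^ (1 + e / 2))) := by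
        refine mul_le_mul' le_rfl (Finset.sum_le_sum fun w hw ↦ ?_)
        have hw0 : w ≠ 0 := (Nat.pos_of_mem_divisors hw).ne'
        have hw1 : (1 : ℝ) ≤ w := by exact_mod_cast Nat.one_le_iff_ne_zero.mpr hw0
        refine (mul_le_mul' le_rfl (tsum_congruent_powWeight_le he2 hw0)).trans ?_
        rw [← hS]
        calc _ = 4 * S ^ 2 * ((w : ℝ≥0∞) * ENNReal.ofReal (((w : ℝ) / 2) ^ (-(1 + e / 2)))) := by ring
          _ ≤ _ := by
              gcongr
              rw [← ENNReal.ofReal_natCast, ← ENNReal.ofReal_mul (by positivity)]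
              refine ENNReal.ofReal_le_ofReal ?_
              rw [div_rpow (by positivity) (by positivity), rpow_neg (by positivity : (0 : ℝ) ≤ 2), div_inv_eq_mul,
                ← mul_assoc, ← rpow_one_add' (by positivity) (by linarith)]
              have : (w : ℝ) ^ (1 + -(1 + e / 2)) ≤ 1 := rpow_le_one_of_one_le_of_nonpos hw1 (by linarith)
              nlinarith [rpow_pos_of_pos two_pos (1 + e / 2)]
    _ ≤ ENNReal.ofReal C₀ ^ 2 * (ENNReal.ofReal (C₀ * (q : ℝ) ^ e) *
          (4 * S ^ 2 * ENNReal.ofReal (2 ^ (1 + e / 2)))) := by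
        rw [Finset.sum_const, nsmul_eq_mul, ← ENNReal.ofReal_natCast]
        gcongr
        refine (hd q (NeZero.ne q)).trans ?_
        exact mul_le_mul_of_nonneg_left (rpow_le_rpow_of_exponent_le hq1 (by linarith)) hC₀'.le
    _ = ENNReal.ofReal (C₀ ^ 3 * (4 * S.toReal ^ 2 * 2 ^ (1 + e / 2)) * (q : ℝ) ^ e) := by
        conv_lhs => rw [← ENNReal.ofReal_toReal hSt]
        have h4 : (4 : ℝ≥0∞) = ENNReal.ofReal 4 := by simp
        rw [h4, ← ENNReal.ofReal_pow (by positivity), ← ENNReal.ofReal_pow (by positivity),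
          ← ENNReal.ofReal_mul (by positivity), ← ENNReal.ofReal_mul (by positivity),
          ← ENNReal.ofReal_mul (by positivity), ← ENNReal.ofReal_mul (by positivity)]
        congr 1
        ring
    _ ≤ _ := by
        refine ENNReal.ofReal_le_ofReal ?_
        gcongr
        linarith
end


/-! ### Off-diagonal bound and decomposition of the mollified form. -/

noncomputable section

open Finset DirichletCharacter Real Filter Topology MeasureTheory
open scoped ENNReal

/-- Rankin's device: it trades a smooth cutoff for a power, so that all sums can be extended to
infinity with the weights `x^{-1-e}`. -/
theorem rpow_le_mul_exp {κ y : ℝ} (hκ : 0 < κ) (hy : 0 < y) : exp (-y) ≤ κ ^ κ * y ^ (-κ) := by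
  have h1 : y / κ ≤ exp (y / κ) := by linarith [add_one_le_exp (y / κ)]
  have h2 := rpow_le_rpow (by positivity) h1 hκ.le
  rw [div_rpow hy.le hκ.le, ← exp_mul, div_mul_cancel₀ y hκ.ne', div_le_iff₀ (by positivity)] at h2
  rw [exp_neg, rpow_neg hy.le, ← div_eq_mul_inv, inv_eq_one_div, div_le_div_iff₀ (exp_pos _) (by positivity)]
  linarith

/-- The off-diagonal terms of the mollified second moment. -/
def offQuad (W h : ℝ → ℝ) (q : ℕ) [NeZero q] (α β : ℂ) (p : (ℕ × ℕ) × (ℕ × ℕ)) : ℂ :=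
  mollCoeff h (log q) p.1.1 * mollCoeff h (log q) p.2.1 *
    afeKernel W (log q) (α / log q) (β / log q) p.1.2 p.2.2 *
    (if p.1.1 * p.1.2 = p.2.1 * p.2.2 then 0 else charSum q (p.1.1 * p.1.2) (p.2.1 * p.2.2))

/-- The mollifier. -/
def mollifier (h : ℝ → ℝ) {q : ℕ} (χ : DirichletCharacter ℂ q) : ℂ :=
  ∑ n ∈ range q, mollCoeff h (log q) n * χ (n : ZMod q)

theorem mollCoeff_zero (h : ℝ → ℝ) (ℓ : ℝ) : mollCoeff h ℓ 0 = 0 := by simp [mollCoeff]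

/-- On the support `a < e^{θℓ}`, so `a^{1/2+e}` may be replaced by its value at the end of the
range. -/
theorem norm_mollCoeff_le {h : ℝ → ℝ} {H θ ℓ e : ℝ} (hH : ∀ x, |h x| ≤ H) (hθ : ∀ x, θ ≤ x → h x = 0)
    (hℓ : 0 < ℓ) (he : 0 < e) (a : ℕ) :
    ‖mollCoeff h ℓ a‖ ≤ H * exp (θ * ℓ * (1 / 2 + e)) * (a : ℝ) ^ (-(1 + e)) := by
  have hH0 : 0 ≤ H := (abs_nonneg _).trans (hH 0)
  rcases eq_or_ne a 0 with rfl | ha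
  · rw [mollCoeff_zero, norm_zero]
    positivity
  have ha0 : (0 : ℝ) < a := by positivity
  by_cases hx : θ ≤ log a / ℓ
  · simp only [mollCoeff, hθ _ hx, Complex.ofReal_zero, mul_zero, zero_mul, norm_zero]
    positivity
  push Not at hx
  rw [div_lt_iff₀ hℓ] at hx
  have hμ : ‖(ArithmeticFunction.moebius a : ℂ)‖ ≤ 1 := by
    rw [Complex.norm_intCast]
    exact_mod_cast ArithmeticFunction.abs_moebius_le_one
  rw [mollCoeff, norm_mul, norm_mul, Complex.norm_real, norm_eq_abs,
    Complex.norm_natCast_cpow_of_pos (Nat.pos_of_ne_zero ha)]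
  have hre : (-(1 / 2) : ℂ).re = (1 / 2 + e) + -(1 + e) := by norm_num
  rw [hre, rpow_add ha0]
  calc _ ≤ 1 * H * (exp (θ * ℓ * (1 / 2 + e)) * (a : ℝ) ^ (-(1 + e))) := by
        gcongr
        · exact hH _
        · rw [rpow_def_of_pos ha0]
          gcongr
    _ = _ := by ring

theorem exists_tsum_offQuad_le {θ δ H : ℝ} (hθ0 : 0 < θ) (hθ : θ < 1 / 2) (hδ : 0 < δ)
    (hδθ : δ ≤ (1 / 2 - θ) / 2) : ∃ C L₀ : ℝ, 0 < C ∧ 2 ≤ L₀ ∧ ∀ (W h : ℝ → ℝ) (q : ℕ) [NeZero q] (α β : ℂ),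
    IsCutoff W δ → (∀ x, |h x| ≤ H) → (∀ x, θ ≤ x → h x = 0) → L₀ ≤ log q → ‖α‖ ≤ 1 / 2 → ‖β‖ ≤ 1 / 2 →
    ∑' p, ‖offQuad W h q α β p‖ₑ ≤ ENNReal.ofReal (C * (q : ℝ) ^ (1 - (1 / 2 - θ) / 2)) := by
  set τ := 1 / 2 - θ with hτ
  have hτ0 : 0 < τ := by linarith
  -- The total exponent of `q` is `θ(1 + 2e) + (1 + δ)(1/2 + 2e) + e`. With `θ = 1/2 - τ` and `δ ≤
  -- τ/2` it is at most `1 - τ + τ/4 + 6e`, so `6e = τ/4` leaves `1 - τ/2`.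
  set e := τ / 24 with he
  have he0 : 0 < e := by positivity
  obtain ⟨C₁, hC₁, hK⟩ := exists_norm_afeKernel_le
  obtain ⟨C₂, hC₂, hS⟩ := exists_tsum_charSum_le he0
  set κ := 1 / 2 + 2 * e with hκ
  have hκ0 : 0 < κ := by positivity
  refine ⟨H ^ 2 * (C₁ * κ ^ κ) * C₂ + 1, 12 / τ + 2, by positivity, by linarith [show 0 < 12 / τ by positivity], ?_⟩
  intro W h q _ α β hW hH hhθ hL hα hβ
  set ℓ := log q with hℓ
  have h12 : 0 < 12 / τ := by positivity
  have hℓ2 : 2 ≤ ℓ := by linarith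
  have hℓ0 : 0 < ℓ := by linarith
  have hH0 : 0 ≤ H := (abs_nonneg _).trans (hH 0)
  have hq0 : (0 : ℝ) < q := by exact_mod_cast NeZero.pos q
  have hq1 : 1 < q := by
    by_contra hcon
    have : q = 1 := le_antisymm (not_lt.mp hcon) NeZero.one_le
    rw [hℓ, this] at hℓ0
    simp at hℓ0
  have hrec (c : ℂ) (hc : ‖c‖ ≤ 1 / 2) : |(c / (ℓ : ℂ)).re| ≤ 1 / (2 * ℓ) := by
    rw [Complex.div_ofReal_re, abs_div, abs_of_pos hℓ0, ← div_div]
    gcongr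
    exact (Complex.abs_re_le_norm c).trans hc
  have hle : 1 / (2 * ℓ) ≤ e := by
    rw [he, div_le_div_iff₀ (by positivity) (by norm_num)]
    have : 12 / τ ≤ ℓ := by linarith
    rw [div_le_iff₀ hτ0] at this
    linarith
  set P := H ^ 2 * (C₁ * κ ^ κ) * exp (ℓ * (θ * (1 + 2 * e) + (1 + δ) * κ)) with hP
  have hP0 : 0 ≤ P := by positivity
  have hpt (p : (ℕ × ℕ) × (ℕ × ℕ)) : ‖offQuad W h q α β p‖ₑ ≤ ENNReal.ofReal P *
      (powWeight e (p.1.1 * p.1.2) * powWeight e (p.2.1 * p.2.2) *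
      (if p.1.1 * p.1.2 = p.2.1 * p.2.2 then 0 else ‖charSum q (p.1.1 * p.1.2) (p.2.1 * p.2.2)‖ₑ)) := by
    obtain ⟨⟨a, m⟩, b, n⟩ := p
    simp only [offQuad]
    -- The kernel is not controlled at zero indices, but there the character sum vanishes because
    -- `0` is not coprime to `q > 1`.
    by_cases hz : (a * m) * (b * n) = 0
    · have : charSum q (a * m) (b * n) = 0 := charSum_eq_zero (by
        rw [hz, Nat.coprime_zero_left]; omega)
      rw [this]
      simp
    have hm : m ≠ 0 := by rintro rfl; simp at hz
    have hn : n ≠ 0 := by rintro rfl; simp at hz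
    have ha : a ≠ 0 := by rintro rfl; simp at hz
    have hb : b ≠ 0 := by rintro rfl; simp at hz
    rw [enorm_mul, ← mul_assoc]
    refine mul_le_mul' ?_ (by split_ifs <;> simp)
    rw [← ofReal_norm, powWeight, powWeight, ← ENNReal.ofReal_mul (by positivity), ← ENNReal.ofReal_mul hP0]
    refine ENNReal.ofReal_le_ofReal ?_
    rw [norm_mul, norm_mul]
    have hmn0 : (0 : ℝ) < (m * n : ℕ) := by positivity
    have hmn1 : (1 : ℝ) ≤ (m * n : ℕ) := by
      exact_mod_cast Nat.one_le_iff_ne_zero.mpr (mul_ne_zero hm hn)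
    have hKb : ‖afeKernel W ℓ (α / ℓ) (β / ℓ) m n‖ ≤ C₁ * κ ^ κ * exp (ℓ * ((1 + δ) * κ)) *
        ((m : ℝ) ^ (-(1 + e)) * (n : ℝ) ^ (-(1 + e))) := by
      refine (hK hW hℓ2 (hrec α hα) (hrec β hβ) hm hn).trans ?_
      have h1 : ((m * n : ℕ) : ℝ) ^ (-1 / 2 + 1 / (2 * ℓ)) ≤ ((m * n : ℕ) : ℝ) ^ (-1 / 2 + e) :=
        rpow_le_rpow_of_exponent_le hmn1 (by linarith)
      have hy : 0 < (m * n : ℕ) * exp (-(1 + δ) * ℓ) := by positivity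
      have h2 : exp (-(π * (m * n : ℕ) * exp (-(1 + δ) * ℓ))) ≤
          κ ^ κ * ((m * n : ℕ) * exp (-(1 + δ) * ℓ)) ^ (-κ) := by
        refine le_trans (exp_le_exp.mpr ?_) (rpow_le_mul_exp hκ0 hy)
        nlinarith [pi_gt_three]
      calc _ ≤ C₁ * ((m * n : ℕ) : ℝ) ^ (-1 / 2 + e) * (κ ^ κ * ((m * n : ℕ) * exp (-(1 + δ) * ℓ)) ^ (-κ)) := by
            gcongr
        _ = C₁ * κ ^ κ * exp (ℓ * ((1 + δ) * κ)) * (((m * n : ℕ) : ℝ) ^ (-1 / 2 + e) * ((m * n : ℕ) : ℝ) ^ (-κ)) := by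
            rw [mul_rpow hmn0.le (exp_pos _).le, ← exp_mul]
            have : -(1 + δ) * ℓ * -κ = ℓ * ((1 + δ) * κ) := by ring
            rw [this]; ring
        _ = _ := by
            rw [← rpow_add hmn0, hκ]
            have : -1 / 2 + e + -(1 / 2 + 2 * e) = -(1 + e) := by ring
            rw [this, Nat.cast_mul, mul_rpow (by positivity) (by positivity)]
    calc _ ≤ (H * exp (θ * ℓ * (1 / 2 + e)) * (a : ℝ) ^ (-(1 + e))) * (H * exp (θ * ℓ * (1 / 2 + e)) * (b : ℝ) ^ (-(1 + e))) *
          (C₁ * κ ^ κ * exp (ℓ * ((1 + δ) * κ)) * ((m : ℝ) ^ (-(1 + e)) * (n : ℝ) ^ (-(1 + e)))) := by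
          gcongr
          · exact norm_mollCoeff_le hH hhθ hℓ0 he0 a
          · exact norm_mollCoeff_le hH hhθ hℓ0 he0 b
      _ = _ := by
          have e1 : exp (ℓ * (θ * (1 + 2 * e) + (1 + δ) * κ)) = exp (θ * ℓ * (1 / 2 + e)) * exp (θ * ℓ * (1 / 2 + e)) *
              exp (ℓ * ((1 + δ) * κ)) := by
            rw [← exp_add, ← exp_add]; congr 1; ring
          rw [hP, e1, Nat.cast_mul, Nat.cast_mul, mul_rpow (by positivity) (by positivity),
            mul_rpow (by positivity) (by positivity)]
          ring
  calc _ ≤ ∑' p : (ℕ × ℕ) × (ℕ × ℕ), ENNReal.ofReal P *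
      (powWeight e (p.1.1 * p.1.2) * powWeight e (p.2.1 * p.2.2) *
      (if p.1.1 * p.1.2 = p.2.1 * p.2.2 then 0 else ‖charSum q (p.1.1 * p.1.2) (p.2.1 * p.2.2)‖ₑ)) :=
        ENNReal.tsum_le_tsum hpt
    _ ≤ ENNReal.ofReal P * ENNReal.ofReal (C₂ * (q : ℝ) ^ e) := by
        rw [ENNReal.tsum_mul_left]
        exact mul_le_mul' le_rfl (hS q)
    _ ≤ _ := by
        rw [← ENNReal.ofReal_mul hP0]
        refine ENNReal.ofReal_le_ofReal ?_
        have e1 : exp (ℓ * (θ * (1 + 2 * e) + (1 + δ) * κ)) * (q : ℝ) ^ e ≤ (q : ℝ) ^ (1 - τ / 2) := by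
          rw [rpow_def_of_pos hq0, rpow_def_of_pos hq0, ← exp_add, ← hℓ, ← mul_add]
          gcongr
          have : δ * e ≤ e := by nlinarith
          have : θ * e ≤ e / 2 := by nlinarith
          rw [hκ]
          linarith
        rw [hP]
        calc _ = H ^ 2 * (C₁ * κ ^ κ) * C₂ * (exp (ℓ * (θ * (1 + 2 * e) + (1 + δ) * κ)) * (q : ℝ) ^ e) := by ring
          _ ≤ (H ^ 2 * (C₁ * κ ^ κ) * C₂ + 1) * (q : ℝ) ^ (1 - τ / 2) := by
              gcongr
              linarith

theorem mollCoeff_eq_zero {h : ℝ → ℝ} {θ : ℝ} (hθ : θ < 1 / 2) (hh : ∀ x, θ ≤ x → h x = 0) {q : ℕ} (hq : 1 < q)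
    {n : ℕ} (hn : q ≤ n) : mollCoeff h (log q) n = 0 := by
  have hL : 0 < log q := log_pos (by exact_mod_cast hq)
  have h1 : 1 ≤ log n / log q := by
    rw [le_div_iff₀ hL, one_mul]
    exact log_le_log (by exact_mod_cast (by omega : 0 < q)) (by exact_mod_cast hn)
  simp [mollCoeff, hh _ (by linarith : θ ≤ log n / log q)]

theorem hasSum_mollifier {h : ℝ → ℝ} {θ : ℝ} (hθ : θ < 1 / 2) (hh : ∀ x, θ ≤ x → h x = 0) {q : ℕ} (hq : 1 < q)
    (χ : DirichletCharacter ℂ q) : HasSum (fun n : ℕ ↦ mollCoeff h (log q) n * χ (n : ZMod q)) (mollifier h χ) ∧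
    Summable fun n : ℕ ↦ ‖mollCoeff h (log q) n * χ (n : ZMod q)‖ := by
  have h0 : ∀ n ∉ range q, mollCoeff h (log q) n * χ (n : ZMod q) = 0 := fun n hn ↦ by
    rw [mollCoeff_eq_zero hθ hh hq (by simpa using hn), zero_mul]
  exact ⟨hasSum_sum_of_ne_finset_zero h0, summable_of_ne_finset_zero (s := range q) fun n hn ↦ by
    rw [h0 n hn, norm_zero]⟩

/-- The smoothed half of the second moment, at scaled shifts. -/
def scaledForm (W : ℝ → ℝ) {q : ℕ} [NeZero q] (χ : DirichletCharacter ℂ q) (α β : ℂ) : ℂ :=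
  Complex.exp (-(1 / 2 + (α / log q + β / log q) / 2) * log q) * thetaForm W χ (α / log q) (β / log q)

theorem hasSum_mul_swap {f g : ℕ × ℕ → ℂ} {s t : ℂ} (hf : HasSum f s) (hg : HasSum g t) :
    HasSum (fun p : (ℕ × ℕ) × (ℕ × ℕ) ↦ f (p.1.1, p.2.1) * g (p.1.2, p.2.2)) (s * t) :=
  ((Equiv.prodProdProdComm ℕ ℕ ℕ ℕ).hasSum_iff
    (f := fun p : (ℕ × ℕ) × (ℕ × ℕ) ↦ f p.1 * g p.2)).mpr
    (hf.mul hg (summable_mul_of_summable_norm hf.summable.norm hg.summable.norm))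

theorem hasSum_scaledForm_mul {W h : ℝ → ℝ} {δ θ : ℝ} (hW : IsCutoff W δ) (hθ : θ < 1 / 2)
    (hh : ∀ x, θ ≤ x → h x = 0) {q : ℕ} [NeZero q] (hq : 2 ≤ log q) (χ : DirichletCharacter ℂ q) {α β : ℂ}
    (hα : ‖α‖ ≤ 1 / 2) (hβ : ‖β‖ ≤ 1 / 2) :
    HasSum (fun p : (ℕ × ℕ) × (ℕ × ℕ) ↦ mollCoeff h (log q) p.1.1 * mollCoeff h (log q) p.2.1 *
      afeKernel W (log q) (α / log q) (β / log q) p.1.2 p.2.2 *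
      (χ ((p.1.1 * p.1.2 : ℕ) : ZMod q) * χ⁻¹ ((p.2.1 * p.2.2 : ℕ) : ZMod q)))
      (mollifier h χ * mollifier h χ⁻¹ * scaledForm W χ α β) := by
  have hL : 0 < log q := by linarith
  have hq1 : 1 < q := by
    by_contra hcon
    have : q = 1 := le_antisymm (not_lt.mp hcon) NeZero.one_le
    rw [this] at hL
    simp at hL
  have hrec (c : ℂ) (hc : ‖c‖ ≤ 1 / 2) : |(c / ((log q : ℝ) : ℂ)).re| ≤ 1 / 4 := by
    rw [Complex.div_ofReal_re, abs_div, abs_of_pos hL, div_le_iff₀ hL]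
    have := (Complex.abs_re_le_norm c).trans hc
    linarith
  have h1 := hasSum_thetaForm hq1 χ hW (hrec α hα) (hrec β hβ)
  obtain ⟨m1, s1⟩ := hasSum_mollifier hθ hh hq1 χ
  obtain ⟨m2, s2⟩ := hasSum_mollifier hθ hh hq1 χ⁻¹
  have hs12 := summable_mul_of_summable_norm s1 s2
  have m12 := m1.mul m2 hs12
  have h3 := hasSum_mul_swap m12 h1
  rw [scaledForm]
  refine (congrArg (fun f ↦ HasSum f _) (funext fun p ↦ ?_)).mp h3
  obtain ⟨⟨a, m⟩, b, n⟩ := p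
  simp only
  rw [Nat.cast_mul, Nat.cast_mul, map_mul, map_mul]
  ring

/-- Terms with `a m = b n` coprime to `q` carry the full number of characters and form the
subtracted main term. Those sharing a factor with `q` vanish, and the rest is `offQuad`. -/
theorem sum_scaledForm_mul {W h : ℝ → ℝ} {δ θ : ℝ} (hW : IsCutoff W δ) (hθ : θ < 1 / 2)
    (hh : ∀ x, θ ≤ x → h x = 0) {ρ σ : ℝ → ℂ} (hρ : IsLineDensity W ρ) (hσ : IsLineDensity h σ)
    {q : ℕ} [NeZero q] (hq : 2 ≤ log q) {α β : ℂ}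
    (hα : ‖α‖ ≤ 1 / 2) (hβ : ‖β‖ ≤ 1 / 2) :
    HasSum (offQuad W h q α β) (∑ χ ∈ evenPrim q, mollifier h χ * mollifier h χ⁻¹ * scaledForm W χ α β -
      #(evenPrim q) * ∑' p, diagQuad W h q α β p) := by
  have h1 := hasSum_sum fun χ (_ : χ ∈ evenPrim q) ↦ hasSum_scaledForm_mul hW hθ hh hq χ hα hβ
  have h2 := (hasSum_diagQuad hρ hσ hq hα hβ).summable.hasSum.mul_left (#(evenPrim q) : ℂ)
  convert! h1.sub h2 using 1
  ext ⟨⟨a, m⟩, b, n⟩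
  rw [← Finset.mul_sum]
  change _ = _ * charSum q (a * m) (b * n) - _
  simp only [offQuad, diagQuad]
  by_cases hab : a * m = b * n
  · by_cases hc : (a * m).Coprime q
    · rw [if_pos hab, if_pos ⟨hab, hc⟩, ← hab, charSum_self hc]
      ring
    · rw [if_pos hab, if_neg fun h ↦ hc h.2, ← hab, charSum_eq_zero fun h ↦ hc (Nat.coprime_mul_iff_left.mp h).1]
      ring
  · rw [if_neg hab, if_neg fun h ↦ hab h.1]
    ring

theorem norm_le_of_hasSum_enorm {ι : Type*} {f : ι → ℂ} {s : ℂ} (hf : HasSum f s) {C : ℝ} (hC : 0 ≤ C)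
    (h : ∑' i, ‖f i‖ₑ ≤ ENNReal.ofReal C) : ‖s‖ ≤ C := by
  have h1 : ‖s‖ₑ ≤ ∑' i, ‖f i‖ₑ := by
    rw [← hf.tsum_eq]
    exact enorm_tsum_le_tsum_enorm
  have h2 := h1.trans h
  rw [← ofReal_norm] at h2
  exact (ENNReal.ofReal_le_ofReal_iff hC).mp h2
end


/-! ### Second moment with shifts: main term and limit. -/

noncomputable section

open Finset DirichletCharacter Real Filter Topology MeasureTheory
open scoped ENNReal

/-- The main term of the mollified second moment at scaled shifts. -/
def secondMain (W h : ℝ → ℝ) (q : ℕ) (α β : ℂ) : ℂ :=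
  (Complex.Gammaℝ (1 / 2 + α / log q))⁻¹ * (Complex.Gammaℝ (1 / 2 + β / log q))⁻¹ *
    (∑' p, diagQuad W h q α β p + Complex.exp (-(α + β)) * ∑' p, diagQuad W h q (-β) (-α) p)

theorem exists_norm_inv_Gammaℝ_le : ∃ C : ℝ, 0 < C ∧ ∀ (ℓ : ℝ) (α : ℂ), 2 ≤ ℓ → ‖α‖ ≤ 1 / 2 →
    ‖(Complex.Gammaℝ (1 / 2 + α / ℓ))⁻¹‖ ≤ C := by
  obtain ⟨C, hC⟩ := (isCompact_closedBall (0 : ℂ) 1).exists_bound_of_continuousOn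
    (f := fun x ↦ (Complex.Gammaℝ (1 / 2 + x))⁻¹)
    (Complex.differentiable_Gammaℝ_inv.continuous.comp (by fun_prop : Continuous fun x : ℂ ↦ 1 / 2 + x)).continuousOn
  refine ⟨|C| + 1, by positivity, fun ℓ α hℓ hα ↦ ?_⟩
  have h1 := hC (α / ℓ) (by
    rw [mem_closedBall_zero_iff, norm_div, Complex.norm_real, norm_of_nonneg (by linarith), div_le_iff₀ (by linarith)]
    linarith)
  exact h1.trans ((le_abs_self C).trans (by linarith))

theorem tendsto_inv_Gammaℝ (α : ℂ) : Tendsto (fun q : ℕ ↦ (Complex.Gammaℝ (1 / 2 + α / log q))⁻¹) atTop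
    (𝓝 (Complex.Gammaℝ (1 / 2))⁻¹) := by
  have h0 : Tendsto (fun q : ℕ ↦ α / (log q : ℂ)) atTop (𝓝 0) := by
    have : Tendsto (fun q : ℕ ↦ ((log q : ℝ) : ℂ)) atTop (Bornology.cobounded ℂ) :=
      (RCLike.tendsto_ofReal_atTop_cobounded ℂ).comp tendsto_log_natCast
    simpa [div_eq_mul_inv] using ((tendsto_inv₀_cobounded (α := ℂ)).comp this).const_mul α
  have h1 : Tendsto (fun q : ℕ ↦ 1 / 2 + α / (log q : ℂ)) atTop (𝓝 (1 / 2)) := by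
    have := h0.const_add (1 / 2 : ℂ)
    rwa [add_zero] at this
  exact (Complex.differentiable_Gammaℝ_inv.continuous.tendsto (1 / 2)).comp h1

/-- The off-diagonal bound is applied to both halves of the product formula, at `(α, β)` and `(-β,
-α)`. The factor `e^{-(α+β)}` is the ratio of their normalizations. Uniformity in the shifts is what
later permits integration over circles. -/
theorem exists_secondMoment_sub_le {θ δ H : ℝ} (hθ0 : 0 < θ) (hθ : θ < 1 / 2) (hδ : 0 < δ)
    (hδθ : δ ≤ (1 / 2 - θ) / 2) : ∃ C L₀ : ℝ, 0 < C ∧ 2 ≤ L₀ ∧ ∀ (W h : ℝ → ℝ) (ρ σ : ℝ → ℂ) (q : ℕ) [NeZero q]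
    (α β : ℂ), IsCutoff W δ → IsLineDensity W ρ → IsLineDensity h σ → (∀ x, |h x| ≤ H) →
    (∀ x, θ ≤ x → h x = 0) → L₀ ≤ log q → ‖α‖ ≤ 1 / 2 → ‖β‖ ≤ 1 / 2 →
    ‖∑ χ ∈ evenPrim q, mollifier h χ * mollifier h χ⁻¹ *
        (LFunction χ (1 / 2 + α / log q) * LFunction χ⁻¹ (1 / 2 + β / log q)) -
      #(evenPrim q) * secondMain W h q α β‖ ≤ C * (q : ℝ) ^ (1 - (1 / 2 - θ) / 2) := by
  obtain ⟨C₁, L₀, hC₁, hL₀, hoff⟩ := exists_tsum_offQuad_le (H := H) hθ0 hθ hδ hδθ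
  obtain ⟨C₂, hC₂, hG⟩ := exists_norm_inv_Gammaℝ_le
  refine ⟨C₂ * C₂ * (C₁ + exp 1 * C₁), L₀, by positivity, hL₀, ?_⟩
  intro W h ρ σ q _ α β hW hρ hσ hH hh hL hα hβ
  have hL2 : 2 ≤ log q := hL₀.trans hL
  have hL0 : 0 < log q := by linarith
  have hLc : ((log q : ℝ) : ℂ) ≠ 0 := by exact_mod_cast hL0.ne'
  have hq1 : 1 < q := by
    by_contra hcon
    have : q = 1 := le_antisymm (not_lt.mp hcon) NeZero.one_le
    rw [this] at hL0
    simp at hL0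
  have hα' : ‖-α‖ ≤ 1 / 2 := by rwa [norm_neg]
  have hβ' : ‖-β‖ ≤ 1 / 2 := by rwa [norm_neg]
  set X := C₁ * (q : ℝ) ^ (1 - (1 / 2 - θ) / 2) with hX
  have hX0 : 0 ≤ X := by positivity
  have b1 := norm_le_of_hasSum_enorm (sum_scaledForm_mul hW hθ hh hρ hσ hL2 hα hβ) hX0
    (hoff W h q α β hW hH hh hL hα hβ)
  have b2 := norm_le_of_hasSum_enorm (sum_scaledForm_mul hW hθ hh hρ hσ hL2 hβ' hα') hX0
    (hoff W h q (-β) (-α) hW hH hh hL hβ' hα')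
  set S₁ := ∑ χ ∈ evenPrim q, mollifier h χ * mollifier h χ⁻¹ * scaledForm W χ α β with hS₁
  set S₂ := ∑ χ ∈ evenPrim q, mollifier h χ * mollifier h χ⁻¹ * scaledForm W χ (-β) (-α) with hS₂
  set G := (Complex.Gammaℝ (1 / 2 + α / log q))⁻¹ * (Complex.Gammaℝ (1 / 2 + β / log q))⁻¹ with hGdef
  have hterm (χ : DirichletCharacter ℂ q) (hχ : χ ∈ evenPrim q) :
      LFunction χ (1 / 2 + α / log q) * LFunction χ⁻¹ (1 / 2 + β / log q) =
      G * (scaledForm W χ α β + Complex.exp (-(α + β)) * scaledForm W χ (-β) (-α)) := by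
    rw [mem_evenPrim] at hχ
    rw [LFunction_mul_eq_thetaForm hq1 hχ.2 hχ.1 hW, scaledForm, scaledForm, ← mul_assoc (Complex.exp (-(α + β))),
      ← Complex.exp_add, neg_div, neg_div]
    have : -(α + β) + -(1 / 2 + (-(β / (log q : ℂ)) + -(α / (log q : ℂ))) / 2) * (log q : ℂ) =
        -(1 / 2 + (α / (log q : ℂ) + β / (log q : ℂ)) / 2) * (log q : ℂ) := by
      field_simp
      ring
    rw [this]
    ring
  have hsum : ∑ χ ∈ evenPrim q, mollifier h χ * mollifier h χ⁻¹ *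
      (LFunction χ (1 / 2 + α / log q) * LFunction χ⁻¹ (1 / 2 + β / log q)) =
      G * (S₁ + Complex.exp (-(α + β)) * S₂) := by
    rw [hS₁, hS₂, Finset.mul_sum, ← Finset.sum_add_distrib, Finset.mul_sum]
    refine Finset.sum_congr rfl fun χ hχ ↦ ?_
    rw [hterm χ hχ]
    ring
  have heq : G * (S₁ + Complex.exp (-(α + β)) * S₂) - #(evenPrim q) * secondMain W h q α β =
      G * ((S₁ - #(evenPrim q) * ∑' p, diagQuad W h q α β p) + Complex.exp (-(α + β)) *
        (S₂ - #(evenPrim q) * ∑' p, diagQuad W h q (-β) (-α) p)) := by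
    rw [secondMain]; ring
  rw [hsum, heq, norm_mul]
  have hGb : ‖G‖ ≤ C₂ * C₂ := by
    rw [hGdef, norm_mul]
    exact mul_le_mul (hG _ _ hL2 hα) (hG _ _ hL2 hβ) (norm_nonneg _) hC₂.le
  have hE : ‖Complex.exp (-(α + β))‖ ≤ exp 1 := by
    rw [Complex.norm_exp]
    apply exp_le_exp.mpr
    have h1 := abs_le.mp ((Complex.abs_re_le_norm α).trans hα)
    have h2 := abs_le.mp ((Complex.abs_re_le_norm β).trans hβ)
    simp only [Complex.neg_re, Complex.add_re]
    linarith
  calc _ ≤ C₂ * C₂ * (X + exp 1 * X) := by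
        refine mul_le_mul hGb ((norm_add_le _ _).trans (add_le_add b1 ?_)) (norm_nonneg _) (by positivity)
        rw [norm_mul]
        exact mul_le_mul hE b2 (norm_nonneg _) (exp_pos _).le
    _ = _ := by rw [hX]; ring

theorem exists_norm_secondMain_le {W h : ℝ → ℝ} {ρ σ : ℝ → ℂ} (hρ : IsLineDensity W ρ) (hσ : IsLineDensity h σ) :
    ∃ C : ℝ, 0 < C ∧ ∀ (q : ℕ) (α β : ℂ), 2 ≤ log q → ‖α‖ ≤ 1 / 2 → ‖β‖ ≤ 1 / 2 → ‖secondMain W h q α β‖ ≤ C := by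
  obtain ⟨C₁, hC₁, hD⟩ := exists_norm_tsum_diagQuad_le hρ hσ
  obtain ⟨C₂, hC₂, hG⟩ := exists_norm_inv_Gammaℝ_le
  refine ⟨C₂ * C₂ * (C₁ + exp 1 * C₁), by positivity, fun q α β hq hα hβ ↦ ?_⟩
  have hE : ‖Complex.exp (-(α + β))‖ ≤ exp 1 := by
    rw [Complex.norm_exp]
    apply exp_le_exp.mpr
    have h1 := abs_le.mp ((Complex.abs_re_le_norm α).trans hα)
    have h2 := abs_le.mp ((Complex.abs_re_le_norm β).trans hβ)
    simp only [Complex.neg_re, Complex.add_re]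
    linarith
  rw [secondMain, norm_mul, norm_mul]
  refine mul_le_mul (mul_le_mul (hG _ _ hq hα) (hG _ _ hq hβ) (norm_nonneg _) hC₂.le)
    ((norm_add_le _ _).trans (add_le_add (hD q α β hq hα hβ) ?_)) (norm_nonneg _) (by positivity)
  rw [norm_mul]
  exact mul_le_mul hE (hD q (-β) (-α) hq (by rwa [norm_neg]) (by rwa [norm_neg])) (norm_nonneg _) (exp_pos _).le

/-- The substitution `r ↦ 1 - r` in the second integral and `W(2r) + W(2 - 2r) = 1` glue the two
smoothed integrals into an unweighted one; thus the limit does not depend on the cutoff. -/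
theorem integral_cutoff_add {W : ℝ → ℝ} {δ : ℝ} (hW : IsCutoff W δ) (hδ : δ < 1) (γ : ℂ) :
    (∫ r in Set.Ioi (0 : ℝ), (W (2 * r) : ℂ) * Complex.exp (-(γ * r))) +
      Complex.exp (-γ) * ∫ r in Set.Ioi (0 : ℝ), (W (2 * r) : ℂ) * Complex.exp (-(-γ * r)) =
    ∫ r in (0 : ℝ)..1, Complex.exp (-(γ * r)) := by
  have hcut (γ : ℂ) : ∫ r in Set.Ioi (0 : ℝ), (W (2 * r) : ℂ) * Complex.exp (-(γ * r)) =
      ∫ r in (0 : ℝ)..1, (W (2 * r) : ℂ) * Complex.exp (-(γ * r)) := by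
    rw [intervalIntegral.integral_of_le zero_le_one]
    refine setIntegral_eq_of_subset_of_forall_sdiff_eq_zero measurableSet_Ioi Set.Ioc_subset_Ioi_self fun r hr ↦ ?_
    have h1 : 1 < r := by
      by_contra hcon
      exact hr.2 ⟨hr.1, not_lt.mp hcon⟩
    rw [hW.supp _ (by linarith), Complex.ofReal_zero, zero_mul]
  have hint (γ : ℂ) : IntervalIntegrable (fun r : ℝ ↦ (W (2 * r) : ℂ) * Complex.exp (-(γ * r))) volume 0 1 := by
    have h1 : IntervalIntegrable (fun r : ℝ ↦ Complex.exp (-(γ * r))) volume 0 1 :=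
      Continuous.intervalIntegrable (by fun_prop) _ _
    rw [intervalIntegrable_iff] at h1 ⊢
    refine h1.bdd_mul (c := 1) (Complex.measurable_ofReal.comp (hW.meas.comp (by fun_prop))).aestronglyMeasurable
      (Eventually.of_forall fun r ↦ ?_)
    rw [Complex.norm_real, norm_of_nonneg (hW.nonneg _)]
    exact hW.le_one _
  rw [hcut, hcut, ← intervalIntegral.integral_const_mul]
  have hrefl := intervalIntegral.integral_comp_sub_left (a := 0) (b := 1)
    (fun r : ℝ ↦ Complex.exp (-γ) * ((W (2 * r) : ℂ) * Complex.exp (-(-γ * r)))) 1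
  rw [sub_self, sub_zero] at hrefl
  rw [← hrefl, ← intervalIntegral.integral_add (hint γ)]
  · refine intervalIntegral.integral_congr fun r _ ↦ ?_
    have h1 := hW.symm (2 * r)
    have h2 : 2 * (1 - r) = 2 - 2 * r := by ring
    have h3 : Complex.exp (-γ) * Complex.exp (-(-γ * ((1 - r : ℝ) : ℂ))) = Complex.exp (-(γ * r)) := by
      rw [← Complex.exp_add]
      congr 1
      push_cast
      ring
    have h4 : (W (2 * r) : ℂ) + W (2 - 2 * r) = 1 := by exact_mod_cast h1
    rw [h2, mul_left_comm, h3, ← add_mul, h4, one_mul]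
  · have := ((hint (-γ)).const_mul (Complex.exp (-γ))).comp_sub_left 1
    rw [sub_self, sub_zero] at this
    exact this.symm

theorem mul_integral_exp (γ : ℂ) : γ * ∫ r in (0 : ℝ)..1, Complex.exp (-(γ * r)) = 1 - Complex.exp (-γ) := by
  have hd (r : ℝ) : HasDerivAt (fun r : ℝ ↦ -Complex.exp (-(γ * r))) (γ * Complex.exp (-(γ * r))) r := by
    have h1 : HasDerivAt (fun r : ℝ ↦ -(γ * (r : ℂ))) (-(γ * 1)) r :=
      ((HasDerivAt.ofReal_comp (hasDerivAt_id r)).const_mul γ).neg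
    have := h1.cexp.neg
    convert! this using 1
    ring
  rw [← intervalIntegral.integral_const_mul, intervalIntegral.integral_eq_sub_of_hasDerivAt (fun r _ ↦ hd r)
    (Continuous.intervalIntegrable (by fun_prop) _ _)]
  simp
  ring

/-- The limit of the mollified second moment at scaled shifts. -/
def secondLimit (A B z : ℝ) (α β : ℂ) : ℂ :=
  (A + B * (α * β)) * (∫ r in (0 : ℝ)..1, Complex.exp (-((α + β) * r))) +
    z ^ 2 / 2 * (1 + Complex.exp (-(α + β)))

theorem tendsto_secondMain {W h h' : ℝ → ℝ} {ρ σ : ℝ → ℂ} {δ : ℝ} (hW : IsCutoff W δ) (hδ : δ < 1)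
    (hρ : IsLineDensity W ρ) (hρ0 : ∫ t, ρ t * lineC t = 0) (hW0 : W 0 = 1)
    (hσ : IsLineDensity h σ) (hσ' : IsLineDensity h' fun t ↦ -(lineC t * σ t)) {α β : ℂ}
    (hα : ‖α‖ ≤ 1 / 2) (hβ : ‖β‖ ≤ 1 / 2) : Tendsto (fun q : ℕ ↦ secondMain W h q α β) atTop
      (𝓝 (secondLimit (∫ r in Set.Ioi 0, h' r * h' r) (∫ r in Set.Ioi 0, h r * h r) (h 0) α β)) := by
  have hα' : ‖-α‖ ≤ 1 / 2 := by rwa [norm_neg]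
  have hβ' : ‖-β‖ ≤ 1 / 2 := by rwa [norm_neg]
  have h1 := tendsto_tsum_diagQuad hρ hσ hα hβ
  have h2 := tendsto_tsum_diagQuad hρ hσ hβ' hα'
  have h3 := ((tendsto_inv_Gammaℝ α).mul (tendsto_inv_Gammaℝ β)).mul (h1.add (h2.const_mul (Complex.exp (-(α + β)))))
  have hG : Complex.Gammaℝ (1 / 2) ≠ 0 := Complex.Gammaℝ_ne_zero_of_re_pos (by norm_num)
  have heq : (Complex.Gammaℝ (1 / 2))⁻¹ * (Complex.Gammaℝ (1 / 2))⁻¹ *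
      (Complex.Gammaℝ (1 / 2) ^ 2 * diagLimit ρ σ α β +
        Complex.exp (-(α + β)) * (Complex.Gammaℝ (1 / 2) ^ 2 * diagLimit ρ σ (-β) (-α))) =
      secondLimit (∫ r in Set.Ioi 0, h' r * h' r) (∫ r in Set.Ioi 0, h r * h r) (h 0) α β := by
    have e1 : (Complex.Gammaℝ (1 / 2))⁻¹ * (Complex.Gammaℝ (1 / 2))⁻¹ *
      (Complex.Gammaℝ (1 / 2) ^ 2 * diagLimit ρ σ α β +
        Complex.exp (-(α + β)) * (Complex.Gammaℝ (1 / 2) ^ 2 * diagLimit ρ σ (-β) (-α))) =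
        diagLimit ρ σ α β + Complex.exp (-(α + β)) * diagLimit ρ σ (-β) (-α) := by
      field_simp
    have hs := integral_cutoff_add hW hδ (α + β)
    have hm := mul_integral_exp (α + β)
    rw [e1, diagLimit_eq hρ hρ0 hW0 hσ hσ' hα hβ, diagLimit_eq hρ hρ0 hW0 hσ hσ' hβ' hα', secondLimit, ← hs]
    rw [← hs] at hm
    have e2 : -β + -α = -(α + β) := by ring
    have e3 : -β - -α = α - β := by ring
    rw [e2, e3]
    generalize (∫ r in Set.Ioi (0 : ℝ), (W (2 * r) : ℂ) * Complex.exp (-((α + β) * r))) = ω₁ at *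
    generalize (∫ r in Set.Ioi (0 : ℝ), (W (2 * r) : ℂ) * Complex.exp (-(-(α + β) * r))) = ω₂ at *
    generalize ((∫ r in Set.Ioi 0, h r * h r : ℝ) : ℂ) = B at *
    -- The boundary terms `± (α + β)/4` combine to `(α + β)(1 - e^{-(α+β)})/4`, which is `(α +
    -- β)²/4` times the glued integral. Subtracting `(α - β)²/4` times the same integral leaves
    -- `αβ`.
    linear_combination (-B * (α + β) / 4) * hm
  rw [heq] at h3
  exact h3
end


/-! ### Derivatives by Cauchy's formula on a circle, and complex conjugation. -/

noncomputable section

open Finset DirichletCharacter Real Filter Topology MeasureTheory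
open scoped ENNReal ComplexConjugate

set_option linter.unusedSectionVars false

/-- The parametrization of the circle of radius `1/2`. -/
def circlePt (t : ℝ) : ℂ := circleMap 0 (1 / 2) t

/-- The measure on the parameters of the circle. -/
def circleMeasure : Measure ℝ := volume.restrict (Set.Ioc 0 (2 * π))

instance : IsFiniteMeasure circleMeasure := by unfold circleMeasure; infer_instance

/-- The weight extracting the `k`-th derivative at the centre. -/
def circleWeight (k : ℕ) (t : ℝ) : ℂ := (k.factorial / (2 * π) : ℂ) * (circlePt t)⁻¹ ^ k

theorem norm_circlePt (t : ℝ) : ‖circlePt t‖ = 1 / 2 := by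
  rw [circlePt, norm_circleMap_zero, abs_of_pos (by norm_num)]

theorem circlePt_ne_zero (t : ℝ) : circlePt t ≠ 0 := by
  rw [← norm_pos_iff, norm_circlePt]; norm_num

theorem continuous_circlePt : Continuous circlePt := continuous_circleMap 0 (1 / 2)

theorem continuous_circleWeight (k : ℕ) : Continuous (circleWeight k) := by
  have := continuous_circlePt.inv₀ circlePt_ne_zero
  exact continuous_const.mul (this.pow k)

theorem norm_circleWeight_le (k : ℕ) (t : ℝ) : ‖circleWeight k t‖ ≤ k.factorial * 2 ^ k := by
  rw [circleWeight, norm_mul, norm_div, norm_pow, norm_inv, norm_circlePt, Complex.norm_natCast, norm_mul,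
    Complex.norm_ofNat, Complex.norm_real, norm_of_nonneg pi_pos.le]
  rw [one_div, inv_inv]
  gcongr
  exact div_le_self (by positivity) (by linarith [pi_gt_three])

/-- Cauchy's formula in the parameter of a circle that does not shrink with `q` in the scaled
variable. Derivatives then become bounded averages, which pass to the limit by dominated
convergence. -/
theorem integral_circleWeight_mul (k : ℕ) {f : ℂ → ℂ} (hf : Differentiable ℂ f) :
    ∫ t, circleWeight k t * f (circlePt t) ∂circleMeasure = iteratedDeriv k f 0 := by
  have h := (hf.differentiableOn (s := Metric.closedBall 0 (1 / 2))).circleIntegral_one_div_sub_center_pow_smul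
    (by norm_num) k
  have hI : (2 * π * Complex.I : ℂ) ≠ 0 := Complex.two_pi_I_ne_zero
  have hk : (k.factorial : ℂ) ≠ 0 := by exact_mod_cast k.factorial_ne_zero
  have h2 : iteratedDeriv k f 0 = (k.factorial / (2 * π * Complex.I) : ℂ) *
      ∮ z in C(0, 1 / 2), (1 / (z - 0) ^ (k + 1)) • f z := by
    rw [h, smul_eq_mul]; field_simp
  rw [h2, circleIntegral, intervalIntegral.integral_of_le (by positivity), circleMeasure, ← integral_const_mul]
  refine setIntegral_congr_fun measurableSet_Ioc fun t _ ↦ ?_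
  have h0 := circlePt_ne_zero t
  have hπ : (π : ℂ) ≠ 0 := by exact_mod_cast pi_ne_zero
  simp only [deriv_circleMap, smul_eq_mul, sub_zero, circleWeight]
  change _ = _ * (circlePt t * Complex.I * (1 / circlePt t ^ (k + 1) * f (circlePt t)))
  rw [pow_succ, inv_pow]
  field_simp

theorem integral_circleWeight_exp (k : ℕ) (c : ℂ) :
    ∫ t, circleWeight k t * Complex.exp (c * circlePt t) ∂circleMeasure = c ^ k := by
  rw [integral_circleWeight_mul k (f := fun z ↦ Complex.exp (c * z)) (by fun_prop), iteratedDeriv_cexp_const_mul]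
  simp

theorem integral_circleWeight_mul_exp {k : ℕ} (hk : k ≠ 0) (c : ℂ) :
    ∫ t, circleWeight k t * (circlePt t * Complex.exp (c * circlePt t)) ∂circleMeasure = k * c ^ (k - 1) := by
  obtain ⟨j, rfl⟩ := Nat.exists_eq_succ_of_ne_zero hk
  rw [← integral_circleWeight_exp, ← integral_const_mul]
  refine integral_congr_ae (Eventually.of_forall fun t ↦ ?_)
  have h0 := circlePt_ne_zero t
  simp only [circleWeight, Nat.succ_eq_add_one, Nat.add_sub_cancel, Nat.factorial_succ, inv_pow, pow_succ]
  push_cast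
  field_simp

theorem integral_circleWeight {k : ℕ} (hk : k ≠ 0) : ∫ t, circleWeight k t ∂circleMeasure = 0 := by
  have := integral_circleWeight_exp k 0
  simpa [hk] using this

theorem integrable_circleMeasure {f : ℝ → ℂ} (hf : Continuous f) : Integrable f circleMeasure :=
  (hf.integrableOn_Icc (a := 0) (b := 2 * π)).mono_set Set.Ioc_subset_Icc_self

/-- The `k`-th derivatives at `0` of `e^{-αr}` and `α e^{-αr}` are `(-r)^k` and `k (-r)^{k-1}`.
Squaring and integrating over `[0, 1]` gives `1/(2k+1)` and `k²/(2k-1)`. In the last term the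
constant `1` is killed because `k ≠ 0`, and the exponential contributes `1`. -/
theorem integral_secondLimit (A B z : ℝ) {k : ℕ} (hk : k ≠ 0) :
    ∫ p : ℝ × ℝ, circleWeight k p.1 * circleWeight k p.2 * secondLimit A B z (circlePt p.1) (circlePt p.2)
      ∂(circleMeasure.prod circleMeasure) =
    ((A / (2 * k + 1) + B * k ^ 2 / (2 * k - 1) + z ^ 2 / 2 : ℝ) : ℂ) := by
  have hw := continuous_circleWeight k
  have hp := continuous_circlePt
  have hprod {f : ℝ × ℝ → ℂ} (hf : Continuous f) : Integrable f (circleMeasure.prod circleMeasure) := by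
    have h1 : IntegrableOn f (Set.Icc 0 (2 * π) ×ˢ Set.Icc 0 (2 * π)) :=
      hf.continuousOn.integrableOn_compact (isCompact_Icc.prod isCompact_Icc)
    have h2 := h1.mono_set (Set.prod_mono Set.Ioc_subset_Icc_self Set.Ioc_subset_Icc_self)
    rwa [IntegrableOn, Measure.volume_eq_prod, ← Measure.prod_restrict] at h2
  have hE (r : ℝ) : ∫ p : ℝ × ℝ, circleWeight k p.1 * circleWeight k p.2 *
      ((A + B * (circlePt p.1 * circlePt p.2)) * Complex.exp (-((circlePt p.1 + circlePt p.2) * r)))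
      ∂(circleMeasure.prod circleMeasure) = ((A * r ^ (2 * k) + B * (k ^ 2 * r ^ (2 * (k - 1))) : ℝ) : ℂ) := by
    have h1 := integral_circleWeight_exp k (-(r : ℂ))
    have h2 := integral_circleWeight_mul_exp hk (-(r : ℂ))
    have h3 : ∫ p : ℝ × ℝ, circleWeight k p.1 * circleWeight k p.2 *
      ((A + B * (circlePt p.1 * circlePt p.2)) * Complex.exp (-((circlePt p.1 + circlePt p.2) * r)))
      ∂(circleMeasure.prod circleMeasure) =
      ∫ p : ℝ × ℝ, (A * ((circleWeight k p.1 * Complex.exp (-(r : ℂ) * circlePt p.1)) *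
        (circleWeight k p.2 * Complex.exp (-(r : ℂ) * circlePt p.2))) +
      B * ((circleWeight k p.1 * (circlePt p.1 * Complex.exp (-(r : ℂ) * circlePt p.1))) *
        (circleWeight k p.2 * (circlePt p.2 * Complex.exp (-(r : ℂ) * circlePt p.2)))))
      ∂(circleMeasure.prod circleMeasure) := by
      refine integral_congr_ae (Eventually.of_forall fun p ↦ ?_)
      have : Complex.exp (-((circlePt p.1 + circlePt p.2) * r)) = Complex.exp (-(r : ℂ) * circlePt p.1) *
          Complex.exp (-(r : ℂ) * circlePt p.2) := by
        rw [← Complex.exp_add]; congr 1; ring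
      simp only [this]
      ring
    rw [h3, integral_add (hprod (by fun_prop)) (hprod (by fun_prop)), integral_const_mul, integral_const_mul,
      integral_prod_mul (fun t ↦ circleWeight k t * Complex.exp (-(r : ℂ) * circlePt t))
        (fun t ↦ circleWeight k t * Complex.exp (-(r : ℂ) * circlePt t)),
      integral_prod_mul (fun t ↦ circleWeight k t * (circlePt t * Complex.exp (-(r : ℂ) * circlePt t)))
        (fun t ↦ circleWeight k t * (circlePt t * Complex.exp (-(r : ℂ) * circlePt t))), h1, h2]
    push_cast
    rw [← pow_add, ← two_mul, (even_two_mul k).neg_pow]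
    have : (k : ℂ) * (-(r : ℂ)) ^ (k - 1) * (k * (-(r : ℂ)) ^ (k - 1)) = k ^ 2 * (r : ℂ) ^ (2 * (k - 1)) := by
      rw [← (even_two_mul (k - 1)).neg_pow (r : ℂ), two_mul (k - 1), pow_add]; ring
    rw [this]
  have hE2 : ∫ p : ℝ × ℝ, circleWeight k p.1 * circleWeight k p.2 *
      ((z : ℂ) ^ 2 / 2 * (1 + Complex.exp (-(circlePt p.1 + circlePt p.2)))) ∂(circleMeasure.prod circleMeasure) =
      ((z ^ 2 / 2 : ℝ) : ℂ) := by
    have h1 := integral_circleWeight_exp k (-1)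
    have h2 := integral_circleWeight hk
    have h3 : ∫ p : ℝ × ℝ, circleWeight k p.1 * circleWeight k p.2 *
      ((z : ℂ) ^ 2 / 2 * (1 + Complex.exp (-(circlePt p.1 + circlePt p.2)))) ∂(circleMeasure.prod circleMeasure) =
      ∫ p : ℝ × ℝ, ((z : ℂ) ^ 2 / 2 * (circleWeight k p.1 * circleWeight k p.2) +
        (z : ℂ) ^ 2 / 2 * ((circleWeight k p.1 * Complex.exp (-1 * circlePt p.1)) *
        (circleWeight k p.2 * Complex.exp (-1 * circlePt p.2)))) ∂(circleMeasure.prod circleMeasure) := by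
      refine integral_congr_ae (Eventually.of_forall fun p ↦ ?_)
      have : Complex.exp (-(circlePt p.1 + circlePt p.2)) = Complex.exp (-1 * circlePt p.1) *
          Complex.exp (-1 * circlePt p.2) := by
        rw [← Complex.exp_add]; congr 1; ring
      simp only [this]
      ring
    rw [h3, integral_add (hprod (by fun_prop)) (hprod (by fun_prop)), integral_const_mul, integral_const_mul,
      integral_prod_mul (circleWeight k) (circleWeight k),
      integral_prod_mul (fun t ↦ circleWeight k t * Complex.exp (-1 * circlePt t))
        (fun t ↦ circleWeight k t * Complex.exp (-1 * circlePt t)), h1, h2, ← pow_add, ← two_mul,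
      (even_two_mul k).neg_pow]
    push_cast
    simp
  have hEc : Continuous fun p : ℝ × ℝ ↦ ∫ r in (0 : ℝ)..1, Complex.exp (-((circlePt p.1 + circlePt p.2) * r)) :=
    intervalIntegral.continuous_parametric_intervalIntegral_of_continuous' (by unfold Function.uncurry; fun_prop) 0 1
  have hswap : ∫ p : ℝ × ℝ, circleWeight k p.1 * circleWeight k p.2 *
      ((A + B * (circlePt p.1 * circlePt p.2)) * ∫ r in (0 : ℝ)..1, Complex.exp (-((circlePt p.1 + circlePt p.2) * r)))
      ∂(circleMeasure.prod circleMeasure) =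
      ∫ r in (0 : ℝ)..1, ((A * r ^ (2 * k) + B * (k ^ 2 * r ^ (2 * (k - 1))) : ℝ) : ℂ) := by
    simp only [← hE]
    rw [intervalIntegral.integral_of_le zero_le_one]
    simp only [intervalIntegral.integral_of_le (zero_le_one' ℝ), ← integral_const_mul]
    refine integral_integral_swap ?_
    have hc : Continuous fun x : (ℝ × ℝ) × ℝ ↦ circleWeight k x.1.1 * circleWeight k x.1.2 *
        ((A + B * (circlePt x.1.1 * circlePt x.1.2)) * Complex.exp (-((circlePt x.1.1 + circlePt x.1.2) * x.2))) := by
      fun_prop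
    have h1 : IntegrableOn (fun x : (ℝ × ℝ) × ℝ ↦ circleWeight k x.1.1 * circleWeight k x.1.2 *
        ((A + B * (circlePt x.1.1 * circlePt x.1.2)) * Complex.exp (-((circlePt x.1.1 + circlePt x.1.2) * x.2))))
        ((Set.Icc 0 (2 * π) ×ˢ Set.Icc 0 (2 * π)) ×ˢ Set.Icc 0 1) :=
      hc.continuousOn.integrableOn_compact ((isCompact_Icc.prod isCompact_Icc).prod isCompact_Icc)
    have h2 := h1.mono_set (Set.prod_mono (Set.prod_mono Set.Ioc_subset_Icc_self Set.Ioc_subset_Icc_self)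
      Set.Ioc_subset_Icc_self)
    rwa [IntegrableOn, Measure.volume_eq_prod, ← Measure.prod_restrict, Measure.volume_eq_prod,
      ← Measure.prod_restrict] at h2
  have hsplit : ∫ p : ℝ × ℝ, circleWeight k p.1 * circleWeight k p.2 * secondLimit A B z (circlePt p.1) (circlePt p.2)
      ∂(circleMeasure.prod circleMeasure) =
      (∫ p : ℝ × ℝ, circleWeight k p.1 * circleWeight k p.2 *
      ((A + B * (circlePt p.1 * circlePt p.2)) * ∫ r in (0 : ℝ)..1, Complex.exp (-((circlePt p.1 + circlePt p.2) * r)))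
      ∂(circleMeasure.prod circleMeasure)) + ∫ p : ℝ × ℝ, circleWeight k p.1 * circleWeight k p.2 *
      ((z : ℂ) ^ 2 / 2 * (1 + Complex.exp (-(circlePt p.1 + circlePt p.2)))) ∂(circleMeasure.prod circleMeasure) := by
    rw [← integral_add (hprod (by fun_prop)) (hprod (by fun_prop))]
    refine integral_congr_ae (Eventually.of_forall fun p ↦ ?_)
    simp only [secondLimit]
    ring
  rw [hsplit, hswap, hE2, intervalIntegral.integral_ofReal, ← Complex.ofReal_add]
  congr 1
  rw [intervalIntegral.integral_add (Continuous.intervalIntegrable (by fun_prop) _ _)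
    (Continuous.intervalIntegrable (by fun_prop) _ _), intervalIntegral.integral_const_mul,
    intervalIntegral.integral_const_mul, intervalIntegral.integral_const_mul, integral_pow, integral_pow]
  have hk1 : (1 : ℝ) ≤ k := by exact_mod_cast Nat.one_le_iff_ne_zero.mpr hk
  have e1 : (2 * (k - 1) : ℕ) + (1 : ℝ) = 2 * k - 1 := by
    have : 1 ≤ k := Nat.one_le_iff_ne_zero.mpr hk
    push_cast [this]
    ring
  rw [e1]
  push_cast
  simp
  ring

section
variable {q : ℕ} [NeZero q]

theorem conj_two : conj (2 : ℂ) = 2 := Complex.conj_ofNat 2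

theorem conj_Gammaℝ (s : ℂ) : conj (Complex.Gammaℝ s) = Complex.Gammaℝ (conj s) := by
  rw [Complex.Gammaℝ_def, Complex.Gammaℝ_def, map_mul, ← Complex.Gamma_conj, map_div₀]
  rw [conj_two]
  congr 1
  have := Complex.cpow_conj (π : ℂ) (-s / 2) (by rw [Complex.arg_ofReal_of_nonneg pi_pos.le]; exact pi_ne_zero.symm)
  rw [Complex.conj_ofReal] at this
  rw [← this]
  simp [conj_two]

/-- The integral representation transfers the conjugation symmetry of the theta series to every `s`,
without analytic continuation. -/
theorem conj_LFunction (hq : 1 < q) {χ : DirichletCharacter ℂ q} (hχ : χ.Even) (hp : χ.IsPrimitive) (s : ℂ) :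
    conj (LFunction χ (conj s)) = LFunction χ⁻¹ s := by
  obtain ⟨a, rfl⟩ : ∃ a, s = 1 / 2 + a := ⟨s - 1 / 2, by ring⟩
  have hs : conj (1 / 2 + a) = 1 / 2 + conj a := by simp [conj_two]
  rw [hs, LFunction_eq_integral hq hχ hp, LFunction_eq_integral hq (inv_even hχ) (inv_isPrimitive hp), map_mul,
    map_mul, map_inv₀, conj_Gammaℝ, ← Complex.exp_conj, ← integral_conj]
  have e1 : conj (1 / 2 + conj a) = 1 / 2 + a := by simp [conj_two]
  have e2 : conj (-(1 / 4 + conj a / 2) * ((log q : ℝ) : ℂ)) = -(1 / 4 + a / 2) * ((log q : ℝ) : ℂ) := by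
    have h4 : conj (4 : ℂ) = 4 := Complex.conj_ofNat 4
    rw [map_mul, Complex.conj_ofReal]; simp [conj_two, h4]
  rw [e1, e2]
  congr 2
  refine integral_congr_ae (Eventually.of_forall fun x ↦ ?_)
  have h1 : conj (logTheta χ x) = logTheta χ⁻¹ x := conj_logTheta χ x
  simp only [map_mul, h1, ← Complex.exp_conj]
  simp [conj_two]

theorem iteratedDeriv_conj {f : ℂ → ℂ} (k : ℕ) : iteratedDeriv k (conj ∘ f ∘ conj) = conj ∘ iteratedDeriv k f ∘ conj := by
  induction k with
  | zero => simp
  | succ k ih => rw [iteratedDeriv_succ, iteratedDeriv_succ, ih, deriv_conj_conj]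

theorem iteratedDeriv_LFunction_inv (hq : 1 < q) {χ : DirichletCharacter ℂ q} (hχ : χ.Even) (hp : χ.IsPrimitive)
    (k : ℕ) : iteratedDeriv k (LFunction χ⁻¹) (1 / 2) = conj (iteratedDeriv k (LFunction χ) (1 / 2)) := by
  have h1 : LFunction χ⁻¹ = conj ∘ LFunction χ ∘ conj := by
    ext s; exact (conj_LFunction hq hχ hp s).symm
  rw [h1, iteratedDeriv_conj]
  simp [conj_two]

theorem integral_circleWeight_LFunction (hq : 1 < q) {χ : DirichletCharacter ℂ q} (hp : χ.IsPrimitive) (k : ℕ) :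
    ∫ t, circleWeight k t * LFunction χ (1 / 2 + circlePt t / log q) ∂circleMeasure =
      iteratedDeriv k (LFunction χ) (1 / 2) / log q ^ k := by
  have hd := differentiable_LFunction (ne_one_of_isPrimitive hq hp)
  rw [integral_circleWeight_mul k (f := fun z ↦ LFunction χ (1 / 2 + z / log q)) (by fun_prop)]
  have h1 : (fun z : ℂ ↦ LFunction χ (1 / 2 + z / (log q : ℝ))) =
      fun z ↦ (fun x ↦ LFunction χ (1 / 2 + x)) (((log q : ℝ) : ℂ)⁻¹ * z) := by
    ext z; simp only; congr 2; ring
  rw [h1, iteratedDeriv_comp_const_mul (h := (by fun_prop : Differentiable ℂ fun x ↦ LFunction χ (1 / 2 + x)).contDiff),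
    iteratedDeriv_comp_const_add]
  simp
  ring

theorem conj_mollifier (h : ℝ → ℝ) (χ : DirichletCharacter ℂ q) : conj (mollifier h χ) = mollifier h χ⁻¹ := by
  rw [mollifier, mollifier, map_sum]
  refine Finset.sum_congr rfl fun n _ ↦ ?_
  have h1 : conj (χ (n : ZMod q)) = χ⁻¹ (n : ZMod q) := conj_char χ n
  rw [map_mul, h1]
  congr 1
  rw [mollCoeff, map_mul, map_mul, Complex.conj_ofReal]
  congr 1
  · congr 1
    exact map_intCast (starRingEnd ℂ) _
  · have := Complex.cpow_conj (n : ℂ) (-(1 / 2) : ℂ) (by rw [Complex.natCast_arg]; exact pi_ne_zero.symm)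
    rw [Complex.conj_natCast] at this
    rw [← this]
    simp [conj_two]
end
end


/-! ### Mollified second moment of the derivatives. -/

noncomputable section

open Finset DirichletCharacter Real Filter Topology MeasureTheory
open scoped ENNReal ComplexConjugate

set_option linter.unusedSectionVars false

/-- The filter of moduli tending to infinity which admit even primitive characters. -/
def admissible : Filter ℕ+ := atTop ⊓ 𝓟 {q : ℕ+ | (evenPrim (q : ℕ)).Nonempty}

instance : admissible.IsCountablyGenerated := by unfold admissible; infer_instance

theorem tendsto_coe_admissible : Tendsto (fun q : ℕ+ ↦ (q : ℕ)) admissible atTop :=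
  tendsto_PNat_val_atTop_atTop.mono_left inf_le_left

theorem eventually_nonempty_admissible : ∀ᶠ q : ℕ+ in admissible, (evenPrim (q : ℕ)).Nonempty :=
  eventually_inf_principal.mpr (Eventually.of_forall fun _ h ↦ h)

theorem eventually_le_log_admissible (L : ℝ) : ∀ᶠ q : ℕ+ in admissible, L ≤ log (q : ℕ) :=
  (tendsto_log_natCast.comp tendsto_coe_admissible).eventually_ge_atTop L

theorem one_lt_of_log_pos {q : ℕ} (h : 0 < log q) : 1 < q := by
  by_contra hcon
  interval_cases q <;> simp at h

theorem tendsto_inv_card_mul {τ : ℝ} (hτ : 0 < τ) (C : ℝ) :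
    Tendsto (fun q : ℕ+ ↦ (#(evenPrim (q : ℕ)) : ℝ)⁻¹ * (C * ((q : ℕ) : ℝ) ^ (1 - τ))) admissible (𝓝 0) := by
  obtain ⟨K, hK, hc⟩ := exists_le_card_evenPrim (half_pos hτ)
  have h1 : Tendsto (fun q : ℕ+ ↦ K * |C| * ((q : ℕ) : ℝ) ^ (-(τ / 2))) admissible (𝓝 0) := by
    have := ((tendsto_rpow_neg_atTop (half_pos hτ)).comp
      (tendsto_natCast_atTop_atTop.comp tendsto_coe_admissible)).const_mul (K * |C|)
    rwa [mul_zero] at this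
  refine squeeze_zero_norm' ?_ h1
  filter_upwards [eventually_nonempty_admissible] with q hq
  have hN : (0 : ℝ) < #(evenPrim (q : ℕ)) := by exact_mod_cast hq.card_pos
  have hq0 : (0 : ℝ) < ((q : ℕ) : ℝ) := by exact_mod_cast q.pos
  have h2 := hc (q : ℕ) hq
  rw [norm_mul, norm_inv, norm_mul, Real.norm_natCast, Real.norm_eq_abs,
    norm_of_nonneg (rpow_nonneg hq0.le _), inv_mul_le_iff₀ hN]
  have h3 : ((q : ℕ) : ℝ) ^ (1 - τ) = ((q : ℕ) : ℝ) ^ (1 - τ / 2) * ((q : ℕ) : ℝ) ^ (-(τ / 2)) := by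
    rw [← rpow_add hq0]; congr 1; ring
  rw [h3]
  calc |C| * (((q : ℕ) : ℝ) ^ (1 - τ / 2) * ((q : ℕ) : ℝ) ^ (-(τ / 2)))
      ≤ |C| * ((K * #(evenPrim (q : ℕ))) * ((q : ℕ) : ℝ) ^ (-(τ / 2))) := by gcongr
    _ = _ := by ring

/-- The data from which the mollifier and the approximate functional equation are built. -/
structure MollifierData (θ δ H : ℝ) (W h h' : ℝ → ℝ) (ρ σ : ℝ → ℂ) : Prop where
  θ_pos : 0 < θ
  θ_lt : θ < 1 / 2
  δ_pos : 0 < δ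
  δ_le : δ ≤ (1 / 2 - θ) / 2
  cutoff : IsCutoff W δ
  cutoff_density : IsLineDensity W ρ
  integral_density : ∫ t, ρ t * lineC t = 0
  cutoff_zero : W 0 = 1
  density : IsLineDensity h σ
  deriv_density : IsLineDensity h' fun t ↦ -(lineC t * σ t)
  bound : ∀ x, |h x| ≤ H
  supp : ∀ x, θ ≤ x → h x = 0

theorem circleIntegrable_LFunction {q : ℕ} [NeZero q] (hq : 1 < q) {χ : DirichletCharacter ℂ q} (hp : χ.IsPrimitive)
    (k : ℕ) : Continuous fun t ↦ circleWeight k t * LFunction χ (1 / 2 + circlePt t / log q) := by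
  have hd := (differentiable_LFunction (ne_one_of_isPrimitive hq hp)).continuous
  have := continuous_circleWeight k
  have := continuous_circlePt
  fun_prop

/-- For fixed shifts the mean converges, and it is bounded uniformly on the torus `|α| = |β| = 1/2`;
integrating against the two Cauchy weights turns the product of L-values into the squared modulus of
the derivative. -/
theorem tendsto_secondMoment {θ δ H : ℝ} {W h h' : ℝ → ℝ} {ρ σ : ℝ → ℂ} (D : MollifierData θ δ H W h h' ρ σ)
    {k : ℕ} (hk : k ≠ 0) :
    Tendsto (fun q : ℕ+ ↦ (#(evenPrim (q : ℕ)) : ℝ)⁻¹ * ∑ χ ∈ evenPrim (q : ℕ),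
      ‖mollifier h χ‖ ^ 2 * ‖iteratedDeriv k (LFunction χ) (1 / 2) / log (q : ℕ) ^ k‖ ^ 2) admissible
      (𝓝 ((∫ r in Set.Ioi 0, h' r * h' r) / (2 * k + 1) + (∫ r in Set.Ioi 0, h r * h r) * k ^ 2 / (2 * k - 1) +
        h 0 ^ 2 / 2)) := by
  obtain ⟨C, L₀, hC, hL₀, hsub⟩ := exists_secondMoment_sub_le (H := H) D.θ_pos D.θ_lt D.δ_pos D.δ_le
  obtain ⟨C₂, hC₂, hmain⟩ := exists_norm_secondMain_le D.cutoff_density D.density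
  have hτ : 0 < (1 / 2 - θ) / 2 := by linarith [D.θ_lt]
  have herr := tendsto_inv_card_mul hτ C
  set S : ℕ+ → ℂ → ℂ → ℂ := fun q α β ↦ (#(evenPrim (q : ℕ)) : ℂ)⁻¹ * ∑ χ ∈ evenPrim (q : ℕ),
    mollifier h χ * mollifier h χ⁻¹ *
        (LFunction χ (1 / 2 + α / log (q : ℕ)) * LFunction χ⁻¹ (1 / 2 + β / log (q : ℕ))) with hS
  have hdiff : ∀ᶠ q : ℕ+ in admissible, ∀ α β : ℂ, ‖α‖ ≤ 1 / 2 → ‖β‖ ≤ 1 / 2 →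
      ‖S q α β - secondMain W h q α β‖ ≤
        (#(evenPrim (q : ℕ)) : ℝ)⁻¹ * (C * ((q : ℕ) : ℝ) ^ (1 - (1 / 2 - θ) / 2)) := by
    filter_upwards [eventually_nonempty_admissible, eventually_le_log_admissible L₀] with q hq hL α β hα hβ
    have hN : (#(evenPrim (q : ℕ)) : ℂ) ≠ 0 := by exact_mod_cast hq.card_pos.ne'
    have h1 := hsub W h ρ σ (q : ℕ) α β D.cutoff D.cutoff_density D.density D.bound D.supp hL hα hβ
    have h2 : S q α β - secondMain W h q α β = (#(evenPrim (q : ℕ)) : ℂ)⁻¹ * (∑ χ ∈ evenPrim (q : ℕ),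
        mollifier h χ * mollifier h χ⁻¹ *
        (LFunction χ (1 / 2 + α / log (q : ℕ)) * LFunction χ⁻¹ (1 / 2 + β / log (q : ℕ))) -
        #(evenPrim (q : ℕ)) * secondMain W h q α β) := by
      rw [mul_sub, inv_mul_cancel_left₀ hN]
    rw [h2, norm_mul, norm_inv, Complex.norm_natCast]
    gcongr
  have hlim (α β : ℂ) (hα : ‖α‖ ≤ 1 / 2) (hβ : ‖β‖ ≤ 1 / 2) : Tendsto (fun q ↦ S q α β) admissible
      (𝓝 (secondLimit (∫ r in Set.Ioi 0, h' r * h' r) (∫ r in Set.Ioi 0, h r * h r) (h 0) α β)) := by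
    have h1 := (tendsto_secondMain D.cutoff (by linarith [D.δ_le, D.θ_pos]) D.cutoff_density D.integral_density
      D.cutoff_zero D.density D.deriv_density hα hβ).comp tendsto_coe_admissible
    have h2 : Tendsto (fun q : ℕ+ ↦ S q α β - secondMain W h q α β) admissible (𝓝 0) := by
      refine squeeze_zero_norm' ?_ herr
      filter_upwards [hdiff] with q hq
      exact hq α β hα hβ
    have h3 := h2.add h1
    rw [zero_add] at h3
    exact h3.congr fun q ↦ by simp
  have hSbound : ∀ᶠ q : ℕ+ in admissible, ∀ α β : ℂ, ‖α‖ ≤ 1 / 2 → ‖β‖ ≤ 1 / 2 → ‖S q α β‖ ≤ 1 + C₂ := by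
    filter_upwards [hdiff, eventually_le_log_admissible 2, herr.eventually_le_const zero_lt_one] with q h1 h2 h3 α β hα hβ
    have h4 := norm_add_le (S q α β - secondMain W h q α β) (secondMain W h q α β)
    rw [sub_add_cancel] at h4
    linarith [h1 α β hα hβ, hmain q α β h2 hα hβ]
  have hcont : ∀ᶠ q : ℕ+ in admissible, Continuous fun p : ℝ × ℝ ↦
      circleWeight k p.1 * circleWeight k p.2 * S q (circlePt p.1) (circlePt p.2) := by
    filter_upwards [eventually_le_log_admissible 1] with q hL
    have hq1 : 1 < (q : ℕ) := one_lt_of_log_pos (by linarith)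
    have hw := continuous_circleWeight k
    have hp := continuous_circlePt
    refine ((hw.comp continuous_fst).mul (hw.comp continuous_snd)).mul (continuous_const.mul
      (continuous_finsetSum _ fun χ hχ ↦ continuous_const.mul ?_))
    have hχ := mem_evenPrim.mp hχ
    have hd := (differentiable_LFunction (ne_one_of_isPrimitive hq1 hχ.1)).continuous
    have hd' := (differentiable_LFunction (ne_one_of_isPrimitive hq1 (inv_isPrimitive hχ.1))).continuous
    fun_prop
  have hDCT : Tendsto (fun q : ℕ+ ↦ ∫ p : ℝ × ℝ, circleWeight k p.1 * circleWeight k p.2 *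
      S q (circlePt p.1) (circlePt p.2) ∂(circleMeasure.prod circleMeasure)) admissible
      (𝓝 (∫ p : ℝ × ℝ, circleWeight k p.1 * circleWeight k p.2 * secondLimit (∫ r in Set.Ioi 0, h' r * h' r)
        (∫ r in Set.Ioi 0, h r * h r) (h 0) (circlePt p.1) (circlePt p.2) ∂(circleMeasure.prod circleMeasure))) := by
    refine tendsto_integral_filter_of_dominated_convergence
      (fun _ ↦ (k.factorial * 2 ^ k) * (k.factorial * 2 ^ k) * (1 + C₂)) ?_ ?_ (integrable_const _) ?_
    · filter_upwards [hcont] with q hq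
      exact hq.aestronglyMeasurable
    · filter_upwards [hSbound] with q hq
      refine Eventually.of_forall fun p ↦ ?_
      rw [norm_mul, norm_mul]
      exact mul_le_mul (mul_le_mul (norm_circleWeight_le k _) (norm_circleWeight_le k _) (norm_nonneg _)
        (by positivity)) (hq _ _ (norm_circlePt _).le (norm_circlePt _).le) (norm_nonneg _) (by positivity)
    · exact Eventually.of_forall fun p ↦ (hlim _ _ (norm_circlePt _).le (norm_circlePt _).le).const_mul _
  rw [integral_secondLimit _ _ _ hk] at hDCT
  have hre := (Complex.continuous_re.tendsto _).comp hDCT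
  rw [Complex.ofReal_re] at hre
  refine hre.congr' ?_
  filter_upwards [eventually_le_log_admissible 1] with q hL
  have hq1 : 1 < (q : ℕ) := one_lt_of_log_pos (by linarith)
  have hp := continuous_circlePt
  have hval : ∫ p : ℝ × ℝ, circleWeight k p.1 * circleWeight k p.2 *
      S q (circlePt p.1) (circlePt p.2) ∂(circleMeasure.prod circleMeasure) =
      (((#(evenPrim (q : ℕ)) : ℝ)⁻¹ * ∑ χ ∈ evenPrim (q : ℕ),
      ‖mollifier h χ‖ ^ 2 * ‖iteratedDeriv k (LFunction χ) (1 / 2) / log (q : ℕ) ^ k‖ ^ 2 : ℝ) : ℂ) := by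
    have e1 : ∀ p : ℝ × ℝ, circleWeight k p.1 * circleWeight k p.2 * S q (circlePt p.1) (circlePt p.2) =
        (#(evenPrim (q : ℕ)) : ℂ)⁻¹ * ∑ χ ∈ evenPrim (q : ℕ), mollifier h χ * mollifier h χ⁻¹ *
        ((circleWeight k p.1 * LFunction χ (1 / 2 + circlePt p.1 / log (q : ℕ))) *
          (circleWeight k p.2 * LFunction χ⁻¹ (1 / 2 + circlePt p.2 / log (q : ℕ)))) := by
      intro p
      simp only [hS]
      rw [mul_left_comm, Finset.mul_sum]
      congr 1
      refine Finset.sum_congr rfl fun χ _ ↦ ?_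
      ring
    simp only [e1]
    rw [integral_const_mul, integral_finsetSum]
    · rw [Complex.ofReal_mul, Complex.ofReal_inv, Complex.ofReal_natCast, Complex.ofReal_sum]
      congr 1
      refine Finset.sum_congr rfl fun χ hχ ↦ ?_
      have hχ := mem_evenPrim.mp hχ
      rw [Complex.ofReal_mul, Complex.ofReal_pow, Complex.ofReal_pow, integral_const_mul, integral_prod_mul
        (fun t ↦ circleWeight k t * LFunction χ (1 / 2 + circlePt t / log (q : ℕ)))
        (fun t ↦ circleWeight k t * LFunction χ⁻¹ (1 / 2 + circlePt t / log (q : ℕ))),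
        integral_circleWeight_LFunction hq1 hχ.1, integral_circleWeight_LFunction hq1 (inv_isPrimitive hχ.1),
        iteratedDeriv_LFunction_inv hq1 hχ.2 hχ.1, ← conj_mollifier, ← Complex.mul_conj', ← Complex.mul_conj',
        map_div₀, map_pow, Complex.conj_ofReal]
    · intro χ hχ
      have hχ := mem_evenPrim.mp hχ
      exact ((integrable_circleMeasure (circleIntegrable_LFunction hq1 hχ.1 k)).mul_prod
        (integrable_circleMeasure (circleIntegrable_LFunction hq1 (inv_isPrimitive hχ.1) k))).const_mul _
  simp only [Function.comp_apply, hval, Complex.ofReal_re]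
end


/-! ### Truncated theta integral for the first moment. -/

noncomputable section

open Finset DirichletCharacter Real Filter Topology MeasureTheory
open scoped ENNReal

set_option linter.unusedSectionVars false

theorem exists_integral_thetaBound_le : ∃ C : ℝ, 0 < C ∧ ∀ (ℓ σ : ℝ) (n : ℕ), n ≠ 0 → 1 / 8 ≤ σ → σ ≤ 1 →
    ∫ x, thetaBound ℓ σ n x ≤ C * (n : ℝ) ^ (-2 * σ) * exp (σ * ℓ) := by
  have hc : ContinuousOn Real.Gamma (Set.Icc (1 / 8) 1) := fun x hx ↦
    (Real.differentiableAt_Gamma fun m h ↦ by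
      have := hx.1; rw [h] at this; linarith [(m.cast_nonneg : (0 : ℝ) ≤ m)]).continuousAt.continuousWithinAt
  obtain ⟨C, hC⟩ := (isCompact_Icc (a := (1 / 8 : ℝ)) (b := 1)).bddAbove_image hc
  have hC' : ∀ x ∈ Set.Icc (1 / 8 : ℝ) 1, Real.Gamma x ≤ C := fun x hx ↦ hC ⟨x, hx, rfl⟩
  have hC0 : 0 < C := lt_of_lt_of_le (Real.Gamma_pos_of_pos one_pos) (hC' 1 ⟨by norm_num, le_rfl⟩)
  refine ⟨C, hC0, fun ℓ σ n hn h1 h2 ↦ ?_⟩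
  rw [integral_thetaBound hn (by linarith)]
  have h3 : (2 / π) ^ σ ≤ 1 := rpow_le_one (by positivity) (by
    rw [div_le_one pi_pos]; linarith [pi_gt_three]) (by linarith)
  have h4 := (Real.Gamma_pos_of_pos (by linarith : 0 < σ)).le
  gcongr
  calc (2 / π) ^ σ * Real.Gamma σ ≤ 1 * C := mul_le_mul h3 (hC' σ ⟨h1, h2⟩) h4 zero_le_one
    _ = C := one_mul C

theorem norm_thetaTerm (ℓ : ℝ) (a : ℂ) (n : ℕ) (x : ℝ) :
    ‖thetaTerm ℓ a n x‖ = exp ((1 / 4 + a.re / 2) * x) * exp (-(π * n ^ 2 * exp (-ℓ) * exp x)) := by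
  rw [thetaTerm, norm_mul, Complex.norm_exp, Complex.norm_real, norm_of_nonneg (exp_pos _).le]
  simp

/-- Part of the theta exponent, minimal at `x = -X`, is extracted as a cutoff confining `n²` to
`e^{ℓ+X}`; half of the exponent is kept for integrability. -/
theorem norm_thetaTerm_le_thetaBound {ℓ X x : ℝ} (a : ℂ) (n : ℕ) (hx : -X ≤ x) :
    ‖thetaTerm ℓ a n x‖ ≤ exp (-(n ^ 2 * exp (-(ℓ + X)))) * thetaBound ℓ (1 / 4 + a.re / 2) n x := by
  rw [norm_thetaTerm, thetaBound, mul_left_comm]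
  refine mul_le_mul_of_nonneg_left ?_ (exp_pos _).le
  rw [← exp_add]
  apply exp_le_exp.mpr
  have h1 : exp (-(ℓ + X)) ≤ exp (-ℓ) * exp x := by
    rw [← exp_add]; gcongr; linarith
  have h2 : (n : ℝ) ^ 2 * exp (-(ℓ + X)) ≤ n ^ 2 * (exp (-ℓ) * exp x) := by gcongr
  have h3 : 0 ≤ (n : ℝ) ^ 2 * (exp (-ℓ) * exp x) := by positivity
  nlinarith [pi_gt_three]

/-- The `n`-th coefficient of the truncated theta integral. -/
def cutTerm (X ℓ : ℝ) (a : ℂ) (n : ℕ) : ℂ :=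
  Complex.exp (-(1 / 4 + a / 2) * ℓ) * ∫ x in Set.Ioi (-X), thetaTerm ℓ a n x

theorem norm_exp_quarter (a : ℂ) (ℓ : ℝ) :
    ‖Complex.exp (-(1 / 4 + a / 2) * ℓ)‖ = exp (-(1 / 4 + a.re / 2) * ℓ) := by
  rw [Complex.norm_exp]
  simp

theorem exists_integral_norm_thetaTerm_le {e : ℝ} (he : 0 < e) : ∃ C : ℝ, 0 < C ∧ ∀ (X ℓ : ℝ) (a : ℂ) (n : ℕ),
    2 ≤ ℓ → 1 / (2 * ℓ) ≤ e → |a.re| ≤ 1 / (2 * ℓ) → n ≠ 0 →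
    exp (-(1 / 4 + a.re / 2) * ℓ) * ∫ x in Set.Ioi (-X), ‖thetaTerm ℓ a n x‖ ≤
      C * exp ((ℓ + X) * (1 / 4 + e)) * (n : ℝ) ^ (-(1 + e)) := by
  obtain ⟨C, hC, hB⟩ := exists_integral_thetaBound_le
  set κ := 1 / 4 + e with hκ
  have hκ0 : 0 < κ := by positivity
  refine ⟨C * κ ^ κ, by positivity, fun X ℓ a n hℓ hℓe ha hn ↦ ?_⟩
  have h4 : 1 / (2 * ℓ) ≤ 1 / 4 := by apply one_div_le_one_div_of_le <;> linarith
  have ha' := abs_le.mp ha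
  have hn1 : (1 : ℝ) ≤ n := by exact_mod_cast Nat.one_le_iff_ne_zero.mpr hn
  have hn0 : (0 : ℝ) < n := by linarith
  set σ := 1 / 4 + a.re / 2 with hσ
  have hσ0 : 0 < σ := by linarith
  have hint := integrable_thetaBound (ℓ := ℓ) hn hσ0
  have h1 : ∫ x in Set.Ioi (-X), ‖thetaTerm ℓ a n x‖ ≤
      exp (-(n ^ 2 * exp (-(ℓ + X)))) * (C * (n : ℝ) ^ (-2 * σ) * exp (σ * ℓ)) := by
    calc _ ≤ ∫ x in Set.Ioi (-X), exp (-(n ^ 2 * exp (-(ℓ + X)))) * thetaBound ℓ σ n x := by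
          refine setIntegral_mono_on (integrable_thetaTerm (ℓ := ℓ) (a := a) hn (by linarith)).norm.integrableOn
            (hint.const_mul _).integrableOn measurableSet_Ioi fun x hx ↦ ?_
          exact norm_thetaTerm_le_thetaBound a n (le_of_lt hx)
      _ ≤ ∫ x, exp (-(n ^ 2 * exp (-(ℓ + X)))) * thetaBound ℓ σ n x :=
          setIntegral_le_integral (hint.const_mul _) (Eventually.of_forall fun x ↦ by
            unfold thetaBound; positivity)
      _ ≤ _ := by
          rw [integral_const_mul]
          gcongr
          exact hB ℓ σ n hn (by linarith) (by linarith)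
  have h2 : exp (-(n ^ 2 * exp (-(ℓ + X)))) ≤ κ ^ κ * ((n : ℝ) ^ (-(2 * κ)) * exp ((ℓ + X) * κ)) := by
    refine (rpow_le_mul_exp hκ0 (by positivity)).trans_eq ?_
    rw [mul_rpow (by positivity) (exp_pos _).le, ← exp_mul, ← rpow_natCast, ← rpow_mul hn0.le]
    congr 3
    · push_cast; ring
    · ring
  have h3 : (n : ℝ) ^ (-2 * σ) ≤ (n : ℝ) ^ (-1 / 2 + e) := rpow_le_rpow_of_exponent_le hn1 (by linarith)
  calc _ ≤ exp (-σ * ℓ) * ((κ ^ κ * ((n : ℝ) ^ (-(2 * κ)) * exp ((ℓ + X) * κ))) *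
        (C * (n : ℝ) ^ (-1 / 2 + e) * exp (σ * ℓ))) := by
        refine mul_le_mul_of_nonneg_left (h1.trans ?_) (exp_pos _).le
        gcongr
    _ = C * κ ^ κ * exp ((ℓ + X) * κ) * ((n : ℝ) ^ (-(2 * κ)) * (n : ℝ) ^ (-1 / 2 + e)) *
        (exp (-σ * ℓ) * exp (σ * ℓ)) := by ring
    _ = _ := by
        rw [← exp_add, ← rpow_add hn0, hκ]
        have e1 : -σ * ℓ + σ * ℓ = 0 := by ring
        have e2 : -(2 * (1 / 4 + e)) + (-1 / 2 + e) = -(1 + e) := by ring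
        rw [e1, e2, exp_zero, mul_one]

theorem norm_cutTerm_le (X ℓ : ℝ) (a : ℂ) (n : ℕ) :
    ‖cutTerm X ℓ a n‖ ≤ exp (-(1 / 4 + a.re / 2) * ℓ) * ∫ x in Set.Ioi (-X), ‖thetaTerm ℓ a n x‖ := by
  rw [cutTerm, norm_mul, norm_exp_quarter]
  gcongr
  exact norm_integral_le_integral_norm _

theorem char_zero {q : ℕ} (hq : 1 < q) (χ : DirichletCharacter ℂ q) : χ ((0 : ℕ) : ZMod q) = 0 := by
  have := Fact.mk hq
  rw [Nat.cast_zero]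
  exact χ.map_nonunit not_isUnit_zero

theorem hasSum_cutTerm {q : ℕ} [NeZero q] (hq : 2 ≤ log q) (χ : DirichletCharacter ℂ q) (X : ℝ) {a : ℂ}
    (ha : |a.re| ≤ 1 / (2 * log q)) :
    HasSum (fun n : ℕ ↦ χ (n : ZMod q) * cutTerm X (log q) a n)
      (Complex.exp (-(1 / 4 + a / 2) * log q) * ∫ x in Set.Ioi (-X), logTheta χ x * Complex.exp (a * x / 2)) ∧
    Summable fun n : ℕ ↦ ‖χ (n : ZMod q) * cutTerm X (log q) a n‖ := by
  have hq1 : 1 < q := one_lt_of_log_pos (by linarith)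
  obtain ⟨C, hC, hB⟩ := exists_integral_norm_thetaTerm_le one_pos
  have h4 : 1 / (2 * log q) ≤ 1 / 4 := by apply one_div_le_one_div_of_le <;> linarith
  have ha' := abs_le.mp ha
  set K := C * exp ((log q + X) * (1 / 4 + 1)) with hK
  have hbound (n : ℕ) : exp (-(1 / 4 + a.re / 2) * log q) *
      (∫ x in Set.Ioi (-X), ‖χ (n : ZMod q) * thetaTerm (log q) a n x‖) ≤ K * (n : ℝ) ^ (-(1 + 1) : ℝ) := by
    rcases eq_or_ne n 0 with rfl | hn
    · simp only [char_zero hq1, zero_mul, norm_zero, integral_zero, mul_zero]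
      positivity
    · refine le_trans ?_ (hB X (log q) a n hq (by linarith) ha hn)
      have hin := integrable_thetaTerm (ℓ := log q) (a := a) hn (by linarith)
      refine mul_le_mul_of_nonneg_left (setIntegral_mono_on (hin.const_mul _).norm.integrableOn
        hin.norm.integrableOn measurableSet_Ioi fun x _ ↦ ?_) (exp_pos _).le
      rw [norm_mul]
      exact (mul_le_of_le_one_left (norm_nonneg _) (χ.norm_le_one _))
  have hs : Summable fun n : ℕ ↦ K * (n : ℝ) ^ (-(1 + 1) : ℝ) :=
    (Real.summable_nat_rpow.mpr (by norm_num)).mul_left K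
  have hsum : Summable fun n : ℕ ↦ ∫ x in Set.Ioi (-X), ‖χ (n : ZMod q) * thetaTerm (log q) a n x‖ := by
    have := Summable.of_nonneg_of_le (fun n ↦ by positivity) hbound hs
    exact (summable_mul_left_iff (exp_pos _).ne').mp this
  constructor
  · have h1 := hasSum_integral_of_summable_integral_norm (μ := volume.restrict (Set.Ioi (-X)))
      (F := fun (n : ℕ) x ↦ χ (n : ZMod q) * thetaTerm (log q) a n x) (fun n ↦ by
        rcases eq_or_ne n 0 with rfl | hn
        · simp only [char_zero hq1, zero_mul]
          exact integrable_zero _ _ _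
        · exact ((integrable_thetaTerm (ℓ := log q) (a := a) hn (by linarith)).const_mul _).integrableOn) hsum
    have h2 : ∀ x, ∑' n : ℕ, χ (n : ZMod q) * thetaTerm (log q) a n x = logTheta χ x * Complex.exp (a * x / 2) :=
      fun x ↦ (hasSum_logTheta_mul χ a x).1.tsum_eq
    simp only [h2] at h1
    refine (congrArg (fun f ↦ HasSum f _) (funext fun n ↦ ?_)).mp
      (h1.mul_left (Complex.exp (-(1 / 4 + a / 2) * log q)))
    rw [cutTerm, integral_const_mul]
    ring
  · refine Summable.of_nonneg_of_le (fun n ↦ norm_nonneg _) (fun n ↦ ?_) hs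
    refine le_trans ?_ (hbound n)
    simp only [norm_mul]
    rw [integral_const_mul, mul_left_comm]
    gcongr
    exact norm_cutTerm_le _ _ _ _

/-- For `x ≤ -X` the theta series is reflected to the region where its argument is at least `e^{X -
log q}`, so the tail is doubly exponentially small. Thus the L-value is given by a single sum of
length about `(q e^X)^{1/2}`, with no dual sum. -/
theorem exists_norm_tail_logTheta_le : ∃ C : ℝ, 0 < C ∧ ∀ (q : ℕ) [NeZero q] (χ : DirichletCharacter ℂ q) (X : ℝ)
    (a : ℂ), 2 ≤ log q → χ.Even → χ.IsPrimitive → log q ≤ X → |a.re| ≤ 1 / (2 * log q) →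
    ‖Complex.exp (-(1 / 4 + a / 2) * log q) * ∫ x in Set.Iic (-X), logTheta χ x * Complex.exp (a * x / 2)‖ ≤
      C * exp (-exp (X - log q)) := by
  obtain ⟨C, hC, hB⟩ := exists_integral_thetaBound_le
  refine ⟨2 * C * exp 1, by positivity, fun q _ χ X a hq hχ hp hX ha ↦ ?_⟩
  have hq1 : 1 < q := one_lt_of_log_pos (by linarith)
  have h4 : 1 / (2 * log q) ≤ 1 / 4 := by apply one_div_le_one_div_of_le <;> linarith
  have ha' := abs_le.mp ha
  set σ := 1 / 4 - a.re / 2 with hσ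
  have hint : Integrable fun x ↦ thetaBound (log q) σ 1 (-x) :=
    (integrable_thetaBound (ℓ := log q) one_ne_zero (by linarith)).comp_neg
  have hpt : ∀ x ∈ Set.Iic (-X), ‖logTheta χ x * Complex.exp (a * x / 2)‖ ≤
      2 * exp (-exp (X - log q)) * thetaBound (log q) σ 1 (-x) := by
    intro x hx
    have hx' : x ≤ -X := hx
    have h1 := logTheta_neg hq1 hχ hp (-x)
    rw [neg_neg] at h1
    rw [norm_mul, h1, norm_mul, norm_thetaSign hq1 hχ hp, one_mul, Complex.norm_exp]
    have h2 := norm_logTheta_le hq1 χ⁻¹ (-x)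
    have h3 : (a * x / 2 : ℂ).re = a.re / 2 * x := by simp; ring
    rw [h3]
    have h5 : exp (log q - -x) ≤ 1 := exp_le_one_iff.mpr (by linarith)
    have h6 : exp (-π * exp (-x - log q)) ≤ exp (-exp (X - log q)) * exp (-(π * (1 : ℕ) ^ 2 * exp (-log q) / 2 * exp (-x))) := by
      rw [← exp_add]
      gcongr
      have e1 : exp (-x - log q) = exp (-log q) * exp (-x) := by rw [← exp_add]; congr 1; ring
      have e2 : exp (X - log q) ≤ exp (-x - log q) := by gcongr; linarith
      have e3 := exp_pos (-x - log q)
      push_cast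
      rw [e1] at *
      nlinarith [pi_gt_three]
    calc _ ≤ (exp (-x / 4) * ((1 + 1) * (exp (-exp (X - log q)) *
          exp (-(π * (1 : ℕ) ^ 2 * exp (-log q) / 2 * exp (-x)))))) * exp (a.re / 2 * x) := by
          refine mul_le_mul_of_nonneg_right (h2.trans ?_) (exp_pos _).le
          gcongr
      _ = 2 * exp (-exp (X - log q)) * ((exp (-x / 4) * exp (a.re / 2 * x)) *
          exp (-(π * (1 : ℕ) ^ 2 * exp (-log q) / 2 * exp (-x)))) := by ring
      _ = _ := by
          rw [thetaBound, ← exp_add]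
          congr 3
          rw [hσ]; ring_nf
  rw [norm_mul, norm_exp_quarter]
  have h1 : ‖∫ x in Set.Iic (-X), logTheta χ x * Complex.exp (a * x / 2)‖ ≤
      2 * exp (-exp (X - log q)) * (C * exp (σ * log q)) := by
    calc _ ≤ ∫ x in Set.Iic (-X), 2 * exp (-exp (X - log q)) * thetaBound (log q) σ 1 (-x) :=
          norm_integral_le_of_norm_le (hint.const_mul _).integrableOn
            ((ae_restrict_iff' measurableSet_Iic).mpr (Eventually.of_forall hpt))
      _ ≤ ∫ x, 2 * exp (-exp (X - log q)) * thetaBound (log q) σ 1 (-x) :=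
          setIntegral_le_integral (hint.const_mul _) (Eventually.of_forall fun x ↦ by
            unfold thetaBound; positivity)
      _ ≤ _ := by
          rw [integral_const_mul, integral_neg_eq_self (fun x ↦ thetaBound (log q) σ 1 x)]
          gcongr
          have := hB (log q) σ 1 one_ne_zero (by linarith) (by linarith)
          simpa using this
  calc _ ≤ exp (-(1 / 4 + a.re / 2) * log q) * (2 * exp (-exp (X - log q)) * (C * exp (σ * log q))) := by gcongr
    _ = 2 * C * (exp (-(1 / 4 + a.re / 2) * log q) * exp (σ * log q)) * exp (-exp (X - log q)) := by ring
    _ ≤ _ := by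
        rw [← exp_add]
        gcongr
        have h5 : |a.re| * log q ≤ 1 := by
          rw [le_div_iff₀ (by linarith)] at ha
          linarith [mul_nonneg (abs_nonneg a.re) (by linarith : 0 ≤ log q)]
        have h6 : -a.re * log q ≤ |a.re| * log q := by gcongr; exact neg_le_abs _
        rw [hσ]
        linarith

/-- The complete integral for `n = 1` is the gamma factor. On the removed range the theta
exponential is at most `1`, leaving an elementary integral of rate at least `1/8`. -/
theorem norm_cutTerm_one_sub_le {X ℓ : ℝ} {a : ℂ} (hX : 0 ≤ ℓ + X) (ha : |a.re| ≤ 1 / 4) :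
    ‖cutTerm X ℓ a 1 - Complex.Gammaℝ (1 / 2 + a)‖ ≤ 8 * exp (-(ℓ + X) / 8) := by
  have ha' := abs_le.mp ha
  have hi := integrable_thetaTerm (ℓ := ℓ) (a := a) one_ne_zero (by linarith)
  have h1 := integral_thetaTerm (ℓ := ℓ) (a := a) one_ne_zero (by linarith)
  rw [← intervalIntegral.integral_Iic_add_Ioi (b := -X) hi.integrableOn hi.integrableOn, Nat.cast_one, Complex.one_cpow,
    mul_one] at h1
  have h2 : cutTerm X ℓ a 1 - Complex.Gammaℝ (1 / 2 + a) =
      -(Complex.exp (-(1 / 4 + a / 2) * ℓ) * ∫ x in Set.Iic (-X), thetaTerm ℓ a 1 x) := by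
    have h3 : Complex.exp (-(1 / 4 + a / 2) * ℓ) * Complex.exp ((1 / 4 + a / 2) * ℓ) = 1 := by
      rw [← Complex.exp_add, neg_mul, neg_add_cancel, Complex.exp_zero]
    rw [cutTerm]
    linear_combination Complex.exp (-(1 / 4 + a / 2) * ℓ) * h1 + Complex.Gammaℝ (1 / 2 + a) * h3
  set σ := 1 / 4 + a.re / 2 with hσ
  have hσ8 : 1 / 8 ≤ σ := by linarith
  have hσ0 : 0 < σ := by linarith
  rw [h2, norm_neg, norm_mul, norm_exp_quarter]
  have h3 : ‖∫ x in Set.Iic (-X), thetaTerm ℓ a 1 x‖ ≤ exp (σ * -X) / σ := by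
    rw [← integral_exp_mul_Iic hσ0]
    refine norm_integral_le_of_norm_le (integrableOn_exp_mul_Iic hσ0 _) (Eventually.of_forall fun x ↦ ?_)
    rw [norm_thetaTerm]
    exact mul_le_of_le_one_right (exp_pos _).le (exp_le_one_iff.mpr (by
      rw [neg_nonpos]; positivity))
  calc _ ≤ exp (-σ * ℓ) * (exp (σ * -X) / σ) := by gcongr
    _ = exp (-(σ * (ℓ + X))) * (1 / σ) := by
        rw [mul_div_assoc', ← exp_add, div_eq_mul_one_div]
        congr 2; ring
    _ ≤ exp (-(ℓ + X) / 8) * 8 := by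
        gcongr
        · nlinarith
        · rw [div_le_iff₀ hσ0]; linarith
    _ = _ := mul_comm _ _
end


/-! ### Mollified first moment with a shift. -/

noncomputable section

open Finset DirichletCharacter Real Filter Topology MeasureTheory
open scoped ENNReal ComplexConjugate

set_option linter.unusedSectionVars false

theorem card_evenPrim_le (q : ℕ) [NeZero q] : #(evenPrim q) ≤ q := by
  classical
  refine (Finset.card_le_univ _).trans ?_
  rw [← Nat.card_eq_fintype_card, DirichletCharacter.card_eq_totient_of_hasEnoughRootsOfUnity]
  exact Nat.totient_le q

theorem norm_mollifier_le {h : ℝ → ℝ} {H θ : ℝ} (hH : ∀ x, |h x| ≤ H) (hθ : θ < 1 / 2) (hh : ∀ x, θ ≤ x → h x = 0)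
    {q : ℕ} [NeZero q] (hq : 1 < q) (χ : DirichletCharacter ℂ q) : ‖mollifier h χ‖ ≤ H * (q : ℝ) ^ 2 := by
  have hq0 : (0 : ℝ) < q := by exact_mod_cast NeZero.pos q
  have hL : 0 < log q := log_pos (by exact_mod_cast hq)
  have hH0 : 0 ≤ H := (abs_nonneg _).trans (hH 0)
  have h1 : ∀ n ∈ range q, ‖mollCoeff h (log q) n * χ (n : ZMod q)‖ ≤ H * q := by
    intro n _
    rw [norm_mul]
    refine (mul_le_of_le_one_right (norm_nonneg _) (χ.norm_le_one _)).trans ?_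
    rcases eq_or_ne n 0 with rfl | hn
    · rw [mollCoeff_zero, norm_zero]; positivity
    have hn1 : (1 : ℝ) ≤ n := by exact_mod_cast Nat.one_le_iff_ne_zero.mpr hn
    refine (norm_mollCoeff_le hH hh hL one_pos n).trans ?_
    have h2 : exp (θ * log q * (1 / 2 + 1)) ≤ q := by
      rw [← exp_log hq0, log_exp]
      apply exp_le_exp.mpr
      nlinarith
    have h3 : (n : ℝ) ^ (-(1 + 1) : ℝ) ≤ 1 := rpow_le_one_of_one_le_of_nonpos hn1 (by norm_num)
    calc _ ≤ H * q * 1 := by gcongr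
      _ = _ := mul_one _
  refine (norm_sum_le_of_le _ h1).trans_eq ?_
  rw [Finset.sum_const, card_range, nsmul_eq_mul]
  ring

/-- Off-diagonal terms of the mollified first moment. -/
def offFirst (h : ℝ → ℝ) (X : ℝ) (q : ℕ) [NeZero q] (a : ℂ) (p : ℕ × ℕ) : ℂ :=
  mollCoeff h (log q) p.1 * cutTerm X (log q) a p.2 * (if p.1 * p.2 = 1 then 0 else charSum q (p.1 * p.2) 1)

theorem mollCoeff_one (h : ℝ → ℝ) (ℓ : ℝ) : mollCoeff h ℓ 1 = h 0 := by simp [mollCoeff]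

theorem hasSum_mul_of_norm {f g : ℕ → ℂ} {s t : ℂ} (hf : HasSum f s ∧ Summable fun n ↦ ‖f n‖)
    (hg : HasSum g t ∧ Summable fun n ↦ ‖g n‖) : HasSum (fun p : ℕ × ℕ ↦ f p.1 * g p.2) (s * t) :=
  hf.1.mul hg.1 (summable_mul_of_summable_norm hf.2 hg.2)

theorem hasSum_mollifier_mul_cutTerm {h : ℝ → ℝ} {θ : ℝ} (hθ : θ < 1 / 2) (hh : ∀ x, θ ≤ x → h x = 0) {q : ℕ}
    [NeZero q] (hq : 2 ≤ log q) (X : ℝ) {a : ℂ} (ha : |a.re| ≤ 1 / (2 * log q)) (χ : DirichletCharacter ℂ q) :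
    HasSum (fun p : ℕ × ℕ ↦ mollCoeff h (log q) p.1 * cutTerm X (log q) a p.2 *
      (χ ((p.1 * p.2 : ℕ) : ZMod q) * χ⁻¹ ((1 : ℕ) : ZMod q))) (mollifier h χ *
      (Complex.exp (-(1 / 4 + a / 2) * log q) * ∫ x in Set.Ioi (-X), logTheta χ x * Complex.exp (a * x / 2))) := by
  have hq1 : 1 < q := one_lt_of_log_pos (by linarith)
  have h1 := hasSum_mul_of_norm (hasSum_mollifier hθ hh hq1 χ) (hasSum_cutTerm hq χ X ha)
  refine (congrArg (fun f ↦ HasSum f _) (funext fun p ↦ ?_)).mp h1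
  rw [Nat.cast_mul, map_mul, Nat.cast_one, map_one]
  ring

theorem hasSum_offFirst {h : ℝ → ℝ} {θ : ℝ} (hθ : θ < 1 / 2) (hh : ∀ x, θ ≤ x → h x = 0) {q : ℕ} [NeZero q]
    (hq : 2 ≤ log q) (X : ℝ) {a : ℂ} (ha : |a.re| ≤ 1 / (2 * log q)) :
    HasSum (offFirst h X q a) (∑ χ ∈ evenPrim q, mollifier h χ *
      (Complex.exp (-(1 / 4 + a / 2) * log q) * ∫ x in Set.Ioi (-X), logTheta χ x * Complex.exp (a * x / 2)) -
      #(evenPrim q) * (h 0 * cutTerm X (log q) a 1)) := by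
  have hq1 : 1 < q := one_lt_of_log_pos (by linarith)
  have h1 := hasSum_sum fun χ (_ : χ ∈ evenPrim q) ↦ hasSum_mollifier_mul_cutTerm hθ hh hq X ha χ
  have h2 := hasSum_ite_eq ((1, 1) : ℕ × ℕ) ((#(evenPrim q) : ℂ) * (h 0 * cutTerm X (log q) a 1))
  refine (congrArg (fun f ↦ HasSum f _) (funext fun p ↦ ?_)).mp (h1.sub h2)
  obtain ⟨m, n⟩ := p
  rw [← Finset.mul_sum]
  change _ * charSum q (m * n) 1 - _ = _
  simp only [offFirst]
  by_cases hmn : m * n = 1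
  · obtain rfl := Nat.eq_one_of_mul_eq_one_right hmn
    obtain rfl := Nat.eq_one_of_mul_eq_one_left hmn
    rw [if_pos rfl, if_pos hmn, mul_one, charSum_self (Nat.coprime_one_left q), mollCoeff_one]
    ring
  · rw [if_neg hmn, if_neg (fun hp ↦ hmn (by rw [Prod.mk.injEq] at hp; rw [hp.1, hp.2])), sub_zero]

/-- The terms satisfy `m n ≡ ± 1` modulo a divisor of `q`. They form the slice with second pair `(1,
1)` of the sum already bounded for the second moment. -/
theorem exists_tsum_offFirst_le {θ H : ℝ} (hθ : θ < 1 / 2) :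
    ∃ C L₀ : ℝ, 0 < C ∧ 2 ≤ L₀ ∧ ∀ (h : ℝ → ℝ) (q : ℕ) [NeZero q] (a : ℂ), (∀ x, |h x| ≤ H) →
    (∀ x, θ ≤ x → h x = 0) → L₀ ≤ log q → |a.re| ≤ 1 / (2 * log q) →
    ∑' p, ‖offFirst h (3 / 2 * log q) q a p‖ₑ ≤ ENNReal.ofReal (C * (q : ℝ) ^ (15 / 16 : ℝ)) := by
  -- The mollifier contributes at most `(1/2)(1/2 + e)` to the exponent of `q`, the truncation at `X
  -- = (3/2) log q` contributes `(5/2)(1/4 + e)`, together at most `7/8 + 3e`. The congruence sum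
  -- adds `e`, so `7/8 + 4e = 15/16`.
  set e : ℝ := 1 / 64 with he
  have he0 : 0 < e := by positivity
  obtain ⟨C₁, hC₁, hK⟩ := exists_integral_norm_thetaTerm_le he0
  obtain ⟨C₂, hC₂, hS⟩ := exists_tsum_charSum_le he0
  refine ⟨|H| * C₁ * C₂ + 1, 32, by positivity, by norm_num, ?_⟩
  intro h q _ a hH hh hL ha
  set ℓ := log q with hℓ
  have hℓ0 : 0 < ℓ := by linarith
  have hH0 : 0 ≤ H := (abs_nonneg _).trans (hH 0)
  have hq0 : (0 : ℝ) < q := by exact_mod_cast NeZero.pos q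
  have hq1 : 1 < q := one_lt_of_log_pos hℓ0
  have hle : 1 / (2 * ℓ) ≤ e := by
    rw [he]; apply one_div_le_one_div_of_le <;> linarith
  set P := H * C₁ * exp (ℓ * (7 / 8 + 3 * e)) with hP
  have hP0 : 0 ≤ P := by positivity
  set F : (ℕ × ℕ) × (ℕ × ℕ) → ℝ≥0∞ := fun p ↦ powWeight e (p.1.1 * p.1.2) * powWeight e (p.2.1 * p.2.2) *
      (if p.1.1 * p.1.2 = p.2.1 * p.2.2 then 0 else ‖charSum q (p.1.1 * p.1.2) (p.2.1 * p.2.2)‖ₑ) with hF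
  have hpt (p : ℕ × ℕ) : ‖offFirst h (3 / 2 * ℓ) q a p‖ₑ ≤ ENNReal.ofReal P * F (p, (1, 1)) := by
    obtain ⟨m, n⟩ := p
    have hw : powWeight e (1 * 1) = 1 := by simp [powWeight]
    simp only [offFirst, hF, hw, mul_one]
    by_cases hz : m * n = 0
    · have : charSum q (m * n) 1 = 0 := charSum_eq_zero (by
        rw [hz, zero_mul, Nat.coprime_zero_left]; omega)
      rw [this]
      simp
    have hm : m ≠ 0 := by rintro rfl; simp at hz
    have hn : n ≠ 0 := by rintro rfl; simp at hz
    rw [enorm_mul, ← mul_assoc]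
    refine mul_le_mul' ?_ (by split_ifs <;> simp)
    rw [← ofReal_norm, powWeight, ← ENNReal.ofReal_mul hP0]
    refine ENNReal.ofReal_le_ofReal ?_
    rw [norm_mul]
    have h1 := norm_mollCoeff_le hH hh hℓ0 he0 m
    have h2 := (norm_cutTerm_le (3 / 2 * ℓ) ℓ a n).trans (hK (3 / 2 * ℓ) ℓ a n (by linarith) hle ha hn)
    have h3 : exp (θ * ℓ * (1 / 2 + e)) * exp ((ℓ + 3 / 2 * ℓ) * (1 / 4 + e)) ≤ exp (ℓ * (7 / 8 + 3 * e)) := by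
      rw [← exp_add]
      apply exp_le_exp.mpr
      have : θ * (1 / 2 + e) ≤ 1 / 2 * (1 / 2 + e) := by gcongr
      have := mul_le_mul_of_nonneg_left this hℓ0.le
      linarith
    calc _ ≤ (H * exp (θ * ℓ * (1 / 2 + e)) * (m : ℝ) ^ (-(1 + e))) *
          (C₁ * exp ((ℓ + 3 / 2 * ℓ) * (1 / 4 + e)) * (n : ℝ) ^ (-(1 + e))) :=
          mul_le_mul h1 h2 (norm_nonneg _) (by positivity)
      _ = H * C₁ * (exp (θ * ℓ * (1 / 2 + e)) * exp ((ℓ + 3 / 2 * ℓ) * (1 / 4 + e))) *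
          ((m : ℝ) ^ (-(1 + e)) * (n : ℝ) ^ (-(1 + e))) := by ring
      _ ≤ H * C₁ * exp (ℓ * (7 / 8 + 3 * e)) * ((m : ℝ) ^ (-(1 + e)) * (n : ℝ) ^ (-(1 + e))) := by gcongr
      _ = _ := by rw [hP, Nat.cast_mul, mul_rpow (by positivity) (by positivity)]
  calc _ ≤ ∑' p : ℕ × ℕ, ENNReal.ofReal P * F (p, (1, 1)) := ENNReal.tsum_le_tsum hpt
    _ ≤ ENNReal.ofReal P * ENNReal.ofReal (C₂ * (q : ℝ) ^ e) := by
        rw [ENNReal.tsum_mul_left]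
        refine mul_le_mul' le_rfl (le_trans ?_ (hS q))
        exact ENNReal.tsum_comp_le_tsum_of_injective (f := fun p : ℕ × ℕ ↦ (p, ((1 : ℕ), (1 : ℕ))))
          (Prod.mk_left_injective _) F
    _ ≤ _ := by
        rw [← ENNReal.ofReal_mul hP0]
        refine ENNReal.ofReal_le_ofReal ?_
        have e1 : exp (ℓ * (7 / 8 + 3 * e)) * (q : ℝ) ^ e = (q : ℝ) ^ (15 / 16 : ℝ) := by
          rw [rpow_def_of_pos hq0, rpow_def_of_pos hq0, ← exp_add, ← hℓ, ← mul_add, he]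
          norm_num
        rw [hP, abs_of_nonneg hH0]
        calc _ = H * C₁ * C₂ * (exp (ℓ * (7 / 8 + 3 * e)) * (q : ℝ) ^ e) := by ring
          _ ≤ (H * C₁ * C₂ + 1) * (q : ℝ) ^ (15 / 16 : ℝ) := by
              rw [e1]
              gcongr
              linarith

theorem exists_firstMoment_sub_le {θ H : ℝ} (hθ : θ < 1 / 2) :
    ∃ C L₀ : ℝ, 0 < C ∧ 2 ≤ L₀ ∧ ∀ (h : ℝ → ℝ) (q : ℕ) [NeZero q] (α : ℂ), (∀ x, |h x| ≤ H) →
    (∀ x, θ ≤ x → h x = 0) → L₀ ≤ log q → ‖α‖ ≤ 1 / 2 →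
    ‖∑ χ ∈ evenPrim q, mollifier h χ * LFunction χ (1 / 2 + α / log q) - #(evenPrim q) * h 0‖ ≤
      C * (q : ℝ) ^ (15 / 16 : ℝ) := by
  obtain ⟨C₁, L₀, hC₁, hL₀, hoff⟩ := exists_tsum_offFirst_le (H := H) hθ
  obtain ⟨C₂, hC₂, hG⟩ := exists_norm_inv_Gammaℝ_le
  obtain ⟨C₃, hC₃, hT⟩ := exists_norm_tail_logTheta_le
  refine ⟨C₂ * (C₁ + |H| * C₃ * 6 ^ (6 : ℝ) + |H| * 8), L₀, by positivity, hL₀, ?_⟩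
  intro h q _ α hH hh hL hα
  have hL2 : 2 ≤ log q := hL₀.trans hL
  have hL0 : 0 < log q := by linarith
  have hq1 : 1 < q := one_lt_of_log_pos hL0
  have hq1' : (1 : ℝ) ≤ q := by exact_mod_cast hq1.le
  have hq0 : (0 : ℝ) < q := by linarith
  have hH0 : 0 ≤ H := (abs_nonneg _).trans (hH 0)
  rw [abs_of_nonneg hH0]
  set a : ℂ := α / log q with ha
  have hre : |a.re| ≤ 1 / (2 * log q) := by
    rw [ha, Complex.div_ofReal_re, abs_div, abs_of_pos hL0, ← div_div]
    gcongr
    exact (Complex.abs_re_le_norm α).trans hα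
  have h4 : 1 / (2 * log q) ≤ 1 / 4 := by apply one_div_le_one_div_of_le <;> linarith
  have hre4 : |a.re| ≤ 1 / 4 := hre.trans h4
  -- A compromise: the tail is `exp(-q^{1/2})`, smaller than any power of `q`, while the sum over
  -- `n` has length about `q^{5/4}`, still within reach of the absolute off-diagonal bound.
  set X := 3 / 2 * log q with hX
  have hN : (#(evenPrim q) : ℝ) ≤ q := by exact_mod_cast card_evenPrim_le q
  set S := ∑ χ ∈ evenPrim q, mollifier h χ * (Complex.exp (-(1 / 4 + a / 2) * log q) *
    ∫ x in Set.Ioi (-X), logTheta χ x * Complex.exp (a * x / 2)) with hS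
  set T := ∑ χ ∈ evenPrim q, mollifier h χ * (Complex.exp (-(1 / 4 + a / 2) * log q) *
    ∫ x in Set.Iic (-X), logTheta χ x * Complex.exp (a * x / 2)) with hTdef
  have hΓ : Complex.Gammaℝ (1 / 2 + a) ≠ 0 := Complex.Gammaℝ_ne_zero_of_re_pos (by
    have := abs_le.mp hre4
    simp; linarith)
  have hsum : ∑ χ ∈ evenPrim q, mollifier h χ * LFunction χ (1 / 2 + a) = (Complex.Gammaℝ (1 / 2 + a))⁻¹ * (T + S) := by
    rw [hS, hTdef, ← Finset.sum_add_distrib, Finset.mul_sum]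
    refine Finset.sum_congr rfl fun χ hχ ↦ ?_
    have hχ := mem_evenPrim.mp hχ
    have hi := integrable_logTheta_mul hq1 hχ.2 hχ.1 a
    rw [LFunction_eq_integral hq1 hχ.2 hχ.1,
      ← intervalIntegral.integral_Iic_add_Ioi (b := -X) hi.integrableOn hi.integrableOn]
    ring
  have b1 : ‖S - #(evenPrim q) * (h 0 * cutTerm X (log q) a 1)‖ ≤ C₁ * (q : ℝ) ^ (15 / 16 : ℝ) :=
    norm_le_of_hasSum_enorm (hasSum_offFirst hθ hh hL2 X hre) (by positivity) (hoff h q a hH hh hL hre)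
  have hq15 : 1 ≤ (q : ℝ) ^ (15 / 16 : ℝ) := one_le_rpow hq1' (by norm_num)
  have b2 : ‖T‖ ≤ H * C₃ * 6 ^ (6 : ℝ) * (q : ℝ) ^ (15 / 16 : ℝ) := by
    have h1 : ∀ χ ∈ evenPrim q, ‖mollifier h χ * (Complex.exp (-(1 / 4 + a / 2) * log q) *
        ∫ x in Set.Iic (-X), logTheta χ x * Complex.exp (a * x / 2))‖ ≤
        H * (q : ℝ) ^ 2 * (C₃ * exp (-exp (X - log q))) := by
      intro χ hχ
      have hχ := mem_evenPrim.mp hχ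
      rw [norm_mul]
      exact mul_le_mul (norm_mollifier_le hH hθ hh hq1 χ)
        (hT q χ X a hL2 hχ.2 hχ.1 (by rw [hX]; linarith) hre) (norm_nonneg _) (by positivity)
    -- The power `q^{-3}` offsets `q²` from the trivial bound for the mollifier and `q` from the
    -- number of characters; `κ = 6` because the inner exponential is `q^{1/2}`.
    have h2 : exp (-exp (X - log q)) ≤ 6 ^ (6 : ℝ) * ((q : ℝ) ^ 3)⁻¹ := by
      refine (rpow_le_mul_exp (κ := 6) (by norm_num) (exp_pos _)).trans_eq ?_
      rw [← exp_mul, hX, ← rpow_natCast, ← rpow_neg hq0.le, rpow_def_of_pos hq0]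
      congr 2
      push_cast
      ring
    calc ‖T‖ ≤ #(evenPrim q) * (H * (q : ℝ) ^ 2 * (C₃ * exp (-exp (X - log q)))) := by
          refine (norm_sum_le_of_le _ h1).trans_eq ?_
          rw [Finset.sum_const, nsmul_eq_mul]
      _ ≤ q * (H * (q : ℝ) ^ 2 * (C₃ * (6 ^ (6 : ℝ) * ((q : ℝ) ^ 3)⁻¹))) := by gcongr
      _ = H * C₃ * 6 ^ (6 : ℝ) * 1 := by field_simp
      _ ≤ _ := by gcongr
  have b3 : ‖#(evenPrim q) * (h 0 * (cutTerm X (log q) a 1 - Complex.Gammaℝ (1 / 2 + a)))‖ ≤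
      H * 8 * (q : ℝ) ^ (15 / 16 : ℝ) := by
    have h1 := norm_cutTerm_one_sub_le (X := X) (ℓ := log q) (a := a) (by rw [hX]; linarith) hre4
    rw [norm_mul, norm_mul, Complex.norm_natCast, Complex.norm_real, Real.norm_eq_abs]
    have h2 : q * exp (-(log q + X) / 8) ≤ (q : ℝ) ^ (15 / 16 : ℝ) := by
      rw [rpow_def_of_pos hq0]
      nth_rw 1 [← exp_log hq0]
      rw [← exp_add]
      apply exp_le_exp.mpr
      rw [hX]
      linarith
    calc _ ≤ q * (H * (8 * exp (-(log q + X) / 8))) := by gcongr; exact hH 0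
      _ = H * 8 * (q * exp (-(log q + X) / 8)) := by ring
      _ ≤ _ := by gcongr
  have heq : (Complex.Gammaℝ (1 / 2 + a))⁻¹ * (T + S) - #(evenPrim q) * h 0 = (Complex.Gammaℝ (1 / 2 + a))⁻¹ *
      ((S - #(evenPrim q) * (h 0 * cutTerm X (log q) a 1)) + T +
      #(evenPrim q) * (h 0 * (cutTerm X (log q) a 1 - Complex.Gammaℝ (1 / 2 + a)))) := by
    linear_combination (#(evenPrim q) * (h 0 : ℂ)) * mul_inv_cancel₀ hΓ
  rw [hsum, heq, norm_mul]
  calc _ ≤ C₂ * (C₁ * (q : ℝ) ^ (15 / 16 : ℝ) + H * C₃ * 6 ^ (6 : ℝ) * (q : ℝ) ^ (15 / 16 : ℝ) +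
        H * 8 * (q : ℝ) ^ (15 / 16 : ℝ)) :=
        mul_le_mul (hG _ _ hL2 hα) (norm_add₃_le.trans (add_le_add (add_le_add b1 b2) b3)) (norm_nonneg _) hC₂.le
    _ = _ := by ring
end


/-! ### First moment of the derivatives, twisted by the sign. -/

noncomputable section

open Finset DirichletCharacter Real Filter Topology MeasureTheory
open scoped ENNReal ComplexConjugate

set_option linter.unusedSectionVars false

theorem sum_evenPrim_inv {q : ℕ} [NeZero q] (f : DirichletCharacter ℂ q → ℂ) :
    ∑ χ ∈ evenPrim q, f χ⁻¹ = ∑ χ ∈ evenPrim q, f χ := by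
  refine Finset.sum_nbij' (fun χ ↦ χ⁻¹) (fun χ ↦ χ⁻¹) ?_ ?_ (fun χ _ ↦ inv_inv χ) (fun χ _ ↦ inv_inv χ) fun χ _ ↦ rfl
  all_goals
    intro χ hχ
    have := mem_evenPrim.mp hχ
    exact mem_evenPrim.mpr ⟨inv_isPrimitive this.1, inv_even this.2⟩

/-- The quotient of gamma factors in the functional equation. -/
def gammaRatio (a : ℂ) : ℂ := (Complex.Gammaℝ (1 / 2 + a))⁻¹ * Complex.Gammaℝ (1 / 2 - a)

/-- Reflection `x ↦ -x` in the theta integral. At `a = α/log q` the conductor factor is exactly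
`e^{-α}`, the source of the nonzero derivatives in the first moment. -/
theorem LFunction_functional_equation {q : ℕ} [NeZero q] (hq : 1 < q) {χ : DirichletCharacter ℂ q} (hχ : χ.Even)
    (hp : χ.IsPrimitive) {a : ℂ} (ha : |a.re| < 1 / 2) :
    thetaSign χ⁻¹ * LFunction χ (1 / 2 + a) = Complex.exp (-(a * log q)) * gammaRatio a * LFunction χ⁻¹ (1 / 2 - a) := by
  have hΓ : Complex.Gammaℝ (1 / 2 - a) ≠ 0 := Complex.Gammaℝ_ne_zero_of_re_pos (by
    have := abs_lt.mp ha
    simp; linarith)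
  have h1 := LFunction_eq_integral hq (inv_even hχ) (inv_isPrimitive hp) (-a)
  have h2 : ∫ x : ℝ, logTheta χ x * Complex.exp (a * x / 2) =
      thetaSign χ * ∫ x : ℝ, logTheta χ⁻¹ x * Complex.exp (-a * x / 2) := by
    rw [← integral_neg_eq_self, ← integral_const_mul]
    refine integral_congr_ae (Eventually.of_forall fun x ↦ ?_)
    simp only
    rw [logTheta_neg hq hχ hp]
    push_cast
    ring_nf
  rw [← sub_eq_add_neg] at h1
  have h3 : ∫ x : ℝ, logTheta χ⁻¹ x * Complex.exp (-a * x / 2) =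
      Complex.Gammaℝ (1 / 2 - a) * (Complex.exp ((1 / 4 + -a / 2) * log q) * LFunction χ⁻¹ (1 / 2 - a)) := by
    have e1 : Complex.exp ((1 / 4 + -a / 2) * log q) * Complex.exp (-(1 / 4 + -a / 2) * log q) = 1 := by
      rw [← Complex.exp_add, neg_mul, add_neg_cancel, Complex.exp_zero]
    rw [h1]
    generalize (∫ x : ℝ, logTheta χ⁻¹ x * Complex.exp (-a * x / 2)) = I
    calc I = Complex.Gammaℝ (1 / 2 - a) * (Complex.Gammaℝ (1 / 2 - a))⁻¹ *
        (Complex.exp ((1 / 4 + -a / 2) * log q) * Complex.exp (-(1 / 4 + -a / 2) * log q)) * I := by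
          rw [e1, mul_inv_cancel₀ hΓ, one_mul, one_mul]
      _ = _ := by ring
  have h4 := thetaSign_mul_inv hq hχ hp
  have h5 : Complex.exp (-(1 / 4 + a / 2) * log q) * Complex.exp ((1 / 4 + -a / 2) * log q) =
      Complex.exp (-(a * log q)) := by
    rw [← Complex.exp_add]; congr 1; ring
  rw [LFunction_eq_integral hq hχ hp, h2, h3, gammaRatio, ← h5]
  linear_combination (Complex.Gammaℝ (1 / 2 + a))⁻¹ * Complex.exp (-(1 / 4 + a / 2) * log q) *
    Complex.Gammaℝ (1 / 2 - a) * (Complex.exp ((1 / 4 + -a / 2) * log q) * LFunction χ⁻¹ (1 / 2 - a)) * h4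

theorem differentiableAt_gammaRatio {a : ℂ} (ha : |a.re| < 1 / 2) : DifferentiableAt ℂ gammaRatio a := by
  have hs := abs_lt.mp ha
  have h1 : DifferentiableAt ℂ (fun a ↦ ((Complex.Gammaℝ (1 / 2 - a))⁻¹)⁻¹) a := by
    refine DifferentiableAt.inv ?_ (inv_ne_zero (Complex.Gammaℝ_ne_zero_of_re_pos (by simp; linarith)))
    exact (Complex.differentiable_Gammaℝ_inv.comp (by fun_prop : Differentiable ℂ fun a : ℂ ↦ 1 / 2 - a)) a
  have h2 := (Complex.differentiable_Gammaℝ_inv.comp (by fun_prop : Differentiable ℂ fun a : ℂ ↦ 1 / 2 + a)) a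
  have h3 := h2.mul h1
  simp only [inv_inv] at h3
  exact h3

theorem exists_norm_gammaRatio_le : ∃ C : ℝ, 0 < C ∧ ∀ (ℓ : ℝ) (α : ℂ), 2 ≤ ℓ → ‖α‖ ≤ 1 / 2 →
    ‖gammaRatio (α / ℓ)‖ ≤ C := by
  obtain ⟨C, hC⟩ := (isCompact_closedBall (0 : ℂ) (1 / 4)).exists_bound_of_continuousOn (f := gammaRatio) fun a ha ↦
    (differentiableAt_gammaRatio (by
      rw [mem_closedBall_zero_iff] at ha
      linarith [Complex.abs_re_le_norm a])).continuousAt.continuousWithinAt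
  refine ⟨|C| + 1, by positivity, fun ℓ α hℓ hα ↦ ?_⟩
  refine (hC (α / ℓ) ?_).trans ((le_abs_self C).trans (by linarith))
  rw [mem_closedBall_zero_iff, norm_div, Complex.norm_real, norm_of_nonneg (by linarith), div_le_iff₀ (by linarith)]
  linarith

theorem tendsto_gammaRatio (α : ℂ) : Tendsto (fun q : ℕ ↦ gammaRatio (α / log q)) atTop (𝓝 1) := by
  have h0 : Tendsto (fun q : ℕ ↦ α / (log q : ℂ)) atTop (𝓝 0) := by
    have : Tendsto (fun q : ℕ ↦ ((log q : ℝ) : ℂ)) atTop (Bornology.cobounded ℂ) :=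
      (RCLike.tendsto_ofReal_atTop_cobounded ℂ).comp tendsto_log_natCast
    simpa [div_eq_mul_inv] using ((tendsto_inv₀_cobounded (α := ℂ)).comp this).const_mul α
  have h1 : gammaRatio 0 = 1 := by
    rw [gammaRatio, add_zero, sub_zero, inv_mul_cancel₀ (Complex.Gammaℝ_ne_zero_of_re_pos (by norm_num))]
  have h2 := (differentiableAt_gammaRatio (a := 0) (by norm_num)).continuousAt.tendsto
  rw [h1] at h2
  exact h2.comp h0

/-- After the functional equation and the bijection `χ ↦ χ⁻¹`, the twisted shifted mean is `e^{-α}`,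
times a gamma ratio tending to `1`, times an untwisted mean at `-α` tending to `h 0`. Cauchy's
formula then extracts `(-1)^k`. -/
theorem tendsto_firstMoment {θ H : ℝ} {h : ℝ → ℝ} (hθ : θ < 1 / 2) (hH : ∀ x, |h x| ≤ H)
    (hh : ∀ x, θ ≤ x → h x = 0) (k : ℕ) :
    Tendsto (fun q : ℕ+ ↦ (#(evenPrim (q : ℕ)) : ℂ)⁻¹ * ∑ χ ∈ evenPrim (q : ℕ),
      mollifier h χ⁻¹ * (thetaSign χ⁻¹ * (iteratedDeriv k (LFunction χ) (1 / 2) / log (q : ℕ) ^ k))) admissible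
      (𝓝 ((-1) ^ k * h 0)) := by
  obtain ⟨C, L₀, hC, hL₀, hsub⟩ := exists_firstMoment_sub_le (H := H) hθ
  obtain ⟨C₂, hC₂, hG⟩ := exists_norm_gammaRatio_le
  have herr := tendsto_inv_card_mul (τ := 1 / 16) (by norm_num) C
  rw [show (1 : ℝ) - 1 / 16 = 15 / 16 by norm_num] at herr
  have hH0 : 0 ≤ H := (abs_nonneg _).trans (hH 0)
  set S : ℕ+ → ℂ → ℂ := fun q α ↦ (#(evenPrim (q : ℕ)) : ℂ)⁻¹ * ∑ χ ∈ evenPrim (q : ℕ),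
    mollifier h χ * LFunction χ (1 / 2 + α / log (q : ℕ)) with hS
  set T : ℕ+ → ℂ → ℂ := fun q α ↦ Complex.exp (-1 * α) * gammaRatio (α / log (q : ℕ)) * S q (-α) with hT
  have hdiff : ∀ᶠ q : ℕ+ in admissible, ∀ α : ℂ, ‖α‖ ≤ 1 / 2 →
      ‖S q α - h 0‖ ≤ (#(evenPrim (q : ℕ)) : ℝ)⁻¹ * (C * ((q : ℕ) : ℝ) ^ (15 / 16 : ℝ)) := by
    filter_upwards [eventually_nonempty_admissible, eventually_le_log_admissible L₀] with q hq hL α hα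
    have hN : (#(evenPrim (q : ℕ)) : ℂ) ≠ 0 := by exact_mod_cast hq.card_pos.ne'
    have h1 := hsub h (q : ℕ) α hH hh hL hα
    have h2 : S q α - h 0 = (#(evenPrim (q : ℕ)) : ℂ)⁻¹ * (∑ χ ∈ evenPrim (q : ℕ),
        mollifier h χ * LFunction χ (1 / 2 + α / log (q : ℕ)) - #(evenPrim (q : ℕ)) * h 0) := by
      rw [mul_sub, inv_mul_cancel_left₀ hN]
    rw [h2, norm_mul, norm_inv, Complex.norm_natCast]
    gcongr
  have hlim (α : ℂ) (hα : ‖α‖ ≤ 1 / 2) : Tendsto (fun q ↦ T q α) admissible (𝓝 (Complex.exp (-1 * α) * h 0)) := by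
    have h2 : Tendsto (fun q : ℕ+ ↦ S q (-α)) admissible (𝓝 (h 0)) := by
      rw [tendsto_iff_norm_sub_tendsto_zero]
      refine squeeze_zero' (Eventually.of_forall fun _ ↦ norm_nonneg _) ?_ herr
      filter_upwards [hdiff] with q hq
      exact hq (-α) (by rwa [norm_neg])
    have h3 := (((tendsto_gammaRatio α).comp tendsto_coe_admissible).const_mul (Complex.exp (-1 * α))).mul h2
    rwa [mul_one] at h3
  have hTbound : ∀ᶠ q : ℕ+ in admissible, ∀ α : ℂ, ‖α‖ ≤ 1 / 2 → ‖T q α‖ ≤ exp 1 * C₂ * (1 + H) := by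
    filter_upwards [hdiff, eventually_le_log_admissible 2, herr.eventually_le_const zero_lt_one] with q h1 h2 h3 α hα
    have h4 := norm_add_le (S q (-α) - h 0) (h 0)
    rw [sub_add_cancel, Complex.norm_real, Real.norm_eq_abs] at h4
    have h5 : ‖S q (-α)‖ ≤ 1 + H := by linarith [h1 (-α) (by rwa [norm_neg]), hH 0]
    have h6 : ‖Complex.exp (-1 * α)‖ ≤ exp 1 := by
      rw [Complex.norm_exp]
      apply exp_le_exp.mpr
      have := abs_le.mp ((Complex.abs_re_le_norm α).trans hα)
      rw [neg_one_mul, Complex.neg_re]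
      linarith
    simp only [hT, norm_mul]
    have h7 := hG (log (q : ℕ)) α h2 hα
    gcongr
  have hFE : ∀ᶠ q : ℕ+ in admissible, ∀ α : ℂ, ‖α‖ ≤ 1 / 2 →
      T q α = (#(evenPrim (q : ℕ)) : ℂ)⁻¹ * ∑ χ ∈ evenPrim (q : ℕ),
        mollifier h χ⁻¹ * (thetaSign χ⁻¹ * LFunction χ (1 / 2 + α / log (q : ℕ))) := by
    filter_upwards [eventually_le_log_admissible 2] with q hL α hα
    have hq1 : 1 < (q : ℕ) := one_lt_of_log_pos (by linarith)
    have hL0 : 0 < log (q : ℕ) := by linarith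
    have hLc : ((log (q : ℕ) : ℝ) : ℂ) ≠ 0 := by exact_mod_cast hL0.ne'
    simp only [hT, hS]
    rw [mul_left_comm, ← sum_evenPrim_inv, Finset.mul_sum]
    congr 1
    refine Finset.sum_congr rfl fun χ hχ ↦ ?_
    have hχ := mem_evenPrim.mp hχ
    rw [LFunction_functional_equation hq1 hχ.2 hχ.1]
    · have e1 : -(α / (log (q : ℕ) : ℂ) * (log (q : ℕ) : ℂ)) = -1 * α := by
        rw [div_mul_cancel₀ _ hLc]; ring
      rw [e1, neg_div, ← sub_eq_add_neg]
      ring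
    · rw [Complex.div_ofReal_re, abs_div, abs_of_pos hL0, div_lt_iff₀ hL0]
      linarith [Complex.abs_re_le_norm α]
  have hcont : ∀ᶠ q : ℕ+ in admissible, Continuous fun t ↦ circleWeight k t * T q (circlePt t) := by
    filter_upwards [eventually_le_log_admissible 2, hFE] with q hL hq
    have hq1 : 1 < (q : ℕ) := one_lt_of_log_pos (by linarith)
    simp only [fun t ↦ hq _ (norm_circlePt t).le]
    refine (continuous_circleWeight k).mul (continuous_const.mul (continuous_finsetSum _ fun χ hχ ↦
      continuous_const.mul (continuous_const.mul ?_)))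
    have hχ := mem_evenPrim.mp hχ
    have hd := (differentiable_LFunction (ne_one_of_isPrimitive hq1 hχ.1)).continuous
    have hp := continuous_circlePt
    fun_prop
  have hDCT : Tendsto (fun q : ℕ+ ↦ ∫ t, circleWeight k t * T q (circlePt t) ∂circleMeasure) admissible
      (𝓝 (∫ t, circleWeight k t * (Complex.exp (-1 * circlePt t) * h 0) ∂circleMeasure)) := by
    refine tendsto_integral_filter_of_dominated_convergence
      (fun _ ↦ (k.factorial * 2 ^ k) * (exp 1 * C₂ * (1 + H))) ?_ ?_ (integrable_const _) ?_
    · filter_upwards [hcont] with q hq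
      exact hq.aestronglyMeasurable
    · filter_upwards [hTbound] with q hq
      refine Eventually.of_forall fun t ↦ ?_
      rw [norm_mul]
      exact mul_le_mul (norm_circleWeight_le k _) (hq _ (norm_circlePt _).le) (norm_nonneg _) (by positivity)
    · exact Eventually.of_forall fun t ↦ (hlim _ (norm_circlePt _).le).const_mul _
  have hval : ∫ t, circleWeight k t * (Complex.exp (-1 * circlePt t) * h 0) ∂circleMeasure = (-1) ^ k * h 0 := by
    rw [← integral_circleWeight_exp k (-1), ← integral_mul_const]
    simp only [mul_assoc]
  rw [hval] at hDCT
  refine hDCT.congr' ?_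
  filter_upwards [eventually_le_log_admissible 2, hFE] with q hL hq
  have hq1 : 1 < (q : ℕ) := one_lt_of_log_pos (by linarith)
  have e1 (t : ℝ) : circleWeight k t * T q (circlePt t) = (#(evenPrim (q : ℕ)) : ℂ)⁻¹ * ∑ χ ∈ evenPrim (q : ℕ),
      mollifier h χ⁻¹ * thetaSign χ⁻¹ * (circleWeight k t * LFunction χ (1 / 2 + circlePt t / log (q : ℕ))) := by
    rw [hq _ (norm_circlePt t).le, mul_left_comm, Finset.mul_sum]
    congr 1
    refine Finset.sum_congr rfl fun χ _ ↦ ?_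
    ring
  simp only [e1]
  rw [integral_const_mul, integral_finsetSum]
  · congr 1
    refine Finset.sum_congr rfl fun χ hχ ↦ ?_
    have hχ := mem_evenPrim.mp hχ
    rw [integral_const_mul, integral_circleWeight_LFunction hq1 hχ.1]
    ring
  · intro χ hχ
    have hχ := mem_evenPrim.mp hχ
    exact (integrable_circleMeasure (circleIntegrable_LFunction hq1 hχ.1 k)).const_mul _
end


/-! ### Cauchy–Schwarz and the extremal profile. -/

noncomputable section

open Finset DirichletCharacter Real Filter Topology MeasureTheory
open scoped ENNReal ComplexConjugate ContDiff

set_option linter.unusedSectionVars false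

theorem coe_evenPrim (q : ℕ) [NeZero q] : (evenPrim q : Set (DirichletCharacter ℂ q)) = evenPrimitive q := by
  ext χ; rw [Finset.mem_coe, mem_evenPrim]; rfl

theorem ncard_evenPrimitive (q : ℕ) [NeZero q] : (evenPrimitive q).ncard = #(evenPrim q) := by
  rw [← coe_evenPrim, Set.ncard_coe_finset]

theorem ncard_nonvanishing (k q : ℕ) [NeZero q] : (nonvanishing k q).ncard =
    #{χ ∈ evenPrim q | iteratedDeriv k (LFunction χ) (1 / 2) ≠ 0} := by
  rw [← Set.ncard_coe_finset]
  congr 1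
  ext χ
  simp only [nonvanishing, Set.mem_ofPred_eq, Finset.coe_filter, mem_evenPrim]
  rfl

theorem norm_sum_sq_le {ι : Type*} (s : Finset ι) (f : ι → ℂ) (p : ι → Prop) [DecidablePred p]
    (hp : ∀ i ∈ s, ¬p i → f i = 0) : ‖∑ i ∈ s, f i‖ ^ 2 ≤ #(s.filter p) * ∑ i ∈ s, ‖f i‖ ^ 2 := by
  have h1 : ∑ i ∈ s, f i = ∑ i ∈ s.filter p, f i := by
    rw [Finset.sum_filter]
    refine Finset.sum_congr rfl fun i hi ↦ ?_
    split_ifs with h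
    · rfl
    · exact hp i hi h
  rw [h1]
  calc _ ≤ (∑ i ∈ s.filter p, ‖f i‖) ^ 2 := by gcongr; exact norm_sum_le _ _
    _ ≤ #(s.filter p) * ∑ i ∈ s.filter p, ‖f i‖ ^ 2 := sq_sum_le_card_mul_sum_sq
    _ ≤ _ := by
        gcongr
        exact Finset.filter_subset _ _

theorem eventually_mul_le_card {θ δ H : ℝ} {W h h' : ℝ → ℝ} {ρ σ : ℝ → ℂ} (D : MollifierData θ δ H W h h' ρ σ)
    (h1 : h 0 = 1) {k : ℕ} (hk : k ≠ 0) {c : ℝ} (hc : c * ((∫ r in Set.Ioi 0, h' r * h' r) / (2 * k + 1) +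
      (∫ r in Set.Ioi 0, h r * h r) * k ^ 2 / (2 * k - 1) + 1 / 2) < 1) :
    ∀ᶠ q : ℕ+ in admissible, c * #(evenPrim (q : ℕ)) ≤
      ((#{χ ∈ evenPrim (q : ℕ) | iteratedDeriv k (LFunction χ) (1 / 2) ≠ 0} : ℕ) : ℝ) := by
  have t1 := (tendsto_firstMoment D.θ_lt D.bound D.supp k).norm.pow 2
  have t2 := tendsto_secondMoment D hk
  have hV : 0 < (∫ r in Set.Ioi 0, h' r * h' r) / (2 * k + 1) +
      (∫ r in Set.Ioi 0, h r * h r) * k ^ 2 / (2 * k - 1) + h 0 ^ 2 / 2 := by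
    have hk1 : (1 : ℝ) ≤ k := by exact_mod_cast Nat.one_le_iff_ne_zero.mpr hk
    have hA : 0 ≤ ∫ r in Set.Ioi 0, h' r * h' r := integral_nonneg fun r ↦ mul_self_nonneg _
    have hB : 0 ≤ ∫ r in Set.Ioi 0, h r * h r := integral_nonneg fun r ↦ mul_self_nonneg _
    have : (0 : ℝ) < 2 * k - 1 := by linarith
    rw [h1]
    positivity
  have t3 := t2.const_mul c
  have hlt : c * ((∫ r in Set.Ioi 0, h' r * h' r) / (2 * k + 1) +
      (∫ r in Set.Ioi 0, h r * h r) * k ^ 2 / (2 * k - 1) + h 0 ^ 2 / 2) < ‖((-1 : ℂ)) ^ k * h 0‖ ^ 2 := by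
    rw [h1]
    simpa using hc
  filter_upwards [t3.eventually_lt t1 hlt, t2.eventually_const_lt hV, eventually_nonempty_admissible,
    eventually_le_log_admissible 1] with q e1 e2 hne hL
  have hq1 : 1 < (q : ℕ) := one_lt_of_log_pos (by linarith)
  have hN : (0 : ℝ) < #(evenPrim (q : ℕ)) := by exact_mod_cast hne.card_pos
  have h3 := norm_sum_sq_le (evenPrim (q : ℕ)) (fun χ ↦ mollifier h χ⁻¹ * (thetaSign χ⁻¹ *
    (iteratedDeriv k (LFunction χ) (1 / 2) / log (q : ℕ) ^ k)))
    (fun χ ↦ iteratedDeriv k (LFunction χ) (1 / 2) ≠ 0) (fun χ _ h ↦ by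
      rw [not_not] at h
      rw [h]; simp)
  have h4 : ∑ χ ∈ evenPrim (q : ℕ), ‖mollifier h χ⁻¹ * (thetaSign χ⁻¹ *
      (iteratedDeriv k (LFunction χ) (1 / 2) / log (q : ℕ) ^ k))‖ ^ 2 = ∑ χ ∈ evenPrim (q : ℕ),
      ‖mollifier h χ‖ ^ 2 * ‖iteratedDeriv k (LFunction χ) (1 / 2) / log (q : ℕ) ^ k‖ ^ 2 := by
    refine Finset.sum_congr rfl fun χ hχ ↦ ?_
    have hχ := mem_evenPrim.mp hχ
    rw [norm_mul, norm_mul, norm_thetaSign hq1 (inv_even hχ.2) (inv_isPrimitive hχ.1), one_mul, ← conj_mollifier,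
      RCLike.norm_conj, mul_pow]
  rw [h4] at h3
  rw [norm_mul, norm_inv, Complex.norm_natCast, mul_pow, inv_pow] at e1
  set n : ℝ := ((#{χ ∈ evenPrim (q : ℕ) | iteratedDeriv k (LFunction χ) (1 / 2) ≠ 0} : ℕ) : ℝ)
  set N : ℝ := ((#(evenPrim (q : ℕ)) : ℕ) : ℝ)
  set S := ∑ χ ∈ evenPrim (q : ℕ), ‖mollifier h χ‖ ^ 2 * ‖iteratedDeriv k (LFunction χ) (1 / 2) / log (q : ℕ) ^ k‖ ^ 2
  have hS : 0 < S := by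
    have := mul_pos hN e2
    rwa [mul_inv_cancel_left₀ hN.ne'] at this
  -- Eventually `c` times the second mean is below the squared first mean, which Cauchy–Schwarz
  -- bounds by `n S / N²`. The sum `S` can be cancelled since the limit of the second mean is
  -- positive.
  have h5 : c * (N⁻¹ * S) ≤ (N ^ 2)⁻¹ * (n * S) := e1.le.trans (by gcongr)
  have h6 := mul_le_mul_of_nonneg_left h5 (by positivity : 0 ≤ N ^ 2)
  rw [mul_inv_cancel_left₀ (by positivity)] at h6
  have h7 : N ^ 2 * (c * (N⁻¹ * S)) = c * N * S := by field_simp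
  rw [h7] at h6
  exact le_of_mul_le_mul_right h6 hS

theorem exists_forall_of_eventually_admissible {p : ℕ+ → Prop} (h : ∀ᶠ q in admissible, p q) :
    ∃ q₀ : ℕ, ∀ q : ℕ+, q₀ ≤ q → (evenPrim (q : ℕ)).Nonempty → p q := by
  rw [admissible, eventually_inf_principal] at h
  obtain ⟨q₀, hq₀⟩ := eventually_atTop.mp h
  exact ⟨q₀, fun q hq hne ↦ hq₀ q (by exact_mod_cast hq) hne⟩

/-- The extremal profile of the mollifier. -/
def profile (κ θ r : ℝ) : ℝ := sinh (κ * (θ - r)) / sinh (κ * θ)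

/-- The derivative of `profile`. -/
def profileDeriv (κ θ r : ℝ) : ℝ := -(κ * cosh (κ * (θ - r))) / sinh (κ * θ)

theorem hasDerivAt_profile (κ θ r : ℝ) : HasDerivAt (profile κ θ) (profileDeriv κ θ r) r := by
  have h1 : HasDerivAt (fun r ↦ κ * (θ - r)) (κ * -1) r := ((hasDerivAt_id r).const_sub θ).const_mul κ
  have h2 := h1.sinh.div_const (sinh (κ * θ))
  convert! h2 using 1
  rw [profileDeriv]
  ring

theorem hasDerivAt_profileDeriv (κ θ r : ℝ) : HasDerivAt (profileDeriv κ θ) (κ ^ 2 * profile κ θ r) r := by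
  have h1 : HasDerivAt (fun r ↦ κ * (θ - r)) (κ * -1) r := ((hasDerivAt_id r).const_sub θ).const_mul κ
  have h2 := ((h1.cosh.const_mul κ).neg).div_const (sinh (κ * θ))
  convert! h2 using 1
  rw [profile]
  ring

/-- The profile solves the Euler–Lagrange equation `f'' = κ² f`, so the energy density is an exact
derivative; only the boundary value `-f'(0) = κ coth(κθ)` survives. -/
theorem hasDerivAt_profile_mul (κ θ r : ℝ) : HasDerivAt (fun r ↦ profile κ θ r * profileDeriv κ θ r)
    (profileDeriv κ θ r ^ 2 + κ ^ 2 * profile κ θ r ^ 2) r := by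
  convert! (hasDerivAt_profile κ θ r).mul (hasDerivAt_profileDeriv κ θ r) using 1
  ring

theorem integral_profile {κ θ : ℝ} (hκ : 0 < κ) (hθ : 0 < θ) :
    ∫ r in (0 : ℝ)..θ, (profileDeriv κ θ r ^ 2 + κ ^ 2 * profile κ θ r ^ 2) = κ * (cosh (κ * θ) / sinh (κ * θ)) := by
  have hc : Continuous fun r ↦ profileDeriv κ θ r ^ 2 + κ ^ 2 * profile κ θ r ^ 2 := by
    unfold profileDeriv profile; fun_prop
  rw [intervalIntegral.integral_eq_sub_of_hasDerivAt (fun r _ ↦ hasDerivAt_profile_mul κ θ r)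
    (hc.intervalIntegrable _ _)]
  have hs : sinh (κ * θ) ≠ 0 := (sinh_pos_iff.mpr (by positivity)).ne'
  simp only [profile, profileDeriv]
  simp
  field_simp

/-- The smooth compactly supported version of `profile`. -/
def smoothProfile (κ θ η r : ℝ) : ℝ :=
  profile κ θ r * smoothTransition ((θ - r) / η) * smoothTransition (r + 2)

theorem contDiff_smoothProfile (κ θ η : ℝ) : ContDiff ℝ ∞ (smoothProfile κ θ η) := by
  have h1 : ContDiff ℝ ∞ (profile κ θ) := by
    unfold profile
    exact (Real.contDiff_sinh.comp (by fun_prop)).div_const _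
  have h2 : ContDiff ℝ ∞ fun r ↦ smoothTransition ((θ - r) / η) :=
    smoothTransition.contDiff.comp (by fun_prop)
  have h3 : ContDiff ℝ ∞ fun r : ℝ ↦ smoothTransition (r + 2) := smoothTransition.contDiff.comp (by fun_prop)
  exact (h1.mul h2).mul h3

theorem smoothProfile_of_le {κ θ η r : ℝ} (hη : 0 < η) (hr : θ ≤ r) : smoothProfile κ θ η r = 0 := by
  rw [smoothProfile, smoothTransition.zero_of_nonpos (div_nonpos_of_nonpos_of_nonneg (by linarith) hη.le), mul_zero,
    zero_mul]

theorem hasCompactSupport_smoothProfile {κ θ η : ℝ} (hη : 0 < η) : HasCompactSupport (smoothProfile κ θ η) := by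
  refine HasCompactSupport.of_support_subset_isCompact (isCompact_Icc (a := -2) (b := θ)) fun r hr ↦ ?_
  by_contra hcon
  rw [Set.mem_Icc, not_and_or, not_le, not_le] at hcon
  apply hr
  rcases hcon with h | h
  · rw [smoothProfile, smoothTransition.zero_of_nonpos (by linarith : r + 2 ≤ 0), mul_zero]
  · exact smoothProfile_of_le hη h.le

theorem smoothProfile_zero {κ θ η : ℝ} (hκ : 0 < κ) (hθ : 0 < θ) (hη : 0 < η) (hηθ : η ≤ θ) :
    smoothProfile κ θ η 0 = 1 := by
  have hs : sinh (κ * θ) ≠ 0 := (sinh_pos_iff.mpr (by positivity)).ne'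
  rw [smoothProfile, sub_zero, smoothTransition.one_of_one_le ((one_le_div hη).mpr hηθ),
    smoothTransition.one_of_one_le (by norm_num), profile, sub_zero, div_self hs, one_mul, one_mul]

/-- Smoothing alters the profile on `r > 0` only in the last stretch of length `η` before `θ`. There
the profile is `O(η)`, which offsets the slope `O(1/η)` of the transition, so the derivative stays
bounded and the extra energy is `O(η)`. The factor in `r + 2` equals `1` for `r ≥ 0` and only
secures compact support. -/
theorem exists_energy_le {κ θ : ℝ} (hκ : 0 < κ) (hθ : 0 < θ) : ∃ M : ℝ, 0 < M ∧ ∀ η : ℝ, 0 < η → η ≤ θ →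
    (∫ r in Set.Ioi 0, deriv (smoothProfile κ θ η) r * deriv (smoothProfile κ θ η) r) +
      κ ^ 2 * (∫ r in Set.Ioi 0, smoothProfile κ θ η r * smoothProfile κ θ η r) ≤
    κ * (cosh (κ * θ) / sinh (κ * θ)) + M * η := by
  have hsd : Continuous (deriv smoothTransition) :=
    (smoothTransition.contDiff (n := ⊤)).continuous_deriv (by simp)
  obtain ⟨S, hS⟩ := (isCompact_Icc (a := (0 : ℝ)) (b := 1)).exists_bound_of_continuousOn hsd.continuousOn
  have hS0 : 0 ≤ S := (norm_nonneg _).trans (hS 0 ⟨le_rfl, zero_le_one⟩)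
  have hs : 0 < sinh (κ * θ) := sinh_pos_iff.mpr (by positivity)
  set K := κ * cosh (κ * θ) / sinh (κ * θ) with hK
  have hK0 : 0 < K := by have := cosh_pos (κ * θ); positivity
  have hg' : ∀ r ∈ Set.Icc 0 θ, |profileDeriv κ θ r| ≤ K := by
    intro r hr
    rw [profileDeriv, abs_div, abs_neg, abs_mul, abs_of_pos hκ, abs_of_pos (cosh_pos _), abs_of_pos hs, hK]
    gcongr
    rw [cosh_le_cosh, abs_of_nonneg (mul_nonneg hκ.le (by linarith [hr.2])), abs_of_pos (by positivity)]
    have := hr.1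
    gcongr
    linarith
  have hg : ∀ r ∈ Set.Icc 0 θ, |profile κ θ r| ≤ K * (θ - r) := by
    intro r hr
    have h1 := (convex_Icc 0 θ).norm_image_sub_le_of_norm_hasDerivWithin_le (f := profile κ θ)
      (fun x _ ↦ (hasDerivAt_profile κ θ x).hasDerivWithinAt) (C := K) (fun x hx ↦ hg' x hx)
      (Set.right_mem_Icc.mpr hθ.le) hr
    have h2 : profile κ θ θ = 0 := by simp [profile]
    rw [h2, sub_zero, Real.norm_eq_abs, Real.norm_eq_abs, abs_sub_comm,
      abs_of_nonneg (by linarith [hr.2] : 0 ≤ θ - r)] at h1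
    exact h1
  refine ⟨(K + K * S) ^ 2, by positivity, fun η hη hηθ ↦ ?_⟩
  set h := smoothProfile κ θ η with hh
  have hcd := contDiff_smoothProfile κ θ η
  have hcs := hasCompactSupport_smoothProfile (κ := κ) (θ := θ) hη
  have hd : ∀ r, 0 < r → HasDerivAt h (profileDeriv κ θ r * smoothTransition ((θ - r) / η) +
      profile κ θ r * (deriv smoothTransition ((θ - r) / η) * (-1 / η))) r := by
    intro r hr
    have h1 : HasDerivAt (fun r ↦ (θ - r) / η) (-1 / η) r := ((hasDerivAt_id r).const_sub θ).div_const η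
    have h2 := ((smoothTransition.contDiff (n := ⊤)).differentiable (by simp) ((θ - r) / η)).hasDerivAt.comp r h1
    have h3 := (hasDerivAt_profile κ θ r).mul h2
    refine h3.congr_of_eventuallyEq ?_
    filter_upwards [lt_mem_nhds hr] with x hx
    rw [hh, smoothProfile, smoothTransition.one_of_one_le (by linarith : 1 ≤ x + 2), mul_one]
    rfl
  have hpt : ∀ r ∈ Set.Ioc 0 θ, deriv h r * deriv h r + κ ^ 2 * (h r * h r) ≤
      (profileDeriv κ θ r ^ 2 + κ ^ 2 * profile κ θ r ^ 2) + (Set.Ioc (θ - η) θ).indicator (fun _ ↦ (K + K * S) ^ 2) r := by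
    intro r hr
    have hr' : r ∈ Set.Icc 0 θ := ⟨hr.1.le, hr.2⟩
    have hb : h r * h r ≤ profile κ θ r ^ 2 := by
      rw [hh, smoothProfile, smoothTransition.one_of_one_le (by linarith [hr.1] : 1 ≤ r + 2), mul_one]
      have e1 := smoothTransition.nonneg ((θ - r) / η)
      have e2 := smoothTransition.le_one ((θ - r) / η)
      have e3 : smoothTransition ((θ - r) / η) * smoothTransition ((θ - r) / η) ≤ 1 := by nlinarith
      have e4 := mul_le_mul_of_nonneg_left e3 (sq_nonneg (profile κ θ r))
      linarith
    have hb' := mul_le_mul_of_nonneg_left hb (sq_nonneg κ)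
    rw [(hd r hr.1).deriv]
    by_cases hrη : θ - η < r
    · rw [Set.indicator_of_mem (show r ∈ Set.Ioc (θ - η) θ from ⟨hrη, hr.2⟩)]
      have e1 := smoothTransition.nonneg ((θ - r) / η)
      have e2 := smoothTransition.le_one ((θ - r) / η)
      have e0 : (θ - r) / η ∈ Set.Icc (0 : ℝ) 1 :=
        ⟨div_nonneg (by linarith [hr.2]) hη.le, (div_le_one hη).mpr (by linarith)⟩
      have e3 : |deriv smoothTransition ((θ - r) / η)| ≤ S := hS _ e0
      have e4 : |profile κ θ r| ≤ K * η := (hg r hr').trans (by gcongr; linarith)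
      have e5 : |profileDeriv κ θ r * smoothTransition ((θ - r) / η) +
          profile κ θ r * (deriv smoothTransition ((θ - r) / η) * (-1 / η))| ≤ K + K * S := by
        refine (abs_add_le _ _).trans (add_le_add ?_ ?_)
        · rw [abs_mul, abs_of_nonneg e1]
          exact (mul_le_of_le_one_right (abs_nonneg _) e2).trans (hg' r hr')
        · rw [abs_mul, abs_mul, abs_div, abs_neg, abs_one, abs_of_pos hη]
          calc _ ≤ (K * η) * (S * (1 / η)) := by gcongr
            _ = K * S := by field_simp
      have e6 := sq_le_sq' (abs_le.mp e5).1 (abs_le.mp e5).2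
      nlinarith [sq_nonneg (profileDeriv κ θ r)]
    · rw [Set.indicator_of_notMem fun hcon ↦ hrη hcon.1, add_zero]
      have hge : 1 ≤ (θ - r) / η := by rw [one_le_div hη]; linarith
      have hz : deriv smoothTransition ((θ - r) / η) = 0 := by
        have : ∀ x : ℝ, 1 < x → deriv smoothTransition x = 0 := by
          intro x hx
          have : smoothTransition =ᶠ[𝓝 x] fun _ ↦ 1 := by
            filter_upwards [lt_mem_nhds hx] with y hy using smoothTransition.one_of_one_le hy.le
          rw [this.deriv_eq, deriv_const]
        -- At the endpoint `1` itself the derivative vanishes by continuity from the right.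
        have hcl : Set.EqOn (deriv smoothTransition) 0 (closure (Set.Ioi 1)) :=
          Set.EqOn.closure (fun x hx ↦ this x hx) hsd continuous_zero
        rw [closure_Ioi] at hcl
        exact hcl hge
      rw [hz, smoothTransition.one_of_one_le hge, mul_one, zero_mul, mul_zero, add_zero]
      linarith
  have hi1 : Integrable fun r ↦ deriv h r * deriv h r :=
    ((hcd.continuous_deriv (by simp)).mul (hcd.continuous_deriv (by simp))).integrable_of_hasCompactSupport
      (hcs.deriv.mul_right)
  have hi2 : Integrable fun r ↦ h r * h r :=
    (hcd.continuous.mul hcd.continuous).integrable_of_hasCompactSupport hcs.mul_right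
  have hzero : ∀ r, θ < r → deriv h r * deriv h r + κ ^ 2 * (h r * h r) = 0 := by
    intro r hr
    have h1 : h =ᶠ[𝓝 r] fun _ ↦ 0 := by
      filter_upwards [lt_mem_nhds hr] with y hy using smoothProfile_of_le hη hy.le
    rw [h1.deriv_eq, h1.self_of_nhds]
    simp
  have hind : Integrable ((Set.Ioc (θ - η) θ).indicator fun _ : ℝ ↦ (K + K * S) ^ 2) :=
    (continuous_const.integrableOn_Icc.mono_set Set.Ioc_subset_Icc_self).integrable_indicator measurableSet_Ioc
  have hc : Continuous fun r ↦ profileDeriv κ θ r ^ 2 + κ ^ 2 * profile κ θ r ^ 2 := by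
    unfold profileDeriv profile; fun_prop
  have hi3 : IntegrableOn (fun r ↦ profileDeriv κ θ r ^ 2 + κ ^ 2 * profile κ θ r ^ 2) (Set.Ioc 0 θ) :=
    hc.integrableOn_Icc.mono_set Set.Ioc_subset_Icc_self
  calc _ = ∫ r in Set.Ioi 0, (deriv h r * deriv h r + κ ^ 2 * (h r * h r)) := by
        rw [integral_add hi1.integrableOn (hi2.integrableOn.const_mul _), integral_const_mul]
    _ = ∫ r in Set.Ioc 0 θ, (deriv h r * deriv h r + κ ^ 2 * (h r * h r)) :=
        setIntegral_eq_of_subset_of_forall_sdiff_eq_zero measurableSet_Ioi Set.Ioc_subset_Ioi_self fun r hr ↦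
          hzero r (by
            by_contra hcon
            exact hr.2 ⟨hr.1, not_lt.mp hcon⟩)
    _ ≤ ∫ r in Set.Ioc 0 θ, ((profileDeriv κ θ r ^ 2 + κ ^ 2 * profile κ θ r ^ 2) +
        (Set.Ioc (θ - η) θ).indicator (fun _ ↦ (K + K * S) ^ 2) r) :=
        setIntegral_mono_on (hi1.add (hi2.const_mul _)).integrableOn (hi3.add hind.integrableOn) measurableSet_Ioc hpt
    _ = (∫ r in Set.Ioc 0 θ, (profileDeriv κ θ r ^ 2 + κ ^ 2 * profile κ θ r ^ 2)) +
        ∫ r in Set.Ioc 0 θ, (Set.Ioc (θ - η) θ).indicator (fun _ ↦ (K + K * S) ^ 2) r :=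
        integral_add hi3 hind.integrableOn
    _ ≤ κ * (cosh (κ * θ) / sinh (κ * θ)) + (K + K * S) ^ 2 * η := by
        refine add_le_add ?_ ?_
        · rw [← intervalIntegral.integral_of_le hθ.le, integral_profile hκ hθ]
        · refine (setIntegral_le_integral hind (Eventually.of_forall fun r ↦
            Set.indicator_nonneg (fun _ _ ↦ by positivity) r)).trans ?_
          rw [integral_indicator measurableSet_Ioc, setIntegral_const, Real.volume_real_Ioc]
          rw [sub_sub_cancel, max_eq_left hη.le, smul_eq_mul, mul_comm]
end


/-! ### Optimization and the proportion of nonvanishing. -/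

noncomputable section

open Finset DirichletCharacter Real Filter Topology MeasureTheory
open scoped ENNReal ContDiff

set_option linter.unusedSectionVars false

theorem exists_mollifierData {θ η κ : ℝ} (hθ0 : 0 < θ) (hθ : θ < 1 / 2) (hη : 0 < η) :
    ∃ δ H W ρ σ, MollifierData θ δ H W (smoothProfile κ θ η) (deriv (smoothProfile κ θ η)) ρ σ := by
  obtain ⟨W, ρ, hW, hρ, hρ0, hW0⟩ := exists_cutoff (δ := (1 / 2 - θ) / 2) (by linarith) (by linarith)
  have hcd := contDiff_smoothProfile κ θ η
  have hcs := hasCompactSupport_smoothProfile (κ := κ) (θ := θ) hη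
  obtain ⟨σ, hσ, hσ'⟩ := exists_lineDensity hcd hcs
  obtain ⟨H, hH⟩ := hcs.exists_bound_of_continuous hcd.continuous
  exact ⟨(1 / 2 - θ) / 2, H, W, ρ, σ, hθ0, hθ, by linarith, le_rfl, hW, hρ, hρ0, hW0, hσ, hσ', hH,
    fun x hx ↦ smoothProfile_of_le hη hx⟩

theorem mollifierParam_pos {k : ℕ} (hk : 1 ≤ k) : 0 < mollifierParam k := by
  have hk1 : (1 : ℝ) ≤ k := by exact_mod_cast hk
  have h1 : (0 : ℝ) < 2 * k - 1 := by linarith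
  rw [mollifierParam]
  positivity

theorem two_mul_mollifierParam_sq {k : ℕ} (hk : 1 ≤ k) :
    (2 * mollifierParam k) ^ 2 = k ^ 2 * ((2 * k + 1) / (2 * k - 1)) := by
  have hk1 : (1 : ℝ) ≤ k := by exact_mod_cast hk
  have h1 : (0 : ℝ) < 2 * k - 1 := by linarith
  have h2 := sq_sqrt (show (0 : ℝ) ≤ (2 * k + 1) / (2 * k - 1) by positivity)
  rw [mollifierParam]
  linear_combination (k : ℝ) ^ 2 * h2

theorem div_sqrt_eq {k : ℕ} (hk : 1 ≤ k) :
    (k : ℝ) / √(4 * (k : ℝ) ^ 2 - 1) = 2 * mollifierParam k / (2 * k + 1) := by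
  have hk1 : (1 : ℝ) ≤ k := by exact_mod_cast hk
  have h1 : (0 : ℝ) < 2 * k - 1 := by linarith
  have h3 : (0 : ℝ) < 4 * k ^ 2 - 1 := by nlinarith
  have h4 := mollifierParam_pos hk
  rw [div_eq_div_iff (sqrt_pos.mpr h3).ne' (by positivity)]
  have h5 : ((k : ℝ) * (2 * k + 1)) ^ 2 = (2 * mollifierParam k * √(4 * (k : ℝ) ^ 2 - 1)) ^ 2 := by
    have h6 : (2 * (k : ℝ) + 1) / (2 * k - 1) * (4 * k ^ 2 - 1) = (2 * k + 1) ^ 2 := by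
      rw [div_mul_eq_mul_div, div_eq_iff h1.ne']
      ring
    rw [mul_pow _ (√_), two_mul_mollifierParam_sq hk, sq_sqrt h3.le, mul_assoc, h6, mul_pow]
  exact (sq_eq_sq₀ (by positivity) (by positivity)).mp h5

theorem inv_Pstar {k : ℕ} : (Pstar k)⁻¹ = 1 / 2 + (k : ℝ) / √(4 * (k : ℝ) ^ 2 - 1) *
    (cosh (mollifierParam k) / sinh (mollifierParam k)) := by
  rw [Pstar, inv_inv]

theorem inv_Pstar_pos {k : ℕ} (hk : 1 ≤ k) : 0 < (Pstar k)⁻¹ := by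
  rw [inv_Pstar]
  have h1 := sinh_pos_iff.mpr (mollifierParam_pos hk)
  have h2 := cosh_pos (mollifierParam k)
  positivity

/-- At `θ = 1/2` and without smoothing the limit of the second mean would be exactly `1/P_k^*`. The
loss `ε` leaves room to choose first `θ < 1/2`, then the smoothing width `η`, by continuity. -/
theorem eventually_Pstar_sub_mul_le {k : ℕ} (hk : 1 ≤ k) {ε : ℝ} (hε : 0 < ε) :
    ∀ᶠ q : ℕ+ in admissible, (Pstar k - ε) * #(evenPrim (q : ℕ)) ≤
      ((#{χ ∈ evenPrim (q : ℕ) | iteratedDeriv k (LFunction χ) (1 / 2) ≠ 0} : ℕ) : ℝ) := by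
  have hk1 : (1 : ℝ) ≤ k := by exact_mod_cast hk
  have hk0 : (0 : ℝ) < 2 * k - 1 := by linarith
  set κ := 2 * mollifierParam k with hκdef
  have hκ : 0 < κ := by have := mollifierParam_pos hk; positivity
  set c := Pstar k - ε with hc
  rcases le_or_gt c 0 with hc0 | hc0
  · exact Eventually.of_forall fun q ↦ (mul_nonpos_of_nonpos_of_nonneg hc0 (Nat.cast_nonneg _)).trans (Nat.cast_nonneg _)
  set V : ℝ → ℝ := fun θ ↦ κ * (cosh (κ * θ) / sinh (κ * θ)) with hV
  have hlim : c * (V (1 / 2) / (2 * k + 1) + 1 / 2) < 1 := by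
    have h1 : V (1 / 2) / (2 * k + 1) + 1 / 2 = (Pstar k)⁻¹ := by
      have h2 : κ * (1 / 2) = mollifierParam k := by rw [hκdef]; ring
      rw [inv_Pstar, div_sqrt_eq hk, ← hκdef, hV]
      simp only [h2]
      ring
    rw [h1, ← lt_div_iff₀ (inv_pos.mpr (inv_pos.mp (inv_Pstar_pos hk))), one_div, inv_inv]
    linarith
  have hcont : ContinuousAt V (1 / 2) := by
    have hs : sinh (κ * (1 / 2)) ≠ 0 := (sinh_pos_iff.mpr (by positivity)).ne'
    exact continuousAt_const.mul (ContinuousAt.div (by fun_prop) (by fun_prop) hs)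
  obtain ⟨θ, hθ, hθ1, hθ0⟩ : ∃ θ, c * (V θ / (2 * k + 1) + 1 / 2) < 1 ∧ θ < 1 / 2 ∧ 0 < θ := by
    have h1 : ContinuousAt (fun θ ↦ c * (V θ / (2 * k + 1) + 1 / 2)) (1 / 2) :=
      continuousAt_const.mul ((hcont.div_const _).add continuousAt_const)
    have h2 := (h1.eventually_lt continuousAt_const hlim).filter_mono (nhdsWithin_le_nhds (s := Set.Iio (1 / 2)))
    have h3 : ∀ᶠ θ : ℝ in 𝓝[<] (1 / 2), 0 < θ := nhdsWithin_le_nhds (lt_mem_nhds (by norm_num))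
    exact (h2.and ((eventually_mem_nhdsWithin).and h3)).exists
  obtain ⟨M, hM, hE⟩ := exists_energy_le hκ hθ0
  obtain ⟨η, hη, hηθ, hη0⟩ : ∃ η, c * ((V θ + M * η) / (2 * k + 1) + 1 / 2) < 1 ∧ η ≤ θ ∧ 0 < η := by
    have h1 : ContinuousAt (fun η ↦ c * ((V θ + M * η) / (2 * k + 1) + 1 / 2)) 0 := by fun_prop
    have h2 := (h1.eventually_lt continuousAt_const (by simpa using hθ)).filter_mono
      (nhdsWithin_le_nhds (s := Set.Ioi 0))
    have h3 : ∀ᶠ η : ℝ in 𝓝[>] 0, η ≤ θ := nhdsWithin_le_nhds (ge_mem_nhds hθ0)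
    exact (h2.and (h3.and eventually_mem_nhdsWithin)).exists
  obtain ⟨δ, H, W, ρ, σ, D⟩ := exists_mollifierData (κ := κ) hθ0 hθ1 hη0
  -- Since `κ² = k²(2k+1)/(2k-1)`, the quadratic form `A/(2k+1) + B k²/(2k-1)` is `(A + κ²
  -- B)/(2k+1)`, the energy just bounded.
  refine eventually_mul_le_card D (smoothProfile_zero hκ hθ0 hη0 hηθ) (by omega) (lt_of_le_of_lt ?_ hη)
  have h1 := hE η hη0 hηθ
  rw [two_mul_mollifierParam_sq hk] at h1
  refine mul_le_mul_of_nonneg_left ?_ hc0.le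
  set A := ∫ r in Set.Ioi 0, deriv (smoothProfile κ θ η) r * deriv (smoothProfile κ θ η) r
  set B := ∫ r in Set.Ioi 0, smoothProfile κ θ η r * smoothProfile κ θ η r
  have h2 : A / (2 * k + 1) + B * k ^ 2 / (2 * k - 1) = (A + k ^ 2 * ((2 * k + 1) / (2 * k - 1)) * B) / (2 * k + 1) := by
    field_simp
  rw [h2]
  gcongr

theorem exists_forall_Pstar_sub_mul_le {k : ℕ} (hk : 1 ≤ k) {ε : ℝ} (hε : 0 < ε) : ∃ q₀ : ℕ, ∀ (q : ℕ) [NeZero q],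
    q₀ ≤ q → (Pstar k - ε) * ((evenPrimitive q).ncard : ℝ) ≤ ((nonvanishing k q).ncard : ℝ) := by
  obtain ⟨q₀, h⟩ := exists_forall_of_eventually_admissible (eventually_Pstar_sub_mul_le hk hε)
  refine ⟨q₀, fun q hq0 hq ↦ ?_⟩
  rw [ncard_evenPrimitive, ncard_nonvanishing]
  -- For moduli without even primitive characters both sides are zero; the others are those seen by
  -- `admissible`.
  rcases (evenPrim q).eq_empty_or_nonempty with he | hne
  · rw [he]; simp
  · exact h ⟨q, NeZero.pos q⟩ hq hne

/-! ### Numerical values and asymptotic expansion of the proportion. -/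

theorem cosh_div_sinh {x : ℝ} (hx : 0 < x) : cosh x / sinh x = 1 + 2 / (exp (2 * x) - 1) := by
  have h1 : 1 < exp (2 * x) := one_lt_exp_iff.mpr (by linarith)
  have h2 : exp (2 * x) = exp x * exp x := by rw [← exp_add]; ring_nf
  have h3 := sinh_pos_iff.mpr hx
  rw [h2] at h1 ⊢
  rw [sinh_eq, exp_neg] at h3
  rw [cosh_eq, sinh_eq, exp_neg]
  have h4 := exp_pos x
  have h5 : exp x * exp x - 1 ≠ 0 := by linarith
  have h6 : exp x ^ 2 - 1 ≠ 0 := by rwa [pow_two]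
  field_simp
  ring

theorem inv_Pstar_le {k : ℕ} (hk : 1 ≤ k) {w l r : ℝ} (hw0 : 0 ≤ w) (hw : (k : ℝ) ^ 2 ≤ w ^ 2 * (4 * k ^ 2 - 1))
    (hl : l ^ 2 * (2 * k - 1) ≤ k ^ 2 * (2 * k + 1)) (hr : r ≤ exp l) (hr1 : 1 < r) :
    (Pstar k)⁻¹ ≤ 1 / 2 + w * (1 + 2 / (r - 1)) := by
  have hk1 : (1 : ℝ) ≤ k := by exact_mod_cast hk
  have hk0 : (0 : ℝ) < 2 * k - 1 := by linarith
  have h3 : (0 : ℝ) < 4 * k ^ 2 - 1 := by nlinarith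
  have hΛ := mollifierParam_pos hk
  have h1 : l ≤ 2 * mollifierParam k := by
    refine le_of_sq_le_sq ?_ (by positivity)
    rw [two_mul_mollifierParam_sq hk, mul_div_assoc', le_div_iff₀ hk0]
    exact hl
  have h2 : (k : ℝ) / √(4 * (k : ℝ) ^ 2 - 1) ≤ w := by
    rw [div_le_iff₀ (sqrt_pos.mpr h3)]
    refine le_of_sq_le_sq ?_ (by positivity)
    rw [mul_pow, sq_sqrt h3.le]
    exact hw
  have h4 : r ≤ exp (2 * mollifierParam k) := hr.trans (exp_le_exp.mpr h1)
  rw [inv_Pstar, cosh_div_sinh hΛ]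
  have h5 : 0 < r - 1 := by linarith
  have h6 : 0 < exp (2 * mollifierParam k) - 1 := by linarith
  gcongr

/-- A rational certificate: `w` is an upper bound for `k/√(4k² - 1)`, `l` a lower bound for `2Λ_k`,
and a Taylor polynomial bounds `e^l` from below. In the applications `w` and `l` are rounded
decimals, with `n` large enough for the stated digits. -/
theorem le_Pstar {k : ℕ} (hk : 1 ≤ k) {w l p : ℝ} (n : ℕ) (hw0 : 0 ≤ w)
    (hw : (k : ℝ) ^ 2 ≤ w ^ 2 * (4 * k ^ 2 - 1)) (hl0 : 0 ≤ l) (hl : l ^ 2 * (2 * k - 1) ≤ k ^ 2 * (2 * k + 1))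
    (hp : 0 < p) (hr1 : 1 < ∑ i ∈ range n, l ^ i / i.factorial)
    (h : 1 / 2 + w * (1 + 2 / (∑ i ∈ range n, l ^ i / i.factorial - 1)) ≤ p⁻¹) : p ≤ Pstar k :=
  (inv_le_inv₀ (inv_pos.mp (inv_Pstar_pos hk)) hp).mp
    ((inv_Pstar_le hk hw0 hw hl (sum_le_exp_of_nonneg hl0 n) hr1).trans h)

theorem le_Pstar_one : 0.7544 ≤ Pstar 1 := by
  refine le_Pstar le_rfl (w := 0.5773503) (l := 1.73205) 13 (by norm_num) (by norm_num) (by norm_num) (by norm_num)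
    (by norm_num) ?_ ?_ <;> norm_num [Finset.sum_range_succ, Nat.factorial]

theorem le_Pstar_two : 0.9083 ≤ Pstar 2 := by
  refine le_Pstar (by norm_num) (w := 0.5164) (l := 2.5819) 14 (by norm_num) (by norm_num) (by norm_num) (by norm_num)
    (by norm_num) ?_ ?_ <;> norm_num [Finset.sum_range_succ, Nat.factorial]

theorem le_Pstar_three : 0.9642 ≤ Pstar 3 := by
  refine le_Pstar (by norm_num) (w := 0.50710) (l := 3.5496) 16 (by norm_num) (by norm_num) (by norm_num) (by norm_num)
    (by norm_num) ?_ ?_ <;> norm_num [Finset.sum_range_succ, Nat.factorial]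

theorem le_Pstar_four : 0.9853 ≤ Pstar 4 := by
  refine le_Pstar (by norm_num) (w := 0.50396) (l := 4.535) 18 (by norm_num) (by norm_num) (by norm_num) (by norm_num)
    (by norm_num) ?_ ?_ <;> norm_num [Finset.sum_range_succ, Nat.factorial]

theorem le_Pstar_five : 0.9935 ≤ Pstar 5 := by
  refine le_Pstar (by norm_num) (w := 0.502519) (l := 5.527) 20 (by norm_num) (by norm_num) (by norm_num) (by norm_num)
    (by norm_num) ?_ ?_ <;> norm_num [Finset.sum_range_succ, Nat.factorial]

theorem le_Pstar_twenty_five : 0.99989 ≤ Pstar 25 := by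
  refine le_Pstar (by norm_num) (w := 0.5001001) (l := 25) 8 (by norm_num) (by norm_num) (by norm_num) (by norm_num)
    (by norm_num) ?_ ?_ <;> norm_num [Finset.sum_range_succ, Nat.factorial]

/-- With `y = 1/(4k²)` one has `k/√(4k² - 1) = (1 - y)^{-1/2}/2 ≤ (1 + y/2 + y²)/2`. Since `2Λ_k ≥
k` and `e^k ≥ 1 + k⁴/24`, the excess of `coth` over `1` is at most `48/k⁴`; the term `y²/2` fits in
the remaining `1/k⁴`. -/
theorem inv_Pstar_le_expansion {k : ℕ} (hk : 1 ≤ k) : (Pstar k)⁻¹ ≤ 1 + 1 / (16 * (k : ℝ) ^ 2) + 49 / (k : ℝ) ^ 4 := by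
  have hk1 : (1 : ℝ) ≤ k := by exact_mod_cast hk
  have hk0 : (0 : ℝ) < k := by linarith
  set y : ℝ := 1 / (4 * (k : ℝ) ^ 2) with hy
  have hy0 : 0 < y := by positivity
  have hy1 : y ≤ 1 / 4 := by
    rw [hy]
    apply one_div_le_one_div_of_le (by norm_num)
    nlinarith
  have hky : (k : ℝ) ^ 2 * (4 * y) = 1 := by rw [hy]; field_simp
  have h4 : ∑ i ∈ range 5, (k : ℝ) ^ i / i.factorial = 1 + k + k ^ 2 / 2 + k ^ 3 / 6 + k ^ 4 / 24 := by
    simp [Finset.sum_range_succ, Nat.factorial]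
  have h5 := sum_le_exp_of_nonneg hk0.le 5
  rw [h4] at h5
  have h6 : 1 + (k : ℝ) ^ 4 / 24 ≤ exp k := by
    have : 0 ≤ (k : ℝ) ^ 2 / 2 + k ^ 3 / 6 := by positivity
    linarith
  have h7 : (1 : ℝ) ≤ (1 + y / 2 + y ^ 2) ^ 2 * (1 - y) := by
    have : (1 + y / 2 + y ^ 2) ^ 2 * (1 - y) = 1 + y ^ 2 * (5 / 4 * (1 - y) - y ^ 3) := by ring
    rw [this]
    have hy3 : y ^ 3 ≤ (1 / 4) ^ 3 := by gcongr
    have : 0 ≤ y ^ 2 * (5 / 4 * (1 - y) - y ^ 3) := mul_nonneg (sq_nonneg y) (by linarith)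
    linarith
  have h8 := inv_Pstar_le hk (w := (1 + y / 2 + y ^ 2) / 2) (l := k) (by positivity) ?_ ?_ h6
    (by linarith [show 0 < (k : ℝ) ^ 4 / 24 by positivity])
  · refine h8.trans ?_
    have e1 : 2 / (1 + (k : ℝ) ^ 4 / 24 - 1) = 768 * y ^ 2 := by rw [hy]; field_simp; ring
    have e2 : 1 / (16 * (k : ℝ) ^ 2) = y / 4 := by rw [hy]; field_simp; norm_num
    have e3 : 49 / (k : ℝ) ^ 4 = 784 * y ^ 2 := by rw [hy]; field_simp; norm_num
    rw [e1, e2, e3]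
    have e4 : (1 + y / 2 + y ^ 2) / 2 ≤ 1 := by nlinarith
    have e5 : (1 + y / 2 + y ^ 2) / 2 * (768 * y ^ 2) ≤ 1 * (768 * y ^ 2) := by gcongr
    nlinarith [sq_nonneg y]
  · have : ((1 + y / 2 + y ^ 2) / 2) ^ 2 * (4 * (k : ℝ) ^ 2 - 1) =
        (k : ℝ) ^ 2 * ((1 + y / 2 + y ^ 2) ^ 2 * (1 - y)) := by
      linear_combination ((1 + y / 2 + y ^ 2) ^ 2 / 4) * hky
    rw [this]
    exact le_mul_of_one_le_right (by positivity) h7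
  · nlinarith [sq_nonneg (k : ℝ)]

/-- Here `coth ≥ 1` suffices: truncating `(1 - y)^{-1/2}` from below gives `1/P_k^* ≥ 1 + y/4 +
y²/8`, and the product with `1 - y/4` exceeds `1` by a positive multiple of `y²`. This yields the
strict positivity of `c_k`. -/
theorem lt_inv_Pstar {k : ℕ} (hk : 1 ≤ k) : 1 < (Pstar k)⁻¹ * (1 - 1 / (16 * (k : ℝ) ^ 2)) := by
  have hk1 : (1 : ℝ) ≤ k := by exact_mod_cast hk
  have hk0 : (0 : ℝ) < k := by linarith
  have h3 : (0 : ℝ) < 4 * k ^ 2 - 1 := by nlinarith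
  set y : ℝ := 1 / (4 * (k : ℝ) ^ 2) with hy
  have hy0 : 0 < y := by positivity
  have hy1 : y ≤ 1 / 4 := by
    rw [hy]
    apply one_div_le_one_div_of_le (by norm_num)
    nlinarith
  have hky : (k : ℝ) ^ 2 * (4 * y) = 1 := by rw [hy]; field_simp
  have h1 : (1 + y / 2 + y ^ 2 / 4) / 2 ≤ (k : ℝ) / √(4 * (k : ℝ) ^ 2 - 1) := by
    rw [le_div_iff₀ (sqrt_pos.mpr h3)]
    refine le_of_sq_le_sq ?_ hk0.le
    rw [mul_pow, sq_sqrt h3.le]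
    have e1 : ((1 + y / 2 + y ^ 2 / 4) / 2) ^ 2 * (4 * (k : ℝ) ^ 2 - 1) =
        (k : ℝ) ^ 2 * ((1 + y / 2 + y ^ 2 / 4) ^ 2 * (1 - y)) := by
      linear_combination ((1 + y / 2 + y ^ 2 / 4) ^ 2 / 4) * hky
    rw [e1]
    refine mul_le_of_le_one_right (by positivity) ?_
    have e2 : (1 + y / 2 + y ^ 2 / 4) ^ 2 * (1 - y) = 1 - y ^ 2 * (1 / 4 + y / 2 + 3 * y ^ 2 / 16 + y ^ 3 / 16) := by ring
    rw [e2]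
    have : 0 ≤ y ^ 2 * (1 / 4 + y / 2 + 3 * y ^ 2 / 16 + y ^ 3 / 16) := by positivity
    linarith
  have h2 : 1 ≤ cosh (mollifierParam k) / sinh (mollifierParam k) := by
    rw [cosh_div_sinh (mollifierParam_pos hk)]
    have : 1 < exp (2 * mollifierParam k) := one_lt_exp_iff.mpr (by linarith [mollifierParam_pos hk])
    have : 0 < 2 / (exp (2 * mollifierParam k) - 1) := div_pos two_pos (by linarith)
    linarith
  have h4 : 1 + y / 4 + y ^ 2 / 8 ≤ (Pstar k)⁻¹ := by
    rw [inv_Pstar]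
    have : (1 + y / 2 + y ^ 2 / 4) / 2 * 1 ≤ (k : ℝ) / √(4 * (k : ℝ) ^ 2 - 1) *
      (cosh (mollifierParam k) / sinh (mollifierParam k)) := by gcongr
    linarith
  have e2 : 1 / (16 * (k : ℝ) ^ 2) = y / 4 := by rw [hy]; field_simp; norm_num
  rw [e2]
  calc (1 : ℝ) < (1 + y / 4 + y ^ 2 / 8) * (1 - y / 4) := by
        have : (1 + y / 4 + y ^ 2 / 8) * (1 - y / 4) = 1 + y ^ 2 * (1 / 16 - y / 32) := by ring
        rw [this]
        have : 0 < y ^ 2 * (1 / 16 - y / 32) := mul_pos (by positivity) (by linarith)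
        linarith
    _ ≤ _ := by
        gcongr
        linarith

theorem exists_Pstar_expansion {k : ℕ} (hk : 1 ≤ k) : ∃ c' : ℝ, 0 < c' ∧ c' ≤ 49 ∧
    Pstar k = 1 - 1 / (16 * (k : ℝ) ^ 2) - c' / (k : ℝ) ^ 4 := by
  have hk0 : (0 : ℝ) < k := by exact_mod_cast hk
  have hP := inv_pos.mp (inv_Pstar_pos hk)
  have h1 := inv_Pstar_le_expansion hk
  have h2 := lt_inv_Pstar hk
  refine ⟨(1 - 1 / (16 * (k : ℝ) ^ 2) - Pstar k) * k ^ 4, ?_, ?_, ?_⟩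
  · refine mul_pos (sub_pos.mpr ?_) (by positivity)
    have := mul_lt_mul_of_pos_left h2 hP
    rwa [mul_one, mul_inv_cancel_left₀ hP.ne'] at this
  · rw [← le_div_iff₀ (by positivity)]
    -- The tangent inequality `P + 1/P ≥ 2` converts the upper bound for `1/P` into a lower bound
    -- for `P` with the same constant `49`.
    have h3 : 2 - (Pstar k)⁻¹ ≤ Pstar k := by
      have h4 : 0 ≤ (Pstar k)⁻¹ * (1 - Pstar k) ^ 2 := by positivity
      have h5 : (Pstar k)⁻¹ * (1 - Pstar k) ^ 2 = (Pstar k)⁻¹ - 2 + Pstar k := by field_simp; ring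
      linarith
    linarith
  · field_simp
    ring

theorem tendsto_Pstar : Tendsto Pstar atTop (𝓝 1) := by
  have h1 : Tendsto (fun k : ℕ ↦ (k : ℝ)⁻¹) atTop (𝓝 0) := tendsto_inv_atTop_nhds_zero_nat
  have h2 : Tendsto (fun k : ℕ ↦ 1 - (1 / 16 + 49) * (k : ℝ)⁻¹) atTop (𝓝 1) := by
    have := (h1.const_mul (1 / 16 + 49)).const_sub 1
    rwa [mul_zero, sub_zero] at this
  refine tendsto_of_tendsto_of_tendsto_of_le_of_le' h2 tendsto_const_nhds ?_ ?_
  · filter_upwards [eventually_ge_atTop 1] with k hk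
    have hk1 : (1 : ℝ) ≤ k := by exact_mod_cast hk
    obtain ⟨c', h0, h3, h4⟩ := exists_Pstar_expansion hk
    have e1 : 1 / (16 * (k : ℝ) ^ 2) ≤ 1 / 16 * (k : ℝ)⁻¹ := by
      rw [← one_div, ← one_div_mul_one_div]
      gcongr
      nlinarith
    have e2 : c' / (k : ℝ) ^ 4 ≤ 49 * (k : ℝ)⁻¹ := by
      rw [div_eq_mul_inv]
      gcongr
      exact le_self_pow₀ hk1 (by norm_num)
    rw [h4]
    linarith
  · filter_upwards [eventually_ge_atTop 1] with k hk
    obtain ⟨c', h0, h3, h4⟩ := exists_Pstar_expansion hk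
    have hk0 : (0 : ℝ) < k := by exact_mod_cast hk
    have : 0 < 1 / (16 * (k : ℝ) ^ 2) := by positivity
    have : 0 < c' / (k : ℝ) ^ 4 := by positivity
    rw [h4]
    linarith
end

theorem theorem1 :
    (∀ k : ℕ, 1 ≤ k → ∀ ε : ℝ, 0 < ε → ∃ q₀ : ℕ, ∀ (q : ℕ) [NeZero q], q₀ ≤ q →
      (Pstar k - ε) * ((evenPrimitive q).ncard : ℝ) ≤ ((nonvanishing k q).ncard : ℝ)) ∧
    (∃ c : ℝ, 0 < c ∧ ∀ k : ℕ, 1 ≤ k → ∃ c' : ℝ, 0 < c' ∧ c' ≤ c ∧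
      Pstar k = 1 - 1 / (16 * (k : ℝ) ^ 2) - c' / (k : ℝ) ^ 4) ∧
    Filter.Tendsto Pstar Filter.atTop (nhds 1) ∧
    0.7544 ≤ Pstar 1 ∧ 0.9083 ≤ Pstar 2 ∧ 0.9642 ≤ Pstar 3 ∧ 0.9853 ≤ Pstar 4 ∧
    0.9935 ≤ Pstar 5 ∧ 0.99989 ≤ Pstar 25 := by
  refine ⟨fun k hk ε hε ↦ exists_forall_Pstar_sub_mul_le hk hε, ⟨49, by norm_num, fun k hk ↦ exists_Pstar_expansion hk⟩,
    tendsto_Pstar, le_Pstar_one, le_Pstar_two, le_Pstar_three, le_Pstar_four, le_Pstar_five, le_Pstar_twenty_five⟩
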